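/- **Setting.** Let $n\ge 0$, and let $(H,J)$ be a smooth almost CR structure of hypersurface type on an open set $U\subset\mathbb R^{2n+1}$: $H\subset TU$ is a smooth real subbundle of corank $1$ and $J\colon H\to H$ is a smooth bundle automorphism with $J^2=-\mathrm{id}$. (Every germ of a hypersurface type almost CR manifold has this form in a chart.) Put $H^{1,0}=\{\xi\in\mathbb C\otimes H: J\xi=i\xi\}$. Let $p\in U$, and assume that the Levi form at $p$, $(X_p,Y_p)\mapsto\frac1{2i}[\bar X,Y]_p \bmod \mathbb C\otimes H_p$ for sections $X,Y$ of $H^{1,0}$, is positive definite for one of the two orientations of the line $T_p/H_p$. Let $\widehat H{}^{1,0}$ be the module, over the ring of complex formal power series at $p$, of formal complex vector fields generated by the Taylor series at $p$ of the smooth sections of $H^{1,0}$ near $p$. The structure is called *integrable near $p$* if $[H^{1,0},H^{1,0}]\subset H^{1,0}$ in a neighbourhood of $p$, and *formally integrable at $p$* (integrable to infinite order) if $\widehat H{}^{1,0}$ is closed under Lie brackets. A *formal embedding at $p$* is a formal power series map $(Z,W)$ at $p$ with values in $\mathbb C^n_z\times\mathbb C_w$, sending $p$ to $0$ and with injective differential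 at $p$, together with a real formal power series $\varphi(z,\bar z,u)$ without constant and linear terms such that $\mathrm{Im}\,W=\varphi(Z,\bar Z,\mathrm{Re}\,W)$; its image is the formal hypersurface $M'=\{\mathrm{Im}\,w=\varphi(z,\bar z,\mathrm{Re}\,w)\}$, on which $(z,u)$, $u=\mathrm{Re}\,w$, are used as coordinates. It is a *formal CR embedding* if $X\bar Z_j=0$ for all $j$ and $X\bar W=0$ for every $X\in\widehat H{}^{1,0}$. A formal almost CR structure on $M'$ is represented by a formal map $L(z,\bar z,u)\colon\mathbb C^n_z\to\mathbb C^n_{\bar z}\oplus\mathbb C_w$ if its $(1,0)$ vector fields satisfy $(d\bar z,du)=L\,dz$. The embedding is a *formal quasi CR embedding* if the almost CR structure transported to $M'$ by $(Z,\mathrm{Re}\,W)$ and the CR structure induced on $M'$ by $\mathbb C^{n+1}$ are represented by formal maps $L$ and $L'$ that agree along the Euler field $e=\sum_j z_j\,\partial/\partial z_j$, i.e. $L(e)\equiv L'(e)$. The series $\varphi$ is in *Chern–Moser normal form* if $$\varphi(z,\bar z,u)=\sum_{j=1}^n|z_j|^2+\sum_{k,l\ge2}F_{kl}(z,\bar z,u),\qquad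 \mathbf{tr}\,F_{22}\equiv0,\quad \mathbf{tr}^2F_{23}\equiv0,\quad \mathbf{tr}^3F_{33}\equiv0,$$ where $F_{kl}$ is bihomogeneous of bidegree $(k,l)$ in $(z,\bar z)$ and $\mathbf{tr}=\sum_j\partial^2/\partial z_j\partial\bar z_j$. **Theorem.** 1. There is a formal quasi CR embedding of the structure at $p$ into $\mathbb C^{n+1}$ as a formal hypersurface in Chern–Moser normal form. 2. A formal quasi CR embedding of the structure at $p$ (in Chern–Moser normal form or not) is a formal CR embedding if and only if the structure is formally integrable at $p$. In particular this is the case if the structure is integrable near $p$, since integrability near $p$ implies formal integrability at $p$. 3. If the structure is formally integrable at $p$, the formal quasi CR embeddings as hypersurfaces in Chern–Moser normal form are exactly the formal CR embeddings as hypersurfaces in Chern–Moser normal form, that is, the formal Chern–Moser normal forms of the structure at $p$. -/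

import Mathlib

open scoped ContDiff Topology

noncomputable section

namespace QuasiCR

/-! ### Smooth almost CR structures near a point of `ℝ^{2n+1}` -/

/-- The real coordinate space `ℝ^{2n+1}`. -/
abbrev RealSpace (n : ℕ) : Type := Fin (2 * n + 1) → ℝ

/-- The complexified tangent space `ℂ ⊗ T_x` of `ℝ^{2n+1}`, in coordinates. -/
abbrev CTangent (n : ℕ) : Type := Fin (2 * n + 1) → ℂ

/-- The real part of a complexified tangent vector. -/
def reVec {n : ℕ} (v : CTangent n) : RealSpace n := fun k => (v k).re

/-- The imaginary part of a complexified tangent vector. -/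
def imVec {n : ℕ} (v : CTangent n) : RealSpace n := fun k => (v k).im

/-- A smooth almost CR structure of hypersurface type on a subset `U` (meant to be open) of
`ℝ^{2n+1}`: a smooth corank one subbundle `H` of the tangent bundle and a smooth bundle
automorphism `J` of `H` with `J² = -id`. Only the restriction of `J x` to `H x`, for `x ∈ U`, is
relevant. Smoothness is expressed through local smooth frames of `H`. -/
structure AlmostCRStructure (n : ℕ) (U : Set (RealSpace n)) where
  /-- the subbundle `H` -/
  H : RealSpace n → Submodule ℝ (RealSpace n)
  /-- the complex structure on the fibres of `H` -/
  J : RealSpace n → RealSpace n →ₗ[ℝ] RealSpace n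
  J_mem : ∀ x ∈ U, ∀ v ∈ H x, J x v ∈ H x
  J_sq : ∀ x ∈ U, ∀ v ∈ H x, J x (J x v) = -v
  smooth : ∀ x ∈ U, ∃ W ∈ 𝓝 x, ∃ X : Fin (2 * n) → RealSpace n → RealSpace n,
    (∀ i, ContDiffOn ℝ ∞ (X i) W) ∧
    (∀ i, ContDiffOn ℝ ∞ (fun y => J y (X i y)) W) ∧
    (∀ y ∈ W, LinearIndependent ℝ (fun i => X i y)) ∧
    (∀ y ∈ W, Submodule.span ℝ (Set.range fun i => X i y) = H y)

/-- The Lie bracket of complex vector fields on `ℝ^{2n+1}`, i.e. the complex bilinear extension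
of the usual bracket: `[X, Y]_k = ∑_j (X_j ∂_j Y_k - Y_j ∂_j X_k)`. -/
def bracket {n : ℕ} (X Y : RealSpace n → CTangent n) (x : RealSpace n) : CTangent n :=
  fun k => ∑ j, (X x j * fderiv ℝ Y x (Pi.single j 1) k - Y x j * fderiv ℝ X x (Pi.single j 1) k)

/-- The complex conjugate of a complex vector field. -/
def conjField {n : ℕ} (X : RealSpace n → CTangent n) : RealSpace n → CTangent n :=
  fun x k => star (X x k)

namespace AlmostCRStructure

variable {n : ℕ} {U : Set (RealSpace n)} (S : AlmostCRStructure n U)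

/-- The fibre `H^{1,0}_x`: the vectors `ξ` in `ℂ ⊗ H_x` with `J ξ = i ξ`, where `J` is extended
complex linearly; for `ξ = a + i b` the equation `J ξ = i ξ` means `J a = -b` and `J b = a`. -/
def H10 (x : RealSpace n) : Submodule ℂ (CTangent n) where
  carrier := {v | reVec v ∈ S.H x ∧ imVec v ∈ S.H x ∧
    S.J x (reVec v) = -imVec v ∧ S.J x (imVec v) = reVec v}
  zero_mem' := by
    have h1 : reVec (0 : CTangent n) = 0 := by ext; simp [reVec]
    have h2 : imVec (0 : CTangent n) = 0 := by ext; simp [imVec]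
    simp [h1, h2]
  add_mem' := by
    rintro v w ⟨h1, h2, h3, h4⟩ ⟨k1, k2, k3, k4⟩
    have e1 : reVec (v + w) = reVec v + reVec w := by ext; simp [reVec]
    have e2 : imVec (v + w) = imVec v + imVec w := by ext; simp [imVec]
    refine ⟨?_, ?_, ?_, ?_⟩
    · rw [e1]; exact add_mem h1 k1
    · rw [e2]; exact add_mem h2 k2
    · rw [e1, e2, map_add, h3, k3]; abel
    · rw [e1, e2, map_add, h4, k4]
  smul_mem' := by
    rintro c v ⟨h1, h2, h3, h4⟩
    have e1 : reVec (c • v) = c.re • reVec v - c.im • imVec v := by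
      ext; simp [reVec, imVec]
    have e2 : imVec (c • v) = c.re • imVec v + c.im • reVec v := by
      ext; simp [reVec, imVec]
    refine ⟨?_, ?_, ?_, ?_⟩
    · rw [e1]; exact sub_mem (Submodule.smul_mem _ _ h1) (Submodule.smul_mem _ _ h2)
    · rw [e2]; exact add_mem (Submodule.smul_mem _ _ h2) (Submodule.smul_mem _ _ h1)
    · rw [e1, e2, map_sub, map_smul, map_smul, h3, h4, smul_neg]; abel
    · rw [e1, e2, map_add, map_smul, map_smul, h3, h4, smul_neg]; abel

/-- `X` is a smooth section of `H^{1,0}` on some neighbourhood of `p`. -/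
def IsSectionNear (p : RealSpace n) (X : RealSpace n → CTangent n) : Prop :=
  ∃ W ∈ 𝓝 p, ContDiffOn ℝ ∞ X W ∧ ∀ x ∈ W, X x ∈ S.H10 x

/-- The Levi form at `p` is positive definite. The form `(1 / 2i) [X̄, Y]` takes values in
`ℂ ⊗ (T_p / H_p)`; positivity refers to one of the two orientations of the real line `T_p / H_p`,
given here by a real covector `θ` with kernel `H_p`. -/
def LeviPosDef (p : RealSpace n) : Prop :=
  ∃ θ : RealSpace n →ₗ[ℝ] ℝ, LinearMap.ker θ = S.H p ∧
    ∀ X : RealSpace n → CTangent n, S.IsSectionNear p X → X p ≠ 0 →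
      0 < (1 / (2 * Complex.I) *
        ∑ k, (θ (Pi.single k 1) : ℂ) * bracket (conjField X) X p k).re

/-- The structure is integrable near `p`: on a neighbourhood of `p`, brackets of local sections of
`H^{1,0}` have values in `H^{1,0}`. -/
def IntegrableNear (p : RealSpace n) : Prop :=
  ∀ᶠ x in 𝓝 p, ∀ X Y : RealSpace n → CTangent n,
    S.IsSectionNear x X → S.IsSectionNear x Y → bracket X Y x ∈ S.H10 x

end AlmostCRStructure

/-! ### Formal power series at a point and formal vector fields -/

/-- Complex formal power series in the `2n+1` real coordinates centred at the base point. -/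
abbrev SourceSeries (n : ℕ) : Type := MvPowerSeries (Fin (2 * n + 1)) ℂ

/-- Formal complex vector fields `∑_j X_j ∂/∂x_j` at the base point. -/
abbrev FormalField (n : ℕ) : Type := Fin (2 * n + 1) → SourceSeries n

/-- The partial derivative of a function in the direction of the `j`-th coordinate. -/
def partialD {n : ℕ} (j : Fin (2 * n + 1)) (F : RealSpace n → ℂ) : RealSpace n → ℂ :=
  fun x => fderiv ℝ F x (Pi.single j 1)

/-- The iterated partial derivative `∂^m F` for a multi-index `m`. -/
def iteratedPartial {n : ℕ} (m : Fin (2 * n + 1) →₀ ℕ) (F : RealSpace n → ℂ) :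
    RealSpace n → ℂ :=
  (List.finRange (2 * n + 1)).foldr (fun j G => (partialD j)^[m j] G) F

/-- The Taylor series at `p`: the coefficient at `(x - p)^m` is `∂^m F (p) / m!`. -/
def taylor {n : ℕ} (p : RealSpace n) (F : RealSpace n → ℂ) : SourceSeries n :=
  fun m => iteratedPartial m F p / ((∏ j, (m j).factorial : ℕ) : ℂ)

/-- The Taylor series at `p` of a complex vector field. -/
def taylorField {n : ℕ} (p : RealSpace n) (X : RealSpace n → CTangent n) : FormalField n :=
  fun k => taylor p (fun x => X x k)

/-- Complex conjugation of power series in real variables. -/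
def conjSeries {n : ℕ} (f : SourceSeries n) : SourceSeries n :=
  MvPowerSeries.map (starRingEnd ℂ) f

/-- The derivative `X f` of a formal power series along a formal vector field. -/
def FormalField.act {n : ℕ} (X : FormalField n) (f : SourceSeries n) : SourceSeries n :=
  ∑ j, X j * MvPowerSeries.pderiv ℂ j f

/-- The Lie bracket of formal vector fields. -/
def formalBracket {n : ℕ} (X Y : FormalField n) : FormalField n :=
  fun k => X.act (Y k) - Y.act (X k)

/-- The formal almost CR structure at `p` induced by a smooth one: the module, over the ring of
formal power series, of formal `(1,0)` vector fields, generated by the Taylor series at `p` of the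
smooth sections of `H^{1,0}` near `p`. -/
def AlmostCRStructure.formalH10 {n : ℕ} {U : Set (RealSpace n)} (S : AlmostCRStructure n U)
    (p : RealSpace n) : Submodule (SourceSeries n) (FormalField n) :=
  Submodule.span (SourceSeries n)
    {A | ∃ X : RealSpace n → CTangent n, S.IsSectionNear p X ∧ A = taylorField p X}

/-- The structure is integrable to infinite order at `p`, i.e. the induced formal almost CR
structure at `p` is integrable: formal `(1,0)` vector fields are closed under the Lie bracket. -/
def AlmostCRStructure.FormallyIntegrableAt {n : ℕ} {U : Set (RealSpace n)}
    (S : AlmostCRStructure n U) (p : RealSpace n) : Prop :=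
  ∀ A ∈ S.formalH10 p, ∀ B ∈ S.formalH10 p, formalBracket A B ∈ S.formalH10 p

/-! ### Formal real hypersurfaces in `ℂ^{n+1}` as graphs -/

/-- The variables `z_1, …, z_n`, `z̄_1, …, z̄_n`, `u`. -/
abbrev Var (n : ℕ) : Type := Fin n ⊕ (Fin n ⊕ Unit)

/-- The variable `z_j`. -/
abbrev Var.z {n : ℕ} (j : Fin n) : Var n := Sum.inl j

/-- The variable `z̄_j`. -/
abbrev Var.zbar {n : ℕ} (j : Fin n) : Var n := Sum.inr (Sum.inl j)

/-- The variable `u`. -/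
abbrev Var.u {n : ℕ} : Var n := Sum.inr (Sum.inr ())

/-- The exchange of `z_j` and `z̄_j`. -/
def Var.swap {n : ℕ} : Var n → Var n
  | Sum.inl j => Var.zbar j
  | Sum.inr (Sum.inl j) => Var.z j
  | Sum.inr (Sum.inr _) => Var.u

/-- Formal power series in `(z, z̄, u)` with complex coefficients. -/
abbrev GraphSeries (n : ℕ) : Type := MvPowerSeries (Var n) ℂ

/-- The formal power series is real valued: conjugation, which exchanges `z` and `z̄`, leaves it
invariant. -/
def GraphSeries.IsReal {n : ℕ} (φ : GraphSeries n) : Prop :=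
  ∀ m : Var n →₀ ℕ,
    MvPowerSeries.coeff (m.mapDomain Var.swap) φ = star (MvPowerSeries.coeff m φ)

/-- `φ` defines a formal real hypersurface `Im w = φ(z, z̄, Re w)` through `0` in `ℂ^{n+1}` whose
tangent space at `0` is `ℂ^n × ℝ`. -/
structure IsHypersurface {n : ℕ} (φ : GraphSeries n) : Prop where
  real : φ.IsReal
  constant : MvPowerSeries.constantCoeff φ = 0
  linear : ∀ v : Var n, MvPowerSeries.coeff (Finsupp.single v 1) φ = 0

/-- The degree of a monomial in the variables `z`. -/
def zDegree {n : ℕ} (m : Var n →₀ ℕ) : ℕ := ∑ j : Fin n, m (Var.z j)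

/-- The degree of a monomial in the variables `z̄`. -/
def zbarDegree {n : ℕ} (m : Var n →₀ ℕ) : ℕ := ∑ j : Fin n, m (Var.zbar j)

/-- The part `F_{kl}(z, z̄, u)` of a power series that is bihomogeneous of bidegree `(k, l)` in
`(z, z̄)`. -/
def bipart {n : ℕ} (k l : ℕ) (φ : GraphSeries n) : GraphSeries n :=
  fun m => if zDegree m = k ∧ zbarDegree m = l then MvPowerSeries.coeff m φ else 0

/-- The trace operator `∑_j ∂² / ∂z_j ∂z̄_j`. -/
def tr {n : ℕ} (φ : GraphSeries n) : GraphSeries n :=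
  ∑ j : Fin n, MvPowerSeries.pderiv ℂ (Var.z j) (MvPowerSeries.pderiv ℂ (Var.zbar j) φ)

/-- The Chern–Moser normalization for a positive definite Levi form:
`φ = ∑_j |z_j|² + ∑_{k,l ≥ 2} F_{kl}` with `tr F₂₂ = 0`, `tr² F₂₃ = 0`, `tr³ F₃₃ = 0`. -/
structure IsChernMoserNormalized {n : ℕ} (φ : GraphSeries n) : Prop where
  expansion : ∀ m : Var n →₀ ℕ, zDegree m < 2 ∨ zbarDegree m < 2 →
    MvPowerSeries.coeff m φ =
      MvPowerSeries.coeff m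
        (∑ j : Fin n, (MvPowerSeries.X (Var.z j) * MvPowerSeries.X (Var.zbar j) : GraphSeries n))
  tr22 : tr (bipart 2 2 φ) = 0
  tr23 : tr (tr (bipart 2 3 φ)) = 0
  tr33 : tr (tr (tr (bipart 3 3 φ))) = 0

/-- A formal map `L(z, z̄, u) : ℂ^n_z → ℂ^n_z̄ ⊕ ℂ_w`, whose graph is spanned by the complex vector
fields `∂/∂z_k + ∑_j L^{z̄}_{jk} ∂/∂z̄_j + L^w_k ∂/∂u`. -/
structure GraphMap (n : ℕ) where
  /-- the matrix of `L^{z̄}` -/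
  zbar : Fin n → Fin n → GraphSeries n
  /-- the components of `L^w` -/
  w : Fin n → GraphSeries n

namespace GraphMap

variable {n : ℕ} (L : GraphMap n)

/-- The derivation by the vector field `∂/∂z_k + ∑_j L^{z̄}_{jk} ∂/∂z̄_j + L^w_k ∂/∂u`. -/
def act (k : Fin n) (f : GraphSeries n) : GraphSeries n :=
  MvPowerSeries.pderiv ℂ (Var.z k) f
    + ∑ j, L.zbar j k * MvPowerSeries.pderiv ℂ (Var.zbar j) f
    + L.w k * MvPowerSeries.pderiv ℂ Var.u f

/-- The `z̄`-component of the evaluation of `L` along the Euler field `e = ∑_k z_k ∂/∂z_k`. -/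
def eulerZbar (j : Fin n) : GraphSeries n := ∑ k, L.zbar j k * MvPowerSeries.X (Var.z k)

/-- The `w`-component of the evaluation of `L` along the Euler field. -/
def eulerW : GraphSeries n := ∑ k, L.w k * MvPowerSeries.X (Var.z k)

/-- `L` represents the CR structure induced by `ℂ^{n+1}` on the hypersurface
`Im w = φ(z, z̄, Re w)`, in the intrinsic coordinates `(z, u)`, `u = Re w`: the images of the
vector fields spanning the graph of `L` under `(z, u) ↦ (z, u + i φ)` are of type `(1,0)`, that is,
they annihilate the antiholomorphic coordinates `z̄_j` and `w̄ = u - i φ`. -/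
def IsInduced (φ : GraphSeries n) : Prop :=
  ∀ k, (∀ j : Fin n, L.act k (MvPowerSeries.X (Var.zbar j)) = 0) ∧
    L.act k (MvPowerSeries.X Var.u - MvPowerSeries.C Complex.I * φ) = 0

end GraphMap

/-- The two formal almost CR structures given by `L` and `L'` coincide along the Euler field. -/
def EulerEqual {n : ℕ} (L L' : GraphMap n) : Prop :=
  (∀ j, L.eulerZbar j = L'.eulerZbar j) ∧ L.eulerW = L'.eulerW

/-! ### Formal embeddings -/

/-- The pull-backs of the coordinates `z`, `z̄`, `u = Re w` under a formal map `(Z, W)` into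
`ℂ^n × ℂ`. -/
def graphCoord {n : ℕ} (Z : Fin n → SourceSeries n) (W : SourceSeries n) : Var n → SourceSeries n
  | Sum.inl j => Z j
  | Sum.inr (Sum.inl j) => conjSeries (Z j)
  | Sum.inr (Sum.inr _) => MvPowerSeries.C (1 / 2 : ℂ) * (W + conjSeries W)

/-- A formal embedding `(Z, W)` of (the formal neighbourhood of the base point in) `ℝ^{2n+1}` into
`ℂ^n × ℂ`, sending the base point to `0`, as the formal real hypersurface
`M' = {Im w = φ(z, z̄, Re w)}` with `T_0 M' = ℂ^n × ℝ`. -/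
structure FormalEmbedding (n : ℕ) where
  /-- the components in `ℂ^n` -/
  Z : Fin n → SourceSeries n
  /-- the component in `ℂ` -/
  W : SourceSeries n
  /-- the defining series of the image hypersurface -/
  φ : GraphSeries n
  Z_zero : ∀ j, MvPowerSeries.constantCoeff (Z j) = 0
  W_zero : MvPowerSeries.constantCoeff W = 0
  hypersurface : IsHypersurface φ
  /-- the image lies in the hypersurface -/
  image : MvPowerSeries.subst (graphCoord Z W) φ
    = MvPowerSeries.C (1 / (2 * Complex.I)) * (W - conjSeries W)
  /-- the differential at the base point is injective -/
  immersion : ∀ v : RealSpace n,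
    (∀ j, ∑ k, (v k : ℂ) * MvPowerSeries.coeff (Finsupp.single k 1) (Z j) = 0) →
    ∑ k, (v k : ℂ) * MvPowerSeries.coeff (Finsupp.single k 1) W = 0 → v = 0

namespace FormalEmbedding

variable {n : ℕ} (E : FormalEmbedding n)

/-- The intrinsic coordinates `z`, `z̄`, `u = Re w` of the image hypersurface, pulled back to the
source; by the immersion property `(Z, Re W)` is a formal coordinate change. -/
def coord : Var n → SourceSeries n := graphCoord E.Z E.W

/-- `L` represents the transform of the formal almost CR structure `H10` to the image hypersurface
with its coordinates `(z, u)`: the push-forward of each formal `(1,0)` vector field `X` satisfies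
`(dz̄, du)(X) = L (dz(X))`. -/
def Transforms (H10 : Submodule (SourceSeries n) (FormalField n)) (L : GraphMap n) : Prop :=
  ∀ X ∈ H10,
    (∀ j, FormalField.act X (E.coord (Var.zbar j)) =
      ∑ k, MvPowerSeries.subst E.coord (L.zbar j k) * FormalField.act X (E.coord (Var.z k))) ∧
    FormalField.act X (E.coord Var.u) =
      ∑ k, MvPowerSeries.subst E.coord (L.w k) * FormalField.act X (E.coord (Var.z k))

/-- `E` is a formal quasi CR embedding of the formal almost CR structure `H10`: the transformed
structure on the image hypersurface and the one induced by `ℂ^{n+1}` coincide along the Euler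
field. -/
def IsQuasiCR (H10 : Submodule (SourceSeries n) (FormalField n)) : Prop :=
  ∃ L L' : GraphMap n, E.Transforms H10 L ∧ L'.IsInduced E.φ ∧ EulerEqual L L'

/-- `E` is a formal CR embedding of `H10`: its differential sends `(1,0)` vectors to `(1,0)`
vectors of `ℂ^{n+1}`. -/
def IsCR (H10 : Submodule (SourceSeries n) (FormalField n)) : Prop :=
  ∀ X ∈ H10, (∀ j, FormalField.act X (conjSeries (E.Z j)) = 0) ∧
    FormalField.act X (conjSeries E.W) = 0

/-- A quasi CR normal form: a formal quasi CR embedding as a hypersurface satisfying the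
Chern–Moser normalization. -/
def IsQuasiNormalForm (H10 : Submodule (SourceSeries n) (FormalField n)) : Prop :=
  E.IsQuasiCR H10 ∧ IsChernMoserNormalized E.φ

/-- A (formal) Chern–Moser normal form: a formal CR embedding as a hypersurface satisfying the
Chern–Moser normalization. -/
def IsChernMoserNormalForm (H10 : Submodule (SourceSeries n) (FormalField n)) : Prop :=
  E.IsCR H10 ∧ IsChernMoserNormalized E.φ

end FormalEmbedding

end QuasiCR

end

noncomputable section

namespace QuasiCR

open MvPowerSeries

/-! ### Filtrations of power series rings by weights -/

section Filtration

variable {σ τ : Type*}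

/-! On the hypersurface `M'` the series z, z̄, u are coordinates, and w̄ = u - iφ.

Quasi CR versus CR. Take a frame X_k of formal (1,0) fields dual to dz_k and put E = Σ z_k X_k, the
lift of the Euler field e. The quasi CR condition says exactly that E annihilates every z̄_j and w̄.
If the structure is closed under brackets, [E, X_k] + X_k is a (1,0) field that annihilates all z_j,
hence it is zero. For F = z̄_j or F = w̄ this gives E(X_k F) = -X_k F. In the coordinates E = e + g
∂/∂u with g in the ideal of z, and on the lowest order in z such an operator acts with eigenvalue k
≥ 0, never -1, so X_k F = 0 (`IsQuasiCR.isCR`). Conversely, the fields annihilating z̄ and w̄ are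
closed under brackets and are determined by their dz-components (`IsCR.formalBracket_mem`). A CR
embedding is always quasi CR, since then the transported and the induced structures are represented
by the same map; this gives the last statement.

Existence. Give z, z̄ weight 1 and u weight 2. Linear coordinates adapted to H^{1,0}, a
diagonalization of the Levi form and a quadratic change of u yield a frame ∂/∂z_k + Σ A_jk ∂/∂z̄_j +
B_k ∂/∂u, where A_jk has weight at least 1 and B_k = i z̄_k + Σ α_kl z_l up to weight 2, with α
antisymmetric (`exists_formalFrame`, `exists_levi_eq_one`, `exists_normalCoordinates`). The unknowns
are a real change of coordinates (z + f, u + g) and φ = |z|² + ψ. The quasi CR condition involves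
the single field e, so there are only n + 1 scalar equations, and no compatibility condition arises.
Their linearization is governed by Y = e + i|z|² ∂/∂u, which maps onto the ideal of z
(`exists_sphereEuler_eq`).

The remaining freedom contains the conjugates of h(z, u + i|z|²), restrictions of holomorphic
functions to the model hypersurface; they lie in the kernel of Y. As in the work of Chern and Moser
they are used to normalize ψ, bidegree by bidegree (`exists_adjustment`). The torsion α disturbs
this only through terms of z-order 3 and z̄-order 2. It matters for tr² F₂₃, where it leads to a
real linear system v̄ + (i/3) αᵗ v = d; pairing with v shows that this is uniquely solvable, because
α is antisymmetric (`exists_star_add_solution`).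

Hence the linearized equations have a solution with normalized ψ (`exists_correction`). Correcting
one weight at a time gives a formal solution of the nonlinear equations (`Trial.exists_solution`),
which is then read as a quasi CR embedding (`NormalCoordinates.exists_isQuasiCR`). -/

/-- The ideal of power series all of whose monomials have weight at least `k`. -/
def fil (w : σ → ℕ) (k : ℕ) : Ideal (MvPowerSeries σ ℂ) where
  carrier := {f | ∀ m, Finsupp.weight w m < k → coeff m f = 0}
  zero_mem' := by simp
  add_mem' := fun {f g} hf hg m hm => by rw [map_add, hf m hm, hg m hm, add_zero]
  smul_mem' := fun c f hf m hm => by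
    classical
    rw [smul_eq_mul, coeff_mul]
    refine Finset.sum_eq_zero fun x hx => ?_
    replace hx := Finset.HasAntidiagonal.mem_antidiagonal.mp hx
    have h : Finsupp.weight w x.2 < k := by
      rw [← hx, map_add] at hm; omega
    rw [hf _ h, mul_zero]

theorem fil_anti (w : σ → ℕ) {j k : ℕ} (h : j ≤ k) {f : MvPowerSeries σ ℂ} (hf : f ∈ fil w k) :
    f ∈ fil w j := fun m hm => hf m (hm.trans_le h)

theorem mem_fil_zero (w : σ → ℕ) (f : MvPowerSeries σ ℂ) : f ∈ fil w 0 :=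
  fun _ hm => absurd hm (Nat.not_lt_zero _)

theorem mul_mem_fil {w : σ → ℕ} {a b k : ℕ} {f g : MvPowerSeries σ ℂ} (hf : f ∈ fil w a)
    (hg : g ∈ fil w b) (hk : k ≤ a + b) : f * g ∈ fil w k := by
  classical
  intro m hm
  rw [coeff_mul]
  refine Finset.sum_eq_zero fun x hx => ?_
  replace hx := Finset.HasAntidiagonal.mem_antidiagonal.mp hx
  rw [← hx, map_add] at hm
  by_cases h : Finsupp.weight w x.1 < a
  · rw [hf _ h, zero_mul]
  · rw [hg _ (by omega), mul_zero]

theorem X_mem_fil (w : σ → ℕ) (v : σ) {k : ℕ} (hk : k ≤ w v) :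
    (X v : MvPowerSeries σ ℂ) ∈ fil w k := by
  classical
  intro m hm
  rw [coeff_X, if_neg]
  rintro rfl
  rw [Finsupp.weight_single, one_smul] at hm
  omega

theorem pow_mem_fil {w : σ → ℕ} {a : ℕ} {f : MvPowerSeries σ ℂ} (hf : f ∈ fil w a) (k : ℕ) :
    f ^ k ∈ fil w (k * a) := by
  induction k with
  | zero => rw [Nat.zero_mul]; exact mem_fil_zero _ _
  | succ k ih => rw [pow_succ]; exact mul_mem_fil ih hf (by rw [Nat.succ_mul])

theorem pderiv_mem_fil {w : σ → ℕ} {a k : ℕ} {f : MvPowerSeries σ ℂ} (hf : f ∈ fil w a) (v : σ)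
    (hk : k ≤ a - w v) : pderiv ℂ v f ∈ fil w k := by
  intro m hm
  rw [coeff_pderiv, hf, zero_mul]
  rw [map_add, Finsupp.weight_single, one_smul]
  omega

theorem eq_zero_of_forall_mem_fil {w : σ → ℕ} {f : MvPowerSeries σ ℂ} (h : ∀ k, f ∈ fil w k) :
    f = 0 := by
  ext m
  exact h _ m (Nat.lt_succ_self _)

theorem constantCoeff_eq_zero_iff_mem_fil {w : σ → ℕ} (hw : ∀ v, w v ≠ 0)
    {f : MvPowerSeries σ ℂ} : constantCoeff f = 0 ↔ f ∈ fil w 1 := by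
  constructor
  · intro h m hm
    have : m = 0 := by
      by_contra hne
      obtain ⟨v, hv⟩ := Finsupp.ne_iff.mp hne
      have := Finsupp.le_weight_of_ne_zero' w hv
      have := hw v
      omega
    rw [this, coeff_zero_eq_constantCoeff_apply, h]
  · intro h
    rw [← coeff_zero_eq_constantCoeff_apply]
    exact h 0 (by simp)

theorem exists_limit (w : σ → ℕ) (u : ℕ → MvPowerSeries σ ℂ) (N : ℕ)
    (hu : ∀ k, u (k + 1) - u k ∈ fil w (k + N)) :
    ∃ L, ∀ k, L - u k ∈ fil w (k + N) := by
  have mono : ∀ k j, u (k + j) - u k ∈ fil w (k + N) := by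
    intro k j
    induction j with
    | zero => simp
    | succ j ih =>
      have := (fil w (k + N)).add_mem (fil_anti w (by omega) (hu (k + j))) ih
      simpa [add_assoc] using this
  -- A coefficient of weight d no longer changes from stage d + 1 on, whatever `N` is, so it is read
  -- off there.
  let L : MvPowerSeries σ ℂ := fun m => coeff m (u (Finsupp.weight w m + 1))
  have hL : ∀ m, coeff m L = coeff m (u (Finsupp.weight w m + 1)) := fun _ => rfl
  refine ⟨L, fun k m hm => ?_⟩
  rw [map_sub, sub_eq_zero, hL]
  rcases le_total k (Finsupp.weight w m + 1) with h | h
  · obtain ⟨j, hj⟩ := Nat.exists_eq_add_of_le h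
    have := mono k j m hm
    rwa [← hj, map_sub, sub_eq_zero] at this
  · obtain ⟨j, hj⟩ := Nat.exists_eq_add_of_le h
    have := mono (Finsupp.weight w m + 1) j m (by omega)
    rw [← hj, map_sub, sub_eq_zero] at this
    exact this.symm

/-- A map that is contracting for the filtration has a fixed point. -/
theorem exists_fixedPoint (w : σ → ℕ) (Φ : MvPowerSeries σ ℂ → MvPowerSeries σ ℂ)
    (hΦ : ∀ f g k, f - g ∈ fil w k → Φ f - Φ g ∈ fil w (k + 1)) :
    ∃ x, Φ x = x ∧ ∀ (w' : σ → ℕ) (M : ℕ), (∀ f ∈ fil w' M, Φ f ∈ fil w' M) → x ∈ fil w' M := by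
  set u : ℕ → MvPowerSeries σ ℂ := fun k => Φ^[k] 0 with hu
  have hs : ∀ k, u (k + 1) = Φ (u k) := fun k => Function.iterate_succ_apply' Φ k 0
  have h1 : ∀ k, u (k + 1) - u k ∈ fil w (k + 0) := by
    intro k
    induction k with
    | zero => exact mem_fil_zero _ _
    | succ k ih =>
      have := hΦ _ _ _ ih
      rwa [← hs, ← hs] at this
  obtain ⟨L, hL⟩ := exists_limit w u 0 h1
  refine ⟨L, ?_, ?_⟩
  · rw [← sub_eq_zero]
    refine eq_zero_of_forall_mem_fil (w := w) fun k => ?_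
    have a := hΦ _ _ _ (hL k)
    rw [← hs] at a
    have b := hL (k + 1)
    have := (fil w (k + 1)).sub_mem a b
    rw [sub_sub_sub_cancel_right] at this
    exact fil_anti w (by omega) this
  · intro w' M h m hm
    have hk : ∀ k, u k ∈ fil w' M := by
      intro k
      induction k with
      | zero => exact zero_mem _
      | succ k ih => rw [hs]; exact h _ ih
    have := hL (Finsupp.weight w m + 1) m (by omega)
    rw [map_sub, sub_eq_zero] at this
    rw [this]
    exact hk _ m hm

end Filtration

/-! ### Substitution -/

section Substitution

variable {σ τ : Type*}

theorem hasSubst_of_mem_fil [Finite σ] {w : τ → ℕ} {c : σ → MvPowerSeries τ ℂ} (h : ∀ v, c v ∈ fil w 1) :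
    HasSubst c :=
  hasSubst_of_constantCoeff_zero fun v => by
    rw [← coeff_zero_eq_constantCoeff_apply]; exact h v 0 (by simp)

theorem prod_pow_mem_fil {w : σ → ℕ} {w' : τ → ℕ} {c : σ → MvPowerSeries τ ℂ}
    (hc : ∀ v, c v ∈ fil w' (w v)) (m : σ →₀ ℕ) :
    (m.prod fun s e => c s ^ e) ∈ fil w' (Finsupp.weight w m) := by
  classical
  induction m using Finsupp.induction_linear with
  | zero => simpa using mem_fil_zero _ _
  | add f g hf hg =>
    rw [Finsupp.prod_add_index' (fun _ => pow_zero _) (fun _ _ _ => pow_add _ _ _), map_add]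
    exact mul_mem_fil hf hg le_rfl
  | single v k =>
    rw [Finsupp.prod_single_index (h := fun s e => c s ^ e) (pow_zero _), Finsupp.weight_single,
      smul_eq_mul]
    exact pow_mem_fil (hc v) k

theorem prod_pow_sub_mem_fil {w : σ → ℕ} {w' : τ → ℕ} {c c' : σ → MvPowerSeries τ ℂ} {d : ℕ}
    (hc : ∀ v, c v ∈ fil w' (w v)) (hc' : ∀ v, c' v ∈ fil w' (w v))
    (h : ∀ v, c v - c' v ∈ fil w' (w v + d)) (m : σ →₀ ℕ) :
    (m.prod fun s e => c s ^ e) - (m.prod fun s e => c' s ^ e) ∈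
      fil w' (Finsupp.weight w m + d) := by
  classical
  induction m using Finsupp.induction_linear with
  | zero => simp
  | add f g hf hg =>
    simp only [Finsupp.prod_add_index' (fun _ => pow_zero _) (fun _ _ _ => pow_add _ _ _), map_add]
    have e : ∀ a b a' b' : MvPowerSeries τ ℂ, a * b - a' * b' = (a - a') * b + a' * (b - b') := by
      intros; ring
    rw [e]
    exact add_mem (mul_mem_fil hf (prod_pow_mem_fil hc g) (by omega))
      (mul_mem_fil (prod_pow_mem_fil hc' f) hg (by omega))
  | single v k =>
    simp only [Finsupp.prod_single_index, pow_zero, Finsupp.weight_single, smul_eq_mul]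
    induction k with
    | zero => simp
    | succ k ih =>
      have e : c v ^ (k + 1) - c' v ^ (k + 1)
          = (c v ^ k - c' v ^ k) * c v + c' v ^ k * (c v - c' v) := by ring
      rw [e]
      exact add_mem (mul_mem_fil ih (hc v) (by rw [Nat.succ_mul]; omega))
        (mul_mem_fil (pow_mem_fil (hc' v) k) (h v) (by rw [Nat.succ_mul]; omega))

theorem subst_mem_fil {w : σ → ℕ} {w' : τ → ℕ} {c : σ → MvPowerSeries τ ℂ} (hs : HasSubst c)
    (hc : ∀ v, c v ∈ fil w' (w v)) {a : ℕ} {A : MvPowerSeries σ ℂ} (hA : A ∈ fil w a) :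
    subst c A ∈ fil w' a := by
  intro e he
  rw [coeff_subst hs, finsum_eq_zero_of_forall_eq_zero]
  intro m
  by_cases hm : Finsupp.weight w m < a
  · rw [hA m hm, zero_smul]
  · rw [prod_pow_mem_fil hc m e (by omega), smul_zero]

/-- Quantitative continuity of substitution: a perturbation of relative weight `d` in every variable
perturbs each monomial, hence each series, by relative weight `d`. All later linearizations rest on
this estimate. -/
theorem subst_sub_subst_mem_fil {w : σ → ℕ} {w' : τ → ℕ} {c c' : σ → MvPowerSeries τ ℂ} {d : ℕ}
    (hs : HasSubst c) (hs' : HasSubst c')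
    (hc : ∀ v, c v ∈ fil w' (w v)) (hc' : ∀ v, c' v ∈ fil w' (w v))
    (h : ∀ v, c v - c' v ∈ fil w' (w v + d)) {a : ℕ} {A : MvPowerSeries σ ℂ} (hA : A ∈ fil w a) :
    subst c A - subst c' A ∈ fil w' (a + d) := by
  intro e he
  rw [map_sub, coeff_subst hs, coeff_subst hs', sub_eq_zero]
  refine finsum_congr fun m => ?_
  by_cases hm : Finsupp.weight w m < a
  · rw [hA m hm, zero_smul, zero_smul]
  · have := prod_pow_sub_mem_fil hc hc' h m e (by omega)
    rw [map_sub, sub_eq_zero] at this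
    rw [this]

variable [Fintype σ]

theorem exists_polynomial_sub_mem_fil (h : MvPowerSeries σ ℂ) (N : ℕ) :
    ∃ P : MvPolynomial σ ℂ, h - (P : MvPowerSeries σ ℂ) ∈ fil (fun _ => 1) N := by
  refine ⟨truncTotal N h, fun m hm => ?_⟩
  have : Finsupp.degree m < N := by rwa [Finsupp.degree_eq_weight_one]
  rw [map_sub, MvPolynomial.coeff_coe, coeff_truncTotal _ this, sub_self]

/-- The chain rule. -/
theorem pderiv_subst {c : σ → MvPowerSeries τ ℂ} (hc : ∀ v, constantCoeff (c v) = 0)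
    (i : τ) (h : MvPowerSeries σ ℂ) :
    pderiv ℂ i (subst c h) = ∑ v, subst c (pderiv ℂ v h) * pderiv ℂ i (c v) := by
  classical
  have hs : HasSubst c := hasSubst_of_constantCoeff_zero hc
  have hc1 : ∀ v, c v ∈ fil (fun _ => 1) 1 := fun v =>
    (constantCoeff_eq_zero_iff_mem_fil (by simp)).mp (hc v)
  have poly : ∀ P : MvPolynomial σ ℂ, pderiv ℂ i (subst c (P : MvPowerSeries σ ℂ)) =
      ∑ v, subst c (pderiv ℂ v (P : MvPowerSeries σ ℂ)) * pderiv ℂ i (c v) := by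
    intro P
    simp only [← coe_substAlgHom hs]
    induction P using MvPolynomial.induction_on with
    | C a =>
      simp only [MvPolynomial.coe_C, pderiv_C, map_zero, zero_mul, Finset.sum_const_zero]
      rw [MvPowerSeries.c_eq_algebraMap, AlgHom.commutes, ← MvPowerSeries.c_eq_algebraMap, pderiv_C]
    | add p q hp hq =>
      simp only [MvPolynomial.coe_add, map_add, hp, hq, add_mul, Finset.sum_add_distrib]
    | mul_X p v hp =>
      simp only [MvPolynomial.coe_mul, MvPolynomial.coe_X, map_mul, Derivation.leibniz, hp,
        smul_eq_mul, map_add, add_mul, Finset.sum_add_distrib, substAlgHom_X]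
      congr 1
      · rw [Finset.sum_eq_single v]
        · rw [pderiv_X_self, map_one, mul_one]
        · intro b _ hb; rw [pderiv_X_of_ne hb.symm, map_zero, mul_zero, zero_mul]
        · simp
      · rw [Finset.mul_sum]
        exact Finset.sum_congr rfl fun _ _ => by ring
  -- Both sides are continuous in `h`. After subtracting a polynomial only a remainder of order k +
  -- 1 is left, and differentiation lowers the order by at most one.
  rw [← sub_eq_zero]
  refine eq_zero_of_forall_mem_fil (w := fun _ => 1) fun k => ?_
  obtain ⟨P, hP⟩ := exists_polynomial_sub_mem_fil h (k + 1)
  set r := h - (P : MvPowerSeries σ ℂ)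
  have hr : h = r + P := by simp [r]
  have hr1 : subst c r ∈ fil (fun _ : τ => 1) (k + 1) := subst_mem_fil hs hc1 hP
  have e : pderiv ℂ i (subst c h) - ∑ v, subst c (pderiv ℂ v h) * pderiv ℂ i (c v)
      = pderiv ℂ i (subst c r) - ∑ v, subst c (pderiv ℂ v r) * pderiv ℂ i (c v) := by
    rw [hr]
    simp only [subst_add hs, map_add, add_mul, Finset.sum_add_distrib, poly]
    ring
  rw [e]
  refine sub_mem (pderiv_mem_fil hr1 i le_rfl) (sum_mem fun v _ => ?_)
  exact Ideal.mul_mem_right _ _ (subst_mem_fil hs hc1 (pderiv_mem_fil hP v le_rfl))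

/-- The substitution is the identity plus an operator that raises the weight. Injectivity follows by
increasing the order of a kernel element, surjectivity by solving x = y - (c*x - x) as a fixed point
problem. -/
theorem bijective_subst_of_sub_X_mem_fil {w : σ → ℕ} (hw : ∀ v, 1 ≤ w v)
    {c : σ → MvPowerSeries σ ℂ} (hc : ∀ v, c v - X v ∈ fil w (w v + 1)) :
    Function.Bijective (subst c : MvPowerSeries σ ℂ → MvPowerSeries σ ℂ) := by
  have hX : ∀ v, (X v : MvPowerSeries σ ℂ) ∈ fil w (w v) := fun v => X_mem_fil w v le_rfl
  have hc0 : ∀ v, c v ∈ fil w (w v) := fun v => by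
    have := add_mem (fil_anti w (Nat.le_succ _) (hc v)) (hX v)
    rwa [sub_add_cancel] at this
  have hs : HasSubst c := hasSubst_of_mem_fil fun v => fil_anti w (hw v) (hc0 v)
  have key : ∀ k (A : MvPowerSeries σ ℂ), A ∈ fil w k → subst c A - A ∈ fil w (k + 1) := by
    intro k A hA
    have := subst_sub_subst_mem_fil hs HasSubst.X hc0 hX hc hA
    rwa [subst_self] at this
  constructor
  · intro f g hfg
    rw [← sub_eq_zero]
    have h0 : subst c (f - g) = 0 := by rw [subst_sub hs, sub_eq_zero]; exact hfg
    refine eq_zero_of_forall_mem_fil (w := w) fun k => ?_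
    induction k with
    | zero => exact mem_fil_zero _ _
    | succ k ih =>
      have := key k _ ih
      rw [h0, zero_sub] at this
      simpa using neg_mem this
  · intro y
    obtain ⟨x, hx, -⟩ := exists_fixedPoint w (fun h => y - (subst c h - h)) (by
      intro f g k hfg
      have := neg_mem (key k _ hfg)
      rw [subst_sub hs] at this
      convert this using 1
      ring)
    exact ⟨x, by linear_combination -hx⟩

/-- The formal inverse function theorem. -/
theorem bijective_subst_of_linear [Fintype τ]
    [DecidableEq σ] [DecidableEq τ] {c : σ → MvPowerSeries τ ℂ}
    (hc : ∀ v, constantCoeff (c v) = 0) (N : τ → σ → ℂ)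
    (hNc : ∀ k l, ∑ v, N k v * coeff (Finsupp.single l 1) (c v) =
      if l = k then 1 else 0)
    (hcN : ∀ v v', ∑ k, coeff (Finsupp.single k 1) (c v) * N k v' = if v' = v then 1 else 0) :
    Function.Bijective (subst c : MvPowerSeries σ ℂ → MvPowerSeries τ ℂ) := by
  classical
  have hs : HasSubst c := hasSubst_of_constantCoeff_zero hc
  set ℓ : τ → MvPowerSeries σ ℂ := fun k => ∑ v, C (N k v) * X v with hℓ
  set ℓ' : σ → MvPowerSeries τ ℂ := fun v => ∑ k, C (coeff (Finsupp.single k 1) (c v)) * X k with hℓ'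
  have sℓ : HasSubst ℓ := hasSubst_of_constantCoeff_zero fun k => by simp [hℓ]
  have sℓ' : HasSubst ℓ' := hasSubst_of_constantCoeff_zero fun k => by simp [hℓ']
  have h1 : ∀ f, subst ℓ (subst ℓ' f) = f := by
    intro f
    rw [subst_comp_subst_apply sℓ' sℓ]
    have : (fun s => subst ℓ (ℓ' s)) = X := by
      funext v
      have e : subst ℓ (ℓ' v) = ∑ k, C (coeff (Finsupp.single k 1) (c v)) * ℓ k := by
        rw [← coe_substAlgHom sℓ, hℓ']
        simp only [map_sum, map_mul, substAlgHom_X]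
        refine Finset.sum_congr rfl fun k _ => ?_
        rw [MvPowerSeries.c_eq_algebraMap, AlgHom.commutes, ← MvPowerSeries.c_eq_algebraMap]
      rw [e]
      simp only [hℓ, Finset.mul_sum, ← mul_assoc, ← map_mul]
      rw [Finset.sum_comm]
      simp only [← Finset.sum_mul, ← map_sum, hcN]
      simp
    rw [this, subst_self]; rfl
  have h2 : ∀ f, subst ℓ' (subst ℓ f) = f := by
    intro f
    rw [subst_comp_subst_apply sℓ sℓ']
    have : (fun s => subst ℓ' (ℓ s)) = X := by
      funext k
      have e : subst ℓ' (ℓ k) = ∑ v, C (N k v) * ℓ' v := by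
        rw [← coe_substAlgHom sℓ', hℓ]
        simp only [map_sum, map_mul, substAlgHom_X]
        refine Finset.sum_congr rfl fun k _ => ?_
        rw [MvPowerSeries.c_eq_algebraMap, AlgHom.commutes, ← MvPowerSeries.c_eq_algebraMap]
      rw [e]
      simp only [hℓ', Finset.mul_sum, ← mul_assoc, ← map_mul]
      rw [Finset.sum_comm]
      simp only [← Finset.sum_mul, ← map_sum, hNc]
      simp
    rw [this, subst_self]; rfl
  have bℓ : Function.Bijective (subst ℓ : MvPowerSeries τ ℂ → MvPowerSeries σ ℂ) :=
    Function.bijective_iff_has_inverse.mpr ⟨_, h2, h1⟩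
  -- `N` is the inverse of the Jacobian matrix at the origin, so composing `c` with the linear
  -- substitution `ℓ` gives a series with identity linear part.
  have bκ : Function.Bijective
      (subst (fun k => subst c (ℓ k)) : MvPowerSeries τ ℂ → MvPowerSeries τ ℂ) := by
    refine bijective_subst_of_sub_X_mem_fil (w := fun _ => 1) (fun _ => le_rfl) fun k => ?_
    have e : subst c (ℓ k) = ∑ v, C (N k v) * c v := by
      rw [← coe_substAlgHom hs, hℓ]
      simp only [map_sum, map_mul, substAlgHom_X]
      refine Finset.sum_congr rfl fun k _ => ?_
      rw [MvPowerSeries.c_eq_algebraMap, AlgHom.commutes, ← MvPowerSeries.c_eq_algebraMap]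
    rw [e]
    intro m hm
    rcases Nat.lt_succ_iff_lt_or_eq.mp hm with h | h
    · have : m = 0 := by
        have h' : Finsupp.degree m = 0 := by
          rw [Finsupp.degree_eq_weight_one]; exact Nat.lt_one_iff.mp h
        exact (Finsupp.degree_eq_zero_iff m).mp h'
      subst this
      simp [hc]
    · obtain ⟨l, rfl⟩ : ∃ l, m = Finsupp.single l 1 := by
        have h' : Finsupp.degree m = 1 := by
          rw [Finsupp.degree_eq_weight_one]; exact h
        have : m ∈ Set.range fun a : τ => Finsupp.single a 1 := by
          rw [Finsupp.range_single_one]; exact h'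
        obtain ⟨l, hl⟩ := this
        exact ⟨l, hl.symm⟩
      simp only [map_sub, map_sum, coeff_C_mul, hNc, coeff_X, Finsupp.single_left_inj one_ne_zero]
      split_ifs <;> simp
  have comp : (subst (fun k => subst c (ℓ k)) : MvPowerSeries τ ℂ → MvPowerSeries τ ℂ)
      = subst c ∘ subst ℓ := (subst_comp_subst sℓ hs).symm
  rw [comp] at bκ
  exact (Function.Bijective.of_comp_iff _ bℓ).mp bκ

theorem bijective_subst_of_injective [Fintype τ] (hcard : Fintype.card σ = Fintype.card τ)
    {c : σ → MvPowerSeries τ ℂ} (hc : ∀ v, constantCoeff (c v) = 0)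
    (hinj : ∀ x : τ → ℂ, (∀ v, ∑ k, coeff (Finsupp.single k 1) (c v) * x k = 0) → x = 0) :
    Function.Bijective (subst c : MvPowerSeries σ ℂ → MvPowerSeries τ ℂ) := by
  classical
  set M : Matrix σ τ ℂ := Matrix.of fun v k => coeff (Finsupp.single k 1) (c v) with hM
  have hker : LinearMap.ker (Matrix.toLin' M) = ⊥ := by
    rw [LinearMap.ker_eq_bot']
    intro x hx
    refine hinj x fun v => ?_
    have := congrFun hx v
    simpa [hM, Matrix.mulVec, dotProduct] using this
  obtain ⟨g, hg⟩ := LinearMap.exists_leftInverse_of_injective _ hker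
  have h1 : LinearMap.toMatrix' g * M = 1 := by
    rw [← LinearMap.toMatrix'_toLin' M, ← LinearMap.toMatrix'_comp, hg, LinearMap.toMatrix'_id]
  have h2 : M * LinearMap.toMatrix' g = 1 :=
    (Matrix.mul_eq_one_comm_of_card_eq (R := ℂ) _ _ hcard.symm).mp h1
  refine bijective_subst_of_linear hc (fun k v => LinearMap.toMatrix' g k v) (fun k l => ?_)
    (fun v v' => ?_)
  · have := congrFun (congrFun h1 k) l
    rw [Matrix.mul_apply, Matrix.one_apply] at this
    simpa [hM, eq_comm] using this
  · have := congrFun (congrFun h2 v) v'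
    rw [Matrix.mul_apply, Matrix.one_apply] at this
    simpa [hM, eq_comm] using this

end Substitution

/-! ### Formal vector fields as derivations -/

theorem pderiv_comm {σ : Type*} (i j : σ) (f : MvPowerSeries σ ℂ) :
    pderiv ℂ i (pderiv ℂ j f) = pderiv ℂ j (pderiv ℂ i f) := by
  classical
  ext m
  simp only [coeff_pderiv, add_assoc, add_comm (Finsupp.single j 1) (Finsupp.single i 1),
    Finsupp.add_apply]
  by_cases h : i = j
  · subst h; rfl
  · rw [Finsupp.single_eq_of_ne h, Finsupp.single_eq_of_ne (Ne.symm h)]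
    push_cast
    ring

namespace FormalField

variable {n : ℕ} (X Y : FormalField n)

/-- A formal vector field as a derivation. -/
def toDer : Derivation ℂ (SourceSeries n) (SourceSeries n) := ∑ j, X j • pderiv ℂ j

theorem toDer_apply (f : SourceSeries n) : X.toDer f = X.act f := by
  rw [toDer, ← Derivation.coeFnAddMonoidHom_apply, map_sum, Finset.sum_apply]
  simp [act]

@[simp] theorem act_add (f g : SourceSeries n) : X.act (f + g) = X.act f + X.act g := by
  simp only [← toDer_apply, map_add]

@[simp] theorem act_sub (f g : SourceSeries n) : X.act (f - g) = X.act f - X.act g := by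
  simp only [← toDer_apply, map_sub]

@[simp] theorem act_sum {ι : Type*} (s : Finset ι) (f : ι → SourceSeries n) :
    X.act (∑ i ∈ s, f i) = ∑ i ∈ s, X.act (f i) := by
  simp only [← toDer_apply, map_sum]

@[simp] theorem act_mul (f g : SourceSeries n) : X.act (f * g) = f * X.act g + g * X.act f := by
  simp only [← toDer_apply, Derivation.leibniz, smul_eq_mul]

@[simp] theorem act_C (a : ℂ) : X.act (C a) = 0 := by simp [act]

@[simp] theorem act_zero : X.act 0 = 0 := by simp [act]

theorem act_X (k : Fin (2 * n + 1)) : X.act (MvPowerSeries.X k) = X k := by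
  rw [act, Finset.sum_eq_single k]
  · simp
  · intro b _ hb; rw [pderiv_X_of_ne hb.symm, mul_zero]
  · simp

@[simp] theorem add_act (f : SourceSeries n) : act (X + Y) f = X.act f + Y.act f := by
  simp [act, add_mul, Finset.sum_add_distrib]

@[simp] theorem sub_act (f : SourceSeries n) : act (X - Y) f = X.act f - Y.act f := by
  simp [act, sub_mul, Finset.sum_sub_distrib]

@[simp] theorem neg_act (f : SourceSeries n) : act (-X) f = - X.act f := by
  simp [act]

@[simp] theorem zero_act (f : SourceSeries n) : act (0 : FormalField n) f = 0 := by
  simp [act]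

@[simp] theorem smul_act (g f : SourceSeries n) : act (g • X) f = g * X.act f := by
  simp [act, Finset.mul_sum, mul_assoc]

@[simp] theorem sum_act {ι : Type*} (s : Finset ι) (A : ι → FormalField n) (f : SourceSeries n) :
    act (∑ i ∈ s, A i) f = ∑ i ∈ s, act (A i) f := by
  classical
  induction s using Finset.induction_on with
  | empty => simp
  | insert a s ha ih => rw [Finset.sum_insert ha, Finset.sum_insert ha, add_act, ih]

theorem act_subst {σ : Type*} [Fintype σ] {c : σ → SourceSeries n}
    (hc : ∀ v, constantCoeff (c v) = 0) (h : MvPowerSeries σ ℂ) :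
    X.act (subst c h) = ∑ v, subst c (pderiv ℂ v h) * X.act (c v) := by
  simp only [act, pderiv_subst hc, Finset.mul_sum]
  rw [Finset.sum_comm]
  exact Finset.sum_congr rfl fun _ _ => Finset.sum_congr rfl fun _ _ => by ring

/-- The second order terms X_j Y_k ∂_j ∂_k are symmetric and cancel in the commutator. -/
theorem bracket_act (f : SourceSeries n) :
    act (formalBracket X Y) f = X.act (Y.act f) - Y.act (X.act f) := by
  have h : ∀ A B : FormalField n, A.act (B.act f) =
      ∑ k, A.act (B k) * pderiv ℂ k f + ∑ j, ∑ k, A j * B k * pderiv ℂ j (pderiv ℂ k f) := by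
    intro A B
    conv_lhs => rw [act.eq_def B, act_sum]
    simp only [act_mul, Finset.sum_add_distrib]
    rw [add_comm]
    congr 1
    · exact Finset.sum_congr rfl fun _ _ => mul_comm _ _
    · simp only [act, Finset.mul_sum]
      rw [Finset.sum_comm]
      exact Finset.sum_congr rfl fun _ _ => Finset.sum_congr rfl fun _ _ => by ring
  rw [h, h]
  have h2 : ∑ j, ∑ k, X j * Y k * pderiv ℂ j (pderiv ℂ k f)
      = ∑ j, ∑ k, Y j * X k * pderiv ℂ j (pderiv ℂ k f) := by
    rw [Finset.sum_comm]
    refine Finset.sum_congr rfl fun j _ => Finset.sum_congr rfl fun k _ => ?_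
    rw [pderiv_comm]; ring
  rw [h2, add_sub_add_right_eq_sub, ← Finset.sum_sub_distrib]
  simp only [act, formalBracket, sub_mul]

theorem constantCoeff_act (f : SourceSeries n) : constantCoeff (X.act f) =
    ∑ j, coeff (Finsupp.single j 1) f * constantCoeff (X j) := by
  simp only [act, map_sum, map_mul]
  refine Finset.sum_congr rfl fun j _ => ?_
  rw [← coeff_zero_eq_constantCoeff_apply (pderiv ℂ j f), coeff_pderiv]
  simp [mul_comm]

end FormalField

theorem formalBracket_smul_left {n : ℕ} (f : SourceSeries n) (A B : FormalField n) :
    formalBracket (f • A) B = f • formalBracket A B - B.act f • A := by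
  funext k
  simp [formalBracket]
  ring

theorem formalBracket_add_left {n : ℕ} (A A' B : FormalField n) :
    formalBracket (A + A') B = formalBracket A B + formalBracket A' B := by
  funext k
  simp [formalBracket]
  ring

theorem formalBracket_antisymm {n : ℕ} (A B : FormalField n) :
    formalBracket A B = -formalBracket B A := by
  funext k
  simp [formalBracket]

/-- By the Leibniz rule [fA, B] = f[A, B] - (Bf)A the bracket is linear modulo the span, so
generators suffice. `key` treats the left slot, antisymmetry the right one. -/
theorem formalBracket_mem_span {n : ℕ} {s : Set (FormalField n)}
    (h : ∀ A ∈ s, ∀ B ∈ s, formalBracket A B ∈ Submodule.span (SourceSeries n) s) :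
    ∀ A ∈ Submodule.span (SourceSeries n) s, ∀ B ∈ Submodule.span (SourceSeries n) s,
      formalBracket A B ∈ Submodule.span (SourceSeries n) s := by
  have key : ∀ (T : Set (FormalField n)), T ⊆ Submodule.span (SourceSeries n) s →
      ∀ B, (∀ A ∈ T, formalBracket A B ∈ Submodule.span (SourceSeries n) s) →
      ∀ A ∈ Submodule.span (SourceSeries n) T,
        formalBracket A B ∈ Submodule.span (SourceSeries n) s := by
    intro T hT B hB A hA
    induction hA using Submodule.span_induction with
    | mem x hx => exact hB x hx
    | zero =>
      have : formalBracket 0 B = 0 := by funext k; simp [formalBracket]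
      rw [this]; exact zero_mem _
    | add x y _ _ hx hy => rw [formalBracket_add_left]; exact add_mem hx hy
    | smul a x hxm hx =>
      rw [formalBracket_smul_left]
      exact sub_mem (Submodule.smul_mem _ _ hx)
        (Submodule.smul_mem _ _ (Submodule.span_le.mpr hT hxm))
  intro A hA B hB
  refine key s Submodule.subset_span B (fun A' hA' => ?_) A hA
  rw [formalBracket_antisymm]
  refine neg_mem (key s Submodule.subset_span A' (fun B' hB' => ?_) B hB)
  exact h _ hB' _ hA'

/-! ### Conjugation on the source -/

theorem coeff_conjSeries {n : ℕ} (f : SourceSeries n) (m) :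
    coeff m (conjSeries f) = star (coeff m f) := by simp [conjSeries]

theorem constantCoeff_conjSeries {n : ℕ} (f : SourceSeries n) :
    constantCoeff (conjSeries f) = star (constantCoeff f) := by simp [conjSeries]

theorem card_var (n : ℕ) : Fintype.card (Var n) = Fintype.card (Fin (2 * n + 1)) := by
  simp only [Var, Fintype.card_sum, Fintype.card_fin, Fintype.card_unit]
  omega

/-! ### Formal embeddings as coordinate systems -/

theorem IsHypersurface.mem_fil {n : ℕ} {φ : GraphSeries n} (h : IsHypersurface φ) :
    φ ∈ fil (fun _ => 1) 2 := by
  intro m hm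
  rw [← Finsupp.degree_eq_weight_one] at hm
  rcases Nat.lt_succ_iff_lt_or_eq.mp hm with h' | h'
  · have : m = 0 := (Finsupp.degree_eq_zero_iff m).mp (by simpa using h')
    rw [this, coeff_zero_eq_constantCoeff_apply, h.constant]
  · have : m ∈ Set.range fun a : Var n => Finsupp.single a 1 := by
      rw [Finsupp.range_single_one]; exact h'
    obtain ⟨v, rfl⟩ := this
    exact h.linear v

namespace FormalEmbedding

variable {n : ℕ} (E : FormalEmbedding n)

theorem constantCoeff_coord (v : Var n) : constantCoeff (E.coord v) = 0 := by
  rcases v with j | j | j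
  · exact E.Z_zero j
  · simp [coord, graphCoord, constantCoeff_conjSeries, E.Z_zero]
  · simp [coord, graphCoord, constantCoeff_conjSeries, E.W_zero]

theorem hasSubst_coord : HasSubst E.coord := hasSubst_of_constantCoeff_zero E.constantCoeff_coord

/-- The immersion hypothesis concerns real tangent vectors only. As φ has order two, Im W has no
linear part, so the linear parts of z, z̄, u form a system closed under conjugation, and a complex
vector in the common kernel splits into a real and an imaginary part. -/
theorem coord_injective (x : Fin (2 * n + 1) → ℂ)
    (hx : ∀ v, ∑ k, coeff (Finsupp.single k 1) (E.coord v) * x k = 0) : x = 0 := by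
  have hW : ∀ k, coeff (Finsupp.single k 1) (conjSeries E.W)
      = coeff (Finsupp.single k 1) E.W := by
    intro k
    have h1 : subst E.coord E.φ ∈ fil (fun _ => 1) 2 :=
      subst_mem_fil E.hasSubst_coord (fun v =>
        (constantCoeff_eq_zero_iff_mem_fil (by simp)).mp (E.constantCoeff_coord v))
        E.hypersurface.mem_fil
    have h2 : subst E.coord E.φ = C (1 / (2 * Complex.I)) * (E.W - conjSeries E.W) := E.image
    rw [h2] at h1
    have h3 := h1 (Finsupp.single k 1) (by simp [Finsupp.weight_single])
    rw [coeff_C_mul, map_sub, mul_eq_zero] at h3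
    rcases h3 with h3 | h3
    · simp at h3
    · exact (sub_eq_zero.mp h3).symm
  -- If a covector and its conjugate both vanish on `x`, then the covector vanishes on Re x and on
  -- Im x.
  have real : ∀ (c : Fin (2 * n + 1) → ℂ), ∑ k, c k * x k = 0 → ∑ k, star (c k) * x k = 0 →
      ∑ k, ((x k).re : ℂ) * c k = 0 ∧ ∑ k, ((x k).im : ℂ) * c k = 0 := by
    intro c h1 h2
    have h2' : ∑ k, c k * star (x k) = 0 := by
      have := congrArg star h2
      simpa [star_sum, mul_comm] using this
    constructor
    · have : ∑ k, ((x k).re : ℂ) * c k = (∑ k, c k * x k + ∑ k, c k * star (x k)) / 2 := by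
        rw [← Finset.sum_add_distrib, Finset.sum_div]
        refine Finset.sum_congr rfl fun k _ => ?_
        rw [Complex.re_eq_add_conj]
        simp only [Complex.star_def]
        ring
      rw [this, h1, h2']; simp
    · have : ∑ k, ((x k).im : ℂ) * c k
          = (∑ k, c k * x k - ∑ k, c k * star (x k)) / (2 * Complex.I) := by
        rw [← Finset.sum_sub_distrib, Finset.sum_div]
        refine Finset.sum_congr rfl fun k _ => ?_
        rw [Complex.im_eq_sub_conj]
        simp only [Complex.star_def]
        ring
      rw [this, h1, h2']; simp
  have hZ : ∀ j, _ := fun j => real (fun k => coeff (Finsupp.single k 1) (E.Z j))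
    (hx (Var.z j)) (by simpa [coord, graphCoord, coeff_conjSeries] using hx (Var.zbar j))
  have hu : ∑ k, coeff (Finsupp.single k 1) E.W * x k = 0 := by
    have := hx Var.u
    simp only [coord, graphCoord, coeff_C_mul, map_add, hW] at this
    rw [← this]
    refine Finset.sum_congr rfl fun k _ => by ring
  have hWr := real (fun k => coeff (Finsupp.single k 1) E.W) hu (by
    simpa only [← coeff_conjSeries, hW] using hu)
  have hre := E.immersion (fun k => (x k).re) (fun j => (hZ j).1) hWr.1
  have him := E.immersion (fun k => (x k).im) (fun j => (hZ j).2) hWr.2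
  funext k
  exact Complex.ext (congrFun hre k) (congrFun him k)

theorem bijective_subst_coord :
    Function.Bijective (subst E.coord : GraphSeries n → SourceSeries n) :=
  bijective_subst_of_injective (card_var n) E.constantCoeff_coord E.coord_injective

/-- Every series on the source is a series in the coordinates, so by the chain rule a field is
determined by its action on them. -/
theorem eq_zero_of_act_coord {X : FormalField n} (h : ∀ v, X.act (E.coord v) = 0) : X = 0 := by
  funext k
  obtain ⟨f, hf⟩ := E.bijective_subst_coord.2 (MvPowerSeries.X k)
  rw [← X.act_X k, ← hf, X.act_subst E.constantCoeff_coord]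
  simp [h]

theorem conj_W : conjSeries E.W =
    E.coord Var.u - C Complex.I * subst E.coord E.φ := by
  have h2 : subst E.coord E.φ = C (1 / (2 * Complex.I)) * (E.W - conjSeries E.W) := E.image
  rw [h2, ← mul_assoc, ← map_mul]
  have : Complex.I * (1 / (2 * Complex.I)) = 1 / 2 := by field_simp
  rw [this]
  have h : (C (1 / 2 : ℂ) : SourceSeries n) * 2 = 1 := by
    rw [show (2 : SourceSeries n) = C 2 from rfl, ← map_mul]; norm_num
  simp only [coord, graphCoord]
  linear_combination (- conjSeries E.W) * h

theorem act_conj_W (X : FormalField n) : X.act (conjSeries E.W) = X.act (E.coord Var.u)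
    - C Complex.I * ∑ v, subst E.coord (pderiv ℂ v E.φ) * X.act (E.coord v) := by
  rw [E.conj_W, X.act_sub, X.act_mul, X.act_C, X.act_subst E.constantCoeff_coord]
  ring

theorem isUnit_one_sub_I_mul : IsUnit (1 - C Complex.I * pderiv ℂ Var.u E.φ) := by
  rw [MvPowerSeries.isUnit_iff_constantCoeff]
  simp only [map_sub, map_one, map_mul]
  rw [← coeff_zero_eq_constantCoeff_apply (pderiv ℂ Var.u E.φ), coeff_pderiv, zero_add,
    E.hypersurface.linear]
  simp

/-- With z and z̄ annihilated, X w̄ reduces to (1 - iφ_u) Xu with a unit as factor. Thus z, z̄, w̄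
determine a field as well as z, z̄, u do. -/
theorem eq_zero_of_act_conj {X : FormalField n} (hZ : ∀ j, X.act (E.Z j) = 0)
    (hZ' : ∀ j, X.act (conjSeries (E.Z j)) = 0) (hW : X.act (conjSeries E.W) = 0) : X = 0 := by
  have hz : ∀ j, X.act (E.coord (Var.z j)) = 0 := hZ
  have hz' : ∀ j, X.act (E.coord (Var.zbar j)) = 0 := hZ'
  refine E.eq_zero_of_act_coord ?_
  rw [E.act_conj_W] at hW
  simp only [Fintype.sum_sum_type, hz, hz', mul_zero, Finset.sum_const_zero, zero_add,
    Finset.univ_unique, Finset.sum_singleton] at hW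
  have hu : subst E.coord (1 - C Complex.I * pderiv ℂ Var.u E.φ) * X.act (E.coord Var.u) = 0 := by
    rw [← coe_substAlgHom E.hasSubst_coord, map_sub, map_mul, map_one,
      MvPowerSeries.c_eq_algebraMap, AlgHom.commutes, ← MvPowerSeries.c_eq_algebraMap,
      coe_substAlgHom]
    linear_combination hW
  have hun : IsUnit (subst E.coord (1 - C Complex.I * pderiv ℂ Var.u E.φ)) := by
    rw [← coe_substAlgHom E.hasSubst_coord]
    exact E.isUnit_one_sub_I_mul.map _
  have hu' := (hun.mul_right_eq_zero).mp hu
  rintro (j | j | j)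
  · exact hz j
  · exact hz' j
  · exact hu'

/-- Fields in the kernel of `dZ` vanish if the structure is transversal to the embedding. -/
theorem Transforms.eq_zero {E : FormalEmbedding n} {M : Submodule (SourceSeries n) (FormalField n)}
    {L : GraphMap n} (hL : E.Transforms M L) {X : FormalField n} (hX : X ∈ M)
    (hZ : ∀ j, X.act (E.Z j) = 0) : X = 0 := by
  have hz : ∀ j, X.act (E.coord (Var.z j)) = 0 := hZ
  refine E.eq_zero_of_act_coord ?_
  obtain ⟨h1, h2⟩ := hL X hX
  rintro (j | j | j)
  · exact hz j
  · simpa [hz] using h1 j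
  · simpa [hz] using h2

/-- A representation by `L` expresses the z̄- and u-derivatives of a field in `M` through its
z-derivatives. A relation between the vectors (e_k Z_j) at the base point would therefore be a
relation between the vectors e_k themselves; so this matrix is invertible over the series ring, and
its inverse gives the dual frame. -/
theorem Transforms.exists_dual_frame {E : FormalEmbedding n}
    {M : Submodule (SourceSeries n) (FormalField n)}
    {L : GraphMap n} (hL : E.Transforms M L) {e : Fin n → FormalField n} (he : ∀ k, e k ∈ M)
    (hli : LinearIndependent ℂ fun k : Fin n => fun i => constantCoeff (e k i)) :
    ∃ X : Fin n → FormalField n, (∀ k, X k ∈ M) ∧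
      ∀ j k, (X k).act (E.Z j) = if j = k then 1 else 0 := by
  classical
  set P : Matrix (Fin n) (Fin n) (SourceSeries n) := Matrix.of fun j k => (e k).act (E.Z j) with hP
  have hdet : IsUnit P.det := by
    rw [MvPowerSeries.isUnit_iff_constantCoeff, RingHom.map_det, ← Matrix.isUnit_iff_isUnit_det,
      ← Matrix.mulVec_injective_iff_isUnit, ← Matrix.coe_mulVecLin, ← LinearMap.ker_eq_bot,
      LinearMap.ker_eq_bot']
    intro a ha
    have hz : ∀ j, ∑ k, a k * constantCoeff ((e k).act (E.coord (Var.z j))) = 0 := by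
      intro j
      have := congrFun ha j
      simp only [Matrix.mulVecLin_apply, Matrix.mulVec, dotProduct, RingHom.mapMatrix_apply,
        Matrix.map_apply, hP, Matrix.of_apply, Pi.zero_apply] at this
      rw [← this]
      exact Finset.sum_congr rfl fun _ _ => mul_comm _ _
    have hcomb : ∀ (b : Fin n → SourceSeries n) (f : SourceSeries n),
        (∀ k, (e k).act f = ∑ l, b l * (e k).act (E.coord (Var.z l))) →
        ∑ k, a k * constantCoeff ((e k).act f) = 0 := by
      intro b f hb
      simp only [hb, map_sum, map_mul, Finset.mul_sum]
      rw [Finset.sum_comm]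
      refine Finset.sum_eq_zero fun l _ => ?_
      have := congrArg (fun t => constantCoeff (b l) * t) (hz l)
      simp only [mul_zero, Finset.mul_sum] at this
      rw [← this]
      exact Finset.sum_congr rfl fun _ _ => by ring
    have hall : ∀ v, ∑ k, a k * constantCoeff ((e k).act (E.coord v)) = 0 := by
      rintro (j | j | j)
      · exact hz j
      · exact hcomb _ _ fun k => (hL _ (he k)).1 j
      · exact hcomb _ _ fun k => (hL _ (he k)).2
    have hv : (∑ k, a k • fun i => constantCoeff (e k i)) = 0 := by
      refine E.coord_injective _ fun v => ?_
      rw [← hall v]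
      simp only [Finset.sum_apply, Pi.smul_apply, smul_eq_mul, FormalField.constantCoeff_act,
        Finset.mul_sum]
      rw [Finset.sum_comm]
      exact Finset.sum_congr rfl fun _ _ => Finset.sum_congr rfl fun _ _ => by ring
    exact funext fun k => Fintype.linearIndependent_iff.mp hli a hv k
  refine ⟨fun l => ∑ k, P⁻¹ k l • e k, fun l => sum_mem fun k _ => Submodule.smul_mem _ _ (he k),
    fun j l => ?_⟩
  have := congrFun (congrFun (Matrix.mul_nonsing_inv P hdet) j) l
  rw [Matrix.mul_apply, Matrix.one_apply] at this
  rw [← this, FormalField.sum_act]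
  exact Finset.sum_congr rfl fun k _ => by rw [FormalField.smul_act, hP, Matrix.of_apply, mul_comm]

end FormalEmbedding

/-! ### Gradings of `ℂ⟦z, z̄, u⟧` -/

section Grading

variable {n : ℕ}

/-- The weight counting the variables `z`. -/
def zWeight : Var n → ℕ
  | Sum.inl _ => 1
  | Sum.inr _ => 0

/-- The weight counting the variables `z̄`. -/
def zbarWeight : Var n → ℕ
  | Sum.inl _ => 0
  | Sum.inr (Sum.inl _) => 1
  | Sum.inr (Sum.inr _) => 0

/-- The weight giving `z`, `z̄` weight one and `u` weight two. -/
def cmWeight : Var n → ℕ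
  | Sum.inl _ => 1
  | Sum.inr (Sum.inl _) => 1
  | Sum.inr (Sum.inr _) => 2

@[simp] theorem zWeight_z (j : Fin n) : zWeight (Var.z j) = 1 := rfl
@[simp] theorem zWeight_zbar (j : Fin n) : zWeight (Var.zbar j) = 0 := rfl
@[simp] theorem zWeight_u : zWeight (Var.u : Var n) = 0 := rfl
@[simp] theorem zbarWeight_z (j : Fin n) : zbarWeight (Var.z j) = 0 := rfl
@[simp] theorem zbarWeight_zbar (j : Fin n) : zbarWeight (Var.zbar j) = 1 := rfl
@[simp] theorem zbarWeight_u : zbarWeight (Var.u : Var n) = 0 := rfl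
@[simp] theorem cmWeight_z (j : Fin n) : cmWeight (Var.z j) = 1 := rfl
@[simp] theorem cmWeight_zbar (j : Fin n) : cmWeight (Var.zbar j) = 1 := rfl
@[simp] theorem cmWeight_u : cmWeight (Var.u : Var n) = 2 := rfl

theorem weight_zWeight (m : Var n →₀ ℕ) : Finsupp.weight zWeight m = zDegree m := by
  simp [Finsupp.weight_eq_sum, zDegree, Fintype.sum_sum_type]

theorem weight_zbarWeight (m : Var n →₀ ℕ) : Finsupp.weight zbarWeight m = zbarDegree m := by
  simp [Finsupp.weight_eq_sum, zbarDegree, Fintype.sum_sum_type]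

/-- The Euler operator `∑_j z_j ∂/∂z_j`. -/
def euler : Derivation ℂ (GraphSeries n) (GraphSeries n) :=
  ∑ j : Fin n, (X (Var.z j) : GraphSeries n) • pderiv ℂ (Var.z j)

/-- The Euler operator `∑_j z̄_j ∂/∂z̄_j`. -/
def eulerBar : Derivation ℂ (GraphSeries n) (GraphSeries n) :=
  ∑ j : Fin n, (X (Var.zbar j) : GraphSeries n) • pderiv ℂ (Var.zbar j)

theorem euler_apply (f : GraphSeries n) :
    euler f = ∑ j : Fin n, X (Var.z j) * pderiv ℂ (Var.z j) f := by
  rw [euler, ← Derivation.coeFnAddMonoidHom_apply, map_sum, Finset.sum_apply]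
  simp

theorem eulerBar_apply (f : GraphSeries n) :
    eulerBar f = ∑ j : Fin n, X (Var.zbar j) * pderiv ℂ (Var.zbar j) f := by
  rw [eulerBar, ← Derivation.coeFnAddMonoidHom_apply, map_sum, Finset.sum_apply]
  simp

theorem coeff_X_mul_pderiv {σ : Type*} (v : σ) (f : MvPowerSeries σ ℂ) (m : σ →₀ ℕ) :
    coeff m (X v * pderiv ℂ v f) = m v * coeff m f := by
  classical
  rw [X, coeff_monomial_mul]
  split_ifs with h
  · rw [one_mul, coeff_pderiv, tsub_add_cancel_of_le h]
    have : 1 ≤ m v := by simpa using h v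
    rw [Finsupp.coe_tsub, Pi.sub_apply, Finsupp.single_eq_same, Nat.cast_sub this]
    push_cast
    ring
  · have : m v = 0 := by
      by_contra hne
      refine h fun w => ?_
      by_cases hw : w = v
      · subst hw; simpa using Nat.one_le_iff_ne_zero.mpr hne
      · rw [Finsupp.single_eq_of_ne hw]; exact Nat.zero_le _
    rw [this]; simp

theorem coeff_euler (f : GraphSeries n) (m : Var n →₀ ℕ) :
    coeff m (euler f) = zDegree m * coeff m f := by
  simp only [euler_apply, map_sum, coeff_X_mul_pderiv, ← Finset.sum_mul, zDegree, Nat.cast_sum]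

theorem coeff_eulerBar (f : GraphSeries n) (m : Var n →₀ ℕ) :
    coeff m (eulerBar f) = zbarDegree m * coeff m f := by
  simp only [eulerBar_apply, map_sum, coeff_X_mul_pderiv, ← Finset.sum_mul, zbarDegree,
    Nat.cast_sum]

theorem euler_mem_fil_zWeight (f : GraphSeries n) : euler f ∈ fil zWeight 1 := by
  intro m hm
  rw [weight_zWeight, Nat.lt_one_iff] at hm
  rw [coeff_euler, hm]
  simp

theorem euler_mem_fil {w : Var n → ℕ} {k : ℕ} {f : GraphSeries n} (hf : f ∈ fil w k) :
    euler f ∈ fil w k := fun m hm => by rw [coeff_euler, hf m hm, mul_zero]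

/-- The equation `e f + g ∂f/∂u = -f`, with `g` in the ideal of `z`, has only the zero solution. -/
theorem eq_zero_of_euler_eq_neg {f g : GraphSeries n} (hg : g ∈ fil zWeight 1)
    (h : euler f + g * pderiv ℂ Var.u f = -f) : f = 0 := by
  refine eq_zero_of_forall_mem_fil (w := zWeight) fun k => ?_
  induction k with
  | zero => exact mem_fil_zero _ _
  | succ k ih =>
    -- This term has higher z-order than `f`. In z-degree k the equation reads k f_k = -f_k, which
    -- is impossible unless f_k = 0.
    have h1 : g * pderiv ℂ Var.u f ∈ fil zWeight (k + 1) :=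
      mul_mem_fil hg (pderiv_mem_fil ih Var.u le_rfl) (by simp [add_comm])
    intro m hm
    have := congrArg (coeff m) h
    rw [map_add, h1 m hm, add_zero, coeff_euler, map_neg] at this
    have h3 : ((zDegree m : ℂ) + 1) * coeff m f = 0 := by rw [add_mul, this]; ring
    rcases mul_eq_zero.mp h3 with h4 | h4
    · exact absurd h4 (Nat.cast_add_one_ne_zero _)
    · exact h4

end Grading

/-! ### The induced structure of a formal hypersurface -/

namespace GraphMap

variable {n : ℕ} {L : GraphMap n} {φ : GraphSeries n}

theorem isInduced_iff : L.IsInduced φ ↔ (∀ j k, L.zbar j k = 0) ∧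
    ∀ k, L.w k * (1 - C Complex.I * pderiv ℂ Var.u φ) = C Complex.I * pderiv ℂ (Var.z k) φ := by
  classical
  have h1 : ∀ j k, L.act k (X (Var.zbar j)) = L.zbar j k := by
    intro j k
    rw [act, Finset.sum_eq_single j]
    · rw [pderiv_X_of_ne (by simp), pderiv_X_self, pderiv_X_of_ne (by simp)]; simp
    · intro b _ hb; rw [pderiv_X_of_ne (by simpa using hb.symm), mul_zero]
    · simp
  have h2 : (∀ j k, L.zbar j k = 0) → ∀ k, L.act k (X Var.u - C Complex.I * φ) =
      L.w k * (1 - C Complex.I * pderiv ℂ Var.u φ) - C Complex.I * pderiv ℂ (Var.z k) φ := by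
    intro h k
    have hI : ∀ v, pderiv ℂ v (C Complex.I * φ) = C Complex.I * pderiv ℂ v φ := by
      intro v; rw [Derivation.leibniz, pderiv_C]; simp
    simp only [act, h, zero_mul, Finset.sum_const_zero, add_zero, map_sub, hI]
    rw [pderiv_X_of_ne (by simp), pderiv_X_self]
    ring
  constructor
  · intro h
    have h0 : ∀ j k, L.zbar j k = 0 := fun j k => by rw [← h1]; exact (h k).1 j
    refine ⟨h0, fun k => ?_⟩
    have := (h k).2
    rwa [h2 h0, sub_eq_zero] at this
  · rintro ⟨h0, h⟩ k
    exact ⟨fun j => by rw [h1, h0], by rw [h2 h0, h, sub_self]⟩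

end GraphMap

/-! ### Formal quasi CR embeddings and integrability -/

namespace FormalEmbedding

variable {n : ℕ} {E : FormalEmbedding n} {M : Submodule (SourceSeries n) (FormalField n)}

/-- The lift `e` of the Euler field annihilates z̄ and w̄. Integrability gives [e, X_k] = -X_k, so
X_k z̄_j and X_k w̄ would be eigenvectors of `e` with eigenvalue -1, which do not exist. -/
theorem IsQuasiCR.isCR (hq : E.IsQuasiCR M) {X : Fin n → FormalField n} (hX : ∀ k, X k ∈ M)
    (hd : ∀ j k, (X k).act (E.Z j) = if j = k then 1 else 0)
    (hint : ∀ A ∈ M, ∀ B ∈ M, formalBracket A B ∈ M) : E.IsCR M := by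
  classical
  obtain ⟨L, L', hL, hL', hLz, hLw⟩ := hq
  rw [GraphMap.isInduced_iff] at hL'
  set τ := substAlgHom (R := ℂ) (S := ℂ) E.hasSubst_coord with hτ
  have τc : ∀ f, subst E.coord f = τ f := fun f => by rw [hτ, coe_substAlgHom]
  have τX : ∀ v, τ (MvPowerSeries.X v) = E.coord v := fun v => by rw [hτ, substAlgHom_X]
  have τC : ∀ a, τ (C a) = C a := fun a => by
    rw [MvPowerSeries.c_eq_algebraMap, AlgHom.commutes, ← MvPowerSeries.c_eq_algebraMap]
  set e : FormalField n := ∑ k, E.Z k • X k with he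
  have heM : e ∈ M := sum_mem fun k _ => Submodule.smul_mem _ _ (hX k)
  have eact : ∀ f, e.act f = ∑ k, E.Z k * (X k).act f := fun f => by
    rw [he, FormalField.sum_act]; simp
  have heZ : ∀ j, e.act (E.coord (Var.z j)) = E.coord (Var.z j) := by
    intro j
    change e.act (E.Z j) = E.Z j
    rw [eact]; simp [hd]
  have Xz : ∀ k j, (X k).act (E.coord (Var.zbar j)) = τ (L.zbar j k) := by
    intro k j
    rw [(hL _ (hX k)).1 j]
    have : ∀ l, (X k).act (E.coord (Var.z l)) = if l = k then 1 else 0 := fun l => hd l k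
    simp [this, τc]
  have Xu : ∀ k, (X k).act (E.coord Var.u) = τ (L.w k) := by
    intro k
    rw [(hL _ (hX k)).2]
    have : ∀ l, (X k).act (E.coord (Var.z l)) = if l = k then 1 else 0 := fun l => hd l k
    simp [this, τc]
  have heZ' : ∀ j, e.act (E.coord (Var.zbar j)) = 0 := by
    intro j
    rw [eact]
    have h1 : ∑ k, E.Z k * (X k).act (E.coord (Var.zbar j)) = τ (L.eulerZbar j) := by
      rw [GraphMap.eulerZbar, map_sum]
      refine Finset.sum_congr rfl fun k _ => ?_
      rw [map_mul, τX, Xz, mul_comm]; rfl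
    rw [h1, hLz, GraphMap.eulerZbar]
    simp [hL'.1]
  have heu : e.act (E.coord Var.u) = τ L'.eulerW := by
    rw [eact, ← hLw, GraphMap.eulerW, map_sum]
    refine Finset.sum_congr rfl fun k _ => ?_
    rw [map_mul, τX, Xu, mul_comm]; rfl
  -- Along the Euler field `L` may be replaced by `L'`, and the defining equation of `L'` says
  -- precisely that w̄ = u - iφ is annihilated.
  have heW : e.act (conjSeries E.W) = 0 := by
    rw [E.act_conj_W]
    simp only [Fintype.sum_sum_type, heZ, heZ', mul_zero, Finset.sum_const_zero, zero_add,
      Finset.univ_unique, Finset.sum_singleton]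
    have h1 : ∑ k, subst E.coord (pderiv ℂ (Var.z k) E.φ) * E.coord (Var.z k)
        = τ (∑ k, pderiv ℂ (Var.z k) E.φ * MvPowerSeries.X (Var.z k)) := by
      rw [map_sum]
      exact Finset.sum_congr rfl fun k _ => by rw [map_mul, τX, τc]
    change e.act (E.coord Var.u) - C Complex.I * (_ + subst E.coord (pderiv ℂ Var.u E.φ) *
      e.act (E.coord Var.u)) = 0
    rw [heu, h1, τc, ← map_mul, ← map_add, ← τC, ← map_mul, ← map_sub, GraphMap.eulerW]
    rw [show (0 : SourceSeries n) = τ 0 by simp]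
    congr 1
    have h2 : (∑ k, L'.w k * MvPowerSeries.X (Var.z k)) *
        (1 - C Complex.I * pderiv ℂ Var.u E.φ)
        = C Complex.I * ∑ k, pderiv ℂ (Var.z k) E.φ * MvPowerSeries.X (Var.z k) := by
      rw [Finset.sum_mul, Finset.mul_sum]
      refine Finset.sum_congr rfl fun k _ => ?_
      linear_combination MvPowerSeries.X (Var.z k) * hL'.2 k
    change _ - C Complex.I * (_ + pderiv ℂ Var.u E.φ * _) = 0
    linear_combination h2
  -- The bracket applied to Z_j gives e(δ_jk) - X_k Z_j = -δ_jk. Hence [e, X_k] + X_k is a field in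
  -- `M` without dz-component, and such a field is zero.
  have hbr : ∀ k, formalBracket e (X k) = - X k := by
    intro k
    rw [eq_neg_iff_add_eq_zero]
    refine hL.eq_zero (add_mem (hint _ heM _ (hX k)) (hX k)) fun j => ?_
    have hc : ∀ f : SourceSeries n, (f = 0 ∨ f = 1) → e.act f = 0 := by
      rintro f (rfl | rfl)
      · simp
      · exact e.act_C 1
    have := heZ j
    change e.act (E.Z j) = E.Z j at this
    rw [FormalField.add_act, FormalField.bracket_act, this, hc, zero_sub, neg_add_cancel]
    rw [hd]; split_ifs <;> simp
  have key : ∀ F, e.act F = 0 → ∀ k, (X k).act F = 0 := by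
    intro F hF k
    have h1 : e.act ((X k).act F) = - (X k).act F := by
      have := FormalField.bracket_act e (X k) F
      rw [hbr, FormalField.neg_act, hF, FormalField.act_zero, sub_zero] at this
      exact this.symm
    obtain ⟨f, hf⟩ := E.bijective_subst_coord.2 ((X k).act F)
    -- In the coordinates `e` acts as the Euler operator plus L'(e) ∂/∂u, because it annihilates z̄;
    -- the coefficient L'(e) lies in the ideal of z.
    have h2 : euler f + L'.eulerW * pderiv ℂ Var.u f = -f := by
      refine E.bijective_subst_coord.1 ?_
      rw [← hf, FormalField.act_subst _ E.constantCoeff_coord] at h1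
      simp only [Fintype.sum_sum_type, heZ, heZ', mul_zero, Finset.sum_const_zero, zero_add,
        Finset.univ_unique, Finset.sum_singleton] at h1
      have hu' : e.act (E.coord (Sum.inr (Sum.inr default))) = τ L'.eulerW := heu
      rw [hu'] at h1
      simp only [τc] at h1 ⊢
      rw [map_neg, ← h1, map_add, map_mul, euler_apply, map_sum]
      simp only [map_mul, τX]
      rw [mul_comm (τ L'.eulerW)]
      congr 1
      exact Finset.sum_congr rfl fun k _ => mul_comm _ _
    have h3 : f = 0 := by
      refine eq_zero_of_euler_eq_neg ?_ h2
      exact sum_mem fun k _ => Ideal.mul_mem_left _ _ (X_mem_fil _ _ (by simp))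
    rw [← hf, h3, τc, map_zero]
  intro A hA
  -- The dual frame generates `M`, again because fields in `M` are determined by their
  -- dz-components.
  have hA' : A = ∑ k, A.act (E.Z k) • X k := by
    rw [← sub_eq_zero]
    refine hL.eq_zero (sub_mem hA (sum_mem fun k _ => Submodule.smul_mem _ _ (hX k))) fun j => ?_
    simp [hd]
  rw [hA']
  constructor
  · intro j
    rw [FormalField.sum_act]
    refine Finset.sum_eq_zero fun k _ => ?_
    rw [FormalField.smul_act,
      show (X k).act (conjSeries (E.Z j)) = 0 from key _ (heZ' j) k, mul_zero]
  · rw [FormalField.sum_act]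
    refine Finset.sum_eq_zero fun k _ => ?_
    rw [FormalField.smul_act, key _ heW, mul_zero]

/-- The bracket of two fields annihilating z̄ and w̄ annihilates them too. It agrees on z, z̄, w̄
with the combination D' of the dual frame having the same dz-components, hence equals it. -/
theorem IsCR.formalBracket_mem (hcr : E.IsCR M) {X : Fin n → FormalField n} (hX : ∀ k, X k ∈ M)
    (hd : ∀ j k, (X k).act (E.Z j) = if j = k then 1 else 0) {A B : FormalField n}
    (hA : A ∈ M) (hB : B ∈ M) : formalBracket A B ∈ M := by
  classical
  set D := formalBracket A B with hD
  set D' : FormalField n := ∑ k, D.act (E.Z k) • X k with hD'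
  have hD'M : D' ∈ M := sum_mem fun k _ => Submodule.smul_mem _ _ (hX k)
  have h1 : ∀ F, A.act F = 0 → B.act F = 0 → D.act F = 0 := fun F hAF hBF => by
    rw [hD, FormalField.bracket_act, hAF, hBF]; simp
  have : D - D' = 0 := by
    refine E.eq_zero_of_act_conj (fun j => ?_) (fun j => ?_) ?_
    · rw [FormalField.sub_act, hD', FormalField.sum_act]; simp [hd]
    · rw [FormalField.sub_act, (hcr _ hD'M).1 j, h1 _ ((hcr _ hA).1 j) ((hcr _ hB).1 j), sub_zero]
    · rw [FormalField.sub_act, (hcr _ hD'M).2, h1 _ (hcr _ hA).2 (hcr _ hB).2, sub_zero]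
  rw [sub_eq_zero.mp this]
  exact hD'M

/-- A formal quasi CR embedding is a formal CR embedding if and only if the formal structure is
integrable. -/
theorem IsQuasiCR.isCR_iff (hq : E.IsQuasiCR M) {e : Fin n → FormalField n} (he : ∀ k, e k ∈ M)
    (hli : LinearIndependent ℂ fun k : Fin n => fun i => constantCoeff (e k i)) :
    E.IsCR M ↔ ∀ A ∈ M, ∀ B ∈ M, formalBracket A B ∈ M := by
  obtain ⟨L, L', hL, h⟩ := id hq
  obtain ⟨X, hX, hd⟩ := hL.exists_dual_frame he hli
  exact ⟨fun hcr A hA B hB => hcr.formalBracket_mem hX hd hA hB, fun h => hq.isCR hX hd h⟩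

theorem IsInduced_exists (E : FormalEmbedding n) : ∃ L : GraphMap n, L.IsInduced E.φ := by
  obtain ⟨b, hb⟩ := E.isUnit_one_sub_I_mul.exists_right_inv
  refine ⟨⟨fun _ _ => 0, fun k => b * (C Complex.I * pderiv ℂ (Var.z k) E.φ)⟩, ?_⟩
  rw [GraphMap.isInduced_iff]
  exact ⟨fun _ _ => rfl, fun k => by
    linear_combination (C Complex.I * pderiv ℂ (Var.z k) E.φ) * hb⟩

/-- A formal CR embedding with a transversal frame is a formal quasi CR embedding. -/
theorem IsCR.isQuasiCR (hcr : E.IsCR M) : E.IsQuasiCR M := by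
  classical
  obtain ⟨L, hL⟩ := E.IsInduced_exists
  -- For a CR embedding the transported structure is represented by the induced map itself.
  refine ⟨L, L, fun A hA => ?_, hL, fun _ => rfl, rfl⟩
  obtain ⟨h0, hw⟩ := GraphMap.isInduced_iff.mp hL
  have hz : ∀ j, A.act (E.coord (Var.zbar j)) = 0 := (hcr A hA).1
  refine ⟨fun j => ?_, ?_⟩
  · rw [hz]
    have : subst E.coord (0 : GraphSeries n) = (0 : SourceSeries n) := by
      rw [← coe_substAlgHom E.hasSubst_coord, map_zero]
    simp [h0, this]
  · have h1 := (hcr A hA).2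
    rw [E.act_conj_W] at h1
    simp only [Fintype.sum_sum_type, hz, mul_zero, Finset.sum_const_zero, zero_add,
      Finset.univ_unique, Finset.sum_singleton] at h1
    change _ - C Complex.I * (_ + subst E.coord (pderiv ℂ Var.u E.φ) * A.act (E.coord Var.u)) = 0
      at h1
    set τ := substAlgHom (R := ℂ) (S := ℂ) E.hasSubst_coord with hτ
    have τc : ∀ f, subst E.coord f = τ f := fun f => by rw [hτ, coe_substAlgHom]
    have τC : ∀ a, τ (C a) = C a := fun a => by
      rw [MvPowerSeries.c_eq_algebraMap, AlgHom.commutes, ← MvPowerSeries.c_eq_algebraMap]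
    have hun : IsUnit (τ (1 - C Complex.I * pderiv ℂ Var.u E.φ)) :=
      E.isUnit_one_sub_I_mul.map _
    simp only [τc] at h1 ⊢
    refine hun.mul_left_cancel ?_
    have hw' : ∀ k, τ (1 - C Complex.I * pderiv ℂ Var.u E.φ) * τ (L.w k)
        = C Complex.I * τ (pderiv ℂ (Var.z k) E.φ) := by
      intro k
      rw [← map_mul, mul_comm _ (L.w k), hw, map_mul, τC]
    rw [Finset.mul_sum]
    simp only [← mul_assoc, hw']
    simp only [mul_assoc, ← Finset.mul_sum]
    simp only [map_sub, map_one, map_mul, τC]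
    linear_combination h1

end FormalEmbedding

/-! ### Taylor series -/

section Taylor

variable {n : ℕ} {W : Set (RealSpace n)} {F G : RealSpace n → ℂ}

theorem contDiffOn_partialD (hW : IsOpen W) (hF : ContDiffOn ℝ ∞ F W) (j : Fin (2 * n + 1)) :
    ContDiffOn ℝ ∞ (partialD j F) W :=
  (hF.fderiv_of_isOpen hW (by simp)).clm_apply contDiffOn_const

theorem partialD_eqOn (hW : IsOpen W) (h : Set.EqOn F G W) (j : Fin (2 * n + 1)) :
    Set.EqOn (partialD j F) (partialD j G) W := by
  intro x hx
  have : F =ᶠ[𝓝 x] G := h.eventuallyEq_of_mem (hW.mem_nhds hx)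
  simp only [partialD, this.fderiv_eq]

theorem differentiableAt_of_contDiffOn {E : Type*} [NormedAddCommGroup E] [NormedSpace ℝ E]
    {F : RealSpace n → E} (hW : IsOpen W) (hF : ContDiffOn ℝ ∞ F W) {x : RealSpace n} (hx : x ∈ W) :
    DifferentiableAt ℝ F x :=
  (hF.contDiffAt (hW.mem_nhds hx)).differentiableAt (by simp)

theorem partialD_comm (hW : IsOpen W) (hF : ContDiffOn ℝ ∞ F W) (i j : Fin (2 * n + 1)) :
    Set.EqOn (partialD i (partialD j F)) (partialD j (partialD i F)) W := by
  intro x hx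
  have hd : DifferentiableAt ℝ (fderiv ℝ F) x :=
    differentiableAt_of_contDiffOn hW (hF.fderiv_of_isOpen hW (by simp)) hx
  have key : ∀ a b : Fin (2 * n + 1), partialD a (partialD b F) x
      = fderiv ℝ (fderiv ℝ F) x (Pi.single a 1) (Pi.single b 1) := by
    intro a b
    have e : partialD b F = fun y => fderiv ℝ F y (Pi.single b 1) := rfl
    rw [e, partialD, fderiv_clm_apply hd (differentiableAt_const _)]
    simp
  rw [key, key]
  have hs : IsSymmSndFDerivAt ℝ F x :=
    (hF.contDiffAt (hW.mem_nhds hx)).isSymmSndFDerivAt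
      (by simpa using WithTop.coe_le_coe.mpr (le_top : (2 : ℕ∞) ≤ ⊤))
  exact hs _ _

theorem iterate_partialD (hW : IsOpen W) (j : Fin (2 * n + 1)) (k : ℕ) :
    (∀ F, ContDiffOn ℝ ∞ F W → ContDiffOn ℝ ∞ ((partialD j)^[k] F) W) ∧
    (∀ F G, Set.EqOn F G W → Set.EqOn ((partialD j)^[k] F) ((partialD j)^[k] G) W) ∧
    (∀ F, ContDiffOn ℝ ∞ F W → ∀ i,
      Set.EqOn ((partialD j)^[k] (partialD i F)) (partialD i ((partialD j)^[k] F)) W) := by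
  induction k with
  | zero => exact ⟨fun _ h => h, fun _ _ h => h, fun _ _ _ _ _ => rfl⟩
  | succ k ih =>
    obtain ⟨h1, h2, h3⟩ := ih
    simp only [Function.iterate_succ_apply']
    refine ⟨fun F hF => contDiffOn_partialD hW (h1 F hF) j,
      fun F G h => partialD_eqOn hW (h2 F G h) j, fun F hF i => ?_⟩
    exact (partialD_eqOn hW (h3 F hF i) j).trans (partialD_comm hW (h1 F hF) j i)

/-- Since mixed partials of smooth functions commute, the fixed order of differentiation in
`iteratedPartial` is immaterial. Equality is kept on the whole open set because it has to survive
further differentiation. -/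
theorem foldr_partialD (hW : IsOpen W) (m : Fin (2 * n + 1) →₀ ℕ) (l : List (Fin (2 * n + 1))) :
    (∀ F, ContDiffOn ℝ ∞ F W →
      ContDiffOn ℝ ∞ (l.foldr (fun j G => (partialD j)^[m j] G) F) W) ∧
    (∀ F G, Set.EqOn F G W → Set.EqOn (l.foldr (fun j G => (partialD j)^[m j] G) F)
      (l.foldr (fun j G => (partialD j)^[m j] G) G) W) ∧
    (∀ F, ContDiffOn ℝ ∞ F W → ∀ i,
      Set.EqOn (l.foldr (fun j G => (partialD j)^[m j] G) (partialD i F))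
        (partialD i (l.foldr (fun j G => (partialD j)^[m j] G) F)) W) := by
  induction l with
  | nil => exact ⟨fun _ h => h, fun _ _ h => h, fun _ _ _ _ _ => rfl⟩
  | cons a l ih =>
    obtain ⟨h1, h2, h3⟩ := ih
    simp only [List.foldr_cons]
    refine ⟨fun F hF => (iterate_partialD hW a _).1 _ (h1 F hF),
      fun F G h => (iterate_partialD hW a _).2.1 _ _ (h2 F G h), fun F hF i => ?_⟩
    exact ((iterate_partialD hW a _).2.1 _ _ (h3 F hF i)).trans
      ((iterate_partialD hW a _).2.2 _ (h1 F hF) i)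

theorem foldr_partialD_add_single (hW : IsOpen W) (hF : ContDiffOn ℝ ∞ F W)
    (m : Fin (2 * n + 1) →₀ ℕ) (i : Fin (2 * n + 1)) (l : List (Fin (2 * n + 1))) (hl : l.Nodup) :
    (i ∈ l → Set.EqOn (l.foldr (fun j G => (partialD j)^[(m + Finsupp.single i 1 : Fin (2 * n + 1) →₀ ℕ) j] G) F)
      (partialD i (l.foldr (fun j G => (partialD j)^[m j] G) F)) W) ∧
    (i ∉ l → l.foldr (fun j G => (partialD j)^[(m + Finsupp.single i 1 : Fin (2 * n + 1) →₀ ℕ) j] G) F =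
      l.foldr (fun j G => (partialD j)^[m j] G) F) := by
  induction l with
  | nil => simp
  | cons a l ih =>
    obtain ⟨h1, h2⟩ := ih hl.of_cons
    simp only [List.foldr_cons, List.mem_cons]
    refine ⟨fun hi => ?_, fun hi => ?_⟩
    · by_cases hia : i = a
      · subst hia
        rw [h2 (List.nodup_cons.mp hl).1, Finsupp.add_apply, Finsupp.single_eq_same,
          Function.iterate_succ_apply']
        exact fun _ _ => rfl
      · have hm : (m + Finsupp.single i 1 : Fin (2 * n + 1) →₀ ℕ) a = m a := by
          rw [Finsupp.add_apply, Finsupp.single_eq_of_ne (Ne.symm hia), add_zero]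
        rw [hm]
        exact ((iterate_partialD hW a _).2.1 _ _ (h1 (hi.resolve_left hia))).trans
          ((iterate_partialD hW a _).2.2 _ ((foldr_partialD hW m l).1 F hF) i)
    · push Not at hi
      have hm : (m + Finsupp.single i 1 : Fin (2 * n + 1) →₀ ℕ) a = m a := by
        rw [Finsupp.add_apply, Finsupp.single_eq_of_ne (Ne.symm hi.1), add_zero]
      rw [hm, h2 hi.2]

theorem iteratedPartial_add_single (hW : IsOpen W) (hF : ContDiffOn ℝ ∞ F W)
    (m : Fin (2 * n + 1) →₀ ℕ) (i : Fin (2 * n + 1)) :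
    Set.EqOn (iteratedPartial (m + Finsupp.single i 1) F) (iteratedPartial m (partialD i F)) W :=
  ((foldr_partialD_add_single hW hF m i _ (List.nodup_finRange _)).1 (List.mem_finRange i)).trans
    ((foldr_partialD hW m _).2.2 F hF i).symm

variable {p : RealSpace n}

theorem coeff_taylor (F : RealSpace n → ℂ) (m : Fin (2 * n + 1) →₀ ℕ) :
    coeff m (taylor p F) = iteratedPartial m F p / ((∏ j, (m j).factorial : ℕ) : ℂ) := rfl

theorem pderiv_taylor (hW : IsOpen W) (hp : p ∈ W) (hF : ContDiffOn ℝ ∞ F W)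
    (i : Fin (2 * n + 1)) : pderiv ℂ i (taylor p F) = taylor p (partialD i F) := by
  ext m
  rw [coeff_pderiv, coeff_taylor, coeff_taylor, iteratedPartial_add_single hW hF m i hp]
  have h : ∏ j, ((m + Finsupp.single i 1 : Fin (2 * n + 1) →₀ ℕ) j).factorial = (m i + 1) * ∏ j, (m j).factorial := by
    rw [← Finset.mul_prod_erase _ _ (Finset.mem_univ i),
      ← Finset.mul_prod_erase _ (fun j => (m j).factorial) (Finset.mem_univ i), ← mul_assoc,
      ← Nat.factorial_succ]
    congr 1
    · simp
    · refine Finset.prod_congr rfl fun j hj => ?_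
      rw [Finsupp.add_apply, Finsupp.single_eq_of_ne (Finset.ne_of_mem_erase hj), add_zero]
  rw [h]
  push_cast
  have h1 : ((m i : ℂ) + 1) ≠ 0 := Nat.cast_add_one_ne_zero _
  have h2 : (∏ j, ((m j).factorial : ℂ)) ≠ 0 :=
    Finset.prod_ne_zero_iff.mpr fun j _ => Nat.cast_ne_zero.mpr (Nat.factorial_ne_zero _)
  field_simp

theorem constantCoeff_taylor (F : RealSpace n → ℂ) : constantCoeff (taylor p F) = F p := by
  rw [← coeff_zero_eq_constantCoeff_apply, coeff_taylor]
  have : ∀ l : List (Fin (2 * n + 1)),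
      l.foldr (fun j G => (partialD j)^[(0 : Fin (2 * n + 1) →₀ ℕ) j] G) F = F := by
    intro l
    induction l with
    | nil => rfl
    | cons a l ih => rw [List.foldr_cons, ih]; rfl
  rw [iteratedPartial, this]
  simp

theorem taylor_congr (hW : IsOpen W) (hp : p ∈ W) (h : Set.EqOn F G W) :
    taylor p F = taylor p G := by
  ext m
  rw [coeff_taylor, coeff_taylor]
  have : iteratedPartial m F p = iteratedPartial m G p := (foldr_partialD hW m _).2.1 F G h hp
  rw [this]

theorem coeff_single_taylor (hW : IsOpen W) (hp : p ∈ W) (hF : ContDiffOn ℝ ∞ F W)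
    (i : Fin (2 * n + 1)) : coeff (Finsupp.single i 1) (taylor p F) = partialD i F p := by
  have := congrArg constantCoeff (pderiv_taylor hW hp hF i)
  rw [constantCoeff_taylor, ← coeff_zero_eq_constantCoeff_apply, coeff_pderiv] at this
  simpa using this

/-- Power series in a set that is closed under differentiation, up to sums, and whose constant terms
vanish are zero. -/
theorem eq_zero_of_pderiv_mem_closure {σ : Type*} (s : Set (MvPowerSeries σ ℂ))
    (hc : ∀ f ∈ s, constantCoeff f = 0)
    (hd : ∀ f ∈ s, ∀ j, pderiv ℂ j f ∈ AddSubgroup.closure s) :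
    ∀ f ∈ s, f = 0 := by
  have hc' : ∀ f ∈ AddSubgroup.closure s, constantCoeff f = 0 := by
    intro f hf
    induction hf using AddSubgroup.closure_induction with
    | mem x hx => exact hc x hx
    | zero => simp
    | add x y _ _ hx hy => rw [map_add, hx, hy, add_zero]
    | neg x _ hx => rw [map_neg, hx, neg_zero]
  have hd' : ∀ f ∈ AddSubgroup.closure s, ∀ j, pderiv ℂ j f ∈ AddSubgroup.closure s := by
    intro f hf j
    induction hf using AddSubgroup.closure_induction with
    | mem x hx => exact hd x hx j
    | zero => simp
    | add x y _ _ hx hy => rw [map_add]; exact add_mem hx hy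
    | neg x _ hx => rw [map_neg]; exact neg_mem hx
  have key : ∀ k, ∀ f ∈ AddSubgroup.closure s, f ∈ fil (fun _ : σ => 1) k := by
    intro k
    induction k with
    | zero => exact fun f _ => mem_fil_zero _ _
    | succ k ih =>
      intro f hf m hm
      by_cases h0 : m = 0
      · rw [h0, coeff_zero_eq_constantCoeff_apply, hc' f hf]
      · obtain ⟨i, hi⟩ := Finsupp.ne_iff.mp h0
        have hi' : m i ≠ 0 := hi
        have hle : Finsupp.single i 1 ≤ m := by
          rw [Finsupp.single_le_iff]; omega
        have hm' : m = (m - Finsupp.single i 1) + Finsupp.single i 1 :=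
          (tsub_add_cancel_of_le hle).symm
        have := ih _ (hd' f hf i) (m - Finsupp.single i 1) (by
          rw [hm', map_add, Finsupp.weight_single] at hm
          simpa using hm)
        rw [coeff_pderiv, ← hm', mul_eq_zero] at this
        exact this.resolve_right (Nat.cast_add_one_ne_zero _)
  intro f hf
  exact eq_zero_of_forall_mem_fil fun k => key k f (AddSubgroup.subset_closure hf)

theorem partialD_add (hW : IsOpen W) (hF : ContDiffOn ℝ ∞ F W) (hG : ContDiffOn ℝ ∞ G W)
    (j : Fin (2 * n + 1)) :
    Set.EqOn (partialD j (fun x => F x + G x)) (fun x => partialD j F x + partialD j G x) W := by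
  intro x hx
  simp only [partialD]
  rw [fderiv_fun_add (differentiableAt_of_contDiffOn hW hF hx)
    (differentiableAt_of_contDiffOn hW hG hx)]
  rfl

theorem partialD_mul (hW : IsOpen W) (hF : ContDiffOn ℝ ∞ F W) (hG : ContDiffOn ℝ ∞ G W)
    (j : Fin (2 * n + 1)) :
    Set.EqOn (partialD j (fun x => F x * G x))
      (fun x => partialD j F x * G x + F x * partialD j G x) W := by
  intro x hx
  simp only [partialD]
  rw [fderiv_fun_mul (differentiableAt_of_contDiffOn hW hF hx)
    (differentiableAt_of_contDiffOn hW hG hx)]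
  simp only [add_apply, smul_apply, smul_eq_mul]
  ring

/-- The defects of additivity, taken over all pairs of smooth functions at once, have vanishing
constant term and are permuted by differentiation, so all of them vanish. Products and constants are
handled by the same device, without higher Leibniz formulas. -/
theorem taylor_add (hW : IsOpen W) (hp : p ∈ W) (hF : ContDiffOn ℝ ∞ F W)
    (hG : ContDiffOn ℝ ∞ G W) : taylor p (fun x => F x + G x) = taylor p F + taylor p G := by
  rw [← sub_eq_zero]
  refine eq_zero_of_pderiv_mem_closure {f | ∃ F G : RealSpace n → ℂ, ContDiffOn ℝ ∞ F W ∧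
    ContDiffOn ℝ ∞ G W ∧ f = taylor p (fun x => F x + G x) - (taylor p F + taylor p G)}
    ?_ ?_ _ ⟨F, G, hF, hG, rfl⟩
  · rintro _ ⟨F, G, hF, hG, rfl⟩
    simp [constantCoeff_taylor]
  · rintro _ ⟨F, G, hF, hG, rfl⟩ j
    refine AddSubgroup.subset_closure ⟨partialD j F, partialD j G, contDiffOn_partialD hW hF j,
      contDiffOn_partialD hW hG j, ?_⟩
    rw [map_sub, map_add, pderiv_taylor hW hp (hF.add hG), pderiv_taylor hW hp hF,
      pderiv_taylor hW hp hG, taylor_congr hW hp (partialD_add hW hF hG j)]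

theorem taylor_mul (hW : IsOpen W) (hp : p ∈ W) (hF : ContDiffOn ℝ ∞ F W)
    (hG : ContDiffOn ℝ ∞ G W) : taylor p (fun x => F x * G x) = taylor p F * taylor p G := by
  rw [← sub_eq_zero]
  refine eq_zero_of_pderiv_mem_closure {f | ∃ F G : RealSpace n → ℂ, ContDiffOn ℝ ∞ F W ∧
    ContDiffOn ℝ ∞ G W ∧ f = taylor p (fun x => F x * G x) - taylor p F * taylor p G}
    ?_ ?_ _ ⟨F, G, hF, hG, rfl⟩
  · rintro _ ⟨F, G, hF, hG, rfl⟩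
    simp [constantCoeff_taylor]
  · rintro _ ⟨F, G, hF, hG, rfl⟩ j
    have hF' := contDiffOn_partialD hW hF j
    have hG' := contDiffOn_partialD hW hG j
    -- The derivative of a defect of multiplicativity is the sum of two such defects.
    have e : pderiv ℂ j (taylor p (fun x => F x * G x) - taylor p F * taylor p G)
        = (taylor p (fun x => partialD j F x * G x) - taylor p (partialD j F) * taylor p G)
          + (taylor p (fun x => F x * partialD j G x) - taylor p F * taylor p (partialD j G)) := by
      rw [map_sub, Derivation.leibniz, pderiv_taylor hW hp (hF.mul hG), pderiv_taylor hW hp hF,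
        pderiv_taylor hW hp hG, taylor_congr hW hp (partialD_mul hW hF hG j),
        taylor_add hW hp (hF'.mul hG) (hF.mul hG')]
      simp only [smul_eq_mul]
      ring
    rw [e]
    exact add_mem (AddSubgroup.subset_closure ⟨_, _, hF', hG, rfl⟩)
      (AddSubgroup.subset_closure ⟨_, _, hF, hG', rfl⟩)

theorem taylor_const (a : ℂ) : taylor p (fun _ : RealSpace n => a) = C a := by
  rw [← sub_eq_zero]
  have hW : IsOpen (Set.univ : Set (RealSpace n)) := isOpen_univ
  refine eq_zero_of_pderiv_mem_closure {f | ∃ a : ℂ, f = taylor p (fun _ => a) - C a}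
    ?_ ?_ _ ⟨a, rfl⟩
  · rintro _ ⟨a, rfl⟩
    simp [constantCoeff_taylor]
  · rintro _ ⟨a, rfl⟩ j
    refine AddSubgroup.subset_closure ⟨0, ?_⟩
    rw [map_sub, pderiv_C, pderiv_taylor hW (Set.mem_univ p) contDiffOn_const]
    have : partialD j (fun _ : RealSpace n => a) = fun _ => 0 := by
      funext x; simp [partialD]
    rw [this, map_zero]

theorem taylor_sum (hW : IsOpen W) (hp : p ∈ W) {ι : Type*} (s : Finset ι)
    (F : ι → RealSpace n → ℂ) (hF : ∀ i, ContDiffOn ℝ ∞ (F i) W) :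
    taylor p (fun x => ∑ i ∈ s, F i x) = ∑ i ∈ s, taylor p (F i) := by
  classical
  induction s using Finset.induction_on with
  | empty => simpa using taylor_const (p := p) (n := n) 0
  | insert a s ha ih =>
    simp only [Finset.sum_insert ha]
    rw [taylor_add hW hp (hF a) (ContDiffOn.sum fun i _ => hF i), ih]

theorem taylor_sub (hW : IsOpen W) (hp : p ∈ W) (hF : ContDiffOn ℝ ∞ F W)
    (hG : ContDiffOn ℝ ∞ G W) : taylor p (fun x => F x - G x) = taylor p F - taylor p G := by
  have := taylor_add hW hp (hF.sub hG) hG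
  simp only [sub_add_cancel] at this
  rw [eq_sub_iff_add_eq]
  exact this.symm

end Taylor

/-! ### Brackets of smooth sections -/

section Bracket

variable {n : ℕ} {W : Set (RealSpace n)} {X Y : RealSpace n → CTangent n} {p : RealSpace n}

theorem contDiffOn_component (hX : ContDiffOn ℝ ∞ X W) (k : Fin (2 * n + 1)) :
    ContDiffOn ℝ ∞ (fun x => X x k) W := contDiffOn_pi.mp hX k

theorem fderiv_component (hW : IsOpen W) (hX : ContDiffOn ℝ ∞ X W) {x : RealSpace n} (hx : x ∈ W)
    (j k : Fin (2 * n + 1)) :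
    fderiv ℝ X x (Pi.single j 1) k = partialD j (fun y => X y k) x := by
  have := hasFDerivAt_pi'.mp (differentiableAt_of_contDiffOn hW hX hx).hasFDerivAt k
  rw [partialD, this.fderiv]
  rfl

theorem bracket_apply (hW : IsOpen W) (hX : ContDiffOn ℝ ∞ X W) (hY : ContDiffOn ℝ ∞ Y W)
    (k : Fin (2 * n + 1)) : Set.EqOn (fun x => bracket X Y x k)
      (fun x => ∑ j, (X x j * partialD j (fun y => Y y k) x
        - Y x j * partialD j (fun y => X y k) x)) W := by
  intro x hx
  simp only [bracket]
  refine Finset.sum_congr rfl fun j _ => ?_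
  rw [fderiv_component hW hX hx, fderiv_component hW hY hx]

theorem contDiffOn_bracket (hW : IsOpen W) (hX : ContDiffOn ℝ ∞ X W) (hY : ContDiffOn ℝ ∞ Y W) :
    ContDiffOn ℝ ∞ (bracket X Y) W := by
  refine contDiffOn_pi.mpr fun k => ContDiffOn.congr ?_ (bracket_apply hW hX hY k)
  refine ContDiffOn.sum fun j _ => ?_
  exact ((contDiffOn_component hX j).mul
    (contDiffOn_partialD hW (contDiffOn_component hY k) j)).sub
    ((contDiffOn_component hY j).mul (contDiffOn_partialD hW (contDiffOn_component hX k) j))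

theorem taylorField_bracket (hW : IsOpen W) (hp : p ∈ W) (hX : ContDiffOn ℝ ∞ X W)
    (hY : ContDiffOn ℝ ∞ Y W) :
    taylorField p (bracket X Y) = formalBracket (taylorField p X) (taylorField p Y) := by
  funext k
  have h1 : ∀ j, ContDiffOn ℝ ∞ (fun x => X x j * partialD j (fun y => Y y k) x) W := fun j =>
    (contDiffOn_component hX j).mul (contDiffOn_partialD hW (contDiffOn_component hY k) j)
  have h2 : ∀ j, ContDiffOn ℝ ∞ (fun x => Y x j * partialD j (fun y => X y k) x) W := fun j =>
    (contDiffOn_component hY j).mul (contDiffOn_partialD hW (contDiffOn_component hX k) j)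
  rw [taylorField, taylor_congr hW hp (bracket_apply hW hX hY k),
    taylor_sum hW hp _ _ fun j => (h1 j).sub (h2 j), formalBracket, FormalField.act,
    FormalField.act, ← Finset.sum_sub_distrib]
  refine Finset.sum_congr rfl fun j _ => ?_
  rw [taylor_sub hW hp (h1 j) (h2 j), taylor_mul hW hp (contDiffOn_component hX j)
    (contDiffOn_partialD hW (contDiffOn_component hY k) j),
    taylor_mul hW hp (contDiffOn_component hY j)
    (contDiffOn_partialD hW (contDiffOn_component hX k) j),
    ← pderiv_taylor hW hp (contDiffOn_component hX k),
    ← pderiv_taylor hW hp (contDiffOn_component hY k)]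
  rfl

end Bracket

namespace AlmostCRStructure

variable {n : ℕ} {U : Set (RealSpace n)} {S : AlmostCRStructure n U} {p : RealSpace n}

theorem IsSectionNear.exists_isOpen {X : RealSpace n → CTangent n} (h : S.IsSectionNear p X) :
    ∃ W, IsOpen W ∧ p ∈ W ∧ ContDiffOn ℝ ∞ X W ∧ ∀ x ∈ W, X x ∈ S.H10 x := by
  obtain ⟨W, hW, h1, h2⟩ := h
  obtain ⟨V, hV, hVo, hpV⟩ := mem_nhds_iff.mp hW
  exact ⟨V, hVo, hpV, h1.mono hV, fun x hx => h2 x (hV hx)⟩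

/-- Integrability near a point implies formal integrability. -/
theorem IntegrableNear.formallyIntegrableAt (h : S.IntegrableNear p) :
    S.FormallyIntegrableAt p := by
  refine formalBracket_mem_span ?_
  rintro _ ⟨X, hX, rfl⟩ _ ⟨Y, hY, rfl⟩
  obtain ⟨W₁, o₁, p₁, c₁, s₁⟩ := hX.exists_isOpen
  obtain ⟨W₂, o₂, p₂, c₂, s₂⟩ := hY.exists_isOpen
  obtain ⟨W₃, hW₃, o₃, p₃⟩ := mem_nhds_iff.mp h
  have o : IsOpen (W₁ ∩ W₂ ∩ W₃) := (o₁.inter o₂).inter o₃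
  have c₁' : ContDiffOn ℝ ∞ X (W₁ ∩ W₂ ∩ W₃) := c₁.mono fun x hx => hx.1.1
  have c₂' : ContDiffOn ℝ ∞ Y (W₁ ∩ W₂ ∩ W₃) := c₂.mono fun x hx => hx.1.2
  -- The bracket is itself a smooth section of H^{1,0} near `p`, so its Taylor series is one of the
  -- generators.
  refine Submodule.subset_span ⟨bracket X Y, ⟨_, o.mem_nhds ⟨⟨p₁, p₂⟩, p₃⟩,
    contDiffOn_bracket o c₁' c₂', fun x hx => hW₃ hx.2 X Y
      ⟨W₁, o₁.mem_nhds hx.1.1, c₁, s₁⟩ ⟨W₂, o₂.mem_nhds hx.1.2, c₂, s₂⟩⟩, ?_⟩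
  rw [taylorField_bracket o ⟨⟨p₁, p₂⟩, p₃⟩ c₁' c₂']

end AlmostCRStructure

/-! ### Adapted frames and adapted linear coordinates -/

/-- A frame of a formal almost CR structure, dual to the `z`-part of a system of linear coordinates
which is adapted to the structure at the base point. -/
structure FormalFrame {n : ℕ} (M : Submodule (SourceSeries n) (FormalField n)) where
  /-- the linear coordinates `z`, `z̄`, `u` -/
  ℓ : Var n → Fin (2 * n + 1) → ℂ
  /-- the frame -/
  η : Fin n → FormalField n
  mem : ∀ k, η k ∈ M
  le_span : M ≤ Submodule.span (SourceSeries n) (Set.range η)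
  injective : ∀ x : Fin (2 * n + 1) → ℂ, (∀ v, ∑ i, ℓ v i * x i = 0) → x = 0
  zbar : ∀ j i, ℓ (Var.zbar j) i = star (ℓ (Var.z j) i)
  real : ∀ i, star (ℓ Var.u i) = ℓ Var.u i
  dual : ∀ j k, ∑ i, C (ℓ (Var.z j) i) * η k i = if j = k then 1 else 0
  zbar_apply : ∀ j k, ∑ i, ℓ (Var.zbar j) i * constantCoeff (η k i) = 0
  u_apply : ∀ k, ∑ i, ℓ Var.u i * constantCoeff (η k i) = 0

/-- The derivatives `∂/∂z̄_k` of the `u`-component of the `l`-th field of the frame. -/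
def FormalFrame.beta {n : ℕ} {M : Submodule (SourceSeries n) (FormalField n)} (F : FormalFrame M)
    (l k : Fin n) : ℂ :=
  ∑ i, star (constantCoeff (F.η k i)) *
    coeff (Finsupp.single i 1) (∑ j, C (F.ℓ Var.u j) * F.η l j)

theorem Var.swap_swap {n : ℕ} (v : Var n) : v.swap.swap = v := by
  rcases v with j | j | j <;> rfl

/-- Complex conjugation of complexified tangent vectors. -/
def conjVec {n : ℕ} (v : CTangent n) : CTangent n := fun k => star (v k)

namespace AlmostCRStructure

variable {n : ℕ} {U : Set (RealSpace n)} {S : AlmostCRStructure n U} {p x : RealSpace n}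

theorem mem_H10 {v : CTangent n} : v ∈ S.H10 x ↔ reVec v ∈ S.H x ∧ imVec v ∈ S.H x ∧
    S.J x (reVec v) = -imVec v ∧ S.J x (imVec v) = reVec v := Iff.rfl

/-- The eigenspaces of J for i and -i meet only in zero. -/
theorem eq_zero_of_mem_H10_of_conj_mem {v : CTangent n} (h : v ∈ S.H10 x)
    (h' : conjVec v ∈ S.H10 x) : v = 0 := by
  have e1 : reVec (conjVec v) = reVec v := by ext; simp [reVec, conjVec]
  have e2 : imVec (conjVec v) = -imVec v := by ext; simp [imVec, conjVec]
  obtain ⟨-, -, a, b⟩ := h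
  obtain ⟨-, -, a', -⟩ := h'
  rw [e1, e2, neg_neg, a, neg_eq_iff_add_eq_zero, ← two_smul ℝ, smul_eq_zero] at a'
  have him : imVec v = 0 := a'.resolve_left two_ne_zero
  rw [him, map_zero] at b
  funext k
  exact Complex.ext (congrFun b.symm k) (congrFun him k)

theorem sum_mul_eq_zero_of_mem_H10 {θ : RealSpace n →ₗ[ℝ] ℝ} (hθ : LinearMap.ker θ = S.H x)
    {v : CTangent n} (h : v ∈ S.H10 x) : ∑ k, (θ (Pi.single k 1) : ℂ) * v k = 0 := by
  have key : ∀ r : RealSpace n, θ r = ∑ k, θ (Pi.single k 1) * r k := by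
    intro r
    conv_lhs => rw [← Finset.univ_sum_single r, map_sum]
    refine Finset.sum_congr rfl fun k _ => ?_
    rw [show Pi.single k (r k) = r k • (Pi.single k 1 : RealSpace n) by
      rw [← Pi.single_smul, smul_eq_mul, mul_one], map_smul, smul_eq_mul, mul_comm]
  obtain ⟨h1, h2, -, -⟩ := h
  rw [← hθ, LinearMap.mem_ker, key] at h1 h2
  refine Complex.ext ?_ ?_
  · simpa [reVec] using h1
  · simpa [imVec] using h2

/-- A smooth family of vectors spanning `H^{1,0}` over the reals. -/
theorem exists_real_frame_H10 (hU : IsOpen U) (hp : p ∈ U) (S : AlmostCRStructure n U) :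
    ∃ V, IsOpen V ∧ p ∈ V ∧ ∃ ξ : Fin (2 * n) → RealSpace n → CTangent n,
      (∀ i, ContDiffOn ℝ ∞ (ξ i) V) ∧ (∀ i, ∀ x ∈ V, ξ i x ∈ S.H10 x) ∧
      (∀ x ∈ V, LinearIndependent ℝ fun i => ξ i x) ∧
      (∀ x ∈ V, ∀ v ∈ S.H10 x, ∃ r : Fin (2 * n) → ℝ, v = ∑ i, r i • ξ i x) := by
  obtain ⟨W, hW, X, hX, hJX, hli, hspan⟩ := S.smooth p hp
  obtain ⟨V₀, hV₀, hV₀o, hpV₀⟩ := mem_nhds_iff.mp hW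
  -- X - iJX is the (1,0) vector with real part X. Taking real parts is thus a real isomorphism of
  -- the fibre of H^{1,0} onto that of H, and the frame of H is transported through it.
  set ξ : Fin (2 * n) → RealSpace n → CTangent n :=
    fun i x k => (X i x k : ℂ) - Complex.I * (S.J x (X i x) k : ℂ) with hξ
  have re : ∀ i x, reVec (ξ i x) = X i x := fun i x => by ext; simp [hξ, reVec]
  have im : ∀ i x, imVec (ξ i x) = - S.J x (X i x) := fun i x => by ext; simp [hξ, imVec]
  have resum : ∀ (r : Fin (2 * n) → ℝ) x, reVec (∑ i, r i • ξ i x) = ∑ i, r i • X i x := by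
    intro r x
    simp only [← re]
    ext k
    simp [reVec]
  refine ⟨V₀ ∩ U, hV₀o.inter hU, ⟨hpV₀, hp⟩, ξ, fun i => ?_, fun i x hx => ?_, fun x hx => ?_,
    fun x hx v hv => ?_⟩
  · refine contDiffOn_pi.mpr fun k => ?_
    have h1 : ContDiffOn ℝ ∞ (fun x => (X i x k : ℂ)) (V₀ ∩ U) :=
      Complex.ofRealCLM.contDiff.comp_contDiffOn
        ((contDiffOn_pi.mp (hX i) k).mono fun x hx => hV₀ hx.1)
    have h2 : ContDiffOn ℝ ∞ (fun x => (S.J x (X i x) k : ℂ)) (V₀ ∩ U) :=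
      Complex.ofRealCLM.contDiff.comp_contDiffOn
        ((contDiffOn_pi.mp (hJX i) k).mono fun x hx => hV₀ hx.1)
    exact h1.sub (contDiffOn_const.mul h2)
  · have hm : X i x ∈ S.H x := by
      rw [← hspan x (hV₀ hx.1)]; exact Submodule.subset_span ⟨i, rfl⟩
    refine mem_H10.mpr ⟨?_, ?_, ?_, ?_⟩
    · rwa [re]
    · rw [im]; exact neg_mem (S.J_mem x hx.2 _ hm)
    · rw [re, im, neg_neg]
    · rw [re, im, map_neg, S.J_sq x hx.2 _ hm, neg_neg]
  · rw [Fintype.linearIndependent_iff]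
    intro r hr
    refine Fintype.linearIndependent_iff.mp (hli x (hV₀ hx.1)) r ?_
    rw [← resum, hr]
    ext; simp [reVec]
  · obtain ⟨h1, h2, h3, h4⟩ := mem_H10.mp hv
    rw [← hspan x (hV₀ hx.1)] at h1
    obtain ⟨r, hr⟩ := (Submodule.mem_span_range_iff_exists_fun ℝ).mp h1
    refine ⟨r, ?_⟩
    have e1 : reVec v = reVec (∑ i, r i • ξ i x) := by rw [resum, hr]
    have e2 : imVec v = imVec (∑ i, r i • ξ i x) := by
      have : imVec (∑ i, r i • ξ i x) = ∑ i, r i • imVec (ξ i x) := by ext; simp [imVec]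
      rw [this]
      simp only [im, smul_neg, Finset.sum_neg_distrib]
      rw [← neg_eq_iff_eq_neg, ← h3, ← hr, map_sum]
      simp
    funext k
    exact Complex.ext (congrFun e1 k) (congrFun e2 k)

theorem finrank_H10 {ξ : Fin (2 * n) → CTangent n} (h1 : ∀ i, ξ i ∈ S.H10 x)
    (h2 : LinearIndependent ℝ ξ)
    (h3 : ∀ v ∈ S.H10 x, ∃ r : Fin (2 * n) → ℝ, v = ∑ i, r i • ξ i) :
    Module.finrank ℂ (S.H10 x) = n := by
  set ζ : Fin (2 * n) → S.H10 x := fun i => ⟨ξ i, h1 i⟩ with hζ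
  have hli : LinearIndependent ℝ ζ := by
    rw [Fintype.linearIndependent_iff]
    intro r hr
    refine Fintype.linearIndependent_iff.mp h2 r ?_
    have := congrArg (Subtype.val) hr
    simpa [hζ] using this
  have hsp : ⊤ ≤ Submodule.span ℝ (Set.range ζ) := by
    rintro ⟨v, hv⟩ -
    obtain ⟨r, hr⟩ := h3 v hv
    rw [Submodule.mem_span_range_iff_exists_fun]
    refine ⟨r, Subtype.ext ?_⟩
    simp [hζ, hr]
  have h := Module.finrank_eq_card_basis (Module.Basis.mk hli hsp)
  rw [Fintype.card_fin, finrank_real_of_complex] at h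
  omega

end AlmostCRStructure

/-- Coordinates on the complexified tangent space adapted to a decomposition into a subspace, its
conjugate, and a real transversal. -/
theorem exists_adapted_coordinates {n : ℕ} (e : Fin n → CTangent n) (he : LinearIndependent ℂ e)
    (hconj : ∀ v ∈ Submodule.span ℂ (Set.range e),
      conjVec v ∈ Submodule.span ℂ (Set.range e) → v = 0)
    (θ : RealSpace n →ₗ[ℝ] ℝ) (hθ : θ ≠ 0) (hθe : ∀ k, ∑ i, (θ (Pi.single i 1) : ℂ) * e k i = 0) :
    ∃ ℓ : Var n → Fin (2 * n + 1) → ℂ,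
      (∀ x : Fin (2 * n + 1) → ℂ, (∀ v, ∑ i, ℓ v i * x i = 0) → x = 0) ∧
      (∀ j i, ℓ (Var.zbar j) i = star (ℓ (Var.z j) i)) ∧
      (∀ i, ℓ Var.u i = (θ (Pi.single i 1) : ℂ)) ∧
      (∀ j k, ∑ i, ℓ (Var.z j) i * e k i = if j = k then 1 else 0) ∧
      (∀ j k, ∑ i, ℓ (Var.zbar j) i * e k i = 0) := by
  classical
  set Θ : CTangent n →ₗ[ℂ] ℂ := ∑ i, (θ (Pi.single i 1) : ℂ) • LinearMap.proj i with hΘ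
  have Θa : ∀ v, Θ v = ∑ i, (θ (Pi.single i 1) : ℂ) * v i := fun v => by
    simp [hΘ]
  have Θc : ∀ v, Θ (conjVec v) = star (Θ v) := fun v => by
    simp [Θa, conjVec, star_sum, mul_comm]
  have key : ∀ r : RealSpace n, θ r = ∑ k, θ (Pi.single k 1) * r k := by
    intro r
    conv_lhs => rw [← Finset.univ_sum_single r, map_sum]
    refine Finset.sum_congr rfl fun k _ => ?_
    rw [show Pi.single k (r k) = r k • (Pi.single k 1 : RealSpace n) by
      rw [← Pi.single_smul, smul_eq_mul, mul_one], map_smul, smul_eq_mul, mul_comm]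
  obtain ⟨t₀, ht₀⟩ : ∃ t, θ t ≠ 0 := by
    by_contra h
    push Not at h
    exact hθ (LinearMap.ext h)
  set t : CTangent n := fun i => (((θ t₀)⁻¹ * t₀ i : ℝ) : ℂ) with ht
  have Θt : Θ t = 1 := by
    have h1 : θ ((θ t₀)⁻¹ • t₀) = 1 := by rw [map_smul, smul_eq_mul, inv_mul_cancel₀ ht₀]
    rw [key] at h1
    rw [Θa]
    have := congrArg (fun r : ℝ => (r : ℂ)) h1
    simpa [ht] using this
  have tc : conjVec t = t := by ext i; simp [ht, conjVec]
  have Θe : ∀ k, Θ (e k) = 0 := fun k => by rw [Θa, hθe]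
  -- The basis consists of the e_k, their conjugates and a real vector t with θ(t) = 1; the required
  -- coordinates form its dual basis. Independence: θ detects t, and the span of the e_k meets its
  -- conjugate trivially.
  set b : Var n → CTangent n := Sum.elim e (Sum.elim (fun k => conjVec (e k)) fun _ => t) with hb
  have conjsum : ∀ c : Fin n → ℂ, conjVec (∑ k, c k • conjVec (e k)) = ∑ k, star (c k) • e k := by
    intro c; ext i; simp [conjVec]
  have hli : LinearIndependent ℂ b := by
    rw [Fintype.linearIndependent_iff]
    intro c hc
    simp only [Fintype.sum_sum_type, hb, Sum.elim_inl, Sum.elim_inr, Finset.univ_unique,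
      Finset.sum_singleton] at hc
    have hu : c (Sum.inr (Sum.inr default)) = 0 := by
      have := congrArg Θ hc
      simpa [Θe, Θc, Θt] using this
    rw [hu, zero_smul, add_zero] at hc
    set v := ∑ k, c (Sum.inl k) • e k with hv
    have hvm : v ∈ Submodule.span ℂ (Set.range e) :=
      sum_mem fun k _ => Submodule.smul_mem _ _ (Submodule.subset_span ⟨k, rfl⟩)
    have hve : v = ∑ k, (-c (Sum.inr (Sum.inl k))) • conjVec (e k) := by
      rw [eq_neg_of_add_eq_zero_left hc]
      simp
    have hcm : conjVec v ∈ Submodule.span ℂ (Set.range e) := by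
      rw [hve, conjsum]
      exact sum_mem fun k _ => Submodule.smul_mem _ _ (Submodule.subset_span ⟨k, rfl⟩)
    have hv0 := hconj v hvm hcm
    have hz := Fintype.linearIndependent_iff.mp he (fun k => c (Sum.inl k)) (by rw [← hv, hv0])
    have hzb := Fintype.linearIndependent_iff.mp he
      (fun k => star (-c (Sum.inr (Sum.inl k)))) (by
        rw [← conjsum, ← hve, hv0]; ext; simp [conjVec])
    rintro (j | j | j)
    · exact hz j
    · simpa using hzb j
    · exact hu
  set B := basisOfLinearIndependentOfCardEqFinrank hli (by
    rw [card_var]; simp) with hB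
  have Bb : ∀ v, B v = b v := fun v => by rw [hB, coe_basisOfLinearIndependentOfCardEqFinrank]
  have hrepr : ∀ v (x : CTangent n), ∑ i, B.repr (Pi.single i 1) v * x i = B.repr x v := by
    intro v x
    have : B.repr x = ∑ i, x i • B.repr (Pi.single i 1) := by
      conv_lhs => rw [← Finset.univ_sum_single x, map_sum]
      refine Finset.sum_congr rfl fun k _ => ?_
      rw [← map_smul, ← Pi.single_smul, smul_eq_mul, mul_one]
    rw [this, Finsupp.finsetSum_apply]
    exact Finset.sum_congr rfl fun i _ => by rw [Finsupp.smul_apply, smul_eq_mul, mul_comm]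
  -- Conjugation permutes the basis vectors by `Var.swap`, so the dual coordinates satisfy the
  -- corresponding reality relations.
  have hconjB : ∀ x v, B.repr (conjVec x) (Var.swap v) = star (B.repr x v) := by
    intro x v
    have hx : conjVec x = ∑ w, star (B.repr x w) • B (Var.swap w) := by
      have h0 : ∑ w, B.repr x w • B w = x := B.sum_repr x
      have hswap : ∀ w, B (Var.swap w) = conjVec (B w) := by
        rintro (j | j | j)
        · simp [Bb, hb, Var.swap]
        · simp only [Bb, hb, Var.swap]
          ext i; simp [conjVec]
        · simp [Bb, hb, Var.swap, tc]
      conv_lhs => rw [← h0]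
      ext i
      simp [conjVec, hswap]
    have hinj : Function.Injective (Var.swap : Var n → Var n) :=
      Function.LeftInverse.injective Var.swap_swap
    rw [hx, map_sum, Finsupp.finsetSum_apply, Finset.sum_eq_single v]
    · simp
    · intro w _ hw
      simp [hinj.ne hw]
    · simp
  have single_real : ∀ i, conjVec (Pi.single i 1 : CTangent n) = Pi.single i 1 := by
    intro i; ext k; by_cases h : k = i
    · subst h; simp [conjVec]
    · simp [conjVec, h]
  refine ⟨fun v i => B.repr (Pi.single i 1) v, fun x hx => ?_, fun j i => ?_, fun i => ?_,
    fun j k => ?_, fun j k => ?_⟩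
  · simp only [hrepr] at hx
    rw [← B.repr.map_eq_zero_iff]
    ext v; exact hx v
  · have := hconjB (Pi.single i 1) (Var.z j)
    rwa [single_real] at this
  · have h1 : Θ = B.coord Var.u := by
      refine B.ext fun v => ?_
      rw [B.coord_apply, B.repr_self]
      rcases v with j | j | j
      · simp [Bb, hb, Θe]
      · simp [Bb, hb, Θe, Θc]
      · simp [Bb, hb, Θt]
    have h2 := congrArg (fun f => f (Pi.single i 1)) h1
    simp only [B.coord_apply] at h2
    change B.repr (Pi.single i 1) Var.u = _
    rw [← h2, Θa, Finset.sum_eq_single i]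
    · simp
    · intro k _ hk; simp [hk]
    · simp
  · have := B.repr_self (Var.z k)
    rw [Bb] at this
    rw [hrepr]
    change B.repr (b (Var.z k)) (Var.z j) = _
    rw [this]
    simp [Finsupp.single_apply, eq_comm]
  · have := B.repr_self (Var.z k)
    rw [Bb] at this
    rw [hrepr]
    change B.repr (b (Var.z k)) (Var.zbar j) = _
    rw [this]
    simp

/-! ### Smoothness of determinants -/

section Det

variable {m : ℕ} {E : Type*} [NormedAddCommGroup E] [NormedSpace ℝ E] {V : Set E}

theorem contDiffOn_det {A : E → Matrix (Fin m) (Fin m) ℂ}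
    (hA : ∀ i j, ContDiffOn ℝ ∞ (fun x => A x i j) V) :
    ContDiffOn ℝ ∞ (fun x => (A x).det) V := by
  simp only [Matrix.det_apply]
  refine ContDiffOn.sum fun σ _ => ?_
  refine ContDiffOn.const_smul (Equiv.Perm.sign σ : ℤˣ) ?_
  exact contDiffOn_prod fun i _ => hA _ _

theorem contDiffOn_inv_apply {A : E → Matrix (Fin m) (Fin m) ℂ}
    (hA : ∀ i j, ContDiffOn ℝ ∞ (fun x => A x i j) V) (hdet : ∀ x ∈ V, (A x).det ≠ 0)
    (i j : Fin m) : ContDiffOn ℝ ∞ (fun x => (A x)⁻¹ i j) V := by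
  have h : ∀ x, (A x)⁻¹ i j = ((A x).det)⁻¹ * (A x).adjugate i j := fun x => by
    rw [Matrix.inv_def, Matrix.smul_apply, smul_eq_mul, Ring.inverse_eq_inv']
  simp only [h]
  refine ((contDiffOn_det hA).inv hdet).mul ?_
  simp only [Matrix.adjugate_apply]
  refine contDiffOn_det fun k l => ?_
  by_cases hk : k = j
  · subst hk
    simp only [Matrix.updateRow_self]
    exact contDiffOn_const
  · simp only [Matrix.updateRow_ne hk]
    exact hA k l

end Det

/-! ### From smooth frames to formal frames; the Levi form -/

namespace AlmostCRStructure

variable {n : ℕ} {U : Set (RealSpace n)} {S : AlmostCRStructure n U} {p : RealSpace n}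

/-- Smooth local frames of `H^{1,0}` dual to linear coordinates. -/
theorem exists_smooth_frame (hU : IsOpen U) (hp : p ∈ U) (S : AlmostCRStructure n U)
    (θ : RealSpace n →ₗ[ℝ] ℝ) (hθ : LinearMap.ker θ = S.H p) :
    ∃ ℓ : Var n → Fin (2 * n + 1) → ℂ,
      (∀ x : Fin (2 * n + 1) → ℂ, (∀ v, ∑ i, ℓ v i * x i = 0) → x = 0) ∧
      (∀ j i, ℓ (Var.zbar j) i = star (ℓ (Var.z j) i)) ∧
      (∀ i, ℓ Var.u i = (θ (Pi.single i 1) : ℂ)) ∧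
      ∃ V, IsOpen V ∧ p ∈ V ∧ ∃ η : Fin n → RealSpace n → CTangent n,
        (∀ k, ContDiffOn ℝ ∞ (η k) V) ∧ (∀ k, ∀ x ∈ V, η k x ∈ S.H10 x) ∧
        (∀ x ∈ V, ∀ j k, ∑ i, ℓ (Var.z j) i * η k x i = if j = k then 1 else 0) ∧
        (∀ j k, ∑ i, ℓ (Var.zbar j) i * η k p i = 0) ∧
        (∀ x ∈ V, ∀ v ∈ S.H10 x, v = ∑ k, (∑ i, ℓ (Var.z k) i * v i) • η k x) := by
  classical
  obtain ⟨V₁, hV₁, hpV₁, ξ, hξ, hξm, hξli, hξsp⟩ := exists_real_frame_H10 hU hp S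
  have hrank : ∀ x ∈ V₁, Module.finrank ℂ (S.H10 x) = n := fun x hx =>
    finrank_H10 (fun i => hξm i x hx) (hξli x hx) (hξsp x hx)
  set e' := Module.finBasisOfFinrankEq ℂ (S.H10 p) (hrank p hpV₁) with he'
  set e : Fin n → CTangent n := fun k => (e' k : CTangent n) with he
  have heli : LinearIndependent ℂ e :=
    e'.linearIndependent.map' (S.H10 p).subtype (Submodule.ker_subtype _)
  have hespan : Submodule.span ℂ (Set.range e) ≤ S.H10 p := by
    rw [Submodule.span_le]; rintro _ ⟨k, rfl⟩; exact (e' k).2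
  -- Otherwise H at `p` would be the whole tangent space, of dimension 2n + 1 rather than 2n.
  have hθ0 : θ ≠ 0 := by
    rintro rfl
    rw [LinearMap.ker_zero] at hθ
    obtain ⟨W, hW, X, -, -, hli, hsp⟩ := S.smooth p hp
    have h1 := finrank_span_eq_card (hli p (mem_of_mem_nhds hW))
    rw [hsp p (mem_of_mem_nhds hW), ← hθ, finrank_top] at h1
    simp at h1
  obtain ⟨ℓ, hℓ, hℓc, hℓu, hℓe, hℓe'⟩ := exists_adapted_coordinates e heli
    (fun v hv hv' => eq_zero_of_mem_H10_of_conj_mem (hespan hv) (hespan hv')) θ hθ0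
    (fun k => sum_mul_eq_zero_of_mem_H10 hθ (e' k).2)
  have hr : ∀ k, ∃ r : Fin (2 * n) → ℝ, e k = ∑ i, r i • ξ i p := fun k =>
    hξsp p hpV₁ _ (e' k).2
  choose r hr using hr
  set ζ : Fin n → RealSpace n → CTangent n := fun k x => ∑ i, r k i • ξ i x with hζ
  have hζs : ∀ k, ContDiffOn ℝ ∞ (ζ k) V₁ := fun k =>
    ContDiffOn.sum fun i _ => (hξ i).const_smul (r k i)
  have hζm : ∀ k, ∀ x ∈ V₁, ζ k x ∈ S.H10 x := fun k x hx =>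
    sum_mem fun i _ => ((S.H10 x).restrictScalars ℝ).smul_mem _ (hξm i x hx)
  -- The sections ζ_k extend the basis e_k, and `A` records their z-coordinates. It is the identity
  -- at `p`, hence invertible nearby, and multiplying the frame by its inverse makes it dual to z.
  set A : RealSpace n → Matrix (Fin n) (Fin n) ℂ :=
    fun x => Matrix.of fun j k => ∑ i, ℓ (Var.z j) i * ζ k x i with hA
  have hAs : ∀ j k, ContDiffOn ℝ ∞ (fun x => A x j k) V₁ := fun j k => by
    simp only [hA, Matrix.of_apply]
    exact ContDiffOn.sum fun i _ => contDiffOn_const.mul (contDiffOn_component (hζs k) i)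
  have hAp : A p = 1 := by
    ext j k
    rw [Matrix.one_apply]
    simp only [hA, Matrix.of_apply, hζ, ← hr]
    exact hℓe j k
  obtain ⟨V, hVsub, hV, hpV⟩ : ∃ V ⊆ V₁ ∩ {x | (A x).det ≠ 0}, IsOpen V ∧ p ∈ V := by
    refine mem_nhds_iff.mp (Filter.inter_mem (hV₁.mem_nhds hpV₁) ?_)
    have hc := (contDiffOn_det hAs).continuousOn.continuousAt (hV₁.mem_nhds hpV₁)
    exact hc.eventually_ne (by rw [hAp]; simp)
  have hsub : V ⊆ V₁ := fun x hx => (hVsub hx).1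
  have hdet : ∀ x ∈ V, (A x).det ≠ 0 := fun x hx => (hVsub hx).2
  set η : Fin n → RealSpace n → CTangent n := fun k x => ∑ l, (A x)⁻¹ l k • ζ l x with hη
  have hηm : ∀ k, ∀ x ∈ V, η k x ∈ S.H10 x := fun k x hx =>
    sum_mem fun l _ => Submodule.smul_mem _ _ (hζm l x (hsub hx))
  have hdual : ∀ x ∈ V, ∀ j k, ∑ i, ℓ (Var.z j) i * η k x i = if j = k then 1 else 0 := by
    intro x hx j k
    have h := congrFun (congrFun (Matrix.mul_nonsing_inv (A x) (hdet x hx).isUnit) j) k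
    rw [Matrix.mul_apply, Matrix.one_apply] at h
    rw [← h]
    simp only [hη, hA, Matrix.of_apply, Finset.sum_apply, Pi.smul_apply, smul_eq_mul,
      Finset.mul_sum, Finset.sum_mul]
    rw [Finset.sum_comm]
    exact Finset.sum_congr rfl fun _ _ => Finset.sum_congr rfl fun _ _ => by ring
  refine ⟨ℓ, hℓ, hℓc, hℓu, V, hV, hpV, η, fun k => ?_, hηm, hdual, fun j k => ?_,
    fun x hx v hv => ?_⟩
  · refine ContDiffOn.sum fun l _ => ?_
    have hinv := contDiffOn_inv_apply (fun i j => (hAs i j).mono hsub) hdet l k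
    exact hinv.smul ((hζs l).mono hsub)
  · have : η k p = e k := by
      simp only [hη, hAp, inv_one, Matrix.one_apply, hζ, ← hr]
      simp
    rw [this]
    exact hℓe' j k
  -- The z-coordinates map the fibre onto ℂ^n because of the dual frame. Both sides have dimension
  -- n, so they determine a vector of H^{1,0}.
  · set T : S.H10 x →ₗ[ℂ] (Fin n → ℂ) := LinearMap.pi fun j =>
      (∑ i, ℓ (Var.z j) i • LinearMap.proj i).comp (S.H10 x).subtype with hT
    have Ta : ∀ w j, T w j = ∑ i, ℓ (Var.z j) i * (w : CTangent n) i := fun w j => by simp [hT]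
    have hsurj : Function.Surjective T := by
      intro c
      refine ⟨⟨∑ k, c k • η k x, sum_mem fun k _ => Submodule.smul_mem _ _ (hηm k x hx)⟩, ?_⟩
      funext j
      rw [Ta]
      simp only [Finset.sum_apply, Pi.smul_apply, smul_eq_mul, Finset.mul_sum]
      rw [Finset.sum_comm]
      have : ∀ k, ∑ i, ℓ (Var.z j) i * (c k * η k x i) = c k * if j = k then 1 else 0 := by
        intro k
        rw [← hdual x hx j k, Finset.mul_sum]
        exact Finset.sum_congr rfl fun _ _ => by ring
      simp [this]
    have hinj : Function.Injective T :=
      (LinearMap.injective_iff_surjective_of_finrank_eq_finrank (by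
        rw [hrank x (hsub hx)]; simp)).mpr hsurj
    have hmem : ∑ k, (∑ i, ℓ (Var.z k) i * v i) • η k x ∈ S.H10 x :=
      sum_mem fun k _ => Submodule.smul_mem _ _ (hηm k x hx)
    have := @hinj ⟨v, hv⟩ ⟨_, hmem⟩ (by
      funext j
      rw [Ta, Ta]
      simp only [Finset.sum_apply, Pi.smul_apply, smul_eq_mul]
      have h2 : ∀ k, ∑ i, ℓ (Var.z j) i * ((∑ i, ℓ (Var.z k) i * v i) * η k x i)
          = (∑ i, ℓ (Var.z k) i * v i) * if j = k then 1 else 0 := by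
        intro k
        rw [← hdual x hx j k, Finset.mul_sum]
        exact Finset.sum_congr rfl fun _ _ => by ring
      simp only [Finset.mul_sum (Finset.univ : Finset (Fin n))]
      rw [Finset.sum_comm]
      simp [h2])
    exact congrArg Subtype.val this

/-- For the covector θ with constant coefficients, θ([X̄, X]) = D - D̄ with D = X̄(θ(X)), and (D -
D̄)/2i = Im D. -/
theorem levi_eq {V : Set (RealSpace n)} (hV : IsOpen V) (hp : p ∈ V)
    {X : RealSpace n → CTangent n} (hX : ContDiffOn ℝ ∞ X V) (θ : RealSpace n →ₗ[ℝ] ℝ) :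
    (1 / (2 * Complex.I) *
        ∑ k, (θ (Pi.single k 1) : ℂ) * bracket (conjField X) X p k).re
      = (∑ i, star (X p i) *
        partialD i (fun x => ∑ k, (θ (Pi.single k 1) : ℂ) * X x k) p).im := by
  have hXc : ContDiffOn ℝ ∞ (conjField X) V := by
    refine contDiffOn_pi.mpr fun k => ?_
    exact Complex.conjCLE.contDiff.comp_contDiffOn (contDiffOn_component hX k)
  have hconj : ∀ j k, partialD j (fun y => conjField X y k) p
      = star (partialD j (fun y => X y k) p) := by
    intro j k
    have hd := differentiableAt_of_contDiffOn hV (contDiffOn_component hX k) hp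
    have := (Complex.conjCLE.toContinuousLinearMap.hasFDerivAt.comp p hd.hasFDerivAt).fderiv
    have e : (fun y => conjField X y k) = ⇑Complex.conjCLE.toContinuousLinearMap ∘
      (fun y => X y k) := rfl
    rw [partialD, e, this]
    rfl
  have hG : ∀ j, partialD j (fun x => ∑ k, (θ (Pi.single k 1) : ℂ) * X x k) p
      = ∑ k, (θ (Pi.single k 1) : ℂ) * partialD j (fun x => X x k) p := by
    intro j
    have hd : ∀ k, DifferentiableAt ℝ (fun x => X x k) p := fun k =>
      differentiableAt_of_contDiffOn hV (contDiffOn_component hX k) hp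
    rw [partialD, fderiv_fun_sum fun k _ => (hd k).const_mul _]
    rw [sum_apply]
    refine Finset.sum_congr rfl fun k _ => ?_
    rw [fderiv_const_mul (hd k)]
    rfl
  have hb : ∀ k, bracket (conjField X) X p k = ∑ j, (star (X p j) * partialD j (fun y => X y k) p
        - X p j * star (partialD j (fun y => X y k) p)) := by
    intro k
    rw [show bracket (conjField X) X p k = _ from bracket_apply hV hXc hX k hp]
    exact Finset.sum_congr rfl fun j _ => by rw [hconj]; rfl
  set D := ∑ i, star (X p i) *
        partialD i (fun x => ∑ k, (θ (Pi.single k 1) : ℂ) * X x k) p with hD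
  have h1 : ∑ k, (θ (Pi.single k 1) : ℂ) * bracket (conjField X) X p k = D - star D := by
    simp only [hD, hG, hb, star_sum, star_mul', star_star, Finset.mul_sum]
    rw [← Finset.sum_sub_distrib, Finset.sum_comm]
    refine Finset.sum_congr rfl fun j _ => ?_
    rw [← Finset.sum_sub_distrib]
    refine Finset.sum_congr rfl fun k _ => ?_
    have : star ((θ (Pi.single k 1) : ℂ)) = (θ (Pi.single k 1) : ℂ) := Complex.conj_ofReal _
    rw [this]
    ring
  rw [h1]
  have h2 : D - star D = (2 * D.im : ℝ) * Complex.I := Complex.sub_conj D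
  rw [h2]
  have h3 : 1 / (2 * Complex.I) * ((2 * D.im : ℝ) * Complex.I) = (D.im : ℂ) := by
    push_cast
    field_simp
  rw [h3, Complex.ofReal_re]

/-- The formal structure induced at a point with positive definite Levi form has an adapted
frame. -/
theorem exists_formalFrame (hU : IsOpen U) (hp : p ∈ U) (hLevi : S.LeviPosDef p) :
    ∃ F : FormalFrame (S.formalH10 p), ∀ c : Fin n → ℂ, c ≠ 0 →
      0 < (∑ k, ∑ l, star (c k) * c l * F.beta l k).im := by
  classical
  obtain ⟨θ, hθ, hpos⟩ := hLevi
  obtain ⟨ℓ, hℓ, hℓc, hℓu, V, hV, hpV, η, hη, hηm, hdual, hzb, hsp⟩ :=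
    exists_smooth_frame hU hp S θ hθ
  have hsec : ∀ k, S.IsSectionNear p (η k) := fun k => ⟨V, hV.mem_nhds hpV, hη k, hηm k⟩
  have tl : ∀ v k, taylor p (fun x => ∑ i, ℓ v i * η k x i)
      = ∑ i, C (ℓ v i) * taylorField p (η k) i := by
    intro v k
    rw [taylor_sum hV hpV _ _ fun i => contDiffOn_const.mul (contDiffOn_component (hη k) i)]
    refine Finset.sum_congr rfl fun i _ => ?_
    rw [taylor_mul hV hpV contDiffOn_const (contDiffOn_component (hη k) i), taylor_const]
    rfl
  have cη : ∀ k i, constantCoeff (taylorField p (η k) i) = η k p i := fun k i =>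
    constantCoeff_taylor _
  refine ⟨⟨ℓ, fun k => taylorField p (η k), fun k => Submodule.subset_span ⟨η k, hsec k, rfl⟩,
    ?_, hℓ, hℓc, fun i => ?_, fun j k => ?_, fun j k => ?_, fun k => ?_⟩, fun c hc => ?_⟩
  · refine Submodule.span_le.mpr ?_
    rintro _ ⟨X, hX, rfl⟩
    obtain ⟨W, hW, hpW, hXs, hXm⟩ := hX.exists_isOpen
    have ho := hV.inter hW
    have hXs' : ContDiffOn ℝ ∞ X (V ∩ W) := hXs.mono Set.inter_subset_right
    have hη' : ∀ k, ContDiffOn ℝ ∞ (η k) (V ∩ W) := fun k => (hη k).mono Set.inter_subset_left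
    have hcoef : ∀ k, ContDiffOn ℝ ∞ (fun x => ∑ i, ℓ (Var.z k) i * X x i) (V ∩ W) := fun k =>
      ContDiffOn.sum fun i _ => contDiffOn_const.mul (contDiffOn_component hXs' i)
    have : taylorField p X = ∑ k, taylor p (fun x => ∑ i, ℓ (Var.z k) i * X x i) •
        taylorField p (η k) := by
      funext i
      have e : Set.EqOn (fun x => X x i)
          (fun x => ∑ k, (∑ i, ℓ (Var.z k) i * X x i) * η k x i) (V ∩ W) := by
        intro x hx
        have := congrFun (hsp x hx.1 (X x) (hXm x hx.2)) i
        simpa using this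
      rw [taylorField, taylor_congr ho ⟨hpV, hpW⟩ e, taylor_sum ho ⟨hpV, hpW⟩ _ _ fun k =>
        (hcoef k).mul (contDiffOn_component (hη' k) i), Finset.sum_apply]
      refine Finset.sum_congr rfl fun k _ => ?_
      rw [taylor_mul ho ⟨hpV, hpW⟩ (hcoef k) (contDiffOn_component (hη' k) i)]
      rfl
    rw [this]
    exact sum_mem fun k _ => Submodule.smul_mem _ _ (Submodule.subset_span ⟨k, rfl⟩)
  · rw [hℓu]; exact Complex.conj_ofReal _
  · rw [← tl, taylor_congr hV hpV (G := fun _ => if j = k then 1 else 0)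
      (fun x hx => hdual x hx j k), taylor_const]
    split_ifs <;> simp
  · simp only [cη]; exact hzb j k
  · simp only [cη, hℓu]
    exact sum_mul_eq_zero_of_mem_H10 hθ (hηm k p hpV)
  -- Constant combinations of the frame suffice: by `levi_eq` the Levi form of Σ c_k η_k is the
  -- imaginary part of Σ c̄_k c_l β_lk.
  · set X : RealSpace n → CTangent n := fun x => ∑ k, c k • η k x with hX
    have hXs : ContDiffOn ℝ ∞ X V := ContDiffOn.sum fun k _ => (hη k).const_smul (c k)
    have hXp : X p ≠ 0 := by
      intro h0
      refine hc (funext fun j => ?_)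
      have h1 : ∑ i, ℓ (Var.z j) i * X p i = c j := by
        simp only [hX, Finset.sum_apply, Pi.smul_apply, smul_eq_mul, Finset.mul_sum]
        rw [Finset.sum_comm]
        have : ∀ k, ∑ i, ℓ (Var.z j) i * (c k * η k p i) = c k * if j = k then 1 else 0 := by
          intro k
          rw [← hdual p hpV j k, Finset.mul_sum]
          exact Finset.sum_congr rfl fun _ _ => by ring
        simp [this]
      rw [← h1, h0]
      simp
    have h := hpos X ⟨V, hV.mem_nhds hpV, hXs, fun x hx =>
      sum_mem fun k _ => Submodule.smul_mem _ _ (hηm k x hx)⟩ hXp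
    rw [levi_eq hV hpV hXs] at h
    convert h using 2
    simp only [FormalFrame.beta]
    have hg : ∀ l, ContDiffOn ℝ ∞ (fun x => ∑ i, ℓ Var.u i * η l x i) V := fun l =>
      ContDiffOn.sum fun i _ => contDiffOn_const.mul (contDiffOn_component (hη l) i)
    have hG : ∀ i, partialD i (fun x => ∑ k, (θ (Pi.single k 1) : ℂ) * X x k) p
        = ∑ l, c l * coeff (Finsupp.single i 1) (∑ j, C (ℓ Var.u j) * taylorField p (η l) j) := by
      intro i
      have e : (fun x => ∑ k, (θ (Pi.single k 1) : ℂ) * X x k)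
          = fun x => ∑ l, c l * ∑ i, ℓ Var.u i * η l x i := by
        funext x
        simp only [hX, hℓu, Finset.sum_apply, Pi.smul_apply, smul_eq_mul, Finset.mul_sum]
        rw [Finset.sum_comm]
        exact Finset.sum_congr rfl fun _ _ => Finset.sum_congr rfl fun _ _ => by ring
      have hs : ContDiffOn ℝ ∞ (fun x => ∑ l, c l * ∑ i, ℓ Var.u i * η l x i) V :=
        ContDiffOn.sum fun l _ => contDiffOn_const.mul (hg l)
      rw [e, ← coeff_single_taylor hV hpV hs, taylor_sum hV hpV _ _ fun l =>
        contDiffOn_const.mul (hg l), map_sum]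
      refine Finset.sum_congr rfl fun l _ => ?_
      rw [taylor_mul hV hpV contDiffOn_const (hg l), taylor_const, tl, coeff_C_mul]
    have e1 : ∀ i, star (X p i) = ∑ k, star (c k) * star (η k p i) := by
      intro i
      simp [hX]
    simp only [hG, e1, cη]
    symm
    simp only [Finset.sum_mul_sum]
    simp only [Finset.mul_sum (Finset.univ : Finset (Fin (2 * n + 1)))]
    rw [Finset.sum_comm]
    refine Finset.sum_congr rfl fun k _ => ?_
    rw [Finset.sum_comm]
    exact Finset.sum_congr rfl fun l _ => Finset.sum_congr rfl fun i _ => by ring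

end AlmostCRStructure

/-! ### Complex conjugation of power series in `(z, z̄, u)` -/

section Conj

variable {n : ℕ}

/-- The exchange of `z` and `z̄` as a permutation. -/
def Var.swapEquiv (n : ℕ) : Var n ≃ Var n where
  toFun := Var.swap
  invFun := Var.swap
  left_inv := Var.swap_swap
  right_inv := Var.swap_swap

/-- Complex conjugation, which exchanges `z` and `z̄`. -/
def cj : GraphSeries n →+* GraphSeries n :=
  (renameEquiv ℂ (Var.swapEquiv n) : GraphSeries n →+* GraphSeries n).comp
    (MvPowerSeries.map (starRingEnd ℂ))

theorem cj_apply (f : GraphSeries n) :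
    cj f = rename (Var.swapEquiv n) (MvPowerSeries.map (starRingEnd ℂ) f) := rfl

theorem coeff_cj_mapDomain (f : GraphSeries n) (m : Var n →₀ ℕ) :
    coeff (m.mapDomain Var.swap) (cj f) = star (coeff m f) := by
  have := coeff_embDomain_rename (Var.swapEquiv n).toEmbedding
    (MvPowerSeries.map (starRingEnd ℂ) f) m
  rw [Finsupp.embDomain_eq_mapDomain] at this
  rw [cj_apply]
  exact this

theorem mapDomain_swap_swap (m : Var n →₀ ℕ) : (m.mapDomain Var.swap).mapDomain Var.swap = m := by
  rw [← Finsupp.mapDomain_comp]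
  have : (Var.swap ∘ Var.swap : Var n → Var n) = id := funext Var.swap_swap
  rw [this, Finsupp.mapDomain_id]

theorem coeff_cj (f : GraphSeries n) (m : Var n →₀ ℕ) :
    coeff m (cj f) = star (coeff (m.mapDomain Var.swap) f) := by
  rw [← coeff_cj_mapDomain, mapDomain_swap_swap]

theorem mapDomain_swap_apply (m : Var n →₀ ℕ) (v : Var n) :
    m.mapDomain Var.swap v = m v.swap := by
  have hinj : Function.Injective (Var.swap : Var n → Var n) :=
    Function.LeftInverse.injective Var.swap_swap
  conv_lhs => rw [← Var.swap_swap v]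
  exact Finsupp.mapDomain_apply hinj m v.swap

@[simp] theorem cj_cj (f : GraphSeries n) : cj (cj f) = f := by
  ext m
  rw [coeff_cj, coeff_cj, mapDomain_swap_swap, star_star]

@[simp] theorem cj_X (v : Var n) : cj (X v : GraphSeries n) = X v.swap := by
  rw [cj_apply, map_X, rename_X]; rfl

@[simp] theorem cj_C (a : ℂ) : cj (C a : GraphSeries n) = C (star a) := by
  rw [cj_apply, map_C, rename_C]; rfl

theorem isReal_iff {φ : GraphSeries n} : φ.IsReal ↔ cj φ = φ := by
  constructor
  · intro h
    ext m
    rw [coeff_cj, h, star_star]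
  · intro h m
    rw [← coeff_cj_mapDomain, h]

theorem pderiv_cj (v : Var n) (f : GraphSeries n) :
    pderiv ℂ v (cj f) = cj (pderiv ℂ v.swap f) := by
  ext m
  rw [coeff_pderiv, coeff_cj, coeff_cj, coeff_pderiv, Finsupp.mapDomain_add,
    Finsupp.mapDomain_single, mapDomain_swap_apply, Var.swap_swap, star_mul']
  simp

theorem cj_mem_fil {w : Var n → ℕ} {k : ℕ} {f : GraphSeries n} (hf : f ∈ fil w k)
    {w' : Var n → ℕ} (hw : ∀ v, w' v = w v.swap) : cj f ∈ fil w' k := by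
  intro m hm
  rw [coeff_cj, hf _ ?_, star_zero]
  convert hm using 1
  rw [Finsupp.weight_apply, Finsupp.sum_mapDomain_index (by intro; exact zero_smul _ _)
    (by intros; exact add_smul _ _ _), Finsupp.weight_apply]
  simp only [hw]

theorem subst_cj {τ : Type*} {c : Var n → MvPowerSeries τ ℂ} (hc : HasSubst c)
    (f : GraphSeries n) :
    subst c (cj f) = subst (fun v => c v.swap) (MvPowerSeries.map (starRingEnd ℂ) f) := by
  rw [cj_apply, rename_eq_subst, subst_comp_subst_apply (HasSubst.X_comp (Var.swapEquiv n)) hc]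
  congr 1
  funext v
  exact subst_X hc _

theorem conjSeries_subst {c : Var n → SourceSeries n} (hc : HasSubst c)
    (hreal : ∀ v, c v.swap = conjSeries (c v)) (f : GraphSeries n) :
    conjSeries (subst c f) = subst c (cj f) := by
  rw [subst_cj hc, conjSeries, map_subst hc]
  congr 1
  exact (funext hreal).symm

theorem cj_subst {c : Var n → GraphSeries n} (hc : HasSubst c)
    (hreal : ∀ v, c v.swap = cj (c v)) (f : GraphSeries n) :
    cj (subst c f) = subst c (cj f) := by
  rw [subst_cj hc, cj_apply, map_subst hc, rename_eq_subst,
    subst_comp_subst_apply (hc.map _) (HasSubst.X_comp (Var.swapEquiv n))]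
  congr 1
  funext v
  rw [hreal, cj_apply, rename_eq_subst]

end Conj

theorem constantCoeff_subst_of_zero {σ τ : Type*} [Finite σ] {c : σ → MvPowerSeries τ ℂ}
    (hc : ∀ v, constantCoeff (c v) = 0) (f : MvPowerSeries σ ℂ) :
    constantCoeff (subst c f) = constantCoeff f := by
  have hs : HasSubst c := hasSubst_of_constantCoeff_zero hc
  have h : constantCoeff (subst c (f - C (constantCoeff f))) = 0 :=
    constantCoeff_subst_eq_zero hs hc (by simp)
  rw [← coe_substAlgHom hs, map_sub, map_sub, MvPowerSeries.c_eq_algebraMap, AlgHom.commutes,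
    ← MvPowerSeries.c_eq_algebraMap, constantCoeff_C, sub_eq_zero] at h
  rw [← coe_substAlgHom hs, h]

theorem sub_linear_mem_fil {σ : Type*} [Fintype σ] {f : MvPowerSeries σ ℂ}
    (hf : constantCoeff f = 0) :
    f - ∑ v, C (coeff (Finsupp.single v 1) f) * X v ∈ fil (fun _ => 1) 2 := by
  classical
  intro m hm
  rw [← Finsupp.degree_eq_weight_one] at hm
  rcases Nat.lt_succ_iff_lt_or_eq.mp hm with h' | h'
  · have : m = 0 := (Finsupp.degree_eq_zero_iff m).mp (by simpa using h')
    simp [this, hf]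
  · have : m ∈ Set.range fun a : σ => Finsupp.single a 1 := by
      rw [Finsupp.range_single_one]; exact h'
    obtain ⟨v, rfl⟩ := this
    simp [coeff_X, Finsupp.single_left_inj]

theorem mem_fil_cmWeight_of_degree {n : ℕ} {f : GraphSeries n} {k : ℕ}
    (hf : f ∈ fil (fun _ => 1) k) : f ∈ fil cmWeight k := by
  intro m hm
  refine hf m (lt_of_le_of_lt ?_ hm)
  rw [Finsupp.weight_eq_sum, Finsupp.weight_eq_sum]
  refine Finset.sum_le_sum fun v _ => Nat.mul_le_mul_left _ ?_
  rcases v with j | j | j <;> simp [cmWeight]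

/-! ### Normalization of the Levi form -/

namespace FormalFrame

variable {n : ℕ} {M : Submodule (SourceSeries n) (FormalField n)}

open scoped ComplexOrder MatrixOrder Matrix.Norms.L2Operator in
theorem exists_eq_conjTranspose_mul_self {h : Matrix (Fin n) (Fin n) ℂ} (hh : h.PosSemidef) :
    ∃ G : Matrix (Fin n) (Fin n) ℂ, h = G.conjTranspose * G :=
  CStarAlgebra.nonneg_iff_eq_star_mul_self.mp hh.nonneg

open scoped ComplexOrder in
-- The hermitian matrix h = (β - β*)/2i is positive definite, so h = G*G with G invertible. In the
-- coordinates Gz, with the frame transformed by K = G⁻¹, β becomes K*βK and h becomes the identity.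
theorem exists_levi_eq_one (F : FormalFrame M)
    (hF : ∀ c : Fin n → ℂ, c ≠ 0 → 0 < (∑ k, ∑ l, star (c k) * c l * F.beta l k).im) :
    ∃ F' : FormalFrame M, ∀ k l, F'.beta l k - star (F'.beta k l)
      = if k = l then 2 * Complex.I else 0 := by
  classical
  set h : Matrix (Fin n) (Fin n) ℂ :=
    Matrix.of fun k l => (F.beta l k - star (F.beta k l)) / (2 * Complex.I) with hh
  have hherm : h.IsHermitian := by
    ext k l
    simp only [hh, Matrix.conjTranspose_apply, Matrix.of_apply, star_div₀, star_sub,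
      star_mul', Complex.star_def, Complex.conj_I, map_ofNat, Complex.conj_conj]
    rw [mul_neg, div_neg, ← neg_div, neg_sub]
  have hquad : ∀ c : Fin n → ℂ, star c ⬝ᵥ h.mulVec c
      = ((∑ k, ∑ l, star (c k) * c l * F.beta l k).im : ℂ) := by
    intro c
    set D := ∑ k, ∑ l, star (c k) * c l * F.beta l k with hD
    have h1 : star c ⬝ᵥ h.mulVec c = (D - star D) / (2 * Complex.I) := by
      have hs : star D = ∑ k, ∑ l, star (c k) * c l * star (F.beta k l) := by
        simp only [hD, star_sum, star_mul', star_star]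
        rw [Finset.sum_comm]
        exact Finset.sum_congr rfl fun _ _ => Finset.sum_congr rfl fun _ _ => by ring
      rw [hs, hD, ← Finset.sum_sub_distrib, Finset.sum_div]
      simp only [dotProduct, Matrix.mulVec, hh, Matrix.of_apply, Pi.star_apply]
      refine Finset.sum_congr rfl fun k _ => ?_
      rw [← Finset.sum_sub_distrib, Finset.sum_div, Finset.mul_sum]
      exact Finset.sum_congr rfl fun l _ => by ring
    rw [h1, show D - star D = (2 * D.im : ℝ) * Complex.I from Complex.sub_conj D]
    push_cast
    field_simp
  have hpos : h.PosDef := by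
    refine Matrix.PosDef.of_dotProduct_mulVec_pos hherm fun c hc => ?_
    rw [hquad]
    exact_mod_cast hF c hc
  obtain ⟨G, hG⟩ := exists_eq_conjTranspose_mul_self hpos.posSemidef
  have hdet : IsUnit G.det := by
    have h1 := hpos.isUnit
    rw [Matrix.isUnit_iff_isUnit_det, hG, Matrix.det_mul] at h1
    exact isUnit_of_mul_isUnit_right h1
  set K := G⁻¹ with hK
  have hGK : G * K = 1 := Matrix.mul_nonsing_inv G hdet
  have hKG : K * G = 1 := Matrix.nonsing_inv_mul G hdet
  set ℓ' : Var n → Fin (2 * n + 1) → ℂ :=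
    Sum.elim (fun j i => ∑ l, G j l * F.ℓ (Var.z l) i)
      (Sum.elim (fun j i => ∑ l, star (G j l) * F.ℓ (Var.zbar l) i) fun _ i => F.ℓ Var.u i) with hℓ'
  have ℓz : ∀ j i, ℓ' (Var.z j) i = ∑ l, G j l * F.ℓ (Var.z l) i := fun _ _ => rfl
  have ℓzb : ∀ j i, ℓ' (Var.zbar j) i = ∑ l, star (G j l) * F.ℓ (Var.zbar l) i := fun _ _ => rfl
  have ℓu : ∀ i, ℓ' Var.u i = F.ℓ Var.u i := fun _ => rfl
  set η' : Fin n → FormalField n := fun k => ∑ l, (C (K l k) : SourceSeries n) • F.η l with hη'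
  have η'a : ∀ k i, η' k i = ∑ l, C (K l k) * F.η l i := fun k i => by simp [hη']
  have hsum : ∀ (a : Fin (2 * n + 1) → ℂ) k, ∑ i, a i * constantCoeff (η' k i)
      = ∑ l, K l k * ∑ i, a i * constantCoeff (F.η l i) := by
    intro a k
    simp only [η'a, map_sum, map_mul, constantCoeff_C, Finset.mul_sum]
    rw [Finset.sum_comm]
    exact Finset.sum_congr rfl fun _ _ => Finset.sum_congr rfl fun _ _ => by ring
  have hsum' : ∀ (a : Fin (2 * n + 1) → ℂ) k, ∑ i, C (a i) * η' k i
      = ∑ l, C (K l k) * ∑ i, C (a i) * F.η l i := by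
    intro a k
    simp only [η'a, Finset.mul_sum]
    rw [Finset.sum_comm]
    exact Finset.sum_congr rfl fun _ _ => Finset.sum_congr rfl fun _ _ => by ring
  refine ⟨⟨ℓ', η', fun k => sum_mem fun l _ => Submodule.smul_mem _ _ (F.mem l), ?_, fun x hx => ?_,
    fun j i => ?_, fun i => F.real i, fun j k => ?_, fun j k => ?_, fun k => ?_⟩, fun k l => ?_⟩
  · refine F.le_span.trans (Submodule.span_le.mpr ?_)
    rintro _ ⟨l, rfl⟩
    have : F.η l = ∑ k, (C (G k l) : SourceSeries n) • η' k := by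
      funext i
      simp only [Finset.sum_apply, Pi.smul_apply, smul_eq_mul, η'a, Finset.mul_sum]
      rw [Finset.sum_comm]
      have : ∀ a, ∑ k, C (G k l) * (C (K a k) * F.η a i) = C ((K * G) a l) * F.η a i := by
        intro a
        rw [Matrix.mul_apply, map_sum, Finset.sum_mul]
        exact Finset.sum_congr rfl fun k _ => by rw [map_mul]; ring
      simp only [this, hKG, Matrix.one_apply]
      simp
    rw [this]
    exact sum_mem fun k _ => Submodule.smul_mem _ _ (Submodule.subset_span ⟨k, rfl⟩)
  · have inv : ∀ (A B : Matrix (Fin n) (Fin n) ℂ) (v : Fin n → ℂ), B * A = 1 →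
        (∀ j, ∑ l, A j l * v l = 0) → ∀ l, v l = 0 := by
      intro A B v hBA hv l
      have h1 : A.mulVec v = 0 := funext hv
      have h2 := congrArg B.mulVec h1
      rw [Matrix.mulVec_mulVec, hBA, Matrix.one_mulVec, Matrix.mulVec_zero] at h2
      exact congrFun h2 l
    have comb : ∀ (a : Fin n → ℂ) (w : Fin n → Var n),
        ∑ i, (∑ l, a l * F.ℓ (w l) i) * x i = ∑ l, a l * ∑ i, F.ℓ (w l) i * x i := by
      intro a w
      simp only [Finset.sum_mul, Finset.mul_sum]
      rw [Finset.sum_comm]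
      exact Finset.sum_congr rfl fun _ _ => Finset.sum_congr rfl fun _ _ => by ring
    refine F.injective x ?_
    have hz : ∀ l, ∑ i, F.ℓ (Var.z l) i * x i = 0 := by
      refine inv G K _ hKG fun j => ?_
      have := hx (Var.z j)
      simp only [ℓz] at this
      rwa [comb] at this
    have hzb : ∀ l, ∑ i, F.ℓ (Var.zbar l) i * x i = 0 := by
      refine inv (Matrix.of fun j l => star (G j l)) (Matrix.of fun j l => star (K j l)) _ ?_
        fun j => ?_
      · ext a b
        have := congrArg star (congrFun (congrFun hKG a) b)
        rw [Matrix.mul_apply, star_sum] at this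
        rw [Matrix.mul_apply]
        simp only [Matrix.of_apply]
        simp only [star_mul', Matrix.one_apply] at this ⊢
        rw [this]
        split_ifs <;> simp
      · have := hx (Var.zbar j)
        simp only [ℓzb] at this
        rwa [comb] at this
    rintro (j | j | j)
    · exact hz j
    · exact hzb j
    · exact hx Var.u
  · rw [ℓz, ℓzb]
    simp only [star_sum, star_mul', F.zbar]
  · rw [hsum']
    have : ∀ l, ∑ i, C (ℓ' (Var.z j) i) * F.η l i = C (G j l) := by
      intro l
      have h1 : ∀ i, C (ℓ' (Var.z j) i) * F.η l i
          = ∑ a, C (G j a) * (C (F.ℓ (Var.z a) i) * F.η l i) := by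
        intro i
        rw [ℓz, map_sum, Finset.sum_mul]
        exact Finset.sum_congr rfl fun _ _ => by rw [map_mul]; ring
      simp only [h1]
      rw [Finset.sum_comm]
      simp only [← Finset.mul_sum, F.dual]
      simp
    simp only [this, ← map_mul, ← map_sum]
    have h2 := congrFun (congrFun hGK j) k
    rw [Matrix.mul_apply, Matrix.one_apply] at h2
    have h3 : ∑ x, K x k * G j x = if j = k then 1 else 0 := by
      rw [← h2]; exact Finset.sum_congr rfl fun _ _ => mul_comm _ _
    rw [h3]
    split_ifs <;> simp
  · rw [hsum]
    refine Finset.sum_eq_zero fun l _ => ?_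
    have : ∑ i, ℓ' (Var.zbar j) i * constantCoeff (F.η l i) = 0 := by
      simp only [ℓzb, Finset.sum_mul]
      rw [Finset.sum_comm]
      simp only [mul_assoc, ← Finset.mul_sum, F.zbar_apply]
      simp
    rw [this, mul_zero]
  · rw [hsum]
    refine Finset.sum_eq_zero fun l _ => ?_
    simp only [ℓu, F.u_apply, mul_zero]
  · have hb : ∀ l k, ∑ i, star (constantCoeff (η' k i)) *
        coeff (Finsupp.single i 1) (∑ j, C (ℓ' Var.u j) * η' l j)
        = ∑ a, ∑ b, star (K a k) * F.beta b a * K b l := by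
      intro l k
      have e1 : ∀ i, coeff (Finsupp.single i 1) (∑ j, C (ℓ' Var.u j) * η' l j)
          = ∑ b, K b l * coeff (Finsupp.single i 1) (∑ j, C (F.ℓ Var.u j) * F.η b j) := by
        intro i
        simp only [ℓu]
        rw [hsum', map_sum]
        exact Finset.sum_congr rfl fun b _ => coeff_C_mul _ _ _
      have e2 : ∀ i, star (constantCoeff (η' k i))
          = ∑ a, star (K a k) * star (constantCoeff (F.η a i)) := by
        intro i
        rw [η'a, map_sum, star_sum]
        exact Finset.sum_congr rfl fun a _ => by rw [map_mul, constantCoeff_C, star_mul']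
      simp only [e1, e2, beta, Finset.sum_mul_sum]
      rw [Finset.sum_comm]
      refine Finset.sum_congr rfl fun a _ => ?_
      rw [Finset.sum_comm]
      refine Finset.sum_congr rfl fun b _ => ?_
      rw [Finset.mul_sum, Finset.sum_mul]
      exact Finset.sum_congr rfl fun i _ => by ring
    have h1 : K.conjTranspose * h * K = 1 := by
      rw [hG]
      have : K.conjTranspose * (G.conjTranspose * G) * K = (G * K).conjTranspose * (G * K) := by
        rw [Matrix.conjTranspose_mul]; simp only [Matrix.mul_assoc]
      rw [this, hGK]; simp
    have h2 : ∑ a, ∑ b, star (K a k) * h a b * K b l = if k = l then 1 else 0 := by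
      have := congrFun (congrFun h1 k) l
      rw [Matrix.mul_apply, Matrix.one_apply] at this
      rw [← this]
      simp only [Matrix.mul_apply, Matrix.conjTranspose_apply, Finset.sum_mul]
      rw [Finset.sum_comm]
    change (∑ i, star (constantCoeff (η' k i)) * coeff (Finsupp.single i 1)
        (∑ j, C (ℓ' Var.u j) * η' l j)) - star (∑ i, star (constantCoeff (η' l i)) *
        coeff (Finsupp.single i 1) (∑ j, C (ℓ' Var.u j) * η' k j)) = _
    rw [hb, hb]
    have h3 : (∑ a, ∑ b, star (K a k) * F.beta b a * K b l)
        - star (∑ a, ∑ b, star (K a l) * F.beta b a * K b k)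
        = (2 * Complex.I) * ∑ a, ∑ b, star (K a k) * h a b * K b l := by
      simp only [star_sum, star_mul', star_star]
      rw [Finset.sum_comm (f := fun a b => K a l * star (F.beta b a) * star (K b k)),
        ← Finset.sum_sub_distrib, Finset.mul_sum]
      refine Finset.sum_congr rfl fun a _ => ?_
      rw [← Finset.sum_sub_distrib, Finset.mul_sum]
      refine Finset.sum_congr rfl fun b _ => ?_
      rw [hh, Matrix.of_apply]
      field_simp
    rw [h3, h2]
    split_ifs <;> simp

end FormalFrame

/-! ### Normal coordinates -/

section Toolkit

variable {σ τ : Type*}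

theorem subst_sum {ι : Type*} {c : σ → MvPowerSeries τ ℂ} (hc : HasSubst c) (s : Finset ι)
    (f : ι → MvPowerSeries σ ℂ) : subst c (∑ i ∈ s, f i) = ∑ i ∈ s, subst c (f i) := by
  simp only [← coe_substAlgHom hc, map_sum]

theorem subst_neg {c : σ → MvPowerSeries τ ℂ} (hc : HasSubst c) (f : MvPowerSeries σ ℂ) :
    subst c (-f) = -subst c f := by
  simp only [← coe_substAlgHom hc, map_neg]

theorem subst_zero {c : σ → MvPowerSeries τ ℂ} (hc : HasSubst c) :
    subst c (0 : MvPowerSeries σ ℂ) = 0 := by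
  simp only [← coe_substAlgHom hc, map_zero]

theorem subst_one {c : σ → MvPowerSeries τ ℂ} (hc : HasSubst c) :
    subst c (1 : MvPowerSeries σ ℂ) = 1 := by
  simp only [← coe_substAlgHom hc, map_one]

theorem pderiv_mul (v : σ) (f g : MvPowerSeries σ ℂ) :
    pderiv ℂ v (f * g) = f * pderiv ℂ v g + g * pderiv ℂ v f := by
  rw [Derivation.leibniz, smul_eq_mul, smul_eq_mul]

theorem pderiv_C_mul (v : σ) (a : ℂ) (g : MvPowerSeries σ ℂ) :
    pderiv ℂ v (C a * g) = C a * pderiv ℂ v g := by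
  rw [pderiv_mul, pderiv_C, mul_zero, add_zero]

theorem C_mul_mem_fil {w : σ → ℕ} {k : ℕ} {f : MvPowerSeries σ ℂ} (a : ℂ) (hf : f ∈ fil w k) :
    C a * f ∈ fil w k := Ideal.mul_mem_left _ _ hf

theorem pderiv_sum_X_mul_X {n : ℕ} (v : σ) [DecidableEq σ] (r : Fin n → Fin n → ℂ)
    (a b : Fin n → σ) :
    pderiv ℂ v (∑ l, ∑ m, C (r l m) * (X (a l) * X (b m)))
      = ∑ l, ∑ m, C (r l m) * ((if a l = v then X (b m) else 0) + if b m = v then X (a l) else 0) := by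
  simp only [map_sum, pderiv_mul, pderiv_C, mul_zero, add_zero, pderiv_X, Pi.single_apply]
  refine Finset.sum_congr rfl fun l _ => Finset.sum_congr rfl fun m _ => ?_
  split_ifs <;> simp [add_comm]

end Toolkit

/-- Formal coordinates for a formal almost CR structure in which the frame of `(1,0)` vector fields
`∂/∂z_k + ∑_j A_jk ∂/∂z̄_j + B_k ∂/∂u` agrees to low order with that of a sphere, up to the part
`α` of `B` which obstructs partial integrability. -/
structure NormalCoordinates {n : ℕ} (M : Submodule (SourceSeries n) (FormalField n)) where
  /-- the coordinates -/
  y : Var n → SourceSeries n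
  /-- the `z̄`-components of the frame -/
  A : Fin n → Fin n → GraphSeries n
  /-- the `u`-components of the frame -/
  B : Fin n → GraphSeries n
  /-- the obstruction to partial integrability -/
  α : Fin n → Fin n → ℂ
  y_zero : ∀ v, constantCoeff (y v) = 0
  y_swap : ∀ v, y v.swap = conjSeries (y v)
  bijective : Function.Bijective (subst y : GraphSeries n → SourceSeries n)
  antisymm : ∀ k l, α k l = -α l k
  A_mem : ∀ j k, A j k ∈ fil cmWeight 1
  B_mem : ∀ k, B k - C Complex.I * X (Var.zbar k) - ∑ l, C (α k l) * X (Var.z l) ∈ fil cmWeight 2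
  act_zbar : ∀ x ∈ M, ∀ j, FormalField.act x (y (Var.zbar j))
    = ∑ k, subst y (A j k) * FormalField.act x (y (Var.z k))
  act_u : ∀ x ∈ M, FormalField.act x (y Var.u)
    = ∑ k, subst y (B k) * FormalField.act x (y (Var.z k))

namespace FormalFrame

variable {n : ℕ} {M : Submodule (SourceSeries n) (FormalField n)} (F : FormalFrame M)

/-- The linear coordinates belonging to a frame. -/
def lin (v : Var n) : SourceSeries n := ∑ i, C (F.ℓ v i) * X i

theorem coeff_lin (v : Var n) (i : Fin (2 * n + 1)) :
    coeff (Finsupp.single i 1) (F.lin v) = F.ℓ v i := by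
  classical
  rw [lin, map_sum, Finset.sum_eq_single i]
  · rw [coeff_C_mul, coeff_X, if_pos rfl, mul_one]
  · intro b _ hb
    rw [coeff_C_mul, coeff_X, if_neg, mul_zero]
    intro h
    exact hb (Finsupp.single_left_injective one_ne_zero h).symm
  · simp

theorem constantCoeff_lin (v : Var n) : constantCoeff (F.lin v) = 0 := by
  simp [lin]

theorem lin_swap (v : Var n) : F.lin v.swap = conjSeries (F.lin v) := by
  simp only [lin, conjSeries, map_sum, map_mul, map_C, map_X]
  refine Finset.sum_congr rfl fun i _ => ?_
  congr 2
  rcases v with j | j | j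
  · exact F.zbar j i
  · change F.ℓ (Var.z j) i = star (F.ℓ (Var.zbar j) i)
    rw [F.zbar, star_star]
  · exact (F.real i).symm

theorem bijective_subst_lin :
    Function.Bijective (subst F.lin : GraphSeries n → SourceSeries n) := by
  refine bijective_subst_of_injective (card_var n) F.constantCoeff_lin fun x hx => F.injective x ?_
  simpa only [coeff_lin] using hx

theorem act_lin (k : Fin n) (v : Var n) : (F.η k).act (F.lin v) = ∑ i, C (F.ℓ v i) * F.η k i := by
  rw [lin, FormalField.act_sum]
  refine Finset.sum_congr rfl fun i _ => ?_
  rw [FormalField.act_mul, FormalField.act_C, FormalField.act_X, mul_zero, add_zero]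

/-- The field `D` with the constant coefficients of the conjugate of η_k at the base point is there
equal to ∂/∂z̄_k, so β_lk is a first order Taylor coefficient of the u-component of η_l. -/
theorem beta_eq_coeff {γ : GraphSeries n} {l : Fin n}
    (hγ : subst F.lin γ = (F.η l).act (F.lin Var.u)) (k : Fin n) :
    F.beta l k = coeff (Finsupp.single (Var.zbar k) 1) γ := by
  classical
  set D : FormalField n := fun i => C (star (constantCoeff (F.η k i))) with hD
  have h1 : F.beta l k = constantCoeff (D.act ((F.η l).act (F.lin Var.u))) := by
    rw [FormalField.constantCoeff_act, act_lin, beta]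
    exact Finset.sum_congr rfl fun i _ => by rw [hD, constantCoeff_C, mul_comm]
  have h2 : ∀ v, constantCoeff (D.act (F.lin v)) = if v = Var.zbar k then 1 else 0 := by
    intro v
    rw [FormalField.constantCoeff_act]
    have e : ∑ i, coeff (Finsupp.single i 1) (F.lin v) * constantCoeff (D i)
        = star (∑ i, star (F.ℓ v i) * constantCoeff (F.η k i)) := by
      rw [star_sum]
      refine Finset.sum_congr rfl fun i _ => ?_
      rw [coeff_lin, star_mul', star_star, hD, constantCoeff_C]
    rw [e]
    rcases v with j | j | j
    · have := F.zbar_apply j k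
      simp only [F.zbar] at this
      rw [this]; simp
    · have h3 : ∀ i, star (F.ℓ (Var.zbar j) i) = F.ℓ (Var.z j) i := fun i => by
        rw [F.zbar, star_star]
      have h4 := congrArg constantCoeff (F.dual j k)
      simp only [map_sum, map_mul, constantCoeff_C] at h4
      change star (∑ i, star (F.ℓ (Var.zbar j) i) * _) = _
      simp only [h3, h4]
      by_cases h : j = k <;> simp [h]
    · change star (∑ i, star (F.ℓ Var.u i) * _) = _
      simp only [F.real, F.u_apply]
      simp
  rw [h1, ← hγ, FormalField.act_subst _ F.constantCoeff_lin, map_sum,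
    Finset.sum_eq_single (Var.zbar k)]
  · rw [map_mul, h2, if_pos rfl, mul_one, constantCoeff_subst_of_zero F.constantCoeff_lin,
      ← coeff_zero_eq_constantCoeff_apply, coeff_pderiv]
    simp
  · intro v _ hv
    rw [map_mul, h2, if_neg hv, mul_zero]
  · simp

/-- A quadratic change u + Q adds Q_{z_k} to the linear part of the u-component of the frame. The
hermitian part of its z̄-coefficients and the symmetric part of its z-coefficients can be removed in
this way. The skew-hermitian part, which is the Levi form, and the antisymmetric part α remain. -/
theorem exists_normalCoordinates
    (hF : ∀ k l, F.beta l k - star (F.beta k l) = if k = l then 2 * Complex.I else 0) :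
    Nonempty (NormalCoordinates M) := by
  classical
  have hs : HasSubst F.lin := hasSubst_of_constantCoeff_zero F.constantCoeff_lin
  choose a ha using fun j k => F.bijective_subst_lin.2 ((F.η k).act (F.lin (Var.zbar j)))
  choose γ hγ using fun k => F.bijective_subst_lin.2 ((F.η k).act (F.lin Var.u))
  have cw : ∀ v : Var n, (cmWeight v) ≠ 0 := by rintro (j | j | j) <;> simp [cmWeight]
  have ha1 : ∀ j k, a j k ∈ fil cmWeight 1 := by
    intro j k
    rw [← constantCoeff_eq_zero_iff_mem_fil cw, ← constantCoeff_subst_of_zero F.constantCoeff_lin,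
      ha, act_lin]
    simpa only [map_sum, map_mul, constantCoeff_C] using F.zbar_apply j k
  have hγ1 : ∀ k, constantCoeff (γ k) = 0 := by
    intro k
    rw [← constantCoeff_subst_of_zero F.constantCoeff_lin, hγ, act_lin]
    simpa only [map_sum, map_mul, constantCoeff_C] using F.u_apply k
  set b : Fin n → Fin n → ℂ := fun l k => coeff (Finsupp.single (Var.zbar k) 1) (γ l) with hb
  have hbb : ∀ k l, b l k - star (b k l) = if k = l then 2 * Complex.I else 0 := by
    intro k l
    simp only [hb]
    rw [← F.beta_eq_coeff (hγ l), ← F.beta_eq_coeff (hγ k)]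
    exact hF k l
  set α₀ : Fin n → Fin n → ℂ := fun l k => coeff (Finsupp.single (Var.z k) 1) (γ l) with hα₀
  -- Here b + r is the skew-hermitian part of b, which is i times the identity.
  set r : Fin n → Fin n → ℂ := fun l m => -((b l m + star (b m l)) / 2) with hr
  -- The quadratic form contributes 2s to the z-derivative, whence the factor 1/4; α₀ + 2s is the
  -- antisymmetric part of α₀.
  set s : Fin n → Fin n → ℂ := fun l m => -((α₀ l m + α₀ m l) / 4) with hsdef
  have hrr : ∀ l m, star (r l m) = r m l := by
    intro l m
    simp only [hr, star_neg, star_div₀, star_add, star_star, star_ofNat]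
    ring
  have hss : ∀ l m, s l m = s m l := by intro l m; simp only [hsdef]; ring
  set Q : GraphSeries n := (∑ l, ∑ m, C (r l m) * (X (Var.z l) * X (Var.zbar m)))
    + (∑ l, ∑ m, C (s l m) * (X (Var.z l) * X (Var.z m)))
    + ∑ l, ∑ m, C (star (s l m)) * (X (Var.zbar l) * X (Var.zbar m)) with hQ
  have hcjQ : cj Q = Q := by
    simp only [hQ, map_add, map_sum, map_mul, cj_C, cj_X, star_star, hrr]
    change (∑ l, ∑ m, C (r m l) * (X (Var.zbar l) * X (Var.z m)))
      + (∑ l, ∑ m, C (star (s l m)) * (X (Var.zbar l) * X (Var.zbar m)))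
      + ∑ l, ∑ m, C (s l m) * (X (Var.z l) * X (Var.z m)) = _
    rw [Finset.sum_comm]
    simp only [mul_comm (X (Var.zbar _) : GraphSeries n) (X (Var.z _))]
    ring
  have hQz : ∀ k, pderiv ℂ (Var.z k) Q = ∑ m, C (r k m) * X (Var.zbar m)
      + ∑ m, C (2 * s k m) * X (Var.z m) := by
    intro k
    simp only [hQ, map_add, pderiv_sum_X_mul_X, mul_add, Finset.sum_add_distrib, mul_ite, mul_zero,
      Sum.inl.injEq, reduceCtorEq, if_false, Finset.sum_const_zero, add_zero, Finset.sum_ite_eq',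
      Finset.mem_univ, if_true]
    have e : ∀ (f : Fin n → Fin n → GraphSeries n), (∑ l, ∑ m, if l = k then f l m else 0)
        = ∑ m, f k m := by
      intro f
      rw [Finset.sum_comm]
      simp
    rw [e, e, ← Finset.sum_add_distrib]
    congr 1
    refine Finset.sum_congr rfl fun m _ => ?_
    rw [hss m k, two_mul, map_add, add_mul]
  have hQzb : ∀ j, pderiv ℂ (Var.zbar j) Q ∈ fil cmWeight 1 := by
    intro j
    simp only [hQ, map_add, pderiv_sum_X_mul_X]
    have h0 : ∀ (P : Prop) [Decidable P] (t : Var n), t ≠ Var.u →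
        (if P then X t else 0 : GraphSeries n) ∈ fil cmWeight 1 := by
      rintro P _ t ht
      by_cases h : P
      · rw [if_pos h]
        refine X_mem_fil _ _ ?_
        rcases t with j | j | j <;> simp [cmWeight]
      · rw [if_neg h]; exact zero_mem _
    refine add_mem (add_mem ?_ ?_) ?_ <;>
    · refine sum_mem fun l _ => sum_mem fun m _ => C_mul_mem_fil _ (add_mem ?_ ?_) <;>
      · exact h0 _ _ (by simp)
  have hQu : pderiv ℂ Var.u Q = 0 := by
    simp only [hQ, map_add, pderiv_sum_X_mul_X]
    simp
  have hQ2 : Q ∈ fil cmWeight 2 := by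
    refine add_mem (add_mem ?_ ?_) ?_ <;>
    · refine sum_mem fun l _ => sum_mem fun m _ => C_mul_mem_fil _ (mul_mem_fil
        (X_mem_fil _ _ le_rfl) (X_mem_fil _ _ le_rfl) le_rfl)
  have hshift : ∀ P : GraphSeries n, P ∈ fil cmWeight 2 → ∀ v : Var n,
      Function.update X Var.u (X Var.u + P) v ∈ fil cmWeight (cmWeight v) := by
    rintro P hP (j | j | j)
    · rw [Function.update_of_ne (by simp)]; exact X_mem_fil _ _ le_rfl
    · rw [Function.update_of_ne (by simp)]; exact X_mem_fil _ _ le_rfl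
    · change Function.update X Var.u (X Var.u + P) Var.u ∈ _
      rw [Function.update_self]; exact add_mem (X_mem_fil _ _ le_rfl) hP
  have hsubst : ∀ P : GraphSeries n, P ∈ fil cmWeight 2 →
      HasSubst (Function.update (X : Var n → GraphSeries n) Var.u (X Var.u + P)) := fun P hP =>
    hasSubst_of_mem_fil fun v => fil_anti _ (Nat.one_le_iff_ne_zero.mpr (cw v)) (hshift P hP v)
  have hsQ : ∀ P : GraphSeries n, P ∈ fil cmWeight 2 →
      subst (Function.update (X : Var n → GraphSeries n) Var.u (X Var.u + P)) Q = Q := by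
    intro P hP
    have hz : ∀ j, subst (Function.update (X : Var n → GraphSeries n) Var.u (X Var.u + P))
        (X (Var.z j) : GraphSeries n) = (X (Var.z j) : GraphSeries n) := fun j => by
      rw [subst_X (hsubst P hP), Function.update_of_ne (by simp)]
    have hzb : ∀ j, subst (Function.update (X : Var n → GraphSeries n) Var.u (X Var.u + P))
        (X (Var.zbar j) : GraphSeries n) = (X (Var.zbar j) : GraphSeries n) := fun j => by
      rw [subst_X (hsubst P hP), Function.update_of_ne (by simp)]
    simp only [hQ, subst_add (hsubst P hP), subst_sum (hsubst P hP), subst_mul (hsubst P hP),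
      subst_C, hz, hzb]
  clear_value Q
  -- Since Q does not involve u, the substitutions u + Q and u - Q are inverse to each other.
  set σ₁ : Var n → GraphSeries n := Function.update X Var.u (X Var.u + Q) with hσ₁
  set σ₂ : Var n → GraphSeries n := Function.update X Var.u (X Var.u + -Q) with hσ₂
  have hQ2' := neg_mem hQ2
  have s1 : HasSubst σ₁ := hsubst Q hQ2
  have s2 : HasSubst σ₂ := hsubst (-Q) hQ2'
  have inv12 : ∀ f : GraphSeries n, subst σ₁ (subst σ₂ f) = f := by
    intro f
    rw [subst_comp_subst_apply s2 s1]
    have : (fun v => subst σ₁ (σ₂ v)) = X := by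
      funext v
      rcases v with j | j | j
      · rw [hσ₂, Function.update_of_ne (by simp), subst_X s1, hσ₁, Function.update_of_ne (by simp)]
      · rw [hσ₂, Function.update_of_ne (by simp), subst_X s1, hσ₁, Function.update_of_ne (by simp)]
      · change subst σ₁ (Function.update X Var.u (X Var.u + -Q) Var.u) = X Var.u
        rw [Function.update_self, subst_add s1, subst_neg s1, show subst σ₁ Q = Q from hsQ Q hQ2, subst_X s1, hσ₁,
          Function.update_self]
        ring
    rw [this, subst_self, id]
  have inv21 : ∀ f : GraphSeries n, subst σ₂ (subst σ₁ f) = f := by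
    intro f
    rw [subst_comp_subst_apply s1 s2]
    have : (fun v => subst σ₂ (σ₁ v)) = X := by
      funext v
      rcases v with j | j | j
      · rw [hσ₁, Function.update_of_ne (by simp), subst_X s2, hσ₂, Function.update_of_ne (by simp)]
      · rw [hσ₁, Function.update_of_ne (by simp), subst_X s2, hσ₂, Function.update_of_ne (by simp)]
      · change subst σ₂ (Function.update X Var.u (X Var.u + Q) Var.u) = X Var.u
        rw [Function.update_self, subst_add s2, show subst σ₂ Q = Q from hsQ (-Q) hQ2', subst_X s2, hσ₂,
          Function.update_self]
        ring
    rw [this, subst_self, id]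
  set y : Var n → SourceSeries n := Function.update F.lin Var.u (F.lin Var.u + subst F.lin Q)
    with hy
  have hyz : ∀ j, y (Var.z j) = F.lin (Var.z j) := fun j => Function.update_of_ne (by simp) _ _
  have hyzb : ∀ j, y (Var.zbar j) = F.lin (Var.zbar j) := fun j =>
    Function.update_of_ne (by simp) _ _
  have hyu : y Var.u = F.lin Var.u + subst F.lin Q := Function.update_self _ _ _
  have hyσ : ∀ v, y v = subst F.lin (σ₁ v) := by
    rintro (j | j | j)
    · rw [hyz, hσ₁, Function.update_of_ne (by simp), subst_X hs]
    · rw [hyzb, hσ₁, Function.update_of_ne (by simp), subst_X hs]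
    · change y Var.u = subst F.lin (Function.update X Var.u (X Var.u + Q) Var.u)
      rw [hyu, Function.update_self, subst_add hs, subst_X hs]
  have hysubst : ∀ f : GraphSeries n, subst y f = subst F.lin (subst σ₁ f) := by
    intro f
    rw [subst_comp_subst_apply s1 hs]
    congr 1
    exact funext hyσ
  -- This is η_k(u + Q), still written in the old linear coordinates; `σ₂` later rewrites it in the
  -- new ones.
  set δ : Fin n → GraphSeries n := fun k => γ k + pderiv ℂ (Var.z k) Q
    + ∑ j, pderiv ℂ (Var.zbar j) Q * a j k with hδ
  have hδ2 : ∀ k, δ k - C Complex.I * X (Var.zbar k)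
      - ∑ l, C ((α₀ k l - α₀ l k) / 2) * X (Var.z l) ∈ fil cmWeight 2 := by
    intro k
    have h1 := mem_fil_cmWeight_of_degree (sub_linear_mem_fil (hγ1 k))
    have h2 : ∑ j, pderiv ℂ (Var.zbar j) Q * a j k ∈ fil cmWeight 2 :=
      sum_mem fun j _ => mul_mem_fil (hQzb j) (ha1 j k) le_rfl
    have h3 : C (coeff (Finsupp.single Var.u 1) (γ k)) * (X Var.u : GraphSeries n)
        ∈ fil cmWeight 2 := C_mul_mem_fil _ (X_mem_fil _ _ le_rfl)
    convert add_mem (add_mem h1 h2) h3 using 1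
    have e1 : (C Complex.I * X (Var.zbar k) : GraphSeries n) =
        ∑ m, C (b k m) * X (Var.zbar m) + ∑ m, C (r k m) * X (Var.zbar m) := by
      rw [← Finset.sum_add_distrib, Finset.sum_eq_single k]
      · rw [← add_mul, ← map_add]
        have := hbb k k
        rw [if_pos rfl] at this
        have e : b k k + r k k = Complex.I := by
          simp only [hr]; linear_combination this / 2
        rw [e]
      · intro m _ hm
        rw [← add_mul, ← map_add]
        have := hbb m k
        rw [if_neg hm] at this
        have e : b k m + r k m = 0 := by
          simp only [hr]; linear_combination this / 2
        rw [e]; simp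
      · simp
    have e2 : ∑ l, C ((α₀ k l - α₀ l k) / 2) * (X (Var.z l) : GraphSeries n) =
        ∑ m, C (α₀ k m) * X (Var.z m) + ∑ m, C (2 * s k m) * X (Var.z m) := by
      rw [← Finset.sum_add_distrib]
      refine Finset.sum_congr rfl fun m _ => ?_
      rw [← add_mul, ← map_add]
      congr 2
      simp only [hsdef]; ring
    rw [e1, e2, hδ]
    simp only [hQz, Fintype.sum_sum_type, Finset.univ_unique, Finset.sum_singleton]
    change _ = (γ k - (∑ m, C (α₀ k m) * X (Var.z m) + (∑ m, C (b k m) * X (Var.zbar m)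
      + C (coeff (Finsupp.single Var.u 1) (γ k)) * X Var.u))) + _ + _
    ring
  have key : ∀ k v, (F.η k).act (y v) = subst F.lin (match v with
      | Sum.inl j => if j = k then 1 else 0
      | Sum.inr (Sum.inl j) => a j k
      | Sum.inr (Sum.inr _) => δ k) := by
    intro k
    have hz : ∀ j, (F.η k).act (F.lin (Var.z j)) = if j = k then 1 else 0 := fun j => by
      rw [act_lin, F.dual]
    rintro (j | j | j)
    · rw [hyz, hz]
      dsimp only
      split_ifs
      · rw [subst_one hs]
      · rw [subst_zero hs]
    · rw [hyzb, ha]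
    · change (F.η k).act (y Var.u) = subst F.lin (δ k)
      rw [hyu, FormalField.act_add, FormalField.act_subst _ F.constantCoeff_lin]
      simp only [Fintype.sum_sum_type, Finset.univ_unique, Finset.sum_singleton]
      have e : (F.η k).act (F.lin Var.u) + (∑ j, subst F.lin (pderiv ℂ (Var.z j) Q)
            * (F.η k).act (F.lin (Var.z j)) + (∑ j, subst F.lin (pderiv ℂ (Var.zbar j) Q)
            * (F.η k).act (F.lin (Var.zbar j)) + subst F.lin (pderiv ℂ Var.u Q)
            * (F.η k).act (F.lin Var.u))) = subst F.lin (δ k) := by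
        simp only [hz, hQu, subst_zero hs, ← ha, ← hγ, hδ, subst_add hs, subst_sum hs,
          subst_mul hs]
        simp
        ring
      exact e
  -- Both sides are linear over the power series, so the identity passes from the frame to all of
  -- `M`.
  have ext : ∀ (f : SourceSeries n) (g : Fin n → GraphSeries n),
      (∀ k, (F.η k).act f = subst F.lin (g k)) → ∀ x ∈ M,
        FormalField.act x f = ∑ k, subst y (subst σ₂ (g k)) * FormalField.act x (y (Var.z k)) := by
    intro f g hg x hx
    simp only [hysubst, inv12]
    have hx' := F.le_span hx
    clear hx
    induction hx' using Submodule.span_induction with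
    | mem x h =>
      obtain ⟨k, rfl⟩ := h
      rw [hg, Finset.sum_eq_single k]
      · rw [key]; simp [subst_one hs]
      · intro l _ hl
        rw [key]; simp [hl, subst_zero hs]
      · simp
    | zero => simp
    | add x y _ _ h1 h2 => simp only [FormalField.add_act, h1, h2, mul_add, Finset.sum_add_distrib]
    | smul c x _ h =>
      simp only [FormalField.smul_act, h, Finset.mul_sum]
      exact Finset.sum_congr rfl fun _ _ => by ring
  refine ⟨⟨y, fun j k => subst σ₂ (a j k), fun k => subst σ₂ (δ k),
    fun k l => (α₀ k l - α₀ l k) / 2, fun v => ?_, fun v => ?_, ?_, fun k l => by ring,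
    fun j k => subst_mem_fil s2 (hshift _ hQ2') (ha1 j k), fun k => ?_, fun x hx j => ?_,
    fun x hx => ?_⟩⟩
  · rw [hyσ, constantCoeff_subst_of_zero F.constantCoeff_lin]
    exact (constantCoeff_eq_zero_iff_mem_fil cw).mpr
      (fil_anti _ (Nat.one_le_iff_ne_zero.mpr (cw v)) (hshift Q hQ2 v))
  · rcases v with j | j | j
    · change y (Var.zbar j) = conjSeries (y (Var.z j))
      rw [hyz, hyzb]; exact F.lin_swap (Var.z j)
    · change y (Var.z j) = conjSeries (y (Var.zbar j))
      rw [hyz, hyzb]; exact F.lin_swap (Var.zbar j)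
    · change y Var.u = conjSeries (y Var.u)
      rw [hyu]
      have h1 : conjSeries (subst F.lin Q) = subst F.lin Q := by
        rw [conjSeries_subst hs F.lin_swap, hcjQ]
      have h2 : conjSeries (F.lin Var.u) = F.lin Var.u := (F.lin_swap Var.u).symm
      calc _ = conjSeries (F.lin Var.u) + conjSeries (subst F.lin Q) := by rw [h1, h2]
        _ = _ := (map_add _ _ _).symm
  · have : (subst y : GraphSeries n → SourceSeries n) = subst F.lin ∘ subst σ₁ := funext hysubst
    rw [this]
    exact F.bijective_subst_lin.comp (Function.bijective_iff_has_inverse.mpr ⟨subst σ₂, inv21, inv12⟩)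
  · have := subst_mem_fil s2 (hshift _ hQ2') (hδ2 k)
    have hz : ∀ j, subst σ₂ (X (Var.z j) : GraphSeries n) = (X (Var.z j) : GraphSeries n) := fun j => by
      rw [subst_X s2, hσ₂, Function.update_of_ne (by simp)]
    have hzb : ∀ j, subst σ₂ (X (Var.zbar j) : GraphSeries n) = (X (Var.zbar j) : GraphSeries n) := fun j => by
      rw [subst_X s2, hσ₂, Function.update_of_ne (by simp)]
    simpa only [subst_sub s2, subst_sum s2, subst_mul s2, subst_C, hz, hzb] using this
  · exact ext _ (fun k => a j k) (fun k => key k (Var.zbar j)) x hx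
  · exact ext _ δ (fun k => key k Var.u) x hx

end FormalFrame

/-! ### Homogeneous components -/

section Homogeneous

variable {σ : Type*}

/-- Multiplication of the coefficients of a power series by given numbers. -/
def diag (r : (σ →₀ ℕ) → ℂ) : MvPowerSeries σ ℂ →ₗ[ℂ] MvPowerSeries σ ℂ where
  toFun f := fun m => r m * coeff m f
  map_add' f g := by
    funext m
    change r m * coeff m (f + g) = r m * coeff m f + r m * coeff m g
    rw [map_add, mul_add]
  map_smul' a f := by
    funext m
    change r m * coeff m (a • f) = a * (r m * coeff m f)
    rw [coeff_smul]; ring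

theorem coeff_diag (r : (σ →₀ ℕ) → ℂ) (f : MvPowerSeries σ ℂ) (m : σ →₀ ℕ) :
    coeff m (diag r f) = r m * coeff m f := rfl

theorem diag_mem_fil {w : σ → ℕ} {k : ℕ} {f : MvPowerSeries σ ℂ} (r : (σ →₀ ℕ) → ℂ)
    (hf : f ∈ fil w k) : diag r f ∈ fil w k := fun m hm => by
  rw [coeff_diag, hf m hm, mul_zero]

/-- The power series which are homogeneous of a given weight. -/
def homog (w : σ → ℕ) (k : ℕ) : Submodule ℂ (MvPowerSeries σ ℂ) where
  carrier := {f | ∀ m, Finsupp.weight w m ≠ k → coeff m f = 0}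
  zero_mem' := by simp
  add_mem' := fun {f g} hf hg m hm => by rw [map_add, hf m hm, hg m hm, add_zero]
  smul_mem' := fun c f hf m hm => by rw [coeff_smul, hf m hm, mul_zero]

variable {w : σ → ℕ} {j k l : ℕ} {f g : MvPowerSeries σ ℂ}

theorem mul_mem_homog (hf : f ∈ homog w j) (hg : g ∈ homog w k) (h : j + k = l) :
    f * g ∈ homog w l := by
  classical
  intro m hm
  rw [coeff_mul]
  refine Finset.sum_eq_zero fun x hx => ?_
  replace hx := Finset.HasAntidiagonal.mem_antidiagonal.mp hx
  rw [← hx, map_add] at hm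
  by_cases h1 : Finsupp.weight w x.1 = j
  · rw [hg _ (by omega), mul_zero]
  · rw [hf _ h1, zero_mul]

theorem C_mul_mem_homog (a : ℂ) (hf : f ∈ homog w k) : C a * f ∈ homog w k := fun m hm => by
  rw [coeff_C_mul, hf m hm, mul_zero]

theorem X_mem_homog (w : σ → ℕ) (v : σ) (h : w v = k) : (X v : MvPowerSeries σ ℂ) ∈ homog w k := by
  classical
  intro m hm
  rw [coeff_X, if_neg]
  rintro rfl
  rw [Finsupp.weight_single, one_smul] at hm
  exact hm h

theorem pderiv_mem_homog (hf : f ∈ homog w k) (v : σ) (h : j + w v = k) :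
    pderiv ℂ v f ∈ homog w j := by
  intro m hm
  rw [coeff_pderiv, hf, zero_mul]
  rw [map_add, Finsupp.weight_single, one_smul]
  omega

theorem pderiv_eq_zero_of_mem_homog (hf : f ∈ homog w k) (v : σ) (h : k < w v) :
    pderiv ℂ v f = 0 := by
  ext m
  rw [coeff_pderiv, hf, zero_mul, coeff_zero]
  rw [map_add, Finsupp.weight_single, one_smul]
  omega

theorem homog_le_fil (hf : f ∈ homog w k) (h : j ≤ k) : f ∈ fil w j :=
  fun m hm => hf m (by omega)

theorem eq_zero_of_mem_homog_of_mem_fil (hf : f ∈ homog w k) (hf' : f ∈ fil w l) (h : k < l) :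
    f = 0 := by
  ext m
  by_cases hm : Finsupp.weight w m = k
  · exact hf' m (by omega)
  · exact hf m hm

theorem diag_mem_homog (r : (σ →₀ ℕ) → ℂ) (hf : f ∈ homog w k) : diag r f ∈ homog w k :=
  fun m hm => by rw [coeff_diag, hf m hm, mul_zero]

open Classical in
/-- The homogeneous component of a given weight. -/
def hcomp (w : σ → ℕ) (k : ℕ) : MvPowerSeries σ ℂ →ₗ[ℂ] MvPowerSeries σ ℂ :=
  diag fun m => if Finsupp.weight w m = k then 1 else 0

theorem hcomp_mem_homog (w : σ → ℕ) (k : ℕ) (f : MvPowerSeries σ ℂ) : hcomp w k f ∈ homog w k :=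
  fun m hm => by rw [hcomp, coeff_diag, if_neg hm, zero_mul]

theorem sub_hcomp_mem_fil (hf : f ∈ fil w k) : f - hcomp w k f ∈ fil w (k + 1) := by
  intro m hm
  rw [map_sub, hcomp, coeff_diag]
  split_ifs with h
  · rw [one_mul, sub_self]
  · rw [zero_mul, sub_zero, hf m (by omega)]

theorem hcomp_of_mem_homog (hf : f ∈ homog w k) : hcomp w k f = f := by
  ext m
  rw [hcomp, coeff_diag]
  split_ifs with h
  · rw [one_mul]
  · rw [zero_mul, hf m h]

theorem hcomp_of_mem_fil (hf : f ∈ fil w l) (h : k < l) : hcomp w k f = 0 :=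
  eq_zero_of_mem_homog_of_mem_fil (hcomp_mem_homog w k f) (diag_mem_fil _ hf) h

theorem hcomp_of_mem_homog_of_ne (hf : f ∈ homog w l) (h : k ≠ l) : hcomp w k f = 0 := by
  ext m
  rw [hcomp, coeff_diag, coeff_zero]
  split_ifs with h'
  · rw [hf m (by omega), mul_zero]
  · rw [zero_mul]

end Homogeneous

/-! ### Calculus on the model hypersurface -/

section Model

variable {n : ℕ}

/-- The derivation `∂/∂u`. -/
abbrev du : Derivation ℂ (GraphSeries n) (GraphSeries n) := pderiv ℂ Var.u

/-- The series `∑_j |z_j|²`. -/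
def normSq : GraphSeries n := ∑ j : Fin n, X (Var.z j) * X (Var.zbar j)

@[simp] theorem cj_normSq : cj (normSq : GraphSeries n) = normSq := by
  simp only [normSq, map_sum, map_mul, cj_X]
  exact Finset.sum_congr rfl fun j _ => mul_comm _ _

theorem pderiv_z_normSq (k : Fin n) : pderiv ℂ (Var.z k) normSq = X (Var.zbar k) := by
  classical
  simp [normSq, pderiv_X, Pi.single_apply]

theorem pderiv_zbar_normSq (k : Fin n) : pderiv ℂ (Var.zbar k) normSq = X (Var.z k) := by
  classical
  simp [normSq, pderiv_X, Pi.single_apply]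

@[simp] theorem du_normSq : du (normSq : GraphSeries n) = 0 := by
  classical
  simp [normSq]

theorem normSq_mem_homog_zWeight : (normSq : GraphSeries n) ∈ homog zWeight 1 :=
  sum_mem fun j _ => mul_mem_homog (X_mem_homog _ (Var.z j) rfl) (X_mem_homog _ (Var.zbar j) rfl) rfl

theorem normSq_mem_homog_zbarWeight : (normSq : GraphSeries n) ∈ homog zbarWeight 1 :=
  sum_mem fun j _ => mul_mem_homog (X_mem_homog _ (Var.z j) rfl) (X_mem_homog _ (Var.zbar j) rfl) rfl

theorem normSq_mem_homog_cmWeight : (normSq : GraphSeries n) ∈ homog cmWeight 2 :=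
  sum_mem fun j _ => mul_mem_homog (X_mem_homog _ (Var.z j) rfl) (X_mem_homog _ (Var.zbar j) rfl) rfl

theorem du_mul (f g : GraphSeries n) : du (f * g) = f * du g + g * du f := pderiv_mul _ _ _

theorem eulerBar_mul (f g : GraphSeries n) :
    eulerBar (f * g) = f * eulerBar g + g * eulerBar f := by
  rw [Derivation.leibniz, smul_eq_mul, smul_eq_mul]

@[simp] theorem euler_C (a : ℂ) : euler (C a : GraphSeries n) = 0 := by simp [euler_apply]

@[simp] theorem eulerBar_C (a : ℂ) : eulerBar (C a : GraphSeries n) = 0 := by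
  simp [eulerBar_apply]

theorem coeff_natCast_mul {σ : Type*} (k : ℕ) (f : MvPowerSeries σ ℂ) (m : σ →₀ ℕ) :
    coeff m ((k : MvPowerSeries σ ℂ) * f) = k * coeff m f := by
  rw [← map_natCast (C : ℂ →+* MvPowerSeries σ ℂ), coeff_C_mul]

theorem euler_of_mem_homog {f : GraphSeries n} {k : ℕ} (hf : f ∈ homog zWeight k) :
    euler f = k * f := by
  ext m
  rw [coeff_euler, coeff_natCast_mul]
  by_cases hm : Finsupp.weight zWeight m = k
  · rw [← hm, weight_zWeight]
  · rw [hf m hm, mul_zero, mul_zero]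

theorem eulerBar_of_mem_homog {f : GraphSeries n} {k : ℕ} (hf : f ∈ homog zbarWeight k) :
    eulerBar f = k * f := by
  ext m
  rw [coeff_eulerBar, coeff_natCast_mul]
  by_cases hm : Finsupp.weight zbarWeight m = k
  · rw [← hm, weight_zbarWeight]
  · rw [hf m hm, mul_zero, mul_zero]

theorem euler_sub_mem_fil {f : GraphSeries n} {k : ℕ} (hf : f ∈ fil zWeight k) :
    euler f - k * f ∈ fil zWeight (k + 1) := by
  intro m hm
  rw [map_sub, coeff_euler, coeff_natCast_mul]
  rw [weight_zWeight] at hm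
  by_cases h : zDegree m = k
  · rw [h, sub_self]
  · rw [hf m (by rw [weight_zWeight]; omega)]; simp

/-- On monomials of positive z̄-degree the operator `eulerBar` only multiplies coefficients by
nonzero integers. -/
theorem mem_fil_of_eulerBar {w : Var n → ℕ} {k : ℕ} {f : GraphSeries n}
    (hf : f ∈ fil zbarWeight 1) (h : eulerBar f ∈ fil w k) : f ∈ fil w k := by
  intro m hm
  by_cases h0 : zbarDegree m = 0
  · exact hf m (by rw [weight_zbarWeight]; omega)
  · have := h m hm
    rw [coeff_eulerBar] at this
    exact (mul_eq_zero.mp this).resolve_left (Nat.cast_ne_zero.mpr h0)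

theorem cj_euler (f : GraphSeries n) : cj (euler f) = eulerBar (cj f) := by
  simp only [euler_apply, eulerBar_apply, map_sum, map_mul, cj_X, pderiv_cj]
  rfl

theorem cj_eulerBar (f : GraphSeries n) : cj (eulerBar f) = euler (cj f) := by
  rw [← cj_cj (euler (cj f)), cj_euler, cj_cj]

theorem cj_du (f : GraphSeries n) : cj (du f) = du (cj f) := (pderiv_cj Var.u f).symm

@[simp] theorem euler_normSq : euler (normSq : GraphSeries n) = normSq := by
  simpa using euler_of_mem_homog (n := n) normSq_mem_homog_zWeight

theorem euler_X_z (j : Fin n) : euler (X (Var.z j) : GraphSeries n) = X (Var.z j) := by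
  simpa using euler_of_mem_homog (X_mem_homog zWeight (Var.z j) rfl)

theorem euler_X_zbar (j : Fin n) : euler (X (Var.zbar j) : GraphSeries n) = 0 := by
  simpa using euler_of_mem_homog (X_mem_homog zWeight (Var.zbar j) rfl)

theorem euler_X_u : euler (X Var.u : GraphSeries n) = 0 := by
  simpa using euler_of_mem_homog (X_mem_homog zWeight (Var.u : Var n) rfl)

theorem du_X_z (j : Fin n) : du (X (Var.z j) : GraphSeries n) = 0 := pderiv_X_of_ne (by simp)

theorem du_X_zbar (j : Fin n) : du (X (Var.zbar j) : GraphSeries n) = 0 := pderiv_X_of_ne (by simp)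

theorem du_X_u : du (X Var.u : GraphSeries n) = 1 := pderiv_X_self

/-- The vector field `e + i |z|² ∂/∂u` along the model hypersurface `Im w = |z|²`, where `e` is the
Euler field. -/
def sphereEuler : Derivation ℂ (GraphSeries n) (GraphSeries n) :=
  euler + (C Complex.I * normSq : GraphSeries n) • du

theorem sphereEuler_apply (f : GraphSeries n) :
    sphereEuler f = euler f + C Complex.I * normSq * du f := rfl

theorem sphereEuler_mul (f g : GraphSeries n) :
    sphereEuler (f * g) = f * sphereEuler g + g * sphereEuler f := by
  rw [Derivation.leibniz, smul_eq_mul, smul_eq_mul]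

@[simp] theorem sphereEuler_C (a : ℂ) : sphereEuler (C a : GraphSeries n) = 0 := by
  simp [sphereEuler_apply]

@[simp] theorem sphereEuler_C_mul (a : ℂ) (f : GraphSeries n) :
    sphereEuler (C a * f) = C a * sphereEuler f := by
  simp

@[simp] theorem sphereEuler_normSq : sphereEuler (normSq : GraphSeries n) = normSq := by
  simp [sphereEuler_apply]

theorem sphereEuler_X_z (j : Fin n) : sphereEuler (X (Var.z j) : GraphSeries n) = X (Var.z j) := by
  rw [sphereEuler_apply, euler_X_z, du_X_z, mul_zero, add_zero]

theorem sphereEuler_X_zbar (j : Fin n) : sphereEuler (X (Var.zbar j) : GraphSeries n) = 0 := by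
  rw [sphereEuler_apply, euler_X_zbar, du_X_zbar, mul_zero, add_zero]

theorem I_normSq_du_mem_fil {w : Var n → ℕ} (hw : (normSq : GraphSeries n) ∈ fil w (w Var.u))
    {k : ℕ} {f : GraphSeries n} (hf : f ∈ fil w k) : C Complex.I * normSq * du f ∈ fil w k :=
  mul_mem_fil (C_mul_mem_fil _ hw) (pderiv_mem_fil hf _ le_rfl) (by omega)

theorem sphereEuler_mem_fil {w : Var n → ℕ} (hw : (normSq : GraphSeries n) ∈ fil w (w Var.u))
    {k : ℕ} {f : GraphSeries n} (hf : f ∈ fil w k) : sphereEuler f ∈ fil w k :=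
  add_mem (euler_mem_fil hf) (I_normSq_du_mem_fil hw hf)

theorem sphereEuler_mem_fil_zWeight (f : GraphSeries n) : sphereEuler f ∈ fil zWeight 1 :=
  add_mem (euler_mem_fil_zWeight f) (Ideal.mul_mem_right _ _
    (C_mul_mem_fil _ (homog_le_fil normSq_mem_homog_zWeight le_rfl)))

/-- The equation `(e + i |z|² ∂/∂u) V = r` is solvable for `r` in the ideal of `z`. -/
theorem exists_sphereEuler_eq {r : GraphSeries n} (hr : r ∈ fil zWeight 1) :
    ∃ V : GraphSeries n, sphereEuler V = r ∧ ∀ (w : Var n → ℕ) (k : ℕ),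
      (normSq : GraphSeries n) ∈ fil w (w Var.u) → r ∈ fil w k → V ∈ fil w k := by
  -- `E` inverts the Euler operator. In z-degree zero its factor is 0⁻¹ = 0, which is harmless on
  -- the ideal of z.
  set E : GraphSeries n →ₗ[ℂ] GraphSeries n := diag fun m => (zDegree m : ℂ)⁻¹ with hE
  have hEe : ∀ f ∈ fil zWeight 1, euler (E f) = f := by
    intro f hf
    ext m
    rw [coeff_euler, hE, coeff_diag]
    by_cases h : zDegree m = 0
    · rw [hf m (by rw [weight_zWeight]; omega)]; simp
    · rw [mul_inv_cancel_left₀ (Nat.cast_ne_zero.mpr h)]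
  -- The term i|z|² ∂/∂u raises the z-order, so V = E(r - i|z|² V_u) is a contraction. It preserves
  -- any filtration in which |z|² weighs at least as much as u, and so does its fixed point.
  obtain ⟨V, hV, hV'⟩ := exists_fixedPoint zWeight
    (fun f : GraphSeries n => E (r - C Complex.I * normSq * du f)) (fun f g k h => by
      rw [← map_sub]
      refine diag_mem_fil _ ?_
      have : r - C Complex.I * normSq * du f - (r - C Complex.I * normSq * du g)
          = -(C Complex.I * normSq * du (f - g)) := by rw [map_sub]; ring
      rw [this]
      exact neg_mem (mul_mem_fil (C_mul_mem_fil _ (homog_le_fil normSq_mem_homog_zWeight le_rfl))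
        (pderiv_mem_fil h _ le_rfl) (by simp [add_comm])))
  refine ⟨V, ?_, fun w k hw hrk => ?_⟩
  · have h1 : r - C Complex.I * normSq * du V ∈ fil zWeight 1 :=
      sub_mem hr (Ideal.mul_mem_right _ _
        (C_mul_mem_fil _ (homog_le_fil normSq_mem_homog_zWeight le_rfl)))
    have h2 := hEe _ h1
    rw [hV] at h2
    rw [sphereEuler_apply, h2]; ring
  · exact hV' w k fun f hf => diag_mem_fil _ (sub_mem hrk (I_normSq_du_mem_fil hw hf))

/-! ### The substitution `u ↦ u + i |z|²` -/

/-- The components of the substitution `u ↦ u + i |z|²`. -/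
def shiftFun (v : Var n) : GraphSeries n := X v + if v = Var.u then C Complex.I * normSq else 0

theorem shiftFun_z (j : Fin n) : shiftFun (Var.z j) = X (Var.z j) := by simp [shiftFun]

theorem shiftFun_zbar (j : Fin n) : shiftFun (Var.zbar j) = X (Var.zbar j) := by simp [shiftFun]

theorem shiftFun_mem_fil {w : Var n → ℕ} (hw : (normSq : GraphSeries n) ∈ fil w (w Var.u))
    (v : Var n) : shiftFun v ∈ fil w (w v) := by
  refine add_mem (X_mem_fil _ _ le_rfl) ?_
  split_ifs with h
  · rw [h]; exact C_mul_mem_fil _ hw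
  · exact zero_mem _

theorem hasSubst_shiftFun : HasSubst (shiftFun : Var n → GraphSeries n) := by
  refine hasSubst_of_mem_fil (w := cmWeight) fun v => fil_anti _ ?_ (shiftFun_mem_fil
    (homog_le_fil normSq_mem_homog_cmWeight le_rfl) v)
  rcases v with j | j | j <;> simp [cmWeight]

/-- The substitution `u ↦ u + i |z|²`. -/
def shift : GraphSeries n →ₐ[ℂ] GraphSeries n := substAlgHom hasSubst_shiftFun

theorem shift_apply (f : GraphSeries n) : shift f = subst shiftFun f := by
  rw [shift, coe_substAlgHom]

theorem shift_C (a : ℂ) : shift (C a : GraphSeries n) = C a := by rw [shift_apply, subst_C]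

theorem shift_X_z (j : Fin n) : shift (X (Var.z j) : GraphSeries n) = X (Var.z j) := by
  rw [shift_apply, subst_X hasSubst_shiftFun, shiftFun_z]

theorem shift_X_zbar (j : Fin n) : shift (X (Var.zbar j) : GraphSeries n) = X (Var.zbar j) := by
  rw [shift_apply, subst_X hasSubst_shiftFun, shiftFun_zbar]

theorem pderiv_shift (v : Var n) (f : GraphSeries n) : pderiv ℂ v (shift f)
    = shift (pderiv ℂ v f) + C Complex.I * pderiv ℂ v normSq * shift (du f) := by
  classical
  have h0 : ∀ v : Var n, constantCoeff (shiftFun v) = 0 := by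
    intro v
    have hq : constantCoeff (normSq : GraphSeries n) = 0 := by simp [normSq]
    rw [shiftFun, map_add, constantCoeff_X, zero_add]
    split_ifs
    · rw [map_mul, hq, mul_zero]
    · simp
  have h1 : ∀ v', pderiv ℂ v (shiftFun v') = (if v' = v then 1 else 0)
      + if v' = Var.u then C Complex.I * pderiv ℂ v normSq else 0 := by
    intro v'
    rw [shiftFun, map_add, pderiv_X, Pi.single_apply]
    congr 1
    split_ifs
    · rw [pderiv_C_mul]
    · simp
  simp only [shift_apply]
  rw [pderiv_subst h0]
  simp only [h1, mul_add, Finset.sum_add_distrib, mul_ite, mul_one, mul_zero,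
    Finset.sum_ite_eq', Finset.mem_univ, if_true]
  ring

theorem du_shift (f : GraphSeries n) : du (shift f) = shift (du f) := by
  have := pderiv_shift Var.u f
  rw [show pderiv ℂ Var.u normSq = (0 : GraphSeries n) from du_normSq] at this
  simpa using this

theorem euler_shift (f : GraphSeries n) :
    euler (shift f) = shift (euler f) + C Complex.I * normSq * shift (du f) := by
  simp only [euler_apply, pderiv_shift, pderiv_z_normSq, mul_add, Finset.sum_add_distrib, map_sum,
    map_mul, shift_X_z]
  congr 1
  rw [normSq, Finset.mul_sum, Finset.sum_mul]
  exact Finset.sum_congr rfl fun _ _ => by ring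

theorem eulerBar_shift (f : GraphSeries n) :
    eulerBar (shift f) = shift (eulerBar f) + C Complex.I * normSq * shift (du f) := by
  simp only [eulerBar_apply, pderiv_shift, pderiv_zbar_normSq, mul_add, Finset.sum_add_distrib,
    map_sum, map_mul, shift_X_zbar]
  congr 1
  rw [normSq, Finset.mul_sum, Finset.sum_mul]
  exact Finset.sum_congr rfl fun _ _ => by ring

theorem sphereEuler_shift (f : GraphSeries n) : sphereEuler (shift f)
    = shift (euler f) + 2 * C Complex.I * normSq * shift (du f) := by
  rw [sphereEuler_apply, euler_shift, du_shift]; ring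

theorem cj_sphereEuler (f : GraphSeries n) :
    sphereEuler (cj f) = cj (eulerBar f - C Complex.I * normSq * du f) := by
  simp only [sphereEuler_apply, map_sub, map_mul, cj_eulerBar, cj_du, cj_C, cj_normSq,
    Complex.star_def, Complex.conj_I, map_neg]
  ring

/-- The conjugate of the shift of a series not depending on `z̄` is annihilated. -/
theorem sphereEuler_cj_shift {f : GraphSeries n} (hf : f ∈ homog zbarWeight 0) :
    sphereEuler (cj (shift f)) = 0 := by
  rw [cj_sphereEuler, eulerBar_shift, du_shift, eulerBar_of_mem_homog hf]
  simp

theorem shift_mem_fil {w : Var n → ℕ} (hw : (normSq : GraphSeries n) ∈ fil w (w Var.u)) {k : ℕ}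
    {f : GraphSeries n} (hf : f ∈ fil w k) : shift f ∈ fil w k := by
  rw [shift_apply]
  exact subst_mem_fil hasSubst_shiftFun (shiftFun_mem_fil hw) hf

theorem shift_sub_mem_fil {w : Var n → ℕ} (hw : (normSq : GraphSeries n) ∈ fil w (w Var.u + 1))
    {k : ℕ} {f : GraphSeries n} (hf : f ∈ fil w k) : shift f - f ∈ fil w (k + 1) := by
  have hX : HasSubst (X : Var n → GraphSeries n) := HasSubst.X
  have := subst_sub_subst_mem_fil (d := 1) hasSubst_shiftFun hX
    (shiftFun_mem_fil (fil_anti _ (Nat.le_succ _) hw)) (fun v => X_mem_fil w v le_rfl) (fun v => by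
      rw [shiftFun, add_sub_cancel_left]
      split_ifs with h
      · rw [h]; exact C_mul_mem_fil _ hw
      · exact zero_mem _) hf
  rwa [subst_self, id, ← shift_apply] at this

theorem iterate_du_mem_homog {w : Var n → ℕ} (hw : w Var.u = 0) {k : ℕ} {f : GraphSeries n}
    (hf : f ∈ homog w k) (m : ℕ) : du^[m] f ∈ homog w k := by
  induction m generalizing f with
  | zero => exact hf
  | succ m ih => exact ih (pderiv_mem_homog hf _ (by omega))

theorem eulerBar_normSq_pow (m : ℕ) :
    eulerBar (normSq ^ m : GraphSeries n) = (m : GraphSeries n) * normSq ^ m := by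
  have h : (normSq ^ m : GraphSeries n) ∈ homog zbarWeight m := by
    induction m with
    | zero =>
      rw [pow_zero, ← map_one (C : ℂ →+* GraphSeries n)]
      intro d hd
      classical
      rw [coeff_C, if_neg]
      rintro rfl
      simp at hd
    | succ m ih => rw [pow_succ]; exact mul_mem_homog ih normSq_mem_homog_zbarWeight rfl
  exact eulerBar_of_mem_homog h

/-- Taylor expansion of a shifted series. -/
theorem shift_sub_sum_mem_fil {w : Var n → ℕ} (hu : w Var.u = 0)
    (hw : (normSq : GraphSeries n) ∈ fil w 1) (M : ℕ) {k : ℕ} {f : GraphSeries n}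
    (hf0 : f ∈ homog zbarWeight 0) (hf : f ∈ fil w k) :
    shift f - ∑ m ∈ Finset.range M, C (Complex.I ^ m / m.factorial) * normSq ^ m * du^[m] f
      ∈ fil w (k + M) := by
  induction M generalizing f with
  | zero => simpa using shift_mem_fil (by rw [hu]; exact mem_fil_zero _ _) hf
  | succ M ih =>
    have hq : (normSq : GraphSeries n) ∈ fil zbarWeight 1 :=
      homog_le_fil normSq_mem_homog_zbarWeight le_rfl
    -- Induction through `eulerBar`: since `f` is free of z̄, the image of the remainder of order M
    -- + 1 of `f` is i|z|² times the remainder of order M of ∂f/∂u.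
    refine mem_fil_of_eulerBar ?_ ?_
    · rw [Finset.sum_range_succ']
      have h1 : shift f - f ∈ fil zbarWeight 1 :=
        shift_sub_mem_fil (by simpa using hq) (mem_fil_zero _ _)
      have h2 : ∑ m ∈ Finset.range M, C (Complex.I ^ (m + 1) / (m + 1).factorial)
          * normSq ^ (m + 1) * du^[m + 1] f ∈ fil zbarWeight 1 := by
        refine sum_mem fun m _ => Ideal.mul_mem_right _ _ (C_mul_mem_fil _ ?_)
        rw [pow_succ]
        exact Ideal.mul_mem_left _ _ hq
      have h3 := sub_mem h1 h2
      convert h3 using 1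
      simp
      ring
    · have key : eulerBar (shift f - ∑ m ∈ Finset.range (M + 1),
          C (Complex.I ^ m / m.factorial) * normSq ^ m * du^[m] f) = C Complex.I * normSq *
          (shift (du f) - ∑ m ∈ Finset.range M,
            C (Complex.I ^ m / m.factorial) * normSq ^ m * du^[m] (du f)) := by
        rw [map_sub, eulerBar_shift, eulerBar_of_mem_homog hf0, Finset.sum_range_succ', map_add,
          map_sum]
        have e0 : eulerBar (C (Complex.I ^ 0 / (Nat.factorial 0 : ℂ)) * normSq ^ 0 * du^[0] f)
            = 0 := by
          rw [eulerBar_mul, eulerBar_mul]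
          simp [eulerBar_of_mem_homog hf0]
        have e1 : ∀ m, eulerBar (C (Complex.I ^ (m + 1) / ((m + 1).factorial : ℂ))
            * normSq ^ (m + 1) * du^[m + 1] f) = C Complex.I * normSq *
            (C (Complex.I ^ m / m.factorial) * normSq ^ m * du^[m] (du f)) := by
          intro m
          have hc : C (Complex.I ^ (m + 1) / ((m + 1).factorial : ℂ)) * ((m + 1 : ℕ) : GraphSeries n)
              = C Complex.I * C (Complex.I ^ m / m.factorial) := by
            rw [← map_natCast (C : ℂ →+* GraphSeries n), ← map_mul, ← map_mul]
            congr 1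
            rw [Nat.factorial_succ]
            have : ((m : ℂ) + 1) ≠ 0 := Nat.cast_add_one_ne_zero m
            have : (m.factorial : ℂ) ≠ 0 := Nat.cast_ne_zero.mpr m.factorial_ne_zero
            push_cast
            field_simp
            ring
          rw [eulerBar_mul, eulerBar_mul, eulerBar_C, eulerBar_normSq_pow,
            eulerBar_of_mem_homog (iterate_du_mem_homog rfl hf0 _), Function.iterate_succ_apply]
          linear_combination (normSq ^ (m + 1) * du^[m] (du f)) * hc
        rw [e0, Finset.sum_congr rfl fun m _ => e1 m, ← Finset.mul_sum]
        simp
        ring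
      rw [key]
      refine mul_mem_fil (C_mul_mem_fil _ hw) (ih (pderiv_mem_homog hf0 _ rfl)
        (pderiv_mem_fil hf _ (by omega))) (by omega)

end Model

/-! ### Bihomogeneous components, traces and integration -/

section Components

variable {n : ℕ}

theorem normSq_mem_fil_zWeight : (normSq : GraphSeries n) ∈ fil zWeight 1 :=
  homog_le_fil normSq_mem_homog_zWeight le_rfl

theorem normSq_mem_fil_zbarWeight : (normSq : GraphSeries n) ∈ fil zbarWeight 1 :=
  homog_le_fil normSq_mem_homog_zbarWeight le_rfl

theorem normSq_mem_fil_cmWeight : (normSq : GraphSeries n) ∈ fil cmWeight 2 :=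
  homog_le_fil normSq_mem_homog_cmWeight le_rfl

theorem zWeight_swap (v : Var n) : zWeight v.swap = zbarWeight v := by
  rcases v with j | j | j <;> rfl

theorem zbarWeight_swap (v : Var n) : zbarWeight v.swap = zWeight v := by
  rcases v with j | j | j <;> rfl

theorem cmWeight_swap (v : Var n) : cmWeight v.swap = cmWeight v := by
  rcases v with j | j | j <;> rfl

theorem cj_mem_fil_zbarWeight {f : GraphSeries n} {k : ℕ} (hf : f ∈ fil zWeight k) :
    cj f ∈ fil zbarWeight k := cj_mem_fil hf fun v => (zWeight_swap v).symm

theorem cj_mem_fil_zWeight {f : GraphSeries n} {k : ℕ} (hf : f ∈ fil zbarWeight k) :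
    cj f ∈ fil zWeight k := cj_mem_fil hf fun v => (zbarWeight_swap v).symm

theorem cj_mem_fil_cmWeight {f : GraphSeries n} {k : ℕ} (hf : f ∈ fil cmWeight k) :
    cj f ∈ fil cmWeight k := cj_mem_fil hf fun v => (cmWeight_swap v).symm

theorem weight_mapDomain_swap {w w' : Var n → ℕ} (hw : ∀ v, w' v = w v.swap) (m : Var n →₀ ℕ) :
    Finsupp.weight w (m.mapDomain Var.swap) = Finsupp.weight w' m := by
  rw [Finsupp.weight_apply, Finsupp.sum_mapDomain_index (by intro; exact zero_smul _ _)
    (by intros; exact add_smul _ _ _), Finsupp.weight_apply]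
  simp only [hw]

theorem cj_hcomp {w w' : Var n → ℕ} (hw : ∀ v, w' v = w v.swap) (k : ℕ) (f : GraphSeries n) :
    cj (hcomp w k f) = hcomp w' k (cj f) := by
  ext m
  rw [coeff_cj, hcomp, hcomp, coeff_diag, coeff_diag, coeff_cj, weight_mapDomain_swap hw, star_mul']
  split_ifs <;> simp

theorem cj_hcomp_zbarWeight (k : ℕ) (f : GraphSeries n) :
    cj (hcomp zbarWeight k f) = hcomp zWeight k (cj f) :=
  cj_hcomp (fun v => (zbarWeight_swap v).symm) k f

theorem cj_hcomp_zWeight (k : ℕ) (f : GraphSeries n) :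
    cj (hcomp zWeight k f) = hcomp zbarWeight k (cj f) :=
  cj_hcomp (fun v => (zWeight_swap v).symm) k f

theorem cj_mem_homog {w w' : Var n → ℕ} (hw : ∀ v, w' v = w v.swap) {k : ℕ} {f : GraphSeries n}
    (hf : f ∈ homog w k) : cj f ∈ homog w' k := by
  rw [← hcomp_of_mem_homog hf, cj_hcomp hw]
  exact hcomp_mem_homog _ _ _

theorem diag_diag {σ : Type*} (r s : (σ →₀ ℕ) → ℂ) (f : MvPowerSeries σ ℂ) :
    diag r (diag s f) = diag s (diag r f) := by
  ext m
  simp only [coeff_diag]; ring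

theorem bipart_eq (k l : ℕ) (f : GraphSeries n) :
    bipart k l f = hcomp zWeight k (hcomp zbarWeight l f) := by
  ext m
  simp only [hcomp, coeff_diag, weight_zWeight, weight_zbarWeight]
  change (if _ then _ else _) = _
  by_cases h1 : zDegree m = k <;> by_cases h2 : zbarDegree m = l <;> simp [h1, h2]

theorem bipart_eq' (k l : ℕ) (f : GraphSeries n) :
    bipart k l f = hcomp zbarWeight l (hcomp zWeight k f) := by
  rw [bipart_eq]; exact diag_diag _ _ _

theorem bipart_add (k l : ℕ) (f g : GraphSeries n) :
    bipart k l (f + g) = bipart k l f + bipart k l g := by simp only [bipart_eq, map_add]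

theorem bipart_sub (k l : ℕ) (f g : GraphSeries n) :
    bipart k l (f - g) = bipart k l f - bipart k l g := by simp only [bipart_eq, map_sub]

theorem bipart_mem_homog_zWeight (k l : ℕ) (f : GraphSeries n) :
    bipart k l f ∈ homog zWeight k := by rw [bipart_eq]; exact hcomp_mem_homog _ _ _

theorem bipart_mem_homog_zbarWeight (k l : ℕ) (f : GraphSeries n) :
    bipart k l f ∈ homog zbarWeight l := by rw [bipart_eq']; exact hcomp_mem_homog _ _ _

theorem bipart_mem_fil {w : Var n → ℕ} {a : ℕ} {f : GraphSeries n} (k l : ℕ) (hf : f ∈ fil w a) :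
    bipart k l f ∈ fil w a := by rw [bipart_eq]; exact diag_mem_fil _ (diag_mem_fil _ hf)

theorem bipart_of_mem_homog {k l : ℕ} {f : GraphSeries n} (hz : f ∈ homog zWeight k)
    (hzb : f ∈ homog zbarWeight l) : bipart k l f = f := by
  rw [bipart_eq, hcomp_of_mem_homog hzb, hcomp_of_mem_homog hz]

theorem bipart_of_mem_fil_zWeight {k l a : ℕ} {f : GraphSeries n} (hf : f ∈ fil zWeight a)
    (h : k < a) : bipart k l f = 0 := by rw [bipart_eq', hcomp_of_mem_fil hf h, map_zero]

theorem bipart_of_mem_fil_zbarWeight {k l a : ℕ} {f : GraphSeries n} (hf : f ∈ fil zbarWeight a)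
    (h : l < a) : bipart k l f = 0 := by rw [bipart_eq, hcomp_of_mem_fil hf h, map_zero]

theorem cj_bipart (k l : ℕ) (f : GraphSeries n) : cj (bipart k l f) = bipart l k (cj f) := by
  rw [bipart_eq, cj_hcomp_zWeight, cj_hcomp_zbarWeight, bipart_eq']

theorem tr_add (f g : GraphSeries n) : tr (f + g) = tr f + tr g := by
  simp only [tr, map_add, Finset.sum_add_distrib]

theorem tr_sub (f g : GraphSeries n) : tr (f - g) = tr f - tr g := by
  simp only [tr, map_sub, Finset.sum_sub_distrib]

theorem tr_C_mul (a : ℂ) (f : GraphSeries n) : tr (C a * f) = C a * tr f := by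
  simp only [tr, pderiv_C_mul, Finset.mul_sum]

theorem tr_zero : tr (0 : GraphSeries n) = 0 := by simp [tr]

theorem cj_tr (f : GraphSeries n) : cj (tr f) = tr (cj f) := by
  simp only [tr, map_sum, pderiv_cj]
  exact Finset.sum_congr rfl fun j _ => congrArg cj (pderiv_comm _ _ _)

/-- The commutator of the trace with multiplication by |z|² is n + e + ē, a scalar on bihomogeneous
series. All traces of multiples of |z|² below are computed from it. -/
theorem tr_normSq_mul (f : GraphSeries n) :
    tr (normSq * f) = (n : GraphSeries n) * f + euler f + eulerBar f + normSq * tr f := by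
  have h : ∀ j : Fin n, pderiv ℂ (Var.z j) (pderiv ℂ (Var.zbar j) (normSq * f))
      = f + X (Var.z j) * pderiv ℂ (Var.z j) f + X (Var.zbar j) * pderiv ℂ (Var.zbar j) f
        + normSq * pderiv ℂ (Var.z j) (pderiv ℂ (Var.zbar j) f) := by
    intro j
    rw [pderiv_mul, pderiv_zbar_normSq, map_add, pderiv_mul, pderiv_mul, pderiv_z_normSq,
      pderiv_X_self]
    ring
  simp only [tr, h, Finset.sum_add_distrib, ← Finset.mul_sum, euler_apply, eulerBar_apply]
  simp

theorem tr_mem_homog_zWeight {k : ℕ} {f : GraphSeries n} (hf : f ∈ homog zWeight (k + 1)) :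
    tr f ∈ homog zWeight k := sum_mem fun _ _ => pderiv_mem_homog (pderiv_mem_homog hf _ rfl) _ rfl

theorem tr_mem_homog_zbarWeight {k : ℕ} {f : GraphSeries n} (hf : f ∈ homog zbarWeight (k + 1)) :
    tr f ∈ homog zbarWeight k :=
  sum_mem fun _ _ => pderiv_mem_homog (pderiv_mem_homog hf _ rfl) _ rfl

theorem tr_mem_fil_cmWeight {k : ℕ} {f : GraphSeries n} (hf : f ∈ fil cmWeight k) :
    tr f ∈ fil cmWeight (k - 2) :=
  sum_mem fun _ _ => pderiv_mem_fil (pderiv_mem_fil hf _ le_rfl) _ (by simp; omega)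

theorem tr_of_mem_homog {f : GraphSeries n} (hf : f ∈ homog zbarWeight 0) : tr f = 0 := by
  refine Finset.sum_eq_zero fun j _ => ?_
  rw [pderiv_eq_zero_of_mem_homog hf _ (by simp), map_zero]

/-- The antiderivative with respect to `u` without constant term. -/
def intU (f : GraphSeries n) : GraphSeries n := fun m =>
  if m Var.u = 0 then 0 else coeff (m - Finsupp.single Var.u 1) f / m Var.u

theorem coeff_intU (f : GraphSeries n) (m : Var n →₀ ℕ) : coeff m (intU f)
    = if m Var.u = 0 then 0 else coeff (m - Finsupp.single Var.u 1) f / m Var.u := rfl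

theorem du_intU (f : GraphSeries n) : du (intU f) = f := by
  ext m
  rw [coeff_pderiv, coeff_intU, if_neg (by simp), add_tsub_cancel_right]
  have : (m Var.u : ℂ) + 1 ≠ 0 := Nat.cast_add_one_ne_zero _
  simp only [Finsupp.coe_add, Pi.add_apply, Finsupp.single_eq_same, Nat.cast_add, Nat.cast_one]
  field_simp

theorem weight_sub_single_u {w : Var n → ℕ} {m : Var n →₀ ℕ} (h : m Var.u ≠ 0) :
    Finsupp.weight w (m - Finsupp.single Var.u 1) + w Var.u = Finsupp.weight w m := by
  have h1 : m - Finsupp.single Var.u 1 + Finsupp.single Var.u 1 = m :=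
    tsub_add_cancel_of_le (Finsupp.single_le_iff.mpr (Nat.one_le_iff_ne_zero.mpr h))
  conv_rhs => rw [← h1, map_add, Finsupp.weight_single, one_smul]

theorem intU_mem_fil {w : Var n → ℕ} {k l : ℕ} {f : GraphSeries n} (hf : f ∈ fil w k)
    (h : l ≤ k + w Var.u) : intU f ∈ fil w l := by
  intro m hm
  rw [coeff_intU]
  split_ifs with h0
  · rfl
  · rw [hf, zero_div]
    have := weight_sub_single_u (w := w) h0
    omega

theorem intU_mem_homog {w : Var n → ℕ} {k l : ℕ} {f : GraphSeries n} (hf : f ∈ homog w k)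
    (h : k + w Var.u = l) : intU f ∈ homog w l := by
  intro m hm
  rw [coeff_intU]
  split_ifs with h0
  · rfl
  · rw [hf, zero_div]
    have := weight_sub_single_u (w := w) h0
    omega

theorem cj_intU (f : GraphSeries n) : cj (intU f) = intU (cj f) := by
  ext m
  rw [coeff_cj, coeff_intU, coeff_intU, mapDomain_swap_apply, coeff_cj]
  change star (if m Var.u = 0 then _ else _) = _
  split_ifs with h0
  · simp
  · rw [star_div₀, star_natCast]
    suffices h : m.mapDomain Var.swap - Finsupp.single Var.u 1
        = (m - Finsupp.single Var.u 1).mapDomain Var.swap by rw [h]; rfl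
    ext v
    rw [mapDomain_swap_apply, Finsupp.coe_tsub, Finsupp.coe_tsub, Pi.sub_apply, Pi.sub_apply,
      mapDomain_swap_apply]
    congr 1
    rcases v with j | j | j
    · rw [Finsupp.single_eq_of_ne (by simp), Finsupp.single_eq_of_ne (by simp [Var.swap])]
    · rw [Finsupp.single_eq_of_ne (by simp), Finsupp.single_eq_of_ne (by simp [Var.swap])]
    · rfl

end Components

/-! ### The linearized equations -/

section Adjustment

variable {n : ℕ}

/-- Twice the real part. -/
def reTwice (f : GraphSeries n) : GraphSeries n := f + cj f

/-- The imaginary part. -/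
def imPart (f : GraphSeries n) : GraphSeries n := C (-Complex.I / 2) * (f - cj f)

@[simp] theorem cj_reTwice (f : GraphSeries n) : cj (reTwice f) = reTwice f := by
  simp [reTwice, add_comm]

@[simp] theorem cj_imPart (f : GraphSeries n) : cj (imPart f) = imPart f := by
  simp only [imPart, map_mul, cj_C, map_sub, cj_cj, star_div₀, star_neg, Complex.star_def,
    Complex.conj_I, map_ofNat, neg_neg]
  rw [neg_div, map_neg]; ring

theorem reTwice_add (f g : GraphSeries n) : reTwice (f + g) = reTwice f + reTwice g := by
  simp only [reTwice, map_add]; ring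

theorem imPart_add (f g : GraphSeries n) : imPart (f + g) = imPart f + imPart g := by
  simp only [imPart, map_add]; ring

theorem imPart_cj (f : GraphSeries n) : imPart (cj f) = -imPart f := by
  simp only [imPart, cj_cj]; ring

theorem C_I_mul_C_I {σ : Type*} : (C Complex.I * C Complex.I : MvPowerSeries σ ℂ) = -1 := by
  rw [← map_mul, Complex.I_mul_I, map_neg, map_one]

theorem C_neg_I_div_two {σ : Type*} :
    (2 * C (-Complex.I / 2) : MvPowerSeries σ ℂ) = -C Complex.I := by
  rw [← map_ofNat (C : ℂ →+* MvPowerSeries σ ℂ) 2, ← map_mul, ← map_neg]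
  congr 1; ring

theorem add_imPart_eq (f : GraphSeries n) :
    reTwice f + 2 * C Complex.I * imPart f = 2 * f := by
  simp only [reTwice, imPart]
  linear_combination (C Complex.I * (f - cj f)) * C_neg_I_div_two
    - (f - cj f) * C_I_mul_C_I (σ := Var n)

theorem reTwice_mem_fil_cmWeight {k : ℕ} {f : GraphSeries n} (hf : f ∈ fil cmWeight k) :
    reTwice f ∈ fil cmWeight k := add_mem hf (cj_mem_fil_cmWeight hf)

theorem imPart_mem_fil_cmWeight {k : ℕ} {f : GraphSeries n} (hf : f ∈ fil cmWeight k) :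
    imPart f ∈ fil cmWeight k := C_mul_mem_fil _ (sub_mem hf (cj_mem_fil_cmWeight hf))

/-- The pairing `∑_kl α_kl z_l F_k`. -/
def twist (α : Fin n → Fin n → ℂ) (F : Fin n → GraphSeries n) : GraphSeries n :=
  ∑ k, ∑ l, C (α k l) * X (Var.z l) * F k

theorem twist_add (α : Fin n → Fin n → ℂ) (F F' : Fin n → GraphSeries n) :
    twist α (fun j => F j + F' j) = twist α F + twist α F' := by
  simp only [twist, mul_add, Finset.sum_add_distrib]

theorem twist_sub (α : Fin n → Fin n → ℂ) (F F' : Fin n → GraphSeries n) :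
    twist α (fun j => F j - F' j) = twist α F - twist α F' := by
  simp only [twist, mul_sub, Finset.sum_sub_distrib]

theorem twist_zero (α : Fin n → Fin n → ℂ) : twist α (fun _ => 0) = 0 := by simp [twist]

/-- α is antisymmetric while z_k z_l is symmetric. A multiple of the vector z may thus be added to F
without changing its twist. -/
theorem twist_X_mul {α : Fin n → Fin n → ℂ} (hα : ∀ k l, α k l = -α l k) (g : GraphSeries n) :
    twist α (fun j => X (Var.z j) * g) = 0 := by
  have h : twist α (fun j => X (Var.z j) * g) = -twist α (fun j => X (Var.z j) * g) := by
    conv_lhs => rw [twist, Finset.sum_comm]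
    simp only [twist, ← Finset.sum_neg_distrib]
    refine Finset.sum_congr rfl fun k _ => Finset.sum_congr rfl fun l _ => ?_
    rw [hα l k, map_neg]; ring
  have h2 : (2 : GraphSeries n) * twist α (fun j => X (Var.z j) * g) = 0 := by
    linear_combination h
  have h3 : C (1 / 2 : ℂ) * (2 : GraphSeries n) = 1 := by
    rw [← map_ofNat (C : ℂ →+* GraphSeries n) 2, ← map_mul]; norm_num
  linear_combination C (1 / 2 : ℂ) * h2 - twist α (fun j => X (Var.z j) * g) * h3

theorem twist_mem_fil {w : Var n → ℕ} (α : Fin n → Fin n → ℂ) {F : Fin n → GraphSeries n} {a k l : ℕ}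
    (hF : ∀ j, F j ∈ fil w k) (ha : ∀ j : Fin n, a ≤ w (Var.z j)) (h : l ≤ a + k) :
    twist α F ∈ fil w l :=
  sum_mem fun j _ => sum_mem fun i _ =>
    mul_mem_fil (C_mul_mem_fil _ (X_mem_fil _ _ (ha i))) (hF j) h

theorem twist_mem_homog {w : Var n → ℕ} (α : Fin n → Fin n → ℂ) {F : Fin n → GraphSeries n}
    {a k l : ℕ} (hF : ∀ j, F j ∈ homog w k) (ha : ∀ j : Fin n, w (Var.z j) = a) (h : a + k = l) :
    twist α F ∈ homog w l :=
  sum_mem fun j _ => sum_mem fun i _ =>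
    mul_mem_homog (C_mul_mem_homog _ (X_mem_homog _ _ (ha i))) (hF j) h

theorem du_twist (α : Fin n → Fin n → ℂ) (F : Fin n → GraphSeries n) :
    du (twist α F) = twist α fun j => du (F j) := by
  simp only [twist, map_sum, mul_assoc, pderiv_C_mul, du_mul, du_X_z, mul_zero, add_zero]

theorem shift_twist (α : Fin n → Fin n → ℂ) (F : Fin n → GraphSeries n) :
    shift (twist α F) = twist α fun j => shift (F j) := by
  simp only [twist, map_sum, map_mul, shift_C, shift_X_z]

theorem sphereEuler_twist (α : Fin n → Fin n → ℂ) (F : Fin n → GraphSeries n) :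
    sphereEuler (twist α F) = twist α F + twist α fun j => sphereEuler (F j) := by
  simp only [twist, map_sum, ← Finset.sum_add_distrib]
  refine Finset.sum_congr rfl fun k _ => Finset.sum_congr rfl fun l _ => ?_
  rw [mul_assoc, sphereEuler_C_mul, sphereEuler_mul, sphereEuler_X_z]
  ring

/-- The changes of the defining series which are induced, in the linearized equations, by
infinitesimal coordinate changes with holomorphic components `F`. -/
def IsAdjustment (α : Fin n → Fin n → ℂ) (k : ℕ) (ψ : GraphSeries n) : Prop :=
  ∃ (F : Fin n → GraphSeries n) (G : GraphSeries n), (∀ j, F j ∈ fil cmWeight k) ∧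
    G ∈ fil cmWeight (k + 1) ∧ (∀ j, sphereEuler (cj (F j)) = 0) ∧
    sphereEuler G = sphereEuler (twist α F) - 2 * twist α F ∧
    ψ = imPart G + reTwice (∑ j, X (Var.zbar j) * F j)

namespace IsAdjustment

variable {α : Fin n → Fin n → ℂ} {k : ℕ} {ψ ψ' : GraphSeries n}

theorem add (h : IsAdjustment α k ψ) (h' : IsAdjustment α k ψ') : IsAdjustment α k (ψ + ψ') := by
  obtain ⟨F, G, a, b, c, d, rfl⟩ := h
  obtain ⟨F', G', a', b', c', d', rfl⟩ := h'
  refine ⟨fun j => F j + F' j, G + G', fun j => add_mem (a j) (a' j), add_mem b b', fun j => ?_,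
    ?_, ?_⟩
  · rw [map_add, map_add, c, c', add_zero]
  · rw [map_add, d, d', twist_add, map_add]; ring
  · simp only [mul_add, Finset.sum_add_distrib, imPart_add, reTwice_add]; ring

theorem cj_eq (h : IsAdjustment α k ψ) : cj ψ = ψ := by
  obtain ⟨F, G, -, -, -, -, rfl⟩ := h
  rw [map_add, cj_imPart, cj_reTwice]

theorem mem_fil (h : IsAdjustment α k ψ) : ψ ∈ fil cmWeight (k + 1) := by
  obtain ⟨F, G, a, b, -, -, rfl⟩ := h
  exact add_mem (imPart_mem_fil_cmWeight b) (reTwice_mem_fil_cmWeight (sum_mem fun j _ =>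
    mul_mem_fil (X_mem_fil _ _ le_rfl) (a j) (by simp [add_comm])))

/-- A change of the w-component alone: F = 0, and G is the conjugate of a holomorphic function on
the model, hence in the kernel of `sphereEuler`. -/
theorem of_shift {h : GraphSeries n} (h0 : h ∈ homog zbarWeight 0) (hk : h ∈ fil cmWeight (k + 1)) :
    IsAdjustment α k (-imPart (shift h)) := by
  refine ⟨fun _ => 0, cj (shift h), fun _ => zero_mem _,
    cj_mem_fil_cmWeight (shift_mem_fil normSq_mem_fil_cmWeight hk), fun j => by simp, ?_, ?_⟩
  · rw [sphereEuler_cj_shift h0, twist_zero]; simp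
  · rw [imPart_cj]; simp [reTwice]

/-- A change of the z-components by holomorphic functions a_j. With p = twist α a, the equations for
x₀ and x₁ give Y(shift x₀ - 2i|z|² shift x₁) = shift p + 4|z|⁴ shift(∂x₁/∂u) for Y = `sphereEuler`,
and T absorbs the last term. The result differs from the adjustment for α = 0 only through T. -/
theorem of_holomorphic (hα : ∀ k l, α k l = -α l k) {a : Fin n → GraphSeries n}
    {x₀ x₁ T : GraphSeries n}
    (ha0 : ∀ j, a j ∈ homog zbarWeight 0) (hak : ∀ j, a j ∈ fil cmWeight k)
    (hx0 : x₀ ∈ homog zbarWeight 0) (hx0k : x₀ ∈ fil cmWeight (k + 1))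
    (hx1 : x₁ ∈ homog zbarWeight 0) (hx1k : x₁ ∈ fil cmWeight (k - 1))
    (hTk : T ∈ fil cmWeight (k + 1)) (e0 : euler x₀ = twist α a) (e1 : euler x₁ + x₁ = du x₀)
    (eT : sphereEuler T = 4 * normSq ^ 2 * shift (du x₁)) :
    IsAdjustment α k (reTwice (∑ j, X (Var.zbar j) * shift (a j) - C Complex.I * T)) := by
  have hq := normSq_mem_fil_cmWeight (n := n)
  have hp0 : twist α a ∈ homog zbarWeight 0 := twist_mem_homog α ha0 (fun _ => rfl) rfl
  have hpk : twist α a ∈ fil cmWeight (k + 1) :=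
    twist_mem_fil α (a := 1) hak (fun _ => le_rfl) (by omega)
  have htw : twist α (fun j => shift (a j) - X (Var.z j) * (2 * shift x₁)) = shift (twist α a) := by
    rw [twist_sub, twist_X_mul hα, shift_twist, sub_zero]
  set S := shift (twist α a) - 2 * shift x₀ with hS
  have hSeq : S = shift (twist α a - 2 * x₀) := by rw [hS, map_sub, map_mul, map_ofNat]
  have h2x0 : (2 * x₀ : GraphSeries n) ∈ homog zbarWeight 0 := by
    rw [← map_ofNat (C : ℂ →+* GraphSeries n) 2]; exact C_mul_mem_homog _ hx0
  -- Adding cj S to G costs nothing in the equation, and makes S enter through its real part only,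
  -- so that it drops out of ψ. The part -2 z_j shift x₁ of F leaves the twist unchanged and cancels
  -- the contribution of 4i|z|² shift x₁ in G.
  refine ⟨fun j => shift (a j) - X (Var.z j) * (2 * shift x₁),
    shift (twist α a) - 2 * (shift x₀ - 2 * C Complex.I * normSq * shift x₁ - T) + cj S,
    fun j => ?_, ?_, fun j => ?_, ?_, ?_⟩
  · exact sub_mem (shift_mem_fil hq (hak j)) (mul_mem_fil (X_mem_fil _ _ le_rfl)
      (Ideal.mul_mem_left _ _ (shift_mem_fil hq hx1k)) (by simp; omega))
  · refine add_mem (sub_mem (shift_mem_fil hq hpk) (Ideal.mul_mem_left _ _ (sub_mem (sub_mem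
      (shift_mem_fil hq hx0k) (mul_mem_fil (Ideal.mul_mem_left _ _ hq) (shift_mem_fil hq hx1k)
        (by omega))) hTk))) (cj_mem_fil_cmWeight ?_)
    exact sub_mem (shift_mem_fil hq hpk) (Ideal.mul_mem_left _ _ (shift_mem_fil hq hx0k))
  · rw [map_sub, map_mul, map_mul, map_ofNat, cj_X, map_sub, sphereEuler_mul]
    rw [sphereEuler_cj_shift (ha0 j), sphereEuler_mul, sphereEuler_cj_shift hx1]
    rw [show Var.swap (Var.z j) = Var.zbar j from rfl, sphereEuler_X_zbar,
      ← map_ofNat (C : ℂ →+* GraphSeries n) 2, sphereEuler_C]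
    simp
  · have hV : sphereEuler (shift x₀ - 2 * C Complex.I * normSq * shift x₁ - T)
        = shift (twist α a) := by
      have h2 : sphereEuler (2 * C Complex.I : GraphSeries n) = 0 := by
        rw [← map_ofNat (C : ℂ →+* GraphSeries n) 2, ← map_mul, sphereEuler_C]
      have e1' : shift (euler x₁) + shift x₁ = shift (du x₀) := by rw [← map_add, e1]
      rw [map_sub, map_sub, eT, sphereEuler_shift, e0, sphereEuler_mul, sphereEuler_mul,
        h2, sphereEuler_normSq, sphereEuler_shift]
      linear_combination (-2 * C Complex.I * normSq) * e1'
        - (4 * normSq ^ 2 * shift (du x₁)) * C_I_mul_C_I (σ := Var n)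
    have h2 : ∀ f : GraphSeries n, sphereEuler (2 * f) = 2 * sphereEuler f := fun f => by
      rw [← map_ofNat (C : ℂ →+* GraphSeries n) 2, sphereEuler_C_mul]
    rw [map_add, map_sub, h2, hV, hSeq, sphereEuler_cj_shift (sub_mem hp0 h2x0), htw, add_zero]
  · have h1 : shift (twist α a) - 2 * (shift x₀ - 2 * C Complex.I * normSq * shift x₁ - T) + cj S
        = reTwice S + (4 * C Complex.I * normSq * shift x₁ + 2 * T) := by
      rw [reTwice, hS]; ring
    have h2 : ∑ j, X (Var.zbar j) * (shift (a j) - X (Var.z j) * (2 * shift x₁))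
        = ∑ j, X (Var.zbar j) * shift (a j) - 2 * normSq * shift x₁ := by
      rw [normSq, Finset.mul_sum, Finset.sum_mul, ← Finset.sum_sub_distrib]
      exact Finset.sum_congr rfl fun _ _ => by ring
    rw [h1, h2]
    simp only [reTwice, imPart, map_add, map_sub, map_mul, map_sum, cj_C, cj_cj, cj_normSq,
      map_ofNat, Complex.star_def, Complex.conj_I, map_neg]
    linear_combination (2 * normSq * (shift x₁ + cj (shift x₁))) * C_I_mul_C_I (σ := Var n)
      + (-(2 * C Complex.I * normSq * (shift x₁ + cj (shift x₁))) - (T - cj T))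
        * C_neg_I_div_two (σ := Var n)

/-- The auxiliary series are found by dividing coefficients by z-degrees. As x₁ lies in the ideal of
z, the source 4|z|⁴ shift(∂x₁/∂u) of T has z-order 3 and z̄-order 2. Thus T does not affect the
components of lower bidegree. -/
theorem exists_of_holomorphic (hα : ∀ k l, α k l = -α l k) {a : Fin n → GraphSeries n}
    (ha0 : ∀ j, a j ∈ homog zbarWeight 0) (hak : ∀ j, a j ∈ fil cmWeight k) :
    ∃ T ∈ fil zWeight 3, T ∈ fil zbarWeight 2 ∧
      IsAdjustment α k (reTwice (∑ j, X (Var.zbar j) * shift (a j) - C Complex.I * T)) := by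
  set x₀ : GraphSeries n := diag (fun m => (zDegree m : ℂ)⁻¹) (twist α a) with hx₀
  set x₁ : GraphSeries n := diag (fun m => ((zDegree m : ℂ) + 1)⁻¹) (du x₀) with hx₁
  have hp1 : twist α a ∈ fil zWeight 1 :=
    twist_mem_fil α (a := 1) (fun j => mem_fil_zero _ _) (fun _ => le_rfl) le_rfl
  have e0 : euler x₀ = twist α a := by
    ext m
    rw [coeff_euler, hx₀, coeff_diag]
    by_cases h : zDegree m = 0
    · rw [hp1 m (by rw [weight_zWeight]; omega)]; simp
    · rw [mul_inv_cancel_left₀ (Nat.cast_ne_zero.mpr h)]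
  have e1 : euler x₁ + x₁ = du x₀ := by
    ext m
    rw [map_add, coeff_euler, hx₁, coeff_diag, ← add_one_mul,
      mul_inv_cancel_left₀ (Nat.cast_add_one_ne_zero _)]
  have hp0 : twist α a ∈ homog zbarWeight 0 := twist_mem_homog α ha0 (fun _ => rfl) rfl
  have hpk : twist α a ∈ fil cmWeight (k + 1) :=
    twist_mem_fil α (a := 1) hak (fun _ => le_rfl) (by omega)
  have hx0 : x₀ ∈ homog zbarWeight 0 := diag_mem_homog _ hp0
  have hx0k : x₀ ∈ fil cmWeight (k + 1) := diag_mem_fil _ hpk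
  have hx0z : x₀ ∈ fil zWeight 1 := diag_mem_fil _ hp1
  have hx1 : x₁ ∈ homog zbarWeight 0 := diag_mem_homog _ (pderiv_mem_homog hx0 _ rfl)
  have hx1k : x₁ ∈ fil cmWeight (k - 1) := diag_mem_fil _ (pderiv_mem_fil hx0k _ (by simp))
  have hx1z : x₁ ∈ fil zWeight 1 := diag_mem_fil _ (pderiv_mem_fil hx0z _ (by simp))
  have hrz : 4 * normSq ^ 2 * shift (du x₁) ∈ fil zWeight 3 := by
    refine mul_mem_fil (Ideal.mul_mem_left _ _ (pow_mem_fil normSq_mem_fil_zWeight 2))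
      (shift_mem_fil (k := 1) (mem_fil_zero _ _) (pderiv_mem_fil hx1z _ (by simp))) (by norm_num)
  have hrzb : 4 * normSq ^ 2 * shift (du x₁) ∈ fil zbarWeight 2 :=
    Ideal.mul_mem_right _ _ (Ideal.mul_mem_left _ _ (fil_anti _ (by norm_num)
      (pow_mem_fil normSq_mem_fil_zbarWeight 2)))
  have hrk : 4 * normSq ^ 2 * shift (du x₁) ∈ fil cmWeight (k + 1) := by
    refine mul_mem_fil (Ideal.mul_mem_left _ _ (pow_mem_fil normSq_mem_fil_cmWeight 2))
      (shift_mem_fil normSq_mem_fil_cmWeight (pderiv_mem_fil hx1k _ le_rfl)) ?_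
    simp only [cmWeight_u]; omega
  obtain ⟨T, eT, hT⟩ := exists_sphereEuler_eq (fil_anti _ (by norm_num) hrz)
  exact ⟨T, hT _ _ (mem_fil_zero _ _) hrz, hT _ _ (mem_fil_zero _ _) hrzb,
    of_holomorphic hα ha0 hak hx0 hx0k hx1 hx1k (hT _ _ normSq_mem_fil_cmWeight hrk) e0 e1 eT⟩

end IsAdjustment

end Adjustment

/-! ### The Chern–Moser normalization of the linearized equations -/

section Normalization

variable {n : ℕ} {α : Fin n → Fin n → ℂ} {k : ℕ} {ψ : GraphSeries n}

/-- The conditions of the Chern–Moser normal form on `φ - ∑_j |z_j|²`, for real series. -/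
structure IsNormalRemainder (ψ : GraphSeries n) : Prop where
  mem_fil : ψ ∈ fil zbarWeight 2
  tr22 : tr (bipart 2 2 ψ) = 0
  tr32 : tr (tr (bipart 3 2 ψ)) = 0
  tr33 : tr (tr (tr (bipart 3 3 ψ))) = 0

theorem mem_fil_zWeight_of_cj_eq (hr : cj ψ = ψ) {a : ℕ} (h : ψ ∈ fil zbarWeight a) :
    ψ ∈ fil zWeight a := hr ▸ cj_mem_fil_zWeight h

theorem tr_normSq_mul_of_mem_homog {f : GraphSeries n} {a b : ℕ} (hz : f ∈ homog zWeight a)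
    (hzb : f ∈ homog zbarWeight b) :
    tr (normSq * f) = C ((n : ℂ) + a + b) * f + normSq * tr f := by
  rw [tr_normSq_mul, euler_of_mem_homog hz, eulerBar_of_mem_homog hzb, map_add, map_add,
    map_natCast, map_natCast, map_natCast]
  ring

theorem normSq_mul_mem_homog_zWeight {f : GraphSeries n} {a : ℕ} (hz : f ∈ homog zWeight a) :
    normSq * f ∈ homog zWeight (a + 1) :=
  mul_mem_homog normSq_mem_homog_zWeight hz (add_comm _ _)

theorem normSq_mul_mem_homog_zbarWeight {f : GraphSeries n} {a : ℕ} (hz : f ∈ homog zbarWeight a) :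
    normSq * f ∈ homog zbarWeight (a + 1) :=
  mul_mem_homog normSq_mem_homog_zbarWeight hz (add_comm _ _)

/-- The components of bidegree (k, 0), and by reality those of bidegree (0, k), are removed by a
change of the w-component. -/
theorem exists_adjustment_zbar_one (hr : cj ψ = ψ) (hk : ψ ∈ fil cmWeight (k + 1)) :
    ∃ δ, IsAdjustment α k δ ∧ ψ + δ ∈ fil zbarWeight 1 := by
  set ψ₀ := hcomp zbarWeight 0 ψ with hψ₀
  set ψ₁ := hcomp zWeight 0 ψ with hψ₁
  set ψ₂ := hcomp zbarWeight 0 ψ₁ with hψ₂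
  have e1 : cj ψ₀ = ψ₁ := by rw [hψ₀, cj_hcomp_zbarWeight, hr]
  have e2 : cj ψ₂ = ψ₂ := by
    rw [hψ₂, hψ₁, cj_hcomp_zbarWeight, cj_hcomp_zWeight, hr]; exact diag_diag _ _ _
  -- The imaginary part of `h` is ψ₀ + ψ₁ - ψ₂; the part ψ₂ depending on u alone occurs in both ψ₀
  -- and ψ₁ and is subtracted once.
  set h : GraphSeries n := 2 * (C Complex.I * ψ₀) - C Complex.I * ψ₂ with hh
  have h0 : h ∈ homog zbarWeight 0 := by
    refine sub_mem ?_ (C_mul_mem_homog _ (hcomp_mem_homog _ _ _))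
    rw [← map_ofNat (C : ℂ →+* GraphSeries n) 2]
    exact C_mul_mem_homog _ (C_mul_mem_homog _ (hcomp_mem_homog _ _ _))
  have hhk : h ∈ fil cmWeight (k + 1) :=
    sub_mem (Ideal.mul_mem_left _ _ (C_mul_mem_fil _ (diag_mem_fil _ hk)))
      (C_mul_mem_fil _ (diag_mem_fil _ (diag_mem_fil _ hk)))
  refine ⟨_, IsAdjustment.of_shift h0 hhk, ?_⟩
  have r1 : shift h - h ∈ fil zbarWeight 1 :=
    shift_sub_mem_fil normSq_mem_fil_zbarWeight (mem_fil_zero _ _)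
  have r2 : cj (shift h - h) ∈ fil zbarWeight 1 :=
    cj_mem_fil_zbarWeight (shift_sub_mem_fil normSq_mem_fil_zWeight (mem_fil_zero _ _))
  have r3 : ψ - ψ₀ ∈ fil zbarWeight 1 := sub_hcomp_mem_fil (mem_fil_zero _ _)
  have r4 : ψ₁ - ψ₂ ∈ fil zbarWeight 1 := sub_hcomp_mem_fil (mem_fil_zero _ _)
  have key : ψ + -imPart (shift h) = (ψ - ψ₀) - (ψ₁ - ψ₂)
      - C (-Complex.I / 2) * ((shift h - h) - cj (shift h - h)) := by
    have hcj : cj h = -(2 * (C Complex.I * ψ₁)) + C Complex.I * ψ₂ := by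
      rw [hh, map_sub, map_mul, map_mul, map_mul, cj_C, e1, e2, map_ofNat, Complex.star_def,
        Complex.conj_I, map_neg]
      ring
    clear_value h
    rw [imPart, map_sub, hcj, hh]
    linear_combination (-(C Complex.I * (ψ₀ + ψ₁ - ψ₂))) * C_neg_I_div_two (σ := Var n)
      + (ψ₀ + ψ₁ - ψ₂) * C_I_mul_C_I (σ := Var n)
  rw [key]
  exact sub_mem (sub_mem r3 r4) (C_mul_mem_fil _ (sub_mem r1 r2))

/-- A series linear in z̄ has the form Σ z̄_j a_j with a_j its z̄_j-derivative, so bidegree (k, 1)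
is removed by a change of the z-components. The errors have z̄-order 2, partly because the a_j lie
in the ideal of z. -/
theorem exists_adjustment_zbar_two (hα : ∀ k l, α k l = -α l k) (hr : cj ψ = ψ)
    (hk : ψ ∈ fil cmWeight (k + 1)) (h1 : ψ ∈ fil zbarWeight 1) :
    ∃ δ, IsAdjustment α k δ ∧ ψ + δ ∈ fil zbarWeight 2 := by
  have h1z := mem_fil_zWeight_of_cj_eq hr h1
  set ψ₁ := hcomp zbarWeight 1 ψ with hψ₁
  set ψ₂ := hcomp zWeight 1 ψ with hψ₂
  set ψ₃ := hcomp zbarWeight 1 ψ₂ with hψ₃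
  have e1 : cj ψ₁ = ψ₂ := by rw [hψ₁, cj_hcomp_zbarWeight, hr]
  have e3 : cj ψ₃ = ψ₃ := by
    rw [hψ₃, hψ₂, cj_hcomp_zbarWeight, cj_hcomp_zWeight, hr]; exact diag_diag _ _ _
  -- The component ψ₃ of bidegree (1, 1) is its own conjugate and would be counted twice; it is
  -- therefore halved.
  set θ := ψ₁ - C (1 / 2) * ψ₃ with hθ
  have hθ1 : θ ∈ homog zbarWeight 1 :=
    sub_mem (hcomp_mem_homog _ _ _) (C_mul_mem_homog _ (hcomp_mem_homog _ _ _))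
  have hθk : θ ∈ fil cmWeight (k + 1) :=
    sub_mem (diag_mem_fil _ hk) (C_mul_mem_fil _ (diag_mem_fil _ (diag_mem_fil _ hk)))
  have hθz : θ ∈ fil zWeight 1 :=
    sub_mem (diag_mem_fil _ h1z) (C_mul_mem_fil _ (diag_mem_fil _ (diag_mem_fil _ h1z)))
  set a : Fin n → GraphSeries n := fun j => -pderiv ℂ (Var.zbar j) θ with ha
  have haz : ∀ j, a j ∈ fil zWeight 1 := fun j => neg_mem (pderiv_mem_fil hθz _ (by simp))
  obtain ⟨T, hTz, hTzb, hT⟩ := IsAdjustment.exists_of_holomorphic hα (a := a)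
    (fun j => neg_mem (pderiv_mem_homog hθ1 _ rfl))
    (fun j => neg_mem (pderiv_mem_fil (k := k) hθk _ (by simp)))
  refine ⟨_, hT, ?_⟩
  have hsum : ∑ j, X (Var.zbar j) * a j = -θ := by
    simp only [ha, mul_neg, Finset.sum_neg_distrib, ← eulerBar_apply]
    rw [eulerBar_of_mem_homog hθ1]; simp
  set E := ∑ j, X (Var.zbar j) * (shift (a j) - a j) with hE
  have hEsum : ∑ j, X (Var.zbar j) * shift (a j) = E - θ := by
    rw [sub_eq_add_neg, ← hsum, hE, ← Finset.sum_add_distrib]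
    exact Finset.sum_congr rfl fun _ _ => by ring
  have r1 : E ∈ fil zbarWeight 2 := sum_mem fun j _ => mul_mem_fil (X_mem_fil _ _ le_rfl)
    (shift_sub_mem_fil (k := 0) normSq_mem_fil_zbarWeight (mem_fil_zero _ _)) le_rfl
  have r2 : cj E ∈ fil zbarWeight 2 := cj_mem_fil_zbarWeight (sum_mem fun j _ =>
    Ideal.mul_mem_left _ _ (shift_sub_mem_fil normSq_mem_fil_zWeight (haz j)))
  have r3 : ψ - ψ₁ ∈ fil zbarWeight 2 := sub_hcomp_mem_fil h1
  have r4 : ψ₂ - ψ₃ ∈ fil zbarWeight 2 := sub_hcomp_mem_fil (diag_mem_fil _ h1)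
  have r5 : cj (C Complex.I * T) ∈ fil zbarWeight 2 :=
    fil_anti _ (by norm_num) (cj_mem_fil_zbarWeight (C_mul_mem_fil _ hTz))
  have hhalf : (2 * C (1 / 2 : ℂ) : GraphSeries n) = 1 := by
    rw [← map_ofNat (C : ℂ →+* GraphSeries n) 2, ← map_mul]; norm_num
  have key : ψ + reTwice (∑ j, X (Var.zbar j) * shift (a j) - C Complex.I * T)
      = (ψ - ψ₁) - (ψ₂ - ψ₃) + (E + cj E) - (C Complex.I * T + cj (C Complex.I * T)) := by
    rw [hEsum, reTwice, map_sub, map_sub, hθ, map_sub, e1, map_mul cj (C _) ψ₃, cj_C, e3]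
    have : star (1 / 2 : ℂ) = 1 / 2 := by simp
    rw [this]
    linear_combination ψ₃ * hhalf
  rw [key]
  exact sub_mem (add_mem (sub_mem r3 r4) (add_mem r1 r2)) (add_mem (C_mul_mem_fil _ hTzb) r5)

/-- An infinitesimal unitary rotation depending on u: for Q real of bidegree (1, 1) the leading term
Σ z̄_j a_j = iQ has real part zero. The next Taylor term contributes -2|z|² Q_u in bidegree (2, 2),
and Q_u can be chosen to cancel the trace. -/
theorem exists_adjustment_tr22 (hα : ∀ k l, α k l = -α l k) (hr : cj ψ = ψ)
    (hk : ψ ∈ fil cmWeight (k + 1)) (h2 : ψ ∈ fil zbarWeight 2) :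
    ∃ δ, IsAdjustment α k δ ∧ ψ + δ ∈ fil zbarWeight 2 ∧ tr (bipart 2 2 (ψ + δ)) = 0 := by
  set t := tr (bipart 2 2 ψ) with ht
  have htz : t ∈ homog zWeight 1 := tr_mem_homog_zWeight (bipart_mem_homog_zWeight _ _ _)
  have htzb : t ∈ homog zbarWeight 1 := tr_mem_homog_zbarWeight (bipart_mem_homog_zbarWeight _ _ _)
  have htk : t ∈ fil cmWeight (k - 1) := by
    have := tr_mem_fil_cmWeight (bipart_mem_fil 2 2 hk)
    exact fil_anti _ (by omega) this
  have htr : cj t = t := by rw [ht, cj_tr, cj_bipart, hr]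
  clear_value t
  have hstar : ∀ m : ℕ, star (1 / ((n : ℂ) + m)) = 1 / ((n : ℂ) + m) := by intro m; simp
  have hstar' : star (1 / (2 * (n : ℂ) + 2)) = 1 / (2 * (n : ℂ) + 2) := by simp
  -- The solution of tr(|z|² P) = (n + 2)P + |z|² tr P = t. Taking the trace gives (2n + 2) tr P =
  -- tr t, whence the constants.
  set P := C (1 / ((n : ℂ) + (2 : ℕ))) * (t - C (1 / (2 * (n : ℂ) + 2)) * (normSq * tr t)) with hP
  have htt0 : tr t ∈ homog zWeight 0 := tr_mem_homog_zWeight htz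
  have httb0 : tr t ∈ homog zbarWeight 0 := tr_mem_homog_zbarWeight htzb
  have hPz : P ∈ homog zWeight 1 := C_mul_mem_homog _ (sub_mem htz (C_mul_mem_homog _
    (normSq_mul_mem_homog_zWeight htt0)))
  have hPzb : P ∈ homog zbarWeight 1 := C_mul_mem_homog _ (sub_mem htzb (C_mul_mem_homog _
    (normSq_mul_mem_homog_zbarWeight httb0)))
  have hPk : P ∈ fil cmWeight (k - 1) := C_mul_mem_fil _ (sub_mem htk (C_mul_mem_fil _
    (mul_mem_fil normSq_mem_fil_cmWeight (tr_mem_fil_cmWeight htk) (by omega))))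
  have hPr : cj P = P := by
    rw [hP, map_mul, cj_C, hstar, map_sub, map_mul, cj_C, hstar', map_mul, cj_normSq, cj_tr, htr]
  have hn2 : ((n : ℂ) + 2) ≠ 0 := by exact_mod_cast (by omega : n + 2 ≠ 0)
  have hn1 : (2 * (n : ℂ) + 2) ≠ 0 := by exact_mod_cast (by omega : 2 * n + 2 ≠ 0)
  have hPtr : tr (normSq * P) = t := by
    have htrq : tr (normSq * tr t) = C (n : ℂ) * tr t := by
      rw [tr_normSq_mul_of_mem_homog htt0 httb0, tr_of_mem_homog httb0]; simp
    have hPt : tr P = C (1 / (2 * (n : ℂ) + 2)) * tr t := by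
      rw [hP, tr_C_mul, tr_sub, tr_C_mul, htrq]
      have : (C (1 / ((n : ℂ) + (2 : ℕ))) * (1 - C (1 / (2 * (n : ℂ) + 2)) * C (n : ℂ)) : GraphSeries n)
          = C (1 / (2 * (n : ℂ) + 2)) := by
        rw [← map_one (C : ℂ →+* GraphSeries n), ← map_mul, ← map_sub, ← map_mul]
        congr 1
        push_cast
        field_simp
        ring
      linear_combination tr t * this
    rw [tr_normSq_mul_of_mem_homog hPz hPzb, hPt, hP]
    have : (C ((n : ℂ) + (1 : ℕ) + (1 : ℕ)) * C (1 / ((n : ℂ) + (2 : ℕ))) : GraphSeries n) = 1 := by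
      rw [← map_mul, ← map_one (C : ℂ →+* GraphSeries n)]
      congr 1
      push_cast
      field_simp
      ring
    linear_combination (t - C (1 / (2 * (n : ℂ) + 2)) * (normSq * tr t)) * this
  set Q := C (1 / 2 : ℂ) * intU P with hQ
  have hQz : Q ∈ homog zWeight 1 := C_mul_mem_homog _ (intU_mem_homog hPz rfl)
  have hQzb : Q ∈ homog zbarWeight 1 := C_mul_mem_homog _ (intU_mem_homog hPzb rfl)
  have hQk : Q ∈ fil cmWeight (k + 1) := C_mul_mem_fil _ (intU_mem_fil hPk (by simp; omega))
  have hQr : cj Q = Q := by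
    rw [hQ, map_mul, cj_C, cj_intU, hPr]; simp
  have hhalf : (2 * C (1 / 2 : ℂ) : GraphSeries n) = 1 := by
    rw [← map_ofNat (C : ℂ →+* GraphSeries n) 2, ← map_mul]; norm_num
  have hduQ : 2 * du Q = P := by
    rw [hQ, pderiv_C_mul, du_intU]; linear_combination P * hhalf
  set a : Fin n → GraphSeries n := fun j => C Complex.I * pderiv ℂ (Var.zbar j) Q with ha
  have haz : ∀ j, a j ∈ homog zWeight 1 := fun j => C_mul_mem_homog _ (pderiv_mem_homog hQz _ rfl)
  have ha0 : ∀ j, a j ∈ homog zbarWeight 0 := fun j =>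
    C_mul_mem_homog _ (pderiv_mem_homog hQzb _ rfl)
  obtain ⟨T, hTz, hTzb, hT⟩ := IsAdjustment.exists_of_holomorphic hα (a := a) ha0
    (fun j => C_mul_mem_fil _ (pderiv_mem_fil (k := k) hQk _ (by simp)))
  have hsum : ∑ j, X (Var.zbar j) * a j = C Complex.I * Q := by
    have : eulerBar Q = Q := by rw [eulerBar_of_mem_homog hQzb]; simp
    conv_rhs => rw [← this, eulerBar_apply, Finset.mul_sum]
    exact Finset.sum_congr rfl fun _ _ => by simp only [ha]; ring
  have hsum' : ∑ j, X (Var.zbar j) * du (a j) = C Complex.I * du Q := by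
    rw [← pderiv_C_mul, ← hsum, map_sum]
    refine Finset.sum_congr rfl fun j _ => ?_
    have := du_mul (X (Var.zbar j)) (a j)
    rw [this, du_X_zbar]; ring
  set e : Fin n → GraphSeries n := fun j =>
    shift (a j) - (a j + C Complex.I * normSq * du (a j)) with he
  have hez : ∀ j, e j ∈ fil zWeight 3 := fun j => by
    have := shift_sub_sum_mem_fil rfl normSq_mem_fil_zWeight 2 (ha0 j) (homog_le_fil (haz j) le_rfl)
    simpa [Finset.sum_range_succ] using this
  have hezb : ∀ j, e j ∈ fil zbarWeight 2 := fun j => by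
    have := shift_sub_sum_mem_fil rfl normSq_mem_fil_zbarWeight 2 (ha0 j) (mem_fil_zero _ _)
    simpa [Finset.sum_range_succ] using this
  set E := ∑ j, X (Var.zbar j) * e j with hE
  have hEz : E ∈ fil zWeight 3 := sum_mem fun j _ => Ideal.mul_mem_left _ _ (hez j)
  have hEzb : E ∈ fil zbarWeight 3 := sum_mem fun j _ =>
    mul_mem_fil (X_mem_fil _ _ le_rfl) (hezb j) le_rfl
  have hEsum : ∑ j, X (Var.zbar j) * shift (a j)
      = E + C Complex.I * Q + C Complex.I * normSq * (C Complex.I * du Q) := by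
    rw [← hsum, ← hsum', hE, Finset.mul_sum, ← Finset.sum_add_distrib, ← Finset.sum_add_distrib]
    exact Finset.sum_congr rfl fun _ _ => by simp only [he]; ring
  set R := (E - C Complex.I * T) + cj (E - C Complex.I * T) with hR
  have key : reTwice (∑ j, X (Var.zbar j) * shift (a j) - C Complex.I * T) = R - normSq * P := by
    rw [hEsum, hR, reTwice, ← hduQ]
    simp only [map_sub, map_add, map_mul, cj_C, cj_du, hQr, Complex.star_def, Complex.conj_I,
      cj_normSq, map_neg]
    linear_combination (2 * normSq * du Q) * C_I_mul_C_I (σ := Var n)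
  have hETz : E - C Complex.I * T ∈ fil zWeight 3 := sub_mem hEz (C_mul_mem_fil _ hTz)
  have hcET : cj (E - C Complex.I * T) ∈ fil zbarWeight 3 := cj_mem_fil_zbarWeight hETz
  have hR2 : R ∈ fil zbarWeight 2 := add_mem (sub_mem (fil_anti _ (by norm_num) hEzb)
    (C_mul_mem_fil _ hTzb)) (fil_anti _ (by norm_num) hcET)
  have hR22 : bipart 2 2 R = 0 := by
    rw [hR, bipart_add, bipart_of_mem_fil_zWeight hETz (by norm_num),
      bipart_of_mem_fil_zbarWeight hcET (by norm_num), add_zero]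
  have hqP : bipart 2 2 (normSq * P) = normSq * P :=
    bipart_of_mem_homog (normSq_mul_mem_homog_zWeight hPz) (normSq_mul_mem_homog_zbarWeight hPzb)
  refine ⟨_, hT, ?_, ?_⟩
  · rw [key]
    exact add_mem h2 (sub_mem hR2 (homog_le_fil (normSq_mul_mem_homog_zbarWeight hPzb) le_rfl))
  · rw [key, bipart_add, bipart_sub, hR22, hqP, zero_sub, ← sub_eq_add_neg, tr_sub, hPtr, ht, sub_self]

end Normalization

/-! ### A real linear system involving the torsion -/

section ConjugateLinear

variable {n : ℕ} {α : Fin n → Fin n → ℂ}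

/-- Pairing the left hand side with v gives Σ |v_l|², because the antisymmetric form α vanishes on
(v, v). The real linear map is therefore injective, hence surjective. The constant i/3 is the one
that arises in bidegree (3, 2). -/
theorem exists_star_add_solution (hα : ∀ k l, α k l = -α l k) :
    ∃ g : (Fin n → ℂ) → (Fin n → ℂ), g 0 = 0 ∧
      ∀ d l, star (g d l) + Complex.I / 3 * ∑ k, α k l * g d k = d l := by
  set Λ : (Fin n → ℂ) →ₗ[ℝ] (Fin n → ℂ) :=
    { toFun := fun v l => star (v l) + Complex.I / 3 * ∑ k, α k l * v k
      map_add' := fun v w => by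
        funext l
        simp only [Pi.add_apply, star_add, mul_add, Finset.sum_add_distrib]
        ring
      map_smul' := fun c v => by
        funext l
        simp only [Pi.smul_apply, Complex.real_smul, star_mul', RingHom.id_apply,
          Complex.star_def, Complex.conj_ofReal, mul_add, Finset.mul_sum]
        congr 1
        exact Finset.sum_congr rfl fun _ _ => by ring } with hΛ
  have hΛa : ∀ v l, Λ v l = star (v l) + Complex.I / 3 * ∑ k, α k l * v k := fun _ _ => rfl
  have hinj : Function.Injective Λ := by
    rw [← LinearMap.ker_eq_bot, LinearMap.ker_eq_bot']
    intro v hv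
    have h0 : ∑ l, v l * Λ v l = 0 := by simp [hv]
    have h1 : ∑ l, ∑ k, α k l * v k * v l = 0 := by
      have : ∑ l, ∑ k, α k l * v k * v l = -∑ l, ∑ k, α k l * v k * v l := by
        conv_lhs => rw [Finset.sum_comm]
        simp only [← Finset.sum_neg_distrib]
        exact Finset.sum_congr rfl fun k _ => Finset.sum_congr rfl fun l _ => by
          rw [hα k l]; ring
      linear_combination this / 2
    have h2 : ∑ l, v l * Λ v l = ((∑ l, Complex.normSq (v l) : ℝ) : ℂ) := by
      simp only [hΛa, mul_add, Finset.sum_add_distrib]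
      have : ∑ l, v l * (Complex.I / 3 * ∑ k, α k l * v k)
          = Complex.I / 3 * ∑ l, ∑ k, α k l * v k * v l := by
        simp only [Finset.mul_sum]
        exact Finset.sum_congr rfl fun _ _ => Finset.sum_congr rfl fun _ _ => by ring
      rw [this, h1, mul_zero, add_zero, Complex.ofReal_sum]
      exact Finset.sum_congr rfl fun l _ => Complex.mul_conj _
    rw [h0, eq_comm, Complex.ofReal_eq_zero,
      Finset.sum_eq_zero_iff_of_nonneg fun l _ => Complex.normSq_nonneg _] at h2
    funext l
    exact Complex.normSq_eq_zero.mp (h2 l (Finset.mem_univ _))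
  have hsurj := LinearMap.injective_iff_surjective.mp hinj
  choose g hg using hsurj
  exact ⟨g, hinj (by rw [hg, map_zero]), fun d l => congrFun (hg d) l⟩

theorem mapDomain_swap_of_mem {m : Var n →₀ ℕ} (hz : zDegree m = 0) (hzb : zbarDegree m = 0) :
    m.mapDomain Var.swap = m := by
  ext v
  rw [mapDomain_swap_apply]
  have h1 := Finset.sum_eq_zero_iff.mp hz
  have h2 := Finset.sum_eq_zero_iff.mp hzb
  rcases v with j | j | j
  · exact (h2 j (Finset.mem_univ _)).trans (h1 j (Finset.mem_univ _)).symm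
  · exact (h1 j (Finset.mem_univ _)).trans (h2 j (Finset.mem_univ _)).symm
  · rfl

/-- For series in u alone, conjugation acts on each coefficient separately, so the system is solved
coefficient by coefficient. Since zero data give the zero solution, weights and vanishing are
inherited. -/
theorem exists_cj_add_solution (hα : ∀ k l, α k l = -α l k) {d : Fin n → GraphSeries n}
    (hz : ∀ l, d l ∈ homog zWeight 0) (hzb : ∀ l, d l ∈ homog zbarWeight 0) :
    ∃ b : Fin n → GraphSeries n, (∀ l, b l ∈ homog zWeight 0) ∧ (∀ l, b l ∈ homog zbarWeight 0) ∧
      (∀ k, (∀ l, d l ∈ fil cmWeight k) → ∀ l, b l ∈ fil cmWeight k) ∧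
      ∀ l, cj (b l) + C (Complex.I / 3) * ∑ k, C (α k l) * b k = d l := by
  obtain ⟨g, hg0, hg⟩ := exists_star_add_solution hα
  set b : Fin n → GraphSeries n := fun l m => g (fun l' => coeff m (d l')) l with hb
  have hbc : ∀ l m, coeff m (b l) = g (fun l' => coeff m (d l')) l := fun _ _ => rfl
  have hb0 : ∀ m, (∀ l, coeff m (d l) = 0) → ∀ l, coeff m (b l) = 0 := by
    intro m h l
    rw [hbc, show (fun l' => coeff m (d l')) = 0 from funext h, hg0]; rfl
  refine ⟨b, fun l m hm => hb0 m (fun l => hz l m hm) l, fun l m hm => hb0 m (fun l => hzb l m hm) l,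
    fun k hk l m hm => hb0 m (fun l => hk l m hm) l, fun l => ?_⟩
  ext m
  rw [map_add, coeff_cj, coeff_C_mul, map_sum]
  simp only [coeff_C_mul]
  have hbz : ∀ m', zDegree m' ≠ 0 ∨ zbarDegree m' ≠ 0 → ∀ l, coeff m' (b l) = 0 := by
    rintro m' (h | h)
    · exact hb0 m' fun l => hz l m' (by rwa [weight_zWeight])
    · exact hb0 m' fun l => hzb l m' (by rwa [weight_zbarWeight])
  by_cases h : zDegree m = 0 ∧ zbarDegree m = 0
  · rw [mapDomain_swap_of_mem h.1 h.2]
    simp only [hbc]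
    exact hg _ _
  · have h' : zDegree m ≠ 0 ∨ zbarDegree m ≠ 0 := by tauto
    have hd : coeff m (d l) = 0 := by
      rcases h' with h | h
      · exact hz l m (by rwa [weight_zWeight])
      · exact hzb l m (by rwa [weight_zbarWeight])
    have hs : zDegree (m.mapDomain Var.swap) = zbarDegree m := by
      simp only [zDegree, zbarDegree, mapDomain_swap_apply]; rfl
    have hs' : zbarDegree (m.mapDomain Var.swap) = zDegree m := by
      simp only [zDegree, zbarDegree, mapDomain_swap_apply]; rfl
    rw [hbz _ (by rw [hs, hs']; exact h'.symm), hd]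
    simp only [hbz m h', mul_zero, Finset.sum_const_zero, star_zero, add_zero]

end ConjugateLinear

/-! ### Normalization in bidegree (3, 2) -/

section Normalization

variable {n : ℕ} {α : Fin n → Fin n → ℂ} {k : ℕ} {ψ : GraphSeries n}

theorem imPart_two_I_mul (f : GraphSeries n) : imPart (2 * (C Complex.I * f)) = reTwice f := by
  simp only [reTwice, imPart, map_mul, cj_C, map_ofNat, Complex.star_def, Complex.conj_I, map_neg]
  linear_combination (C Complex.I * (f + cj f)) * C_neg_I_div_two (σ := Var n)
    - (f + cj f) * C_I_mul_C_I (σ := Var n)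

theorem C_one_half_mul {σ : Type*} : (2 * C (1 / 2 : ℂ) : MvPowerSeries σ ℂ) = 1 := by
  rw [← map_ofNat (C : ℂ →+* MvPowerSeries σ ℂ) 2, ← map_mul]; norm_num

theorem C_I_div_three {σ : Type*} : (3 * C (Complex.I / 3) : MvPowerSeries σ ℂ) = C Complex.I := by
  rw [← map_ofNat (C : ℂ →+* MvPowerSeries σ ℂ) 3, ← map_mul]
  congr 1; ring

theorem C_neg_one_div_two {σ : Type*} : (C (-1 / 2 : ℂ) : MvPowerSeries σ ℂ) = -C (1 / 2) := by
  rw [← map_neg]; congr 1; ring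

theorem shift_sub_three_mem_fil {w : Var n → ℕ} (hu : w Var.u = 0)
    (hw : (normSq : GraphSeries n) ∈ fil w 1) {a : ℕ} {f : GraphSeries n}
    (hf0 : f ∈ homog zbarWeight 0) (hf : f ∈ fil w a) :
    shift f - (f + C Complex.I * normSq * du f - C (1 / 2) * normSq ^ 2 * du (du f))
      ∈ fil w (a + 3) := by
  have := shift_sub_sum_mem_fil hu hw 3 hf0 hf
  convert this using 2
  simp [Finset.sum_range_succ, C_neg_one_div_two]
  ring

/-- A change of the transversal curve with velocities b_j(u), accompanied by terms that cancel
everything up to bidegree (2, 2). In bidegree (3, 2) there remains |z|⁴ℓ with ℓ linear in z. Up to a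
factor, prescribing ℓ is the system v̄ + (i/3) αᵗ v = d for the second derivatives of b. -/
theorem exists_adjustment_tr32 (hα : ∀ k l, α k l = -α l k)
    (hk : ψ ∈ fil cmWeight (k + 1)) :
    ∃ δ, IsAdjustment α k δ ∧ δ ∈ fil zbarWeight 2 ∧ bipart 2 2 δ = 0 ∧
      tr (tr (bipart 3 2 (ψ + δ))) = 0 := by
  set κ := tr (tr (bipart 3 2 ψ)) with hκ
  have hκz : κ ∈ homog zWeight 1 :=
    tr_mem_homog_zWeight (tr_mem_homog_zWeight (bipart_mem_homog_zWeight _ _ _))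
  have hκzb : κ ∈ homog zbarWeight 0 :=
    tr_mem_homog_zbarWeight (tr_mem_homog_zbarWeight (bipart_mem_homog_zbarWeight _ _ _))
  have hκk : κ ∈ fil cmWeight (k + 1 - 2 - 2) :=
    tr_mem_fil_cmWeight (tr_mem_fil_cmWeight (bipart_mem_fil 3 2 hk))
  set c : ℂ := 1 / (4 * ((n + 2) * (n + 1))) with hc
  set d : Fin n → GraphSeries n := fun l => C c * pderiv ℂ (Var.z l) κ with hd
  obtain ⟨β, hβz, hβzb, hβk, hβ⟩ := exists_cj_add_solution hα (d := d)
    (fun l => C_mul_mem_homog _ (pderiv_mem_homog hκz _ rfl))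
    (fun l => C_mul_mem_homog _ (pderiv_mem_homog hκzb _ rfl))
  have hβk' := hβk (k + 1 - 2 - 2 - 1) fun l => C_mul_mem_fil _ (pderiv_mem_fil hκk _ (by simp))
  -- β is the second u-derivative of b, the one that occurs in bidegree (3, 2); hence the two
  -- integrations.
  set b : Fin n → GraphSeries n := fun l => intU (intU (β l)) with hb
  have hbb : ∀ l, du (du (b l)) = β l := fun l => by simp only [hb, du_intU]
  have hbz : ∀ l, b l ∈ homog zWeight 0 := fun l => intU_mem_homog (intU_mem_homog (hβz l) rfl) rfl
  have hbzb : ∀ l, b l ∈ homog zbarWeight 0 := fun l =>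
    intU_mem_homog (intU_mem_homog (hβzb l) rfl) rfl
  have hbk : ∀ l, b l ∈ fil cmWeight k := fun l =>
    intU_mem_fil (intU_mem_fil (hβk' l) le_rfl) (by simp; omega)
  clear_value b
  have hcbz : ∀ l, cj (b l) ∈ homog zWeight 0 := fun l =>
    cj_mem_homog (fun v => (zbarWeight_swap v).symm) (hbzb l)
  have hcbzb : ∀ l, cj (b l) ∈ homog zbarWeight 0 := fun l =>
    cj_mem_homog (fun v => (zWeight_swap v).symm) (hbz l)
  set s := ∑ l, X (Var.z l) * cj (b l) with hs
  have hsz : s ∈ homog zWeight 1 :=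
    sum_mem fun l _ => mul_mem_homog (X_mem_homog _ _ rfl) (hcbz l) rfl
  have hszb : s ∈ homog zbarWeight 0 :=
    sum_mem fun l _ => mul_mem_homog (X_mem_homog _ _ rfl) (hcbzb l) rfl
  have hsk : s ∈ fil cmWeight (k + 1) := sum_mem fun l _ =>
    mul_mem_fil (X_mem_fil _ _ le_rfl) (cj_mem_fil_cmWeight (hbk l)) (by simp [add_comm])
  have hcs : cj s = ∑ l, X (Var.zbar l) * b l := by
    simp only [hs, map_sum, map_mul, cj_X, cj_cj]; rfl
  have hddu : ∀ (v : Var n) (g : Fin n → GraphSeries n), v ≠ Var.u → ∀ l,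
      du (X v * g l) = X v * du (g l) := by
    intro v g hv l
    rw [du_mul, show du (X v) = (0 : GraphSeries n) from pderiv_X_of_ne hv, mul_zero, add_zero]
  have hdcs : cj (du s) = ∑ l, X (Var.zbar l) * du (b l) := by
    rw [cj_du, hcs, map_sum]
    exact Finset.sum_congr rfl fun l _ => hddu _ b (by simp) l
  have hddcs : cj (du (du s)) = ∑ l, X (Var.zbar l) * du (du (b l)) := by
    rw [cj_du, hdcs, map_sum]
    exact Finset.sum_congr rfl fun l _ => hddu _ (fun l => du (b l)) (by simp) l
  clear_value s
  have hdsz : du s ∈ homog zWeight 1 := pderiv_mem_homog hsz _ rfl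
  have hdszb : du s ∈ homog zbarWeight 0 := pderiv_mem_homog hszb _ rfl
  have hdsk : du s ∈ fil cmWeight (k - 1) := pderiv_mem_fil hsk _ (by simp)
  set p := twist α b with hp
  have hpz : p ∈ homog zWeight 1 := twist_mem_homog α hbz (fun _ => rfl) rfl
  have hpzb : p ∈ homog zbarWeight 0 := twist_mem_homog α hbzb (fun _ => rfl) rfl
  have hpk : p ∈ fil cmWeight (k + 1) :=
    twist_mem_fil α (a := 1) hbk (fun _ => le_rfl) (by omega)
  have hddp : du (du p) = twist α β := by rw [hp, du_twist, du_twist]; simp only [hbb]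
  have hdpz : du p ∈ homog zWeight 1 := pderiv_mem_homog hpz _ rfl
  have hdpk : du p ∈ fil cmWeight (k - 1) := pderiv_mem_fil hpk _ (by simp)
  -- With the w-component 2is, the terms s and s̄ cancel. The extra term 2i z_j s_u turns the terms
  -- with |z|² into the purely imaginary i|z|²(s_u + s̄_u); being a multiple of z, it leaves the
  -- twist unchanged.
  set a : Fin n → GraphSeries n := fun j => b j + X (Var.z j) * (2 * (C Complex.I * du s)) with ha
  have htwa : twist α a = p := by rw [ha, twist_add, twist_X_mul hα, add_zero]
  clear_value p
  have h2 : ∀ {w : Var n → ℕ} {a : ℕ} {f : GraphSeries n}, f ∈ homog w a →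
      2 * (C Complex.I * f) ∈ homog w a := by
    intro w a f hf
    rw [← map_ofNat (C : ℂ →+* GraphSeries n) 2]
    exact C_mul_mem_homog _ (C_mul_mem_homog _ hf)
  have ha0 : ∀ j, a j ∈ homog zbarWeight 0 := fun j =>
    add_mem (hbzb j) (mul_mem_homog (X_mem_homog _ _ rfl) (h2 hdszb) rfl)
  have hak : ∀ j, a j ∈ fil cmWeight k := fun j => add_mem (hbk j)
    (mul_mem_fil (X_mem_fil _ _ le_rfl) (Ideal.mul_mem_left _ _ (C_mul_mem_fil _ hdsk))
      (by simp; omega))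
  set r : GraphSeries n := 4 * normSq ^ 2 * shift (du (C (1 / 2) * du p)) with hr
  have hddpz : du (C (1 / 2) * du p) ∈ fil zWeight 1 :=
    pderiv_mem_fil (C_mul_mem_fil _ (homog_le_fil hdpz le_rfl)) _ (by simp)
  have hrz : r ∈ fil zWeight 3 :=
    mul_mem_fil (Ideal.mul_mem_left _ _ (pow_mem_fil normSq_mem_fil_zWeight 2))
      (shift_mem_fil (k := 1) (mem_fil_zero _ _) hddpz) (by norm_num)
  have hrzb : r ∈ fil zbarWeight 2 :=
    Ideal.mul_mem_right _ _ (Ideal.mul_mem_left _ _ (fil_anti _ (by norm_num)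
      (pow_mem_fil normSq_mem_fil_zbarWeight 2)))
  have hrk : r ∈ fil cmWeight (k + 1) := by
    refine mul_mem_fil (Ideal.mul_mem_left _ _ (pow_mem_fil normSq_mem_fil_cmWeight 2))
      (shift_mem_fil normSq_mem_fil_cmWeight (pderiv_mem_fil (C_mul_mem_fil _ hdpk) _ le_rfl)) ?_
    simp only [cmWeight_u]; omega
  obtain ⟨T, eT, hT⟩ := exists_sphereEuler_eq (fil_anti _ (by norm_num) hrz)
  have hTz : T ∈ fil zWeight 3 := hT _ _ (mem_fil_zero _ _) hrz
  have hTzb : T ∈ fil zbarWeight 2 := hT _ _ (mem_fil_zero _ _) hrzb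
  -- Here x₀ = p and x₁ = p_u/2 explicitly, since p has z-degree one; the leading part of T is
  -- needed below.
  have hadj := (IsAdjustment.of_shift (α := α) (h2 hszb)
    (Ideal.mul_mem_left _ _ (C_mul_mem_fil _ hsk))).add
    (IsAdjustment.of_holomorphic hα ha0 hak hpzb hpk (C_mul_mem_homog (1 / 2) (pderiv_mem_homog hpzb
      _ rfl)) (C_mul_mem_fil _ hdpk) (hT _ _ normSq_mem_fil_cmWeight hrk)
      (by rw [htwa, euler_of_mem_homog hpz]; simp)
      (by
        rw [euler_of_mem_homog (C_mul_mem_homog (1 / 2) hdpz)]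
        linear_combination du p * C_one_half_mul (σ := Var n)) eT)
  -- the leading part of `T`
  have hT4 : 3 * T - 2 * normSq ^ 2 * du (du p) ∈ fil zWeight 4 := by
    have r1 := euler_sub_mem_fil hTz
    have r2 : C Complex.I * normSq * du T ∈ fil zWeight 4 :=
      mul_mem_fil (C_mul_mem_fil _ normSq_mem_fil_zWeight) (pderiv_mem_fil hTz _ le_rfl) (by simp)
    have r3 : 4 * normSq ^ 2 * (shift (du (C (1 / 2) * du p)) - du (C (1 / 2) * du p))
        ∈ fil zWeight 4 :=
      mul_mem_fil (Ideal.mul_mem_left _ _ (pow_mem_fil normSq_mem_fil_zWeight 2))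
        (shift_sub_mem_fil normSq_mem_fil_zWeight hddpz) (by norm_num)
    have := add_mem (sub_mem r3 (add_mem r1 r2)) (zero_mem (fil zWeight 4))
    convert this using 1
    rw [sphereEuler_apply, hr] at eT
    rw [pderiv_C_mul] at eT ⊢
    push_cast
    linear_combination eT + (2 * normSq ^ 2 * du (du p)) * C_one_half_mul (σ := Var n)
  set T' := 3 * T - 2 * normSq ^ 2 * du (du p) with hT'
  have hT'zb : T' ∈ fil zbarWeight 2 := sub_mem (Ideal.mul_mem_left _ _ hTzb)
    (Ideal.mul_mem_right _ _ (Ideal.mul_mem_left _ _ (fil_anti _ (by norm_num)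
      (pow_mem_fil normSq_mem_fil_zbarWeight 2))))
  clear_value r
  -- the remainders of the expansions
  set e₁ : GraphSeries n := ∑ j, X (Var.zbar j) * (shift (b j) -
    (b j + C Complex.I * normSq * du (b j) - C (1 / 2) * normSq ^ 2 * du (du (b j)))) with he₁
  have e1z : e₁ ∈ fil zWeight 3 := sum_mem fun j _ => Ideal.mul_mem_left _ _
    (shift_sub_three_mem_fil (a := 0) rfl normSq_mem_fil_zWeight (hbzb j) (mem_fil_zero _ _))
  have e1zb : e₁ ∈ fil zbarWeight 3 := sum_mem fun j _ => Ideal.mul_mem_left _ _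
    (shift_sub_three_mem_fil (a := 0) rfl normSq_mem_fil_zbarWeight (hbzb j) (mem_fil_zero _ _))
  have e1sum : ∑ j, X (Var.zbar j) * shift (b j) = e₁ + cj s + C Complex.I * normSq * cj (du s)
      - C (1 / 2) * normSq ^ 2 * cj (du (du s)) := by
    rw [hcs, hdcs, hddcs, he₁, Finset.mul_sum, Finset.mul_sum, ← Finset.sum_add_distrib,
      ← Finset.sum_add_distrib, ← Finset.sum_sub_distrib]
    exact Finset.sum_congr rfl fun _ _ => by ring
  clear_value e₁
  set e₂ := shift (du s) - (du s + C Complex.I * normSq * du (du s)) with he₂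
  have e2z : e₂ ∈ fil zWeight 2 := by
    have := shift_sub_sum_mem_fil rfl normSq_mem_fil_zWeight 2 hdszb (mem_fil_zero _ _)
    simpa [Finset.sum_range_succ] using this
  have e2zb : e₂ ∈ fil zbarWeight 2 := by
    have := shift_sub_sum_mem_fil rfl normSq_mem_fil_zbarWeight 2 hdszb (mem_fil_zero _ _)
    simpa [Finset.sum_range_succ] using this
  set e₃ := shift s - (s + C Complex.I * normSq * du s - C (1 / 2) * normSq ^ 2 * du (du s)) with he₃
  have e3z : e₃ ∈ fil zWeight 3 :=
    shift_sub_three_mem_fil (a := 0) rfl normSq_mem_fil_zWeight hszb (mem_fil_zero _ _)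
  have e3zb : e₃ ∈ fil zbarWeight 3 :=
    shift_sub_three_mem_fil (a := 0) rfl normSq_mem_fil_zbarWeight hszb (mem_fil_zero _ _)
  set E := e₁ + 2 * C Complex.I * (normSq * e₂) - e₃ with hE
  have hEz : E ∈ fil zWeight 3 := sub_mem (add_mem e1z (Ideal.mul_mem_left _ _
    (mul_mem_fil normSq_mem_fil_zWeight e2z (by norm_num)))) e3z
  have hEzb : E ∈ fil zbarWeight 3 := sub_mem (add_mem e1zb (Ideal.mul_mem_left _ _
    (mul_mem_fil normSq_mem_fil_zbarWeight e2zb (by norm_num)))) e3zb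
  -- The term s_uu comes from the second order Taylor terms. The term (i/3) p_uu comes from T, where
  -- 3T = 2|z|⁴ p_uu up to z-order 4; the 3 is the z-degree of this leading part.
  set ℓ := -(2 * (du (du s) + C (Complex.I / 3) * du (du p))) with hℓ
  have hℓz : ℓ ∈ homog zWeight 1 := by
    rw [hℓ, ← map_ofNat (C : ℂ →+* GraphSeries n) 2]
    exact neg_mem (C_mul_mem_homog _ (add_mem (pderiv_mem_homog hdsz _ rfl)
      (C_mul_mem_homog _ (pderiv_mem_homog hdpz _ rfl))))
  have hℓzb : ℓ ∈ homog zbarWeight 0 := by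
    rw [hℓ, ← map_ofNat (C : ℂ →+* GraphSeries n) 2]
    exact neg_mem (C_mul_mem_homog _ (add_mem (pderiv_mem_homog hdszb _ rfl)
      (C_mul_mem_homog _ (pderiv_mem_homog (pderiv_mem_homog hpzb _ rfl) _ rfl))))
  set lam := normSq * (normSq * ℓ) with hlam
  have hlz : lam ∈ homog zWeight 3 := normSq_mul_mem_homog_zWeight (normSq_mul_mem_homog_zWeight hℓz)
  have hlzb : lam ∈ homog zbarWeight 2 :=
    normSq_mul_mem_homog_zbarWeight (normSq_mul_mem_homog_zbarWeight hℓzb)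
  set R := cj lam + E + cj E - cj (C (Complex.I / 3) * T') with hR
  have key : -imPart (shift (2 * (C Complex.I * s)))
      + reTwice (∑ j, X (Var.zbar j) * shift (a j) - C Complex.I * T)
      = lam - C (Complex.I / 3) * T' + R := by
    have h1 : ∑ j, X (Var.zbar j) * shift (a j) = ∑ j, X (Var.zbar j) * shift (b j)
        + 2 * C Complex.I * normSq * shift (du s) := by
      rw [normSq, Finset.mul_sum, Finset.sum_mul, ← Finset.sum_add_distrib]
      refine Finset.sum_congr rfl fun j _ => ?_
      simp only [ha, map_add, map_mul, shift_X_z, shift_C, map_ofNat]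
      ring
    rw [h1, e1sum, map_mul, map_mul, shift_C, map_ofNat, imPart_two_I_mul]
    have h2 : shift (du s) = e₂ + (du s + C Complex.I * normSq * du (du s)) := by rw [he₂]; ring
    have h3 : shift s
        = e₃ + (s + C Complex.I * normSq * du s - C (1 / 2) * normSq ^ 2 * du (du s)) := by
      rw [he₃]; ring
    rw [h2, h3, hR, hE, hlam, hℓ, hT']
    clear_value e₂ e₃
    have hst : star (1 / 2 : ℂ) = 1 / 2 := by simp
    have hst3 : star (Complex.I / 3) = -(Complex.I / 3) := by
      simp [neg_div]
    simp only [reTwice, map_add, map_sub, map_mul, map_neg, cj_C, cj_cj, cj_normSq, map_ofNat,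
      map_pow, hst, hst3, Complex.star_def, Complex.conj_I]
    linear_combination (2 * normSq ^ 2 * (du (du s) + cj (du (du s)))) * C_I_mul_C_I (σ := Var n)
      + (T - cj T) * C_I_div_three (σ := Var n)
  have hcl : cj lam ∈ fil zbarWeight 3 := cj_mem_fil_zbarWeight (homog_le_fil hlz le_rfl)
  have hR3 : R ∈ fil zbarWeight 3 := sub_mem (add_mem (add_mem hcl hEzb)
    (cj_mem_fil_zbarWeight hEz)) (fil_anti _ (by norm_num)
      (cj_mem_fil_zbarWeight (C_mul_mem_fil _ hT4)))
  have hT4' := C_mul_mem_fil (Complex.I / 3) hT4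
  refine ⟨_, hadj, ?_, ?_, ?_⟩
  · rw [key]
    exact add_mem (sub_mem (homog_le_fil hlzb le_rfl) (C_mul_mem_fil _ hT'zb))
      (fil_anti _ (by norm_num) hR3)
  · rw [key, bipart_add, bipart_sub, bipart_of_mem_fil_zWeight (homog_le_fil hlz le_rfl)
      (by norm_num), bipart_of_mem_fil_zWeight hT4' (by norm_num),
      bipart_of_mem_fil_zbarWeight hR3 (by norm_num)]
    ring
  · rw [key, bipart_add, bipart_add, bipart_sub, bipart_of_mem_homog hlz hlzb,
      bipart_of_mem_fil_zWeight hT4' (by norm_num), bipart_of_mem_fil_zbarWeight hR3 (by norm_num),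
      sub_zero, add_zero, tr_add, tr_add, ← hκ, hlam,
      tr_normSq_mul_of_mem_homog (normSq_mul_mem_homog_zWeight hℓz)
        (normSq_mul_mem_homog_zbarWeight hℓzb),
      tr_normSq_mul_of_mem_homog hℓz hℓzb, tr_of_mem_homog hℓzb, tr_add, tr_C_mul,
      tr_normSq_mul_of_mem_homog hℓz hℓzb, tr_of_mem_homog hℓzb]
    have h3 : tr (normSq * (C ((n : ℂ) + (1 : ℕ) + (0 : ℕ)) * ℓ + normSq * 0))
        = C ((n : ℂ) + (1 : ℕ) + (0 : ℕ)) * (C ((n : ℂ) + (1 : ℕ) + (0 : ℕ)) * ℓ) := by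
      rw [mul_zero, add_zero, mul_left_comm, tr_C_mul, tr_normSq_mul_of_mem_homog hℓz hℓzb,
        tr_of_mem_homog hℓzb, mul_zero, add_zero]
    rw [h3]
    -- This is the choice of β: the coefficient of z_l in s_uu + (i/3) p_uu is the left hand side of
    -- the system.
    have h4 : ℓ = -(2 * (C c * κ)) := by
      have hek : ∑ l, X (Var.z l) * d l = C c * κ := by
        have : euler κ = κ := by rw [euler_of_mem_homog hκz]; simp
        conv_rhs => rw [← this, euler_apply, Finset.mul_sum]
        exact Finset.sum_congr rfl fun _ _ => by simp only [hd]; ring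
      have hss : du (du s) = ∑ l, X (Var.z l) * cj (β l) := by
        have := congrArg cj hddcs
        rw [cj_cj] at this
        rw [this]
        simp only [map_sum, map_mul, cj_X, hbb]; rfl
      have htw : twist α β = ∑ l, X (Var.z l) * ∑ k, C (α k l) * β k := by
        rw [twist, Finset.sum_comm]
        simp only [Finset.mul_sum]
        exact Finset.sum_congr rfl fun _ _ => Finset.sum_congr rfl fun _ _ => by ring
      rw [hℓ, hddp, ← hek, hss, htw, Finset.mul_sum, ← Finset.sum_add_distrib]
      congr 2
      refine Finset.sum_congr rfl fun l _ => ?_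
      rw [← hβ l]; ring
    have h5 : ((C ((n : ℂ) + (2 : ℕ) + (1 : ℕ)) + C ((n : ℂ) + (1 : ℕ) + (0 : ℕ)))
        * C ((n : ℂ) + (1 : ℕ) + (0 : ℕ)) * (2 * C c) : GraphSeries n) = 1 := by
      rw [← map_ofNat (C : ℂ →+* GraphSeries n) 2, ← map_add, ← map_mul, ← map_mul, ← map_mul,
        ← map_one (C : ℂ →+* GraphSeries n), hc]
      congr 1
      have h6 : ((n : ℂ) + 1) ≠ 0 := Nat.cast_add_one_ne_zero n
      have h7 : ((n : ℂ) + 2) ≠ 0 := by exact_mod_cast (by omega : n + 2 ≠ 0)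
      push_cast
      field_simp
      ring
    rw [h4]
    linear_combination (-κ) * h5

end Normalization

/-! ### Bidegree (3, 3) and the solution of the linearized equations -/

section Normalization

variable {n : ℕ} {α : Fin n → Fin n → ℂ} {k : ℕ} {ψ : GraphSeries n}

theorem shift_sub_four_mem_fil {w : Var n → ℕ} (hu : w Var.u = 0)
    (hw : (normSq : GraphSeries n) ∈ fil w 1) {f : GraphSeries n} (hf0 : f ∈ homog zbarWeight 0) :
    shift f - (f + C Complex.I * normSq * du f - C (1 / 2) * normSq ^ 2 * du (du f)
      - C (Complex.I / 6) * normSq ^ 3 * du (du (du f))) ∈ fil w 4 := by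
  have := shift_sub_sum_mem_fil hu hw 4 hf0 (mem_fil_zero w f)
  rw [zero_add] at this
  convert this using 2
  have h : (C (-Complex.I / 6) : GraphSeries n) = -C (Complex.I / 6) := by
    rw [← map_neg]; congr 1; ring
  simp [Finset.sum_range_succ, C_neg_one_div_two, Nat.factorial, Complex.I_pow_three, h]
  ring

/-- A reparametrization ρ(u) of the transversal curve, with a_j = z_j ρ_u/2 so that the terms with
|z|² cancel. What remains is -(1/3)|z|⁶ ρ_uuu, because 1/6 - 1/2 = -1/3. The twist vanishes since a
is a multiple of z. -/
theorem exists_adjustment_tr33 (hα : ∀ k l, α k l = -α l k) (hr : cj ψ = ψ)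
    (hk : ψ ∈ fil cmWeight (k + 1)) :
    ∃ δ, IsAdjustment α k δ ∧ δ ∈ fil zbarWeight 3 ∧ tr (tr (tr (bipart 3 3 (ψ + δ)))) = 0 := by
  -- The constant below would divide by zero; for n = 0 the trace is an empty sum and nothing is to
  -- be done.
  by_cases hn : n = 0
  · subst hn
    refine ⟨-imPart (shift 0), IsAdjustment.of_shift (zero_mem _) (zero_mem _), ?_, by simp [tr]⟩
    simp [imPart]
  set κ := tr (tr (tr (bipart 3 3 ψ))) with hκ
  have hκz : κ ∈ homog zWeight 0 := tr_mem_homog_zWeight (tr_mem_homog_zWeight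
    (tr_mem_homog_zWeight (bipart_mem_homog_zWeight _ _ _)))
  have hκzb : κ ∈ homog zbarWeight 0 := tr_mem_homog_zbarWeight (tr_mem_homog_zbarWeight
    (tr_mem_homog_zbarWeight (bipart_mem_homog_zbarWeight _ _ _)))
  have hκk : κ ∈ fil cmWeight (k + 1 - 2 - 2 - 2) :=
    tr_mem_fil_cmWeight (tr_mem_fil_cmWeight (tr_mem_fil_cmWeight (bipart_mem_fil 3 3 hk)))
  have hκr : cj κ = κ := by rw [hκ, cj_tr, cj_tr, cj_tr, cj_bipart, hr]
  -- The triple trace of |z|⁶ is (3n + 6)(2n + 2)n; the 3 cancels the factor 1/3.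
  set c : ℂ := 3 / ((3 * n + 6) * (2 * n + 2) * n) with hc
  have hcr : star c = c := by simp [hc]
  set ρ := intU (intU (intU (C c * κ))) with hρ
  have hρ0 : ρ ∈ homog zbarWeight 0 := intU_mem_homog (intU_mem_homog (intU_mem_homog
    (C_mul_mem_homog _ hκzb) rfl) rfl) rfl
  have hρk : ρ ∈ fil cmWeight (k + 1) := intU_mem_fil (intU_mem_fil (intU_mem_fil
    (C_mul_mem_fil _ hκk) le_rfl) le_rfl) (by simp; omega)
  have hρr : cj ρ = ρ := by rw [hρ, cj_intU, cj_intU, cj_intU, map_mul, hκr, cj_C, hcr]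
  have hρ3 : du (du (du ρ)) = C c * κ := by rw [hρ, du_intU, du_intU, du_intU]
  clear_value ρ κ
  have hρ1 : du ρ ∈ homog zbarWeight 0 := pderiv_mem_homog hρ0 _ rfl
  have hadj := (IsAdjustment.of_shift (α := α) hρ0 hρk).add
    (IsAdjustment.of_holomorphic hα (a := fun j => X (Var.z j) * (C (1 / 2) * du ρ))
      (x₀ := 0) (x₁ := 0) (T := 0)
      (fun j => mul_mem_homog (X_mem_homog _ _ rfl) (C_mul_mem_homog _ hρ1) rfl)
      (fun j => mul_mem_fil (X_mem_fil _ _ le_rfl) (C_mul_mem_fil _ (pderiv_mem_fil hρk _ le_rfl))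
        (by simp; omega))
      (zero_mem _) (zero_mem _) (zero_mem _) (zero_mem _) (zero_mem _)
      (by rw [twist_X_mul hα, map_zero]) (by simp) (by simp))
  set e₁ := shift ρ - (ρ + C Complex.I * normSq * du ρ - C (1 / 2) * normSq ^ 2 * du (du ρ)
      - C (Complex.I / 6) * normSq ^ 3 * du (du (du ρ))) with he₁
  have e1z : e₁ ∈ fil zWeight 4 := shift_sub_four_mem_fil rfl normSq_mem_fil_zWeight hρ0
  have e1zb : e₁ ∈ fil zbarWeight 4 := shift_sub_four_mem_fil rfl normSq_mem_fil_zbarWeight hρ0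
  set e₂ := shift (du ρ) - (du ρ + C Complex.I * normSq * du (du ρ)
    - C (1 / 2) * normSq ^ 2 * du (du (du ρ))) with he₂
  have e2z : e₂ ∈ fil zWeight 3 :=
    shift_sub_three_mem_fil (a := 0) rfl normSq_mem_fil_zWeight hρ1 (mem_fil_zero _ _)
  have e2zb : e₂ ∈ fil zbarWeight 3 :=
    shift_sub_three_mem_fil (a := 0) rfl normSq_mem_fil_zbarWeight hρ1 (mem_fil_zero _ _)
  set R := reTwice (C (1 / 2) * (normSq * e₂)) - imPart e₁ with hR
  have hRzb : R ∈ fil zbarWeight 4 := by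
    refine sub_mem (add_mem (C_mul_mem_fil _ (mul_mem_fil normSq_mem_fil_zbarWeight e2zb
      (by norm_num))) (cj_mem_fil_zbarWeight (C_mul_mem_fil _ (mul_mem_fil normSq_mem_fil_zWeight
      e2z (by norm_num))))) (C_mul_mem_fil _ (sub_mem e1zb (cj_mem_fil_zbarWeight e1z)))
  set lam := normSq * (normSq * (normSq * (C c * κ))) with hlam
  have key : -imPart (shift ρ) + reTwice (∑ j, X (Var.zbar j) * shift (X (Var.z j) *
      (C (1 / 2) * du ρ)) - C Complex.I * 0) = R - C (1 / 3) * lam := by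
    have h1 : ∑ j, X (Var.zbar j) * shift (X (Var.z j) * (C (1 / 2) * du ρ))
        = C (1 / 2) * (normSq * shift (du ρ)) := by
      rw [normSq, Finset.sum_mul, Finset.mul_sum]
      refine Finset.sum_congr rfl fun j _ => ?_
      rw [map_mul, map_mul, shift_X_z, shift_C]; ring
    have h2 : shift (du ρ) = e₂ + (du ρ + C Complex.I * normSq * du (du ρ)
        - C (1 / 2) * normSq ^ 2 * du (du (du ρ))) := by rw [he₂]; ring
    have h3 : shift ρ = e₁ + (ρ + C Complex.I * normSq * du ρ - C (1 / 2) * normSq ^ 2 * du (du ρ)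
      - C (Complex.I / 6) * normSq ^ 3 * du (du (du ρ))) := by rw [he₁]; ring
    have hst : star (1 / 2 : ℂ) = 1 / 2 := by simp
    have hst6 : star (Complex.I / 6) = -(Complex.I / 6) := by simp [neg_div]
    have h16 : (C (-Complex.I / 2) * C (Complex.I / 6) : GraphSeries n) = C (1 / 12) := by
      rw [← map_mul]; congr 1
      linear_combination (-1 / 12) * Complex.I_mul_I
    have h17 : (C (-Complex.I / 2) * C Complex.I : GraphSeries n) = C (1 / 2) := by
      rw [← map_mul]; congr 1
      linear_combination (-1 / 2) * Complex.I_mul_I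
    have h18 : (2 * C (1 / 12) - C (1 / 2) * C (1 / 2) * 2 : GraphSeries n) = -C (1 / 3) := by
      rw [← map_ofNat (C : ℂ →+* GraphSeries n) 2, ← map_mul, ← map_mul, ← map_mul, ← map_sub,
        ← map_neg]
      congr 1; norm_num
    rw [h1, h2, h3, hR, hlam, ← hρ3]
    clear_value e₁ e₂
    simp only [reTwice, imPart, map_add, map_sub, map_mul, map_neg, cj_C, cj_normSq, mul_zero,
      map_pow, hst, hst6, Complex.star_def, Complex.conj_I, cj_du, hρr, map_zero]
    linear_combination (-2 * normSq * du ρ) * h17 + (2 * normSq ^ 3 * du (du (du ρ))) * h16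
      + (normSq ^ 3 * du (du (du ρ))) * h18
  have hcκz : C c * κ ∈ homog zWeight 0 := C_mul_mem_homog _ hκz
  have hcκzb : C c * κ ∈ homog zbarWeight 0 := C_mul_mem_homog _ hκzb
  have q1z := normSq_mul_mem_homog_zWeight hcκz
  have q1zb := normSq_mul_mem_homog_zbarWeight hcκzb
  have q2z := normSq_mul_mem_homog_zWeight q1z
  have q2zb := normSq_mul_mem_homog_zbarWeight q1zb
  have hlz : lam ∈ homog zWeight 3 := normSq_mul_mem_homog_zWeight q2z
  have hlzb : lam ∈ homog zbarWeight 3 := normSq_mul_mem_homog_zbarWeight q2zb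
  refine ⟨_, hadj, ?_, ?_⟩
  · rw [key]
    exact sub_mem (fil_anti _ (by norm_num) hRzb) (C_mul_mem_fil _ (homog_le_fil hlzb le_rfl))
  · have hn0 : (n : ℂ) ≠ 0 := Nat.cast_ne_zero.mpr hn
    have t1 : tr (normSq * (C c * κ)) = C (n : ℂ) * (C c * κ) := by
      rw [tr_normSq_mul_of_mem_homog hcκz hcκzb, tr_of_mem_homog hcκzb]; simp
    have t2 : tr (normSq * (normSq * (C c * κ))) = C (2 * n + 2 : ℂ) * (normSq * (C c * κ)) := by
      have h : (C ((n : ℂ) + (0 + 1 : ℕ) + (0 + 1 : ℕ)) + C (n : ℂ) : GraphSeries n)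
          = C (2 * n + 2 : ℂ) := by
        rw [← map_add]; congr 1; push_cast; ring
      rw [tr_normSq_mul_of_mem_homog q1z q1zb, t1]
      linear_combination (normSq * (C c * κ)) * h
    have t3 : tr lam = C (3 * n + 6 : ℂ) * (normSq * (normSq * (C c * κ))) := by
      have h : (C ((n : ℂ) + (0 + 1 + 1 : ℕ) + (0 + 1 + 1 : ℕ)) + C (2 * n + 2 : ℂ)
          : GraphSeries n) = C (3 * n + 6 : ℂ) := by
        rw [← map_add]; congr 1; push_cast; ring
      rw [hlam, tr_normSq_mul_of_mem_homog q2z q2zb, t2]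
      linear_combination (normSq * (normSq * (C c * κ))) * h
    rw [key, bipart_add, bipart_sub, bipart_of_mem_fil_zbarWeight hRzb (by norm_num),
      bipart_of_mem_homog (C_mul_mem_homog _ hlz) (C_mul_mem_homog _ hlzb), zero_sub,
      ← sub_eq_add_neg, tr_sub, tr_sub, tr_sub, ← hκ]
    simp only [tr_C_mul, t3, t2, t1]
    have h5 : (C (1 / 3) * (C (3 * n + 6 : ℂ) * (C (2 * n + 2 : ℂ) * (C (n : ℂ) * C c)))
        : GraphSeries n) = 1 := by
      simp only [← map_mul]
      rw [← map_one (C : ℂ →+* GraphSeries n), hc]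
      congr 1
      have h6 : ((n : ℂ) + 1) ≠ 0 := Nat.cast_add_one_ne_zero n
      have h7 : ((n : ℂ) + 2) ≠ 0 := by exact_mod_cast (by omega : n + 2 ≠ 0)
      rw [show (3 * (n : ℂ) + 6) = 3 * (n + 2) by ring, show (2 * (n : ℂ) + 2) = 2 * (n + 1) by ring]
      field_simp
    linear_combination (-κ) * h5

/-- Every real series can be brought to normal form by the changes induced by infinitesimal
coordinate changes. -/
theorem exists_adjustment (hα : ∀ k l, α k l = -α l k) (hr : cj ψ = ψ)
    (hk : ψ ∈ fil cmWeight (k + 1)) :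
    ∃ δ, IsAdjustment α k δ ∧ IsNormalRemainder (ψ + δ) := by
  have step : ∀ {ψ δ : GraphSeries n}, cj ψ = ψ → ψ ∈ fil cmWeight (k + 1) →
      IsAdjustment α k δ → cj (ψ + δ) = ψ + δ ∧ ψ + δ ∈ fil cmWeight (k + 1) :=
    fun h1 h2 h3 => ⟨by rw [map_add, h1, h3.cj_eq], add_mem h2 h3.mem_fil⟩
  -- Each step preserves what has been achieved: δ₃ and δ₄ keep z̄-order 2, δ₄ has no component of
  -- bidegree (2, 2), and δ₅ has z̄-order 3 and thus meets neither (2, 2) nor (3, 2).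
  obtain ⟨δ₁, a1, m1⟩ := exists_adjustment_zbar_one (α := α) hr hk
  obtain ⟨r1, k1⟩ := step hr hk a1
  obtain ⟨δ₂, a2, m2⟩ := exists_adjustment_zbar_two hα r1 k1 m1
  obtain ⟨r2, k2⟩ := step r1 k1 a2
  obtain ⟨δ₃, a3, m3, t3⟩ := exists_adjustment_tr22 hα r2 k2 m2
  obtain ⟨r3, k3⟩ := step r2 k2 a3
  obtain ⟨δ₄, a4, m4, b4, t4⟩ := exists_adjustment_tr32 hα k3
  obtain ⟨r4, k4⟩ := step r3 k3 a4
  obtain ⟨δ₅, a5, m5, t5⟩ := exists_adjustment_tr33 hα r4 k4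
  refine ⟨δ₁ + δ₂ + δ₃ + δ₄ + δ₅, (((a1.add a2).add a3).add a4).add a5, ?_⟩
  have e : ψ + (δ₁ + δ₂ + δ₃ + δ₄ + δ₅) = ψ + δ₁ + δ₂ + δ₃ + δ₄ + δ₅ := by ring
  rw [e]
  refine ⟨add_mem (add_mem m3 m4) (fil_anti _ (by norm_num) m5), ?_, ?_, t5⟩
  · rw [bipart_add, bipart_of_mem_fil_zbarWeight m5 (by norm_num), add_zero, bipart_add, b4,
      add_zero, t3]
  · rw [bipart_add, bipart_of_mem_fil_zbarWeight m5 (by norm_num), add_zero, t4]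

theorem IsNormalRemainder.add {ψ ψ' : GraphSeries n} (h : IsNormalRemainder ψ)
    (h' : IsNormalRemainder ψ') : IsNormalRemainder (ψ + ψ') where
  mem_fil := add_mem h.mem_fil h'.mem_fil
  tr22 := by rw [bipart_add, tr_add, h.tr22, h'.tr22, add_zero]
  tr32 := by rw [bipart_add, tr_add, tr_add, h.tr32, h'.tr32, add_zero]
  tr33 := by rw [bipart_add, tr_add, tr_add, tr_add, h.tr33, h'.tr33, add_zero]

theorem IsNormalRemainder.zero : IsNormalRemainder (0 : GraphSeries n) where
  mem_fil := zero_mem _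
  tr22 := by rw [bipart_of_mem_homog (zero_mem _) (zero_mem _)]; simp [tr_zero]
  tr32 := by rw [bipart_of_mem_homog (zero_mem _) (zero_mem _)]; simp [tr_zero]
  tr33 := by rw [bipart_of_mem_homog (zero_mem _) (zero_mem _)]; simp [tr_zero]

/-- The conditions are closed under formal limits. Each trace lowers the weight by at most 2, which
accounts for the shifts 2, 4, 6. -/
theorem IsNormalRemainder.of_forall
    (h : ∀ k, ∃ ψ', IsNormalRemainder ψ' ∧ ψ - ψ' ∈ fil cmWeight k) : IsNormalRemainder ψ := by
  refine ⟨fun m hm => ?_, ?_, ?_, ?_⟩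
  · obtain ⟨ψ', h1, h2⟩ := h (Finsupp.weight cmWeight m + 1)
    have := h2 m (Nat.lt_succ_self _)
    rwa [map_sub, h1.mem_fil m hm, sub_zero] at this
  · refine eq_zero_of_forall_mem_fil (w := cmWeight) fun k => ?_
    obtain ⟨ψ', h1, h2⟩ := h (k + 2)
    have := tr_mem_fil_cmWeight (bipart_mem_fil 2 2 h2)
    rwa [bipart_sub, tr_sub, h1.tr22, sub_zero] at this
  · refine eq_zero_of_forall_mem_fil (w := cmWeight) fun k => ?_
    obtain ⟨ψ', h1, h2⟩ := h (k + 4)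
    have := tr_mem_fil_cmWeight (tr_mem_fil_cmWeight (bipart_mem_fil 3 2 h2))
    rwa [bipart_sub, tr_sub, tr_sub, h1.tr32, sub_zero] at this
  · refine eq_zero_of_forall_mem_fil (w := cmWeight) fun k => ?_
    obtain ⟨ψ', h1, h2⟩ := h (k + 6)
    have := tr_mem_fil_cmWeight (tr_mem_fil_cmWeight (tr_mem_fil_cmWeight (bipart_mem_fil 3 3 h2)))
    rwa [bipart_sub, tr_sub, tr_sub, tr_sub, h1.tr33, sub_zero] at this

/-- The linearized equations are solvable with normalized `ψ`. -/
theorem exists_correction (hα : ∀ k l, α k l = -α l k) {r₁ : Fin n → GraphSeries n}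
    {r₂ : GraphSeries n} (hz₁ : ∀ j, r₁ j ∈ fil zWeight 1) (hk₁ : ∀ j, r₁ j ∈ fil cmWeight k)
    (hz₂ : r₂ ∈ fil zWeight 1) (hk₂ : r₂ ∈ fil cmWeight (k + 1)) :
    ∃ (f : Fin n → GraphSeries n) (g ψ : GraphSeries n), (∀ j, f j ∈ fil cmWeight k) ∧
      g ∈ fil cmWeight (k + 1) ∧ ψ ∈ fil cmWeight (k + 1) ∧ cj g = g ∧ cj ψ = ψ ∧
      IsNormalRemainder ψ ∧ (∀ j, sphereEuler (cj (f j)) = r₁ j) ∧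
      sphereEuler (g + C Complex.I * ψ - C Complex.I * reTwice (∑ j, X (Var.zbar j) * f j))
        + C Complex.I * ∑ j, X (Var.z j) * sphereEuler (cj (f j))
        - (twist α (fun j => sphereEuler (f j)) - twist α f) = r₂ := by
  have hqk := normSq_mem_fil_cmWeight (n := n)
  -- The first equations determine f up to the kernel: the conjugate of f_j may be taken to be V_j.
  choose V hV hV' using fun j => exists_sphereEuler_eq (hz₁ j)
  have hVk : ∀ j, cj (V j) ∈ fil cmWeight k := fun j =>
    cj_mem_fil_cmWeight (hV' j _ _ hqk (hk₁ j))
  have hpair : ∀ {F : Fin n → GraphSeries n}, (∀ j, F j ∈ fil cmWeight k) →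
      ∑ j, X (Var.zbar j) * F j ∈ fil cmWeight (k + 1) := fun hF => sum_mem fun j _ =>
    mul_mem_fil (X_mem_fil _ _ le_rfl) (hF j) (by simp [add_comm])
  -- With f = cj V inserted, the second equation becomes Y(g + iψ) = r for Y = `sphereEuler`; its
  -- solution H provides g and ψ as real and imaginary parts.
  set r := r₂ - C Complex.I * ∑ j, X (Var.z j) * r₁ j
    + (twist α (fun j => sphereEuler (cj (V j))) - twist α (fun j => cj (V j)))
    + sphereEuler (C Complex.I * reTwice (∑ j, X (Var.zbar j) * cj (V j))) with hr
  have tz : ∀ F : Fin n → GraphSeries n, twist α F ∈ fil zWeight 1 := fun F =>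
    twist_mem_fil α (a := 1) (fun j => mem_fil_zero _ _) (fun _ => le_rfl) le_rfl
  have tk : ∀ {F : Fin n → GraphSeries n}, (∀ j, F j ∈ fil cmWeight k) →
      twist α F ∈ fil cmWeight (k + 1) := fun hF =>
    twist_mem_fil α (a := 1) hF (fun _ => le_rfl) (by omega)
  have hrz : r ∈ fil zWeight 1 := add_mem (add_mem (sub_mem hz₂ (C_mul_mem_fil _ (sum_mem fun j _ =>
    Ideal.mul_mem_left _ _ (hz₁ j)))) (sub_mem (tz _) (tz _))) (sphereEuler_mem_fil_zWeight _)
  have hrk : r ∈ fil cmWeight (k + 1) := add_mem (add_mem (sub_mem hk₂ (C_mul_mem_fil _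
    (sum_mem fun j _ => mul_mem_fil (X_mem_fil _ _ le_rfl) (hk₁ j) (by simp [add_comm]))))
    (sub_mem (tk fun j => sphereEuler_mem_fil hqk (hVk j)) (tk hVk)))
    (sphereEuler_mem_fil hqk (C_mul_mem_fil _ (reTwice_mem_fil_cmWeight (hpair hVk))))
  obtain ⟨H, hH, hH'⟩ := exists_sphereEuler_eq hrz
  have hHk : H ∈ fil cmWeight (k + 1) := hH' _ _ hqk hrk
  -- The kernel elements F and G now normalize ψ = Im H without changing the right hand sides. The
  -- defining equation of an adjustment is what makes the twist terms of F cancel against Y(G).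
  obtain ⟨δ, ⟨F, G, hF, hG, hFe, hGe, rfl⟩, hδ⟩ :=
    exists_adjustment hα (cj_imPart H) (imPart_mem_fil_cmWeight hHk)
  have hhalf := C_one_half_mul (σ := Var n)
  refine ⟨fun j => cj (V j) + F j, C (1 / 2) * reTwice (H + G),
    imPart H + (imPart G + reTwice (∑ j, X (Var.zbar j) * F j)), fun j => add_mem (hVk j) (hF j),
    C_mul_mem_fil _ (reTwice_mem_fil_cmWeight (add_mem hHk hG)),
    add_mem (imPart_mem_fil_cmWeight hHk) (add_mem (imPart_mem_fil_cmWeight hG)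
      (reTwice_mem_fil_cmWeight (hpair hF))), ?_, ?_, hδ, fun j => ?_, ?_⟩
  · rw [map_mul, cj_reTwice, cj_C]; simp
  · rw [map_add, map_add, cj_imPart, cj_imPart, cj_reTwice]
  · rw [map_add, cj_cj, map_add, hV, hFe, add_zero]
  · have e1 : C (1 / 2) * reTwice (H + G)
        + C Complex.I * (imPart H + (imPart G + reTwice (∑ j, X (Var.zbar j) * F j)))
        - C Complex.I * reTwice (∑ j, X (Var.zbar j) * (cj (V j) + F j))
        = H + G - C Complex.I * reTwice (∑ j, X (Var.zbar j) * cj (V j)) := by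
      have h1 := add_imPart_eq (H + G)
      rw [imPart_add] at h1
      have h2 : ∑ j, X (Var.zbar j) * (cj (V j) + F j)
          = ∑ j, X (Var.zbar j) * cj (V j) + ∑ j, X (Var.zbar j) * F j := by
        rw [← Finset.sum_add_distrib]
        exact Finset.sum_congr rfl fun _ _ => by ring
      rw [h2, reTwice_add (∑ j, X (Var.zbar j) * cj (V j))]
      linear_combination C (1 / 2) * h1 + (H + G - C Complex.I * (imPart H + imPart G)) * hhalf
    have e2 : ∀ j, sphereEuler (cj (cj (V j) + F j)) = r₁ j := fun j => by
      rw [map_add, cj_cj, map_add, hV, hFe, add_zero]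
    have e3 : twist α (fun j => sphereEuler (cj (V j) + F j))
        = twist α (fun j => sphereEuler (cj (V j))) + twist α (fun j => sphereEuler (F j)) := by
      rw [← twist_add]; simp only [map_add]
    have e4 := sphereEuler_twist α F
    rw [e1, map_sub, map_add, hH, hGe, e3, twist_add, hr]
    simp only [e2]
    linear_combination e4

end Normalization

/-! ### The nonlinear equations and their linearization -/

section Iteration

variable {n : ℕ}

/-- The push-forward of the Euler field along the hypersurface `Im w = φ`, up to a factor. -/
def graphEuler (φ : GraphSeries n) : Derivation ℂ (GraphSeries n) (GraphSeries n) :=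
  (1 - C Complex.I * du φ) • euler + (C Complex.I * euler φ) • du

theorem graphEuler_apply (φ f : GraphSeries n) : graphEuler φ f
    = (1 - C Complex.I * du φ) * euler f + C Complex.I * euler φ * du f := rfl

theorem graphEuler_mem_fil_zWeight (φ f : GraphSeries n) : graphEuler φ f ∈ fil zWeight 1 :=
  add_mem (Ideal.mul_mem_left _ _ (euler_mem_fil_zWeight f))
    (Ideal.mul_mem_right _ _ (C_mul_mem_fil _ (euler_mem_fil_zWeight φ)))

theorem graphEuler_add_sub (φ ψ f : GraphSeries n) : graphEuler (φ + ψ) f - graphEuler φ f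
    = C Complex.I * euler ψ * du f - C Complex.I * du ψ * euler f := by
  simp only [graphEuler_apply, map_add]; ring

theorem graphEuler_add_sub_mem_fil (φ : GraphSeries n) {ψ f : GraphSeries n} {d a : ℕ}
    (hψ : ψ ∈ fil cmWeight (2 + d)) (hf : f ∈ fil cmWeight a) :
    graphEuler (φ + ψ) f - graphEuler φ f ∈ fil cmWeight (a + d) := by
  rw [graphEuler_add_sub]
  exact sub_mem (mul_mem_fil (C_mul_mem_fil _ (euler_mem_fil hψ))
    (pderiv_mem_fil (k := a - 2) hf _ le_rfl) (by omega))
    (mul_mem_fil (C_mul_mem_fil _ (pderiv_mem_fil (k := d) hψ _ (by simp [cmWeight])))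
      (euler_mem_fil hf) (by omega))

theorem graphEuler_normSq (f : GraphSeries n) : graphEuler normSq f = sphereEuler f := by
  rw [graphEuler_apply, sphereEuler_apply, du_normSq, euler_normSq]; ring

theorem graphEuler_sub_sphereEuler_mem_fil {ψ f : GraphSeries n} {a : ℕ}
    (hψ : ψ ∈ fil cmWeight 3) (hf : f ∈ fil cmWeight a) :
    graphEuler (normSq + ψ) f - sphereEuler f ∈ fil cmWeight (a + 1) := by
  rw [← graphEuler_normSq]
  exact graphEuler_add_sub_mem_fil _ (d := 1) hψ hf

theorem graphEuler_mem_fil {ψ f : GraphSeries n} {a : ℕ}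
    (hψ : ψ ∈ fil cmWeight 3) (hf : f ∈ fil cmWeight a) :
    graphEuler (normSq + ψ) f ∈ fil cmWeight a := by
  have h := add_mem (fil_anti _ (Nat.le_succ a) (graphEuler_sub_sphereEuler_mem_fil hψ hf))
    (sphereEuler_mem_fil normSq_mem_fil_cmWeight hf)
  rwa [sub_add_cancel] at h

/-- A candidate for a change of coordinates `(z, u) ↦ (z + f, u + g)` and for a hypersurface
`Im w = |z|² + ψ`. -/
structure Trial (n : ℕ) where
  /-- the change of `z` -/
  f : Fin n → GraphSeries n
  /-- the change of `u` -/
  g : GraphSeries n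
  /-- the higher order part of the defining series -/
  ψ : GraphSeries n

namespace Trial

/-- The change of coordinates. -/
def coord (t : Trial n) : Var n → GraphSeries n
  | Sum.inl j => X (Var.z j) + t.f j
  | Sum.inr (Sum.inl j) => X (Var.zbar j) + cj (t.f j)
  | Sum.inr (Sum.inr _) => X Var.u + t.g

/-- The sum of two candidates. -/
def add (t s : Trial n) : Trial n := ⟨fun j => t.f j + s.f j, t.g + s.g, t.ψ + s.ψ⟩

/-- The candidate is a deviation of order `k` from the identity and the sphere. -/
structure Small (t : Trial n) (k : ℕ) : Prop where
  f_mem : ∀ j, t.f j ∈ fil cmWeight (1 + k)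
  g_mem : t.g ∈ fil cmWeight (2 + k)
  ψ_mem : t.ψ ∈ fil cmWeight (2 + k)

/-- The candidate is real and normalized. -/
structure Normal (t : Trial n) : Prop where
  cj_g : cj t.g = t.g
  cj_ψ : cj t.ψ = t.ψ
  normal : IsNormalRemainder t.ψ

/-- The `z̄`-component of the defect along the Euler field. -/
def defectZbar (A : Fin n → Fin n → GraphSeries n) (t : Trial n) (j : Fin n) : GraphSeries n :=
  graphEuler (normSq + t.ψ) (t.coord (Var.zbar j))
    - ∑ k, subst t.coord (A j k) * graphEuler (normSq + t.ψ) (t.coord (Var.z k))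

/-- The `u`-component of the defect along the Euler field. -/
def defectU (B : Fin n → GraphSeries n) (t : Trial n) : GraphSeries n :=
  graphEuler (normSq + t.ψ) (t.coord Var.u)
    - ∑ k, subst t.coord (B k) * graphEuler (normSq + t.ψ) (t.coord (Var.z k))

variable {t s : Trial n} {k d : ℕ}

theorem Small.anti (h : t.Small k) (hd : d ≤ k) : t.Small d :=
  ⟨fun j => fil_anti _ (by omega) (h.f_mem j), fil_anti _ (by omega) h.g_mem,
    fil_anti _ (by omega) h.ψ_mem⟩

theorem Small.add (ht : t.Small k) (hs : s.Small k) : (t.add s).Small k :=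
  ⟨fun j => add_mem (ht.f_mem j) (hs.f_mem j), add_mem ht.g_mem hs.g_mem,
    add_mem ht.ψ_mem hs.ψ_mem⟩

theorem Normal.add (ht : t.Normal) (hs : s.Normal) : (t.add s).Normal :=
  ⟨by simp only [Trial.add, map_add, ht.cj_g, hs.cj_g],
    by simp only [Trial.add, map_add, ht.cj_ψ, hs.cj_ψ], ht.normal.add hs.normal⟩

theorem Small.coord_sub_X_mem_fil (h : t.Small k) (v : Var n) :
    t.coord v - X v ∈ fil cmWeight (cmWeight v + k) := by
  rcases v with j | j | j
  · change X (Var.z j) + t.f j - X (Var.z j) ∈ _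
    rw [add_sub_cancel_left]; exact h.f_mem j
  · change X (Var.zbar j) + cj (t.f j) - X (Var.zbar j) ∈ _
    rw [add_sub_cancel_left]; exact cj_mem_fil_cmWeight (h.f_mem j)
  · change X Var.u + t.g - X Var.u ∈ _
    rw [add_sub_cancel_left]; exact h.g_mem

theorem Small.coord_mem_fil (h : t.Small k) (v : Var n) : t.coord v ∈ fil cmWeight (cmWeight v) := by
  have := add_mem (fil_anti _ (Nat.le_add_right _ k) (h.coord_sub_X_mem_fil v))
    (X_mem_fil cmWeight v le_rfl)
  rwa [sub_add_cancel] at this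

theorem one_le_cmWeight (v : Var n) : 1 ≤ cmWeight v := by
  rcases v with j | j | j <;> simp [cmWeight]

theorem Small.hasSubst (h : t.Small k) : HasSubst t.coord :=
  hasSubst_of_mem_fil fun v => fil_anti _ (one_le_cmWeight v) (h.coord_mem_fil v)

theorem Small.subst_mem_fil (h : t.Small k) {a : ℕ} {A : GraphSeries n} (hA : A ∈ fil cmWeight a) :
    subst t.coord A ∈ fil cmWeight a :=
  QuasiCR.subst_mem_fil h.hasSubst h.coord_mem_fil hA

theorem coord_add_sub_mem_fil (hs : s.Small d) (v : Var n) :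
    (t.add s).coord v - t.coord v ∈ fil cmWeight (cmWeight v + d) := by
  rcases v with j | j | j
  · change X (Var.z j) + (t.f j + s.f j) - (X (Var.z j) + t.f j) ∈ _
    rw [add_sub_add_left_eq_sub, add_sub_cancel_left]; exact hs.f_mem j
  · change X (Var.zbar j) + cj (t.f j + s.f j) - (X (Var.zbar j) + cj (t.f j)) ∈ _
    rw [add_sub_add_left_eq_sub, map_add, add_sub_cancel_left]
    exact cj_mem_fil_cmWeight (hs.f_mem j)
  · change X Var.u + (t.g + s.g) - (X Var.u + t.g) ∈ _
    rw [add_sub_add_left_eq_sub, add_sub_cancel_left]; exact hs.g_mem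

theorem subst_add_sub_mem_fil (ht : t.Small k) (hs : s.Small d) (hts : (t.add s).Small k) {a : ℕ}
    {A : GraphSeries n} (hA : A ∈ fil cmWeight a) :
    subst (t.add s).coord A - subst t.coord A ∈ fil cmWeight (a + d) :=
  subst_sub_subst_mem_fil hts.hasSubst ht.hasSubst hts.coord_mem_fil ht.coord_mem_fil
    (coord_add_sub_mem_fil hs) hA

theorem add_ψ (t s : Trial n) : normSq + (t.add s).ψ = normSq + t.ψ + s.ψ := by
  simp only [add]; ring

theorem graphEuler_coord_add_sub_mem_fil (hs : s.Small d) (ht : t.Small 1)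
    (hts : (t.add s).Small 1) (v : Var n) :
    graphEuler (normSq + (t.add s).ψ) ((t.add s).coord v)
      - graphEuler (normSq + t.ψ) (t.coord v) ∈ fil cmWeight (cmWeight v + d) := by
  have h1 := graphEuler_mem_fil hts.ψ_mem (coord_add_sub_mem_fil (t := t) hs v)
  have h2 := graphEuler_add_sub_mem_fil (normSq + t.ψ) hs.ψ_mem (ht.coord_mem_fil v)
  rw [← add_ψ] at h2
  have := add_mem h1 h2
  rwa [map_sub, sub_add_sub_cancel] at this

/-- Relative to the leading weight 1 + d, the terms with `A` gain one weight because `A` has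
positive weight, and replacing the hypersurface by the model gains one more. Only the action of
`sphereEuler` on the conjugate of f remains. -/
theorem defectZbar_add_sub_mem_fil {A : Fin n → Fin n → GraphSeries n}
    (hA : ∀ j k, A j k ∈ fil cmWeight 1) (hs : s.Small d) (ht : t.Small 1)
    (hts : (t.add s).Small 1) (j : Fin n) :
    defectZbar A (t.add s) j - defectZbar A t j - sphereEuler (cj (s.f j))
      ∈ fil cmWeight (2 + d) := by
  have h1 : graphEuler (normSq + (t.add s).ψ) ((t.add s).coord (Var.zbar j))
      - graphEuler (normSq + t.ψ) (t.coord (Var.zbar j)) - sphereEuler (cj (s.f j))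
      ∈ fil cmWeight (2 + d) := by
    have e1 := graphEuler_sub_sphereEuler_mem_fil hts.ψ_mem (cj_mem_fil_cmWeight (hs.f_mem j))
    have e2 := graphEuler_add_sub_mem_fil (normSq + t.ψ) hs.ψ_mem
      (cj_mem_fil_cmWeight (ht.f_mem j))
    have e3 : graphEuler (normSq + (t.add s).ψ) (X (Var.zbar j))
        - graphEuler (normSq + t.ψ) (X (Var.zbar j)) = 0 := by
      simp only [graphEuler_apply, euler_X_zbar, du_X_zbar]; ring
    rw [← add_ψ] at e2
    have := add_mem (fil_anti _ (by omega : 2 + d ≤ _) e1) (fil_anti _ (by omega : 2 + d ≤ _) e2)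
    convert this using 1
    change graphEuler (normSq + (t.add s).ψ) (X (Var.zbar j) + cj (t.f j + s.f j))
      - graphEuler (normSq + t.ψ) (X (Var.zbar j) + cj (t.f j)) - sphereEuler (cj (s.f j)) = _
    simp only [map_add] at e3 ⊢
    linear_combination e3
  have h2 : ∑ k, subst (t.add s).coord (A j k) *
        graphEuler (normSq + (t.add s).ψ) ((t.add s).coord (Var.z k))
      - ∑ k, subst t.coord (A j k) * graphEuler (normSq + t.ψ) (t.coord (Var.z k))
      ∈ fil cmWeight (2 + d) := by
    rw [← Finset.sum_sub_distrib]
    refine sum_mem fun k _ => ?_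
    have e1 := mul_mem_fil (k := 2 + d) (subst_add_sub_mem_fil ht hs hts (hA j k))
      (graphEuler_mem_fil hts.ψ_mem (hts.coord_mem_fil (Var.z k))) (by simp [cmWeight]; omega)
    have e2 := mul_mem_fil (k := 2 + d) (ht.subst_mem_fil (hA j k))
      (graphEuler_coord_add_sub_mem_fil hs ht hts (Var.z k)) (by simp [cmWeight]; omega)
    have := add_mem e1 e2
    convert this using 1
    ring
  have := sub_mem h1 h2
  convert this using 1
  simp only [defectZbar]; ring

/-- The linearization of the `u`-component of the defect. -/
def defectULin (α : Fin n → Fin n → ℂ) (s : Trial n) : GraphSeries n :=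
  sphereEuler (s.g + C Complex.I * s.ψ - C Complex.I * reTwice (∑ j, X (Var.zbar j) * s.f j))
    + C Complex.I * ∑ j, X (Var.z j) * sphereEuler (cj (s.f j))
    - (twist α (fun j => sphereEuler (s.f j)) - twist α s.f)

/-- The right hand side is what direct linearization produces. Antisymmetry of α removes the product
of α with z_k z_l, and gathering the terms with z̄_j f_j and its conjugate into one real part gives
the form that is solved by `exists_correction`. -/
theorem defectULin_eq {α : Fin n → Fin n → ℂ} (hα : ∀ k l, α k l = -α l k) (s : Trial n) :
    defectULin α s = C Complex.I * euler s.ψ + sphereEuler s.g - ∑ k,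
      ((C Complex.I * cj (s.f k) + ∑ l, C (α k l) * s.f l) * X (Var.z k)
      + (C Complex.I * X (Var.zbar k) + ∑ l, C (α k l) * X (Var.z l))
        * (sphereEuler (s.f k) - C Complex.I * du s.ψ * X (Var.z k))) := by
  have h1 : ∑ k, (∑ l, C (α k l) * s.f l) * X (Var.z k) = -twist α s.f := by
    rw [twist, Finset.sum_comm' (t' := Finset.univ) (s' := fun _ => Finset.univ) (by simp),
      ← Finset.sum_neg_distrib]
    refine Finset.sum_congr rfl fun k _ => ?_
    rw [Finset.sum_mul, ← Finset.sum_neg_distrib]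
    refine Finset.sum_congr rfl fun l _ => ?_
    rw [hα k l, map_neg]; ring
  have h2 : ∑ k, (∑ l, C (α k l) * X (Var.z l)) * sphereEuler (s.f k)
      = twist α fun j => sphereEuler (s.f j) := by
    rw [twist]
    exact Finset.sum_congr rfl fun k _ => by rw [Finset.sum_mul]
  have h3 : ∑ k, (∑ l, C (α k l) * X (Var.z l)) * (C Complex.I * du s.ψ * X (Var.z k)) = 0 := by
    have := twist_X_mul hα (C Complex.I * du s.ψ)
    rw [twist] at this
    rw [← this]
    refine Finset.sum_congr rfl fun k _ => ?_
    rw [Finset.sum_mul]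
    exact Finset.sum_congr rfl fun l _ => by ring
  have h4 : sphereEuler (reTwice (∑ j, X (Var.zbar j) * s.f j))
      = ∑ j, X (Var.zbar j) * sphereEuler (s.f j) + ∑ j, X (Var.z j) * cj (s.f j)
        + ∑ j, X (Var.z j) * sphereEuler (cj (s.f j)) := by
    simp only [reTwice, map_sum, map_add, map_mul, cj_X, sphereEuler_mul, Var.swap,
      sphereEuler_X_zbar, sphereEuler_X_z, ← Finset.sum_add_distrib]
    exact Finset.sum_congr rfl fun k _ => by ring
  have h5 : ∑ k, X (Var.zbar k) * (du s.ψ * X (Var.z k)) = normSq * du s.ψ := by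
    rw [normSq, Finset.sum_mul]
    exact Finset.sum_congr rfl fun k _ => by ring
  have h6 : ∑ k, ((C Complex.I * cj (s.f k) + ∑ l, C (α k l) * s.f l) * X (Var.z k)
      + (C Complex.I * X (Var.zbar k) + ∑ l, C (α k l) * X (Var.z l))
        * (sphereEuler (s.f k) - C Complex.I * du s.ψ * X (Var.z k)))
      = C Complex.I * ∑ k, X (Var.z k) * cj (s.f k) - twist α s.f
        + C Complex.I * ∑ k, X (Var.zbar k) * sphereEuler (s.f k)
        + (twist α fun j => sphereEuler (s.f j)) - C Complex.I * C Complex.I * (normSq * du s.ψ) := by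
    rw [← sub_zero (_ - _ * _ * _), ← h3, ← h2, ← h5, sub_eq_add_neg _ (twist α s.f), ← h1]
    simp only [Finset.mul_sum, ← Finset.sum_add_distrib, ← Finset.sum_sub_distrib]
    exact Finset.sum_congr rfl fun k _ => by ring
  rw [h6, defectULin, map_sub, map_add, sphereEuler_C_mul, sphereEuler_C_mul, h4,
    sphereEuler_apply s.ψ]
  ring

/-- In contrast to `A`, the components `B` have a linear part of weight 1, so first order variations
of both factors in B_k · Y(z_k) contribute to the linearization. -/
theorem defectU_add_sub_mem_fil {α : Fin n → Fin n → ℂ} (hα : ∀ k l, α k l = -α l k)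
    {B : Fin n → GraphSeries n}
    (hB : ∀ k, B k - C Complex.I * X (Var.zbar k) - ∑ l, C (α k l) * X (Var.z l) ∈ fil cmWeight 2)
    (hs : s.Small d) (ht : t.Small 1) (hts : (t.add s).Small 1) :
    defectU B (t.add s) - defectU B t - defectULin α s ∈ fil cmWeight (3 + d) := by
  have h1 : graphEuler (normSq + (t.add s).ψ) ((t.add s).coord Var.u)
      - graphEuler (normSq + t.ψ) (t.coord Var.u) - (C Complex.I * euler s.ψ + sphereEuler s.g)
      ∈ fil cmWeight (3 + d) := by
    have e1 := graphEuler_sub_sphereEuler_mem_fil hts.ψ_mem hs.g_mem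
    have e2 := graphEuler_add_sub_mem_fil (normSq + t.ψ) hs.ψ_mem ht.g_mem
    have e3 : graphEuler (normSq + (t.add s).ψ) (X Var.u)
        - graphEuler (normSq + t.ψ) (X Var.u) = C Complex.I * euler s.ψ := by
      simp only [graphEuler_apply, euler_X_u, du_X_u, add_ψ, map_add]; ring
    rw [← add_ψ] at e2
    have := add_mem (fil_anti _ (by omega : 3 + d ≤ _) e1) (fil_anti _ (by omega : 3 + d ≤ _) e2)
    convert this using 1
    change graphEuler (normSq + (t.add s).ψ) (X Var.u + (t.g + s.g))
      - graphEuler (normSq + t.ψ) (X Var.u + t.g) - _ = _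
    simp only [map_add] at e3 ⊢
    linear_combination e3
  have h2 : ∑ k, subst (t.add s).coord (B k) *
        graphEuler (normSq + (t.add s).ψ) ((t.add s).coord (Var.z k))
      - ∑ k, subst t.coord (B k) * graphEuler (normSq + t.ψ) (t.coord (Var.z k))
      - ∑ k, ((C Complex.I * cj (s.f k) + ∑ l, C (α k l) * s.f l) * X (Var.z k)
      + (C Complex.I * X (Var.zbar k) + ∑ l, C (α k l) * X (Var.z l))
        * (sphereEuler (s.f k) - C Complex.I * du s.ψ * X (Var.z k)))
      ∈ fil cmWeight (3 + d) := by
    rw [← Finset.sum_sub_distrib, ← Finset.sum_sub_distrib]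
    refine sum_mem fun k _ => ?_
    have lin : ∀ {r : Trial n}, r.Small 1 → subst r.coord (B k)
        - (C Complex.I * (X (Var.zbar k) + cj (r.f k)) + ∑ l, C (α k l) * (X (Var.z l) + r.f l))
        = subst r.coord (B k - C Complex.I * X (Var.zbar k) - ∑ l, C (α k l) * X (Var.z l)) := by
      intro r hr
      have hs := hr.hasSubst
      have e : ∀ l, subst r.coord (C (α k l) * X (Var.z l) : GraphSeries n)
          = C (α k l) * (X (Var.z l) + r.f l) := fun l => by
        rw [subst_mul hs, subst_C, subst_X hs]; rfl
      rw [subst_sub hs, subst_sub hs, subst_mul hs, subst_sum hs, subst_C, subst_X hs]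
      simp only [e, coord]; ring
    have b1 : subst (t.add s).coord (B k) - subst t.coord (B k)
        - (C Complex.I * cj (s.f k) + ∑ l, C (α k l) * s.f l) ∈ fil cmWeight (2 + d) := by
      have := subst_add_sub_mem_fil ht hs hts (hB k)
      rw [← lin ht, ← lin hts] at this
      convert this using 1
      simp only [add, map_add, mul_add, Finset.sum_add_distrib]
      ring
    have b1' : C Complex.I * cj (s.f k) + ∑ l, C (α k l) * s.f l ∈ fil cmWeight (1 + d) :=
      add_mem (C_mul_mem_fil _ (cj_mem_fil_cmWeight (hs.f_mem k)))
        (sum_mem fun l _ => C_mul_mem_fil _ (hs.f_mem l))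
    have b2 : subst t.coord (B k)
        - (C Complex.I * X (Var.zbar k) + ∑ l, C (α k l) * X (Var.z l)) ∈ fil cmWeight 2 := by
      have := add_mem (ht.subst_mem_fil (hB k)) (add_mem (C_mul_mem_fil Complex.I
        (cj_mem_fil_cmWeight (ht.f_mem k))) (sum_mem (t := Finset.univ) fun l _ =>
          C_mul_mem_fil (α k l) (ht.f_mem l)))
      rw [← lin ht] at this
      convert this using 1
      simp only [mul_add, Finset.sum_add_distrib]
      ring
    have b2' : C Complex.I * X (Var.zbar k) + ∑ l, C (α k l) * X (Var.z l) ∈ fil cmWeight 1 :=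
      add_mem (C_mul_mem_fil _ (X_mem_fil _ _ le_rfl))
        (sum_mem fun l _ => C_mul_mem_fil _ (X_mem_fil _ _ le_rfl))
    have y1 : graphEuler (normSq + (t.add s).ψ) ((t.add s).coord (Var.z k)) - X (Var.z k)
        ∈ fil cmWeight 2 := by
      have e1 := graphEuler_sub_sphereEuler_mem_fil hts.ψ_mem (X_mem_fil cmWeight (Var.z k) le_rfl)
      have e2 := graphEuler_mem_fil hts.ψ_mem (hts.coord_sub_X_mem_fil (Var.z k))
      have := add_mem e1 e2
      rw [sphereEuler_X_z, map_sub] at this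
      change _ ∈ fil cmWeight 2 at this
      convert this using 1
      ring
    have y2 : graphEuler (normSq + (t.add s).ψ) ((t.add s).coord (Var.z k))
        - graphEuler (normSq + t.ψ) (t.coord (Var.z k))
        - (sphereEuler (s.f k) - C Complex.I * du s.ψ * X (Var.z k)) ∈ fil cmWeight (2 + d) := by
      have e1 := graphEuler_sub_sphereEuler_mem_fil hts.ψ_mem (hs.f_mem k)
      have e2 := graphEuler_add_sub_mem_fil (normSq + t.ψ) hs.ψ_mem (ht.f_mem k)
      have e3 : graphEuler (normSq + (t.add s).ψ) (X (Var.z k))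
          - graphEuler (normSq + t.ψ) (X (Var.z k)) = -(C Complex.I * du s.ψ * X (Var.z k)) := by
        simp only [graphEuler_apply, euler_X_z, du_X_z, add_ψ, map_add]; ring
      rw [← add_ψ] at e2
      have := add_mem (fil_anti _ (by omega : 2 + d ≤ _) e1) (fil_anti _ (by omega : 2 + d ≤ _) e2)
      convert this using 1
      change graphEuler (normSq + (t.add s).ψ) (X (Var.z k) + (t.f k + s.f k))
        - graphEuler (normSq + t.ψ) (X (Var.z k) + t.f k) - _ = _
      simp only [map_add] at e3 ⊢
      linear_combination e3
    have y2' := graphEuler_coord_add_sub_mem_fil hs ht hts (Var.z k)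
    -- With B', y' the new and B, y the old factors, B'y' - By = (B' - B)y' + B(y' - y). In each
    -- product both factors are split into leading part and error; these are the four error terms.
    have m1 := mul_mem_fil (k := 3 + d) b1
      (graphEuler_mem_fil hts.ψ_mem (hts.coord_mem_fil (Var.z k))) (by simp [cmWeight]; omega)
    have m2 := mul_mem_fil (k := 3 + d) b1' y1 (by omega)
    have m3 := mul_mem_fil (k := 3 + d) b2 y2' (by simp [cmWeight]; omega)
    have m4 := mul_mem_fil (k := 3 + d) b2' y2 (by omega)
    have := add_mem (add_mem (add_mem m1 m2) m3) m4
    convert this using 1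
    ring
  have := sub_mem h1 h2
  convert this using 1
  rw [defectULin_eq hα]
  simp only [defectU]; ring

end Trial

end Iteration

/-! ### Solution of the nonlinear equations by iteration -/

namespace Trial

variable {n : ℕ}

/-- The candidate solves the equations along the Euler field to order `k`. -/
structure Solves (A : Fin n → Fin n → GraphSeries n) (B : Fin n → GraphSeries n) (t : Trial n)
    (k : ℕ) : Prop where
  zbar_mem : ∀ j, defectZbar A t j ∈ fil cmWeight (1 + k)
  u_mem : defectU B t ∈ fil cmWeight (2 + k)

theorem defectZbar_mem_fil_zWeight (A : Fin n → Fin n → GraphSeries n) (t : Trial n) (j : Fin n) :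
    defectZbar A t j ∈ fil zWeight 1 :=
  sub_mem (graphEuler_mem_fil_zWeight _ _)
    (sum_mem fun _ _ => Ideal.mul_mem_left _ _ (graphEuler_mem_fil_zWeight _ _))

theorem defectU_mem_fil_zWeight (B : Fin n → GraphSeries n) (t : Trial n) :
    defectU B t ∈ fil zWeight 1 :=
  sub_mem (graphEuler_mem_fil_zWeight _ _)
    (sum_mem fun _ _ => Ideal.mul_mem_left _ _ (graphEuler_mem_fil_zWeight _ _))

theorem defectULin_mem_fil (α : Fin n → Fin n → ℂ) {s : Trial n} {d : ℕ} (hs : s.Small d) :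
    defectULin α s ∈ fil cmWeight (2 + d) := by
  have hq := normSq_mem_fil_cmWeight (n := n)
  have tw : ∀ {F : Fin n → GraphSeries n}, (∀ j, F j ∈ fil cmWeight (1 + d)) →
      twist α F ∈ fil cmWeight (2 + d) := fun hF =>
    twist_mem_fil α (a := 1) hF (fun _ => le_rfl) (by omega)
  refine sub_mem (add_mem (sphereEuler_mem_fil hq (sub_mem (add_mem hs.g_mem
    (C_mul_mem_fil _ hs.ψ_mem)) (C_mul_mem_fil _ (reTwice_mem_fil_cmWeight (sum_mem fun j _ =>
    mul_mem_fil (a := 1) (X_mem_fil _ _ le_rfl) (hs.f_mem j) (by omega))))))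
    (C_mul_mem_fil _ (sum_mem fun j _ => mul_mem_fil (a := 1) (X_mem_fil _ _ le_rfl)
    (sphereEuler_mem_fil hq (cj_mem_fil_cmWeight (hs.f_mem j))) (by omega))))
    (sub_mem (tw fun j => sphereEuler_mem_fil hq (hs.f_mem j)) (tw hs.f_mem))

section Solution

variable {A : Fin n → Fin n → GraphSeries n} {B : Fin n → GraphSeries n} {α : Fin n → Fin n → ℂ}

/-- The linearized equations are solved with minus the current defect as right hand side. This is
possible because defects always lie in the ideal of z; the new defect consists of linearization
errors only, one weight higher. -/
theorem exists_improvement (hα : ∀ k l, α k l = -α l k) (hA : ∀ j k, A j k ∈ fil cmWeight 1)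
    (hB : ∀ k, B k - C Complex.I * X (Var.zbar k) - ∑ l, C (α k l) * X (Var.z l) ∈ fil cmWeight 2)
    {t : Trial n} {d : ℕ} (hd : 1 ≤ d) (ht : t.Small 1) (htB : t.Solves A B d) :
    ∃ s : Trial n, s.Small d ∧ s.Normal ∧ (t.add s).Solves A B (d + 1) := by
  obtain ⟨f, g, ψ, hf, hg, hψ, hgr, hψr, hN, e1, e2⟩ := exists_correction (k := 1 + d) hα
    (r₁ := fun j => -defectZbar A t j) (r₂ := -defectU B t)
    (fun j => neg_mem (defectZbar_mem_fil_zWeight A t j)) (fun j => neg_mem (htB.zbar_mem j))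
    (neg_mem (defectU_mem_fil_zWeight B t)) (by
      rw [show 1 + d + 1 = 2 + d by omega]; exact neg_mem htB.u_mem)
  rw [show 1 + d + 1 = 2 + d by omega] at hg hψ
  have hs : (⟨f, g, ψ⟩ : Trial n).Small d := ⟨hf, hg, hψ⟩
  have hts := ht.add (hs.anti hd)
  refine ⟨⟨f, g, ψ⟩, hs, ⟨hgr, hψr, hN⟩, fun j => ?_, ?_⟩
  · have := defectZbar_add_sub_mem_fil hA hs ht hts j
    rw [show sphereEuler (cj (f j)) = _ from e1 j, sub_neg_eq_add, sub_add_cancel] at this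
    rwa [show 1 + (d + 1) = 2 + d by omega]
  · have := defectU_add_sub_mem_fil hα hB hs ht hts
    rw [show defectULin α ⟨f, g, ψ⟩ = _ from e2, sub_neg_eq_add, sub_add_cancel] at this
    rwa [show 2 + (d + 1) = 3 + d by omega]

/-- For the identity and the model hypersurface, Y(u) = i|z|² for Y = `sphereEuler`, which cancels
against the terms i z̄_k z_k, while the α-terms vanish by antisymmetry. -/
theorem solves_zero
    (hA : ∀ j k, A j k ∈ fil cmWeight 1)
    (hα : ∀ k l, α k l = -α l k)
    (hB : ∀ k, B k - C Complex.I * X (Var.zbar k) - ∑ l, C (α k l) * X (Var.z l) ∈ fil cmWeight 2) :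
    (⟨fun _ => 0, 0, 0⟩ : Trial n).Solves A B 1 := by
  have hc : (⟨fun _ => 0, 0, 0⟩ : Trial n).coord = X := by
    funext v; rcases v with j | j | j <;> simp [coord]
  have hs : ∀ f : GraphSeries n, subst (X : Var n → GraphSeries n) f = f := fun f => by
    rw [subst_self]; rfl
  have hy : ∀ f : GraphSeries n, graphEuler (normSq + (⟨fun _ => 0, 0, 0⟩ : Trial n).ψ) f
      = sphereEuler f := fun f => by rw [add_zero, graphEuler_normSq]
  have h3 : ∑ k, (∑ l, C (α k l) * X (Var.z l)) * (X (Var.z k) : GraphSeries n) = 0 := by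
    have := twist_X_mul hα 1
    rw [twist] at this
    rw [← this]
    refine Finset.sum_congr rfl fun k _ => ?_
    rw [Finset.sum_mul]
    exact Finset.sum_congr rfl fun l _ => by ring
  refine ⟨fun j => ?_, ?_⟩
  · simp only [defectZbar, hs, hy, hc, sphereEuler_X_zbar, sphereEuler_X_z]
    exact sub_mem (zero_mem _) (sum_mem fun k _ => mul_mem_fil (hA j k) (X_mem_fil _ _ le_rfl)
      le_rfl)
  · simp only [defectU, hs, hy, hc, sphereEuler_X_z]
    have h4 : sphereEuler (X Var.u : GraphSeries n) = C Complex.I * normSq := by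
      rw [sphereEuler_apply, euler_X_u, du_X_u]; ring
    have h5 : ∑ k, B k * X (Var.z k) = ∑ k, (B k - C Complex.I * X (Var.zbar k)
        - ∑ l, C (α k l) * X (Var.z l)) * X (Var.z k) + C Complex.I * normSq := by
      rw [← sub_eq_zero, ← h3, normSq, Finset.mul_sum, ← Finset.sum_add_distrib,
        ← Finset.sum_sub_distrib]
      exact Finset.sum_congr rfl fun k _ => by ring
    rw [h4, h5, sub_add_cancel_right]
    exact neg_mem (sum_mem fun k _ => mul_mem_fil (hB k) (X_mem_fil _ _ le_rfl) le_rfl)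

/-- The equations along the Euler field have a normalized formal solution. -/
theorem exists_solution (hα : ∀ k l, α k l = -α l k) (hA : ∀ j k, A j k ∈ fil cmWeight 1)
    (hB : ∀ k, B k - C Complex.I * X (Var.zbar k) - ∑ l, C (α k l) * X (Var.z l) ∈ fil cmWeight 2) :
    ∃ t : Trial n, t.Small 1 ∧ t.Normal ∧ (∀ j, defectZbar A t j = 0) ∧ defectU B t = 0 := by
  -- The hypotheses are placed inside the existential so that a correction can be chosen for every
  -- candidate, before it is known that the sequence consists of admissible ones.
  have step : ∀ (k : ℕ) (t : Trial n), ∃ s : Trial n, t.Small 1 → t.Normal → t.Solves A B (k + 1) →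
      s.Small (k + 1) ∧ (t.add s).Small 1 ∧ (t.add s).Normal ∧ (t.add s).Solves A B (k + 2) := by
    intro k t
    by_cases h : t.Small 1 ∧ t.Normal ∧ t.Solves A B (k + 1)
    · obtain ⟨s, h1, h2, h3⟩ := exists_improvement hα hA hB (by omega) h.1 h.2.2
      exact ⟨s, fun _ _ _ => ⟨h1, h.1.add (h1.anti (by omega)), h.2.1.add h2, h3⟩⟩
    · exact ⟨t, fun h1 h2 h3 => absurd ⟨h1, h2, h3⟩ h⟩
  choose s hs using step
  let T : ℕ → Trial n := fun k => Nat.rec ⟨fun _ => 0, 0, 0⟩ (fun k t => t.add (s k t)) k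
  have hT : ∀ k, (T k).Small 1 ∧ (T k).Normal ∧ (T k).Solves A B (k + 1) := by
    intro k
    induction k with
    | zero => exact ⟨⟨fun _ => zero_mem _, zero_mem _, zero_mem _⟩,
        ⟨map_zero _, map_zero _, IsNormalRemainder.zero⟩, solves_zero hA hα hB⟩
    | succ k ih => exact (hs k (T k) ih.1 ih.2.1 ih.2.2).2
  have hsm : ∀ k, (s k (T k)).Small (k + 1) := fun k =>
    (hs k (T k) (hT k).1 (hT k).2.1 (hT k).2.2).1
  have hf : ∀ j, ∃ L, ∀ k, L - (T k).f j ∈ fil cmWeight (k + 2) := fun j =>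
    exists_limit cmWeight (fun k => (T k).f j) 2 fun k => by
      change (T k).f j + (s k (T k)).f j - (T k).f j ∈ _
      rw [add_sub_cancel_left]
      exact fil_anti _ (by omega) ((hsm k).f_mem j)
  have hg : ∃ L, ∀ k, L - (T k).g ∈ fil cmWeight (k + 3) :=
    exists_limit cmWeight (fun k => (T k).g) 3 fun k => by
      change (T k).g + (s k (T k)).g - (T k).g ∈ _
      rw [add_sub_cancel_left]
      exact fil_anti _ (by omega) (hsm k).g_mem
  have hψ : ∃ L, ∀ k, L - (T k).ψ ∈ fil cmWeight (k + 3) :=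
    exists_limit cmWeight (fun k => (T k).ψ) 3 fun k => by
      change (T k).ψ + (s k (T k)).ψ - (T k).ψ ∈ _
      rw [add_sub_cancel_left]
      exact fil_anti _ (by omega) (hsm k).ψ_mem
  choose f hf using hf
  obtain ⟨g, hg⟩ := hg
  obtain ⟨ψ, hψ⟩ := hψ
  -- The limit differs from the k-th candidate by a deviation of order k + 1, so the linearization
  -- estimates compare their defects.
  have hD : ∀ k, (⟨fun j => f j - (T k).f j, g - (T k).g, ψ - (T k).ψ⟩ : Trial n).Small (k + 1) :=
    fun k => ⟨fun j => fil_anti _ (by omega) (hf j k), fil_anti _ (by omega) (hg k),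
      fil_anti _ (by omega) (hψ k)⟩
  have hadd : ∀ k, (T k).add ⟨fun j => f j - (T k).f j, g - (T k).g, ψ - (T k).ψ⟩
      = ⟨f, g, ψ⟩ := fun k => by simp [Trial.add]
  have hL : (⟨f, g, ψ⟩ : Trial n).Small 1 := by
    rw [← hadd 0]; exact (hT 0).1.add (hD 0)
  have real : ∀ {h : GraphSeries n} {u : ℕ → GraphSeries n}, (∀ k, h - u k ∈ fil cmWeight (k + 3)) →
      (∀ k, cj (u k) = u k) → cj h = h := by
    intro h u h1 h2
    rw [← sub_eq_zero]
    refine eq_zero_of_forall_mem_fil (w := cmWeight) fun k => ?_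
    have := sub_mem (cj_mem_fil_cmWeight (h1 k)) (h1 k)
    rw [map_sub, h2, sub_sub_sub_cancel_right] at this
    exact fil_anti _ (by omega) this
  refine ⟨⟨f, g, ψ⟩, hL, ⟨real hg fun k => (hT k).2.1.cj_g, real hψ fun k => (hT k).2.1.cj_ψ,
    IsNormalRemainder.of_forall fun k => ⟨(T k).ψ, (hT k).2.1.normal,
      fil_anti _ (by omega) (hψ k)⟩⟩, fun j => ?_, ?_⟩
  · refine eq_zero_of_forall_mem_fil (w := cmWeight) fun k => ?_
    have h1 := defectZbar_add_sub_mem_fil hA (hD k) (hT k).1 (by rw [hadd]; exact hL) j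
    rw [hadd] at h1
    have h2 := sphereEuler_mem_fil normSq_mem_fil_cmWeight (cj_mem_fil_cmWeight ((hD k).f_mem j))
    have := add_mem (add_mem (fil_anti _ (by omega : k ≤ _) h1) (fil_anti _ (by omega : k ≤ _) h2))
      (fil_anti _ (by omega : k ≤ _) ((hT k).2.2.zbar_mem j))
    convert this using 1
    ring
  · refine eq_zero_of_forall_mem_fil (w := cmWeight) fun k => ?_
    have h1 := defectU_add_sub_mem_fil hα hB (hD k) (hT k).1 (by rw [hadd]; exact hL)
    rw [hadd] at h1
    have h2 := defectULin_mem_fil α (hD k)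
    have := add_mem (add_mem (fil_anti _ (by omega : k ≤ _) h1) (fil_anti _ (by omega : k ≤ _) h2))
      (fil_anti _ (by omega : k ≤ _) (hT k).2.2.u_mem)
    convert this using 1
    ring

end Solution

end Trial

/-! ### From a solution to a hypersurface with its transformed structure -/

section Assembly

variable {n : ℕ}

theorem bipart_normSq {k l : ℕ} (h : k ≠ 1) : bipart k l (normSq : GraphSeries n) = 0 := by
  rw [bipart_eq', hcomp_of_mem_homog_of_ne normSq_mem_homog_zWeight h, map_zero]

theorem weight_single_one (w : Var n → ℕ) (v : Var n) :
    Finsupp.weight w (Finsupp.single v 1) = w v := by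
  rw [Finsupp.weight_single, one_smul]

theorem isChernMoserNormalized_normSq_add {ψ : GraphSeries n} (hr : cj ψ = ψ)
    (hN : IsNormalRemainder ψ) : IsChernMoserNormalized (normSq + ψ) where
  expansion m hm := by
    have h : coeff m ψ = 0 := by
      rcases hm with h | h
      · exact mem_fil_zWeight_of_cj_eq hr hN.mem_fil m (by rwa [weight_zWeight])
      · exact hN.mem_fil m (by rwa [weight_zbarWeight])
    rw [map_add, h, add_zero, normSq]
  tr22 := by rw [bipart_add, bipart_normSq (by norm_num), zero_add, hN.tr22]
  tr23 := by
    rw [bipart_add, bipart_normSq (by norm_num), zero_add, ← hr, ← cj_bipart, ← cj_tr, ← cj_tr,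
      hN.tr32, map_zero]
  tr33 := by rw [bipart_add, bipart_normSq (by norm_num), zero_add, hN.tr33]

theorem isHypersurface_normSq_add {ψ : GraphSeries n} (hr : cj ψ = ψ)
    (hN : ψ ∈ fil zbarWeight 2) : IsHypersurface (normSq + ψ) where
  real := isReal_iff.mpr (by rw [map_add, cj_normSq, hr])
  constant := by
    rw [map_add, ← coeff_zero_eq_constantCoeff_apply, ← coeff_zero_eq_constantCoeff_apply,
      hN 0 (by simp), normSq_mem_homog_zWeight 0 (by simp), add_zero]
  linear v := by
    have h1 : (normSq : GraphSeries n) ∈ homog (fun _ => 1) 2 :=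
      sum_mem fun j _ => mul_mem_homog (X_mem_homog _ _ rfl) (X_mem_homog _ _ rfl) rfl
    rw [map_add, hN _ (by rw [weight_single_one]; rcases v with j | j | j <;> simp [zbarWeight]),
      h1 _ (by rw [weight_single_one]; norm_num), add_zero]

namespace Trial

variable {t : Trial n}

theorem Small.bijective_subst (h : t.Small 1) :
    Function.Bijective (subst t.coord : GraphSeries n → GraphSeries n) :=
  bijective_subst_of_sub_X_mem_fil one_le_cmWeight h.coord_sub_X_mem_fil

theorem coord_swap (hg : cj t.g = t.g) (v : Var n) : t.coord v.swap = cj (t.coord v) := by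
  rcases v with j | j | j
  · change X (Var.zbar j) + cj (t.f j) = cj (X (Var.z j) + t.f j)
    rw [map_add, cj_X]; rfl
  · change X (Var.z j) + t.f j = cj (X (Var.zbar j) + cj (t.f j))
    rw [map_add, cj_X, cj_cj]; rfl
  · change X Var.u + t.g = cj (X Var.u + t.g)
    rw [map_add, cj_X, hg]; rfl

/-- The coefficients of the equations for the transformed structure: the row `r` describes the
defect of `∂/∂v` as a `(1,0)` vector field. -/
def row (A : Fin n → Fin n → GraphSeries n) (B : Fin n → GraphSeries n) (t : Trial n) :
    Fin n ⊕ Unit → Var n → GraphSeries n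
  | Sum.inl j, v => pderiv ℂ v (t.coord (Var.zbar j))
      - ∑ k, subst t.coord (A j k) * pderiv ℂ v (t.coord (Var.z k))
  | Sum.inr _, v => pderiv ℂ v (t.coord Var.u)
      - ∑ k, subst t.coord (B k) * pderiv ℂ v (t.coord (Var.z k))

/-- The part of the equations belonging to `∂/∂z̄` and `∂/∂u`. -/
def rowMatrix (A : Fin n → Fin n → GraphSeries n) (B : Fin n → GraphSeries n) (t : Trial n) :
    Matrix (Fin n ⊕ Unit) (Fin n ⊕ Unit) (GraphSeries n) :=
  Matrix.of fun r s => row A B t r (Sum.inr s)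

theorem constantCoeff_pderiv_of_mem_fil {k : ℕ} {f : GraphSeries n} (v : Var n)
    (hf : f ∈ fil cmWeight k) (h : cmWeight v < k) : constantCoeff (pderiv ℂ v f) = 0 :=
  (constantCoeff_eq_zero_iff_mem_fil fun v => Nat.one_le_iff_ne_zero.mp (one_le_cmWeight v)).mpr
    (pderiv_mem_fil hf v (by omega))

/-- At the base point the matrix is unipotent and block triangular. The z̄-components have
deviations of weight 2 and may contain u linearly, so the upper right block need not vanish; g has
weight at least 3, so the lower left block does. -/
theorem isUnit_det_rowMatrix {A : Fin n → Fin n → GraphSeries n} {B : Fin n → GraphSeries n}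
    (h : t.Small 1) (hA : ∀ j k, A j k ∈ fil cmWeight 1) (hB : ∀ k, B k ∈ fil cmWeight 1) :
    IsUnit (rowMatrix A B t).det := by
  classical
  have h0 : ∀ {f : GraphSeries n}, f ∈ fil cmWeight 1 → constantCoeff (subst t.coord f) = 0 :=
    fun hf => (constantCoeff_eq_zero_iff_mem_fil fun v => Nat.one_le_iff_ne_zero.mp (one_le_cmWeight v)).mpr
      (h.subst_mem_fil hf)
  have hz : ∀ (v : Var n) {a : Fin n → GraphSeries n}, (∀ k, a k ∈ fil cmWeight 1) →
      constantCoeff (∑ k, subst t.coord (a k) * pderiv ℂ v (t.coord (Var.z k))) = 0 := by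
    intro v a ha
    rw [map_sum]
    exact Finset.sum_eq_zero fun k _ => by rw [map_mul, h0 (ha k), zero_mul]
  rw [MvPowerSeries.isUnit_iff_constantCoeff, RingHom.map_det]
  have e : (constantCoeff : GraphSeries n →+* ℂ).mapMatrix (rowMatrix A B t)
      = Matrix.fromBlocks 1 (Matrix.of fun j _ => constantCoeff (row A B t (Sum.inl j) Var.u))
        0 1 := by
    ext (r | r) (s | s)
    · change constantCoeff (row A B t (Sum.inl r) (Var.zbar s)) = (1 : Matrix _ _ ℂ) r s
      rw [row, map_sub, hz _ (hA r), sub_zero]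
      change constantCoeff (pderiv ℂ _ (X (Var.zbar r) + cj (t.f r))) = _
      rw [map_add, map_add, constantCoeff_pderiv_of_mem_fil (Var.zbar s)
        (cj_mem_fil_cmWeight (h.f_mem r)) (by simp), pderiv_X, Pi.single_apply, Matrix.one_apply]
      by_cases hrs : r = s <;> simp [hrs]
    · rfl
    · change constantCoeff (row A B t (Sum.inr r) (Var.zbar s)) = 0
      rw [row, map_sub, hz _ hB, sub_zero]
      change constantCoeff (pderiv ℂ _ (X Var.u + t.g)) = _
      rw [map_add, map_add, constantCoeff_pderiv_of_mem_fil (Var.zbar s) h.g_mem (by simp),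
        pderiv_X_of_ne (by simp)]
      simp
    · change constantCoeff (row A B t (Sum.inr r) Var.u) = 1
      rw [row, map_sub, hz _ hB, sub_zero]
      change constantCoeff (pderiv ℂ _ (X Var.u + t.g)) = _
      rw [map_add, map_add, constantCoeff_pderiv_of_mem_fil Var.u h.g_mem (by simp),
        pderiv_X_self]
      simp
  rw [e, Matrix.det_fromBlocks_zero₂₁, Matrix.det_one, Matrix.det_one]
  simp

/-- The representation of the transformed structure. -/
def graphMap (A : Fin n → Fin n → GraphSeries n) (B : Fin n → GraphSeries n) (t : Trial n) :
    GraphMap n where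
  zbar j k := -((rowMatrix A B t)⁻¹.mulVec fun r => row A B t r (Var.z k)) (Sum.inl j)
  w k := -((rowMatrix A B t)⁻¹.mulVec fun r => row A B t r (Var.z k)) (Sum.inr ())

/-- All components of the representation of the transformed structure. -/
theorem eq_sum_of_rowMatrix_mulVec {S : Type*} [CommRing S] (τ : GraphSeries n →+* S)
    {A : Fin n → Fin n → GraphSeries n} {B : Fin n → GraphSeries n} {t : Trial n}
    (hdet : IsUnit (rowMatrix A B t).det) (a : Var n → S)
    (ha : ∀ r, ∑ v, τ (row A B t r v) * a v = 0) :
    (∀ j, a (Var.zbar j) = ∑ k, τ ((graphMap A B t).zbar j k) * a (Var.z k)) ∧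
      a Var.u = ∑ k, τ ((graphMap A B t).w k) * a (Var.z k) := by
  classical
  -- The equations in `ha` are solved for the components along z̄ and u. This is used over two
  -- rings: for the action of fields on the pulled back coordinates, and for the components of the
  -- Euler field itself.
  set P := (rowMatrix A B t)⁻¹
  have hP : P * rowMatrix A B t = 1 := Matrix.nonsing_inv_mul _ hdet
  have key : ∀ s, a (Sum.inr s)
      = ∑ k, τ (-(P.mulVec fun r => row A B t r (Var.z k)) s) * a (Var.z k) := by
    intro s
    have h1 : ∑ r, τ (P s r) * ∑ v, τ (row A B t r v) * a v = 0 :=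
      Finset.sum_eq_zero fun r _ => by rw [ha, mul_zero]
    have h2 : ∀ s', ∑ r, τ (P s r) * τ (row A B t r (Sum.inr s')) = if s = s' then 1 else 0 := by
      intro s'
      have := congrArg τ (congrFun (congrFun hP s) s')
      rw [Matrix.mul_apply, map_sum, Matrix.one_apply] at this
      simp only [map_mul, rowMatrix, Matrix.of_apply] at this
      rw [this]
      split_ifs <;> simp
    have h3 : ∑ s', (∑ r, τ (P s r) * τ (row A B t r (Sum.inr s'))) * a (Sum.inr s')
        = a (Sum.inr s) := by
      simp only [h2, ite_mul, one_mul, zero_mul, Finset.sum_ite_eq, Finset.mem_univ, if_true]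
    have h4 : ∑ r, τ (P s r) * ∑ v, τ (row A B t r v) * a v
        = ∑ k, (∑ r, τ (P s r) * τ (row A B t r (Var.z k))) * a (Var.z k)
          + ∑ s', (∑ r, τ (P s r) * τ (row A B t r (Sum.inr s'))) * a (Sum.inr s') := by
      simp only [Fintype.sum_sum_type (fun v : Var n => τ (row A B t _ v) * a v), mul_add,
        Finset.sum_add_distrib, Finset.mul_sum, Finset.sum_mul, mul_assoc]
      congr 1
      · exact Finset.sum_comm
      · exact Finset.sum_comm
    rw [h4, h3] at h1
    rw [eq_neg_of_add_eq_zero_right h1, ← Finset.sum_neg_distrib]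
    refine Finset.sum_congr rfl fun k _ => ?_
    rw [Matrix.mulVec, dotProduct, map_neg, map_sum, neg_mul]
    simp only [map_mul]
  exact ⟨fun j => key (Sum.inl j), key (Sum.inr ())⟩

end Trial

end Assembly

/-! ### Construction of the embedding -/

section Embedding

variable {n : ℕ} {M : Submodule (SourceSeries n) (FormalField n)}

/-- Coordinates in which `t.coord` are given formal coordinates `y`. -/
theorem Trial.exists_coord {y : Var n → SourceSeries n} (hy : ∀ v, constantCoeff (y v) = 0)
    (hys : ∀ v, y v.swap = conjSeries (y v))
    (hyb : Function.Bijective (subst y : GraphSeries n → SourceSeries n))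
    {t : Trial n} (ht : t.Small 1) (hg : cj t.g = t.g) :
    ∃ x : Var n → SourceSeries n, (∀ v, constantCoeff (x v) = 0) ∧
      (∀ v, x v.swap = conjSeries (x v)) ∧
      Function.Surjective (subst x : GraphSeries n → SourceSeries n) ∧
      ∀ f : GraphSeries n, subst x (subst t.coord f) = subst y f := by
  have hb := ht.bijective_subst
  have hc := ht.hasSubst
  have hc0 : ∀ v, constantCoeff (t.coord v) = 0 := fun v =>
    (constantCoeff_eq_zero_iff_mem_fil fun v => Nat.one_le_iff_ne_zero.mp (one_le_cmWeight v)).mpr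
      (fil_anti _ (one_le_cmWeight v) (ht.coord_mem_fil v))
  -- `d` is the inverse of the change of coordinates `t.coord`, and the new coordinates are x =
  -- d(y). Their reality follows from uniqueness of the inverse.
  choose d hd using fun v => hb.2 (X v)
  have hd0 : ∀ v, constantCoeff (d v) = 0 := fun v => by
    rw [← constantCoeff_subst_of_zero hc0, hd, constantCoeff_X]
  have hds := hasSubst_of_constantCoeff_zero hd0
  have hyS := hasSubst_of_constantCoeff_zero hy
  have hcd : ∀ f : GraphSeries n, subst t.coord (subst d f) = f := fun f => by
    rw [subst_comp_subst_apply hds hc, funext hd, subst_self]; rfl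
  have hdc : ∀ f : GraphSeries n, subst d (subst t.coord f) = f := fun f => hb.1 (hcd _)
  have hsw : ∀ v, d v.swap = cj (d v) := fun v => hb.1 (by
    rw [hd, ← cj_subst hc (coord_swap hg), hd, cj_X])
  have hx : ∀ f : GraphSeries n, subst (fun v => subst y (d v)) f = subst y (subst d f) := fun f =>
    (subst_comp_subst_apply hds hyS f).symm
  refine ⟨fun v => subst y (d v), fun v => ?_, fun v => ?_, fun f => ?_, fun f => ?_⟩
  · rw [constantCoeff_subst_of_zero hy, hd0]
  · change subst y (d v.swap) = conjSeries (subst y (d v))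
    rw [hsw, conjSeries_subst hyS hys]
  · obtain ⟨g, hg⟩ := hyb.2 f
    exact ⟨subst t.coord g, by rw [hx, hdc, hg]⟩
  · rw [hx, hdc]

/-- Real formal coordinates on the source and a hypersurface define a formal embedding. -/
theorem exists_formalEmbedding {x : Var n → SourceSeries n} (hx : ∀ v, constantCoeff (x v) = 0)
    (hxs : ∀ v, x v.swap = conjSeries (x v))
    (hxb : Function.Surjective (subst x : GraphSeries n → SourceSeries n))
    {φ : GraphSeries n} (hφ : IsHypersurface φ) :
    ∃ E : FormalEmbedding n, E.φ = φ ∧ E.coord = x := by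
  have hS := hasSubst_of_constantCoeff_zero hx
  have hu : conjSeries (x Var.u) = x Var.u := (hxs Var.u).symm
  have hr : conjSeries (subst x φ) = subst x φ := by
    rw [conjSeries_subst hS hxs, isReal_iff.mp hφ.real]
  have hhalf := C_one_half_mul (σ := Fin (2 * n + 1))
  -- W is u + iφ on the graph; as u and φ are real, its real part is u and its imaginary part is φ.
  set W := x Var.u + C Complex.I * subst x φ with hW
  have hWc : conjSeries W = x Var.u - C Complex.I * subst x φ := by
    have : ∀ a b c : SourceSeries n, conjSeries (a + b * c) = conjSeries a
        + conjSeries b * conjSeries c := fun a b c => by simp only [conjSeries, map_add, map_mul]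
    rw [hW, this, hu, hr]
    simp only [conjSeries, map_C, Complex.conj_I, map_neg]
    ring
  have hgc : graphCoord (fun j => x (Var.z j)) W = x := by
    funext v
    rcases v with j | j | j
    · rfl
    · exact (hxs (Var.z j)).symm
    · change C (1 / 2) * (W + conjSeries W) = x Var.u
      rw [hWc, hW]
      linear_combination (x Var.u) * hhalf
  have hφ0 : constantCoeff (subst x φ) = 0 := by
    rw [constantCoeff_subst_of_zero hx, hφ.constant]
  have hφ1 : ∀ k, coeff (Finsupp.single k 1) (subst x φ) = 0 := by
    intro k
    have := subst_mem_fil (w' := fun _ => 1) hS (fun v =>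
      (constantCoeff_eq_zero_iff_mem_fil (by simp)).mp (hx v)) hφ.mem_fil
    exact this _ (by rw [Finsupp.weight_single]; simp)
  refine ⟨⟨fun j => x (Var.z j), W, φ, fun j => hx _, ?_, hφ, ?_, fun v hz hw => ?_⟩, rfl, hgc⟩
  · rw [hW, map_add, map_mul, hx, hφ0]; simp
  · rw [hgc, hWc, hW]
    have h2 : (C (1 / (2 * Complex.I)) * (2 * C Complex.I) : SourceSeries n) = 1 := by
      rw [← map_ofNat (C : ℂ →+* SourceSeries n) 2, ← map_mul, ← map_mul,
        ← map_one (C : ℂ →+* SourceSeries n)]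
      congr 1
      field_simp [Complex.I_ne_zero]
    linear_combination (-subst x φ) * h2
  · have hall : ∀ w, ∑ k, (v k : ℂ) * coeff (Finsupp.single k 1) (x w) = 0 := by
      rintro (j | j | j)
      · exact hz j
      · change ∑ k, (v k : ℂ) * coeff (Finsupp.single k 1) (x (Var.z j).swap) = 0
        rw [hxs, ← star_zero, ← hz j, star_sum]
        refine Finset.sum_congr rfl fun k _ => ?_
        rw [coeff_conjSeries, star_mul', Complex.star_def, Complex.conj_ofReal]
      · change ∑ k, (v k : ℂ) * coeff (Finsupp.single k 1) (x Var.u) = 0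
        rw [← hw]
        refine Finset.sum_congr rfl fun k _ => ?_
        rw [hW, map_add, coeff_C_mul, hφ1, mul_zero, add_zero]
    -- A constant field annihilating all coordinates to first order annihilates every series in them
    -- to first order. By surjectivity these include the original coordinates, whose derivatives are
    -- the components of `v`.
    set D : FormalField n := fun k => C (v k : ℂ) with hD
    have hDc : ∀ f, constantCoeff (D.act f) = ∑ k, (v k : ℂ) * coeff (Finsupp.single k 1) f := by
      intro f
      rw [FormalField.constantCoeff_act]
      exact Finset.sum_congr rfl fun k _ => by rw [hD, constantCoeff_C, mul_comm]
    funext i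
    obtain ⟨h, hh⟩ := hxb (X i)
    have e : constantCoeff (D.act (X i)) = 0 := by
      rw [← hh, FormalField.act_subst _ hx, map_sum]
      exact Finset.sum_eq_zero fun w _ => by rw [map_mul, hDc, hall, mul_zero]
    rw [FormalField.act_X, hD, constantCoeff_C] at e
    exact_mod_cast e

theorem graphEuler_eq {φ b : GraphSeries n}
    (hb : b * (1 - C Complex.I * du φ) = C Complex.I * euler φ) (f : GraphSeries n) :
    graphEuler φ f = (1 - C Complex.I * du φ) * (euler f + b * du f) := by
  rw [graphEuler_apply, ← hb]; ring

/-- A solution of the equations along the Euler field defines a quasi CR embedding. -/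
theorem NormalCoordinates.exists_isQuasiCR (N : NormalCoordinates M) {t : Trial n}
    (ht : t.Small 1) (hN : t.Normal) (hz : ∀ j, Trial.defectZbar N.A t j = 0)
    (hu : Trial.defectU N.B t = 0) :
    ∃ E : FormalEmbedding n, E.φ = normSq + t.ψ ∧ E.IsQuasiCR M := by
  obtain ⟨x, hx, hxs, hxb, hxy⟩ := Trial.exists_coord N.y_zero N.y_swap N.bijective ht hN.cj_g
  obtain ⟨E, hEφ, rfl⟩ := exists_formalEmbedding hx hxs hxb
    (isHypersurface_normSq_add hN.cj_ψ hN.normal.mem_fil)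
  refine ⟨E, hEφ, ?_⟩
  have hS := E.hasSubst_coord
  have hB1 : ∀ k, N.B k ∈ fil cmWeight 1 := fun k => by
    have := add_mem (fil_anti _ (Nat.le_succ 1) (N.B_mem k)) (add_mem (C_mul_mem_fil Complex.I
      (X_mem_fil cmWeight (Var.zbar k) le_rfl)) (sum_mem (t := Finset.univ) fun l _ =>
        C_mul_mem_fil (N.α k l) (X_mem_fil cmWeight (Var.z l) le_rfl)))
    convert this using 1
    ring
  have hdet := Trial.isUnit_det_rowMatrix ht N.A_mem hB1
  obtain ⟨L', hL'⟩ := E.IsInduced_exists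
  obtain ⟨l0, lw⟩ := GraphMap.isInduced_iff.mp hL'
  refine ⟨Trial.graphMap N.A N.B t, L', fun v hv => ?_, hL', ?_⟩
  · set τ := (substAlgHom (R := ℂ) (S := ℂ) hS).toRingHom with hτ
    have τc : ∀ f, subst E.coord f = τ f := fun f => by
      rw [← coe_substAlgHom hS]; rfl
    have hact : ∀ w, v.act (N.y w)
        = ∑ i, τ (pderiv ℂ i (t.coord w)) * v.act (E.coord i) := by
      intro w
      have : N.y w = subst E.coord (t.coord w) := by
        rw [← subst_X (R := ℂ) ht.hasSubst w, hxy,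
          subst_X (hasSubst_of_constantCoeff_zero N.y_zero)]
      rw [this, FormalField.act_subst _ hx]
      simp only [τc]
    -- The chain rule for y = t.coord(x) turns the equations of the structure in the coordinates y
    -- into linear equations for the derivatives of x.
    have hrow : ∀ r, ∑ i, τ (Trial.row N.A N.B t r i) * v.act (E.coord i) = 0 := by
      rintro (j | j)
      · have := N.act_zbar v hv j
        simp only [← hxy, τc, hact, Finset.mul_sum] at this
        rw [Finset.sum_comm, ← sub_eq_zero, ← Finset.sum_sub_distrib] at this
        rw [← this]
        refine Finset.sum_congr rfl fun i _ => ?_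
        simp only [Trial.row, map_sub, map_sum, map_mul, sub_mul, Finset.sum_mul, mul_assoc]
      · have := N.act_u v hv
        simp only [← hxy, τc, hact, Finset.mul_sum] at this
        rw [Finset.sum_comm, ← sub_eq_zero, ← Finset.sum_sub_distrib] at this
        rw [← this]
        refine Finset.sum_congr rfl fun i _ => ?_
        simp only [Trial.row, map_sub, map_sum, map_mul, sub_mul, Finset.sum_mul, mul_assoc]
    have := Trial.eq_sum_of_rowMatrix_mulVec τ hdet (fun i => v.act (E.coord i)) hrow
    simp only [τc]
    exact this
  · set b := L'.eulerW with hb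
    have hb' : b * (1 - C Complex.I * du (normSq + t.ψ)) = C Complex.I * euler (normSq + t.ψ) := by
      rw [hb, GraphMap.eulerW, Finset.sum_mul, euler_apply, Finset.mul_sum]
      refine Finset.sum_congr rfl fun k _ => ?_
      have := lw k
      rw [hEφ] at this
      linear_combination (X (Var.z k)) * this
    have hun : IsUnit (1 - C Complex.I * du (normSq + t.ψ)) := hEφ ▸ E.isUnit_one_sub_I_mul
    -- The components (z, 0, b) of the lift of the Euler field to the structure induced by the
    -- ambient space.
    let a : Var n → GraphSeries n
      | Sum.inl j => X (Var.z j)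
      | Sum.inr (Sum.inl _) => 0
      | Sum.inr (Sum.inr _) => b
    have hfield : ∀ f : GraphSeries n, euler f + b * du f = ∑ i, pderiv ℂ i f * a i := by
      intro f
      simp only [Fintype.sum_sum_type, a, zero_mul, Finset.sum_const_zero, zero_add,
        Finset.univ_unique, Finset.sum_singleton, euler_apply, mul_comm (pderiv ℂ _ f)]
    obtain ⟨κ, hκ, hY⟩ : ∃ κ, IsUnit κ ∧ ∀ f, graphEuler (normSq + t.ψ) f
        = κ * ∑ i, pderiv ℂ i f * a i :=
      ⟨_, hun, fun f => by rw [graphEuler_eq hb', hfield]⟩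
    -- Up to the unit κ, the vanishing of the defects says that this lift satisfies the equations of
    -- the transformed structure. Solving them for the z̄- and u-components yields L(e) = L'(e).
    have hrow : ∀ r, ∑ i, RingHom.id _ (Trial.row N.A N.B t r i) * a i = 0 := by
      intro r
      refine hκ.mul_left_cancel ?_
      rw [mul_zero]
      rcases r with j | j
      · rw [← hz j, Trial.defectZbar]
        simp only [hY, RingHom.id_apply, Trial.row, sub_mul,
          Finset.sum_sub_distrib, mul_sub, Finset.sum_mul, Finset.mul_sum]
        rw [sub_right_inj, Finset.sum_comm]
        exact Finset.sum_congr rfl fun _ _ => Finset.sum_congr rfl fun _ _ => by ring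
      · rw [← hu, Trial.defectU]
        simp only [hY, RingHom.id_apply, Trial.row, sub_mul,
          Finset.sum_sub_distrib, mul_sub, Finset.sum_mul, Finset.mul_sum]
        rw [sub_right_inj, Finset.sum_comm]
        exact Finset.sum_congr rfl fun _ _ => Finset.sum_congr rfl fun _ _ => by ring
    obtain ⟨h1, h2⟩ := Trial.eq_sum_of_rowMatrix_mulVec (RingHom.id _) hdet a hrow
    refine ⟨fun j => ?_, ?_⟩
    · rw [show L'.eulerZbar j = 0 by simp [GraphMap.eulerZbar, l0]]
      exact (h1 j).symm
    · exact h2.symm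

/-- A formal almost CR structure with normal coordinates has a quasi CR normal form. -/
theorem NormalCoordinates.exists_isQuasiNormalForm (N : NormalCoordinates M) :
    ∃ E : FormalEmbedding n, E.IsQuasiNormalForm M := by
  obtain ⟨t, ht, hN, hz, hu⟩ := Trial.exists_solution N.antisymm N.A_mem N.B_mem
  obtain ⟨E, hE, hq⟩ := N.exists_isQuasiCR ht hN hz hu
  exact ⟨E, hq, hE ▸ isChernMoserNormalized_normSq_add hN.cj_ψ hN.normal⟩

theorem FormalFrame.linearIndependent (F : FormalFrame M) :
    LinearIndependent ℂ fun k : Fin n => fun i => constantCoeff (F.η k i) := by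
  classical
  rw [Fintype.linearIndependent_iff]
  intro g hg j
  have h : ∑ k, g k * ∑ i, F.ℓ (Var.z j) i * constantCoeff (F.η k i) = 0 := by
    have : ∀ i, ∑ k, g k * constantCoeff (F.η k i) = 0 := fun i => by
      simpa using congrFun hg i
    calc _ = ∑ i, F.ℓ (Var.z j) i * ∑ k, g k * constantCoeff (F.η k i) := by
          simp only [Finset.mul_sum]
          rw [Finset.sum_comm]
          exact Finset.sum_congr rfl fun _ _ => Finset.sum_congr rfl fun _ _ => by ring
      _ = 0 := by simp [this]
  have hd : ∀ k, ∑ i, F.ℓ (Var.z j) i * constantCoeff (F.η k i) = if j = k then 1 else 0 := by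
    intro k
    have := congrArg constantCoeff (F.dual j k)
    simp only [map_sum, map_mul, constantCoeff_C] at this
    rw [this]
    split_ifs <;> simp
  simpa [hd] using h

end Embedding

end QuasiCR

end

theorem theorem1p2 (n : ℕ) (U : Set (QuasiCR.RealSpace n)) (hU : IsOpen U)
    (S : QuasiCR.AlmostCRStructure n U) (p : QuasiCR.RealSpace n) (hp : p ∈ U)
    (hLevi : S.LeviPosDef p) :
    (∃ E : QuasiCR.FormalEmbedding n, E.IsQuasiNormalForm (S.formalH10 p)) ∧
    (∀ E : QuasiCR.FormalEmbedding n, E.IsQuasiCR (S.formalH10 p) →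
      (E.IsCR (S.formalH10 p) ↔ S.FormallyIntegrableAt p)) ∧
    (S.IntegrableNear p → S.FormallyIntegrableAt p) ∧
    (S.FormallyIntegrableAt p → ∀ E : QuasiCR.FormalEmbedding n,
      (E.IsQuasiNormalForm (S.formalH10 p) ↔ E.IsChernMoserNormalForm (S.formalH10 p))) := by
  obtain ⟨F, hF⟩ := QuasiCR.AlmostCRStructure.exists_formalFrame hU hp hLevi
  obtain ⟨F', hF'⟩ := F.exists_levi_eq_one hF
  obtain ⟨N⟩ := F'.exists_normalCoordinates hF'
  have h : ∀ E : QuasiCR.FormalEmbedding n, E.IsQuasiCR (S.formalH10 p) →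
      (E.IsCR (S.formalH10 p) ↔ S.FormallyIntegrableAt p) := fun E hE =>
    hE.isCR_iff F.mem F.linearIndependent
  -- In the last statement only the direction from quasi CR to CR uses formal integrability.
  exact ⟨N.exists_isQuasiNormalForm, h, fun hi => hi.formallyIntegrableAt, fun hi E =>
    ⟨fun hE => ⟨(h E hE.1).mpr hi, hE.2⟩, fun hE => ⟨hE.1.isQuasiCR, hE.2⟩⟩⟩
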